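/- **Setting.** Let $\mathbf g$ be a simple Lie algebra with root system $\Phi$, simple roots $\alpha_1,\dots,\alpha_\ell$, fundamental weights $\omega_i$, longest Weyl group element $w_0$, and Cartan matrix $C_{ij}=(\alpha_i^\vee,\alpha_j)$. Let $r^\vee$ be the squared length of a long root divided by that of a short root (so $r^\vee\in\{1,2,3\}$), and let $r_i=r^\vee(\alpha_i,\alpha_i)/2$ with long roots normalized to squared length $2$. Let $\theta$ be the highest root, $\mathrm h=1+\mathrm{ht}(\theta)$ the Coxeter number and $\mathrm h^\vee=1+\mathrm{ht}(\theta^\vee)$ the dual Coxeter number. Let $q,t$ be independent variables over $\mathbb C$, formally $t=q^\beta$. Put $[n]_q=\frac{q^n-q^{-n}}{q-q^{-1}}$ and $$C_{ij}(q,t)=(q^{r_i}t^{-1}+q^{-r_i}t)\delta_{ij}-[2\delta_{ij}-C_{ij}]_q,\qquad B_{ij}(q,t)=[r_i]_q\,C_{ij}(q,t).$$ The deformed Heisenberg algebra has generators $a_i[m]$ ($1\le i\le\ell$, $m\in\mathbb Z$) with $$[a_i[m],a_j[n]]=\tfrac1m(q^m-q^{-m})(t^m-t^{-m})B_{ij}(q^m,t^m)\,\delta_{m+n,0},$$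 the zero modes $a_i[0]$ being central. The $y_i[m]$ are defined by $a_i[m]=\sum_jC_{ji}(q^m,t^m)\,y_j[m]$. The Fock module $F(\mu)$ is freely generated by the $a_i[m]$, $m<0$, from a vector killed by the $a_i[m]$, $m>0$, and $a_i[0]$ acts on it by $(\mu,\alpha_i)$. Set $$A_i(z)=t^{2}q^{-2r_i+2a_i[0]}{:}\exp\Big(\sum_{m\ne0}a_i[m]z^{-m}\Big){:}\,,\qquad Y_i(z)=t^{2(\rho^\vee,\omega_i)}q^{-2r^\vee(\rho,\omega_i)+2y_i[0]}{:}\exp\Big(\sum_{m\neq0}y_i[m]z^{-m}\Big){:}\,.$$ Let $e^{Q_j}$ be the shift operators of the zero modes: they commute with all $a_i[m]$, $m\neq0$, and $[a_i[0],e^{Q_j}]=r_iC_{ij}\beta\, e^{Q_j}$. The screening operators $S_i^+:F(0)\to F(-\beta\alpha_i^\vee)$ and $S_i^-:F(0)\to F(r^\vee\alpha_i)$ are the coefficients of $z^{-1}$ in $$e^{-Q_i/r_i}z^{-a_i[0]/r_i}{:}\exp\Big(\sum_{m\ne0}\tfrac{a_i[m]z^{-m}}{q^{mr_i}-q^{-mr_i}}\Big){:}\quad\text{and}\quad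 e^{Q_i/\beta}z^{a_i[0]/\beta}{:}\exp\Big(-\sum_{m\ne0}\tfrac{a_i[m]z^{-m}}{t^{m}-t^{-m}}\Big){:}\,.$$ **Generators.** A field $T_i(z)=\sum_mT_i[m]z^{-m}$ is a *generator with highest weight component $Y_i(z)$* if all the modes $T_i[m]$ commute with all the screening operators $S_j^\pm$, and $T_i(z)$ is the sum of $Y_i(z)$ (with coefficient $1$) and of finitely many terms $$c(q,t)\;{:}Y_i(z)A_{i_1}(zq^{a_1}t^{b_1})^{-1}\cdots A_{i_k}(zq^{a_k}t^{b_k})^{-1}{:}\,,\qquad k\ge1,\ a_l,b_l\in\mathbb Z,\ c(q,t)\in\mathbb C(q,t).$$ **Involution.** Let $\vartheta$ be the transformation with $\vartheta(q)=q^{-1}$, $\vartheta(t)=t^{-1}$, $\vartheta(q^{a_i[0]})=q^{-a_i[0]}$ and $\vartheta(a_i[m])=-a_i[m]$ for $m\ne0$; it acts on a field mode by mode. **Theorem 2.6.** Let $i^*$ be the index with $\omega_{i^*}=-w_0\omega_i$. If $T_i(z)$ and $T_{i^*}(z)$ are generators with highest weight components $Y_i(z)$ and $Y_{i^*}(z)$,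 then $$\vartheta\big(T_i(z)\big)=T_{i^*}\big(z\,q^{r^\vee\mathrm h^\vee}t^{-\mathrm h}\big).$$ -/

import Mathlib

namespace DeformedW

noncomputable section

open scoped Classical

/-! ### The field `ℂ(q, t)` and its involution -/

/-- Laurent polynomials `ℂ[q^{±1}, t^{±1}]`; the basis element at `(a, c)` is `q ^ a * t ^ c`. -/
abbrev LaurentQT : Type := AddMonoidAlgebra ℂ (ℤ × ℤ)

/-- The field `ℂ(q, t)` of rational functions in the deformation parameters. -/
abbrev QT : Type := FractionRing LaurentQT

/-- The parameter `q`. -/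
def q : QT := algebraMap LaurentQT QT (AddMonoidAlgebra.single (1, 0) 1)

/-- The parameter `t`. -/
def t : QT := algebraMap LaurentQT QT (AddMonoidAlgebra.single (0, 1) 1)

/-- The `ℂ`-linear field involution `q ↦ q⁻¹`, `t ↦ t⁻¹` of `ℂ(q, t)`. -/
def conj : QT ≃+* QT :=
  IsFractionRing.ringEquivOfRingEquiv (K := QT) (L := QT)
    (AddMonoidAlgebra.domCongr ℂ ℂ (AddEquiv.neg (ℤ × ℤ))).toRingEquiv

/-- The monomial `q ^ a * t ^ c` for `u = (a, c)`. -/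
def mono (u : ℤ × ℤ) : QT := q ^ u.1 * t ^ u.2

/-- The `q`-integer `[n]_x = (x ^ n - x ^ (-n)) / (x - x⁻¹)`. -/
def qInt (x : QT) (n : ℤ) : QT := (x ^ n - x ^ (-n)) / (x - x⁻¹)

/-! ### Root system data -/

variable {ι R M N : Type*} [Fintype ι] [Field R] [CharZero R] [AddCommGroup M] [Module R M]
  [AddCommGroup N] [Module R N] {P : RootPairing ι R M N} [P.IsRootSystem] [P.IsCrystallographic]
  (b : P.Base)

/-- The squared length `(α, α)` of a root, for a Weyl invariant form (not yet normalized). -/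
def sqLength (P : RootPairing ι R M N) [P.IsCrystallographic] (α : ι) : ℕ :=
  (P.RootFormIn ℤ (P.rootSpanMem ℤ α) (P.rootSpanMem ℤ α)).toNat

/-- The dual tier number `r^∨`: the ratio of the squared lengths of long and short roots, i.e.
`1`, `2` or `3` according to the maximal number of edges between two vertices of the Dynkin
diagram. -/
def dualTier (P : RootPairing ι R M N) [P.IsCrystallographic] : ℤ :=
  (((⨆ α, sqLength P α) / (⨅ α, sqLength P α) : ℕ) : ℤ)

/-- The symmetrizing integers `r_i = r^∨ (α_i, α_i) / 2`, for the form in which long roots have squared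
length `2`; equivalently, `(α_i, α_i)` divided by the squared length of a short root. -/
def symmetrizer (i : b.support) : ℤ :=
  ((sqLength P i / (⨅ α, sqLength P α) : ℕ) : ℤ)

/-- The Cartan matrix `C_{ij} = (α_i^∨, α_j)`. -/
def cartan : Matrix b.support b.support ℤ := b.cartanMatrix.transpose

/-- The highest root: all the differences `θ - β` are sums of simple roots. -/
def IsHighestRoot (θ : ι) : Prop :=
  ∀ β : ι, P.root θ - P.root β ∈ AddSubmonoid.closure (P.root '' b.support)

/-- The Coxeter number `h = 1 + ht θ`, where `θ` is the highest root. -/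
def coxeterNumber (θ : ι) : ℤ := 1 + b.height θ

/-- The dual Coxeter number `h^∨ = 1 + ht θ^∨`, where `θ` is the highest root and the height of
`θ^∨` is taken with respect to the simple coroots. -/
def dualCoxeterNumber (θ : ι) : ℤ := 1 + b.flip.height θ

/-- The longest element of the Weyl group: it maps all positive roots to negative roots. -/
def IsLongest (w : P.weylGroup) : Prop :=
  ∀ α : ι, b.IsPos α → ∃ β : ι, b.IsPos β ∧ w • P.root α = -P.root β

/-- The fundamental weight `ω_i`, i.e. `(ω_i, α_j^∨) = δ_{ij}`. -/
def fundamentalWeight (i : b.support) : M :=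
  P.toPerfPair.symm (b.toCoweightBasis.coord i)

/-- The integer `2 r^∨ (ρ, ω_i) = r_i * ∑_{β > 0} (coefficient of α_i in β)`. -/
def rhoWeight (i : b.support) : ℤ :=
  symmetrizer b i * ∑ β : ι, if b.IsPos β then b.toWeightBasisInt.repr (P.rootSpanMem ℤ β) i else 0

/-- The integer `2 (ρ^∨, ω_i) = ∑_{β > 0} (coefficient of α_i^∨ in β^∨)`. -/
def rhoCoweight (i : b.support) : ℤ :=
  ∑ β : ι, if b.IsPos β then
    b.flip.toWeightBasisInt.repr (P.flip.rootSpanMem ℤ β) i else 0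

/-! ### Deformed Cartan matrices -/

/-- `C_{ij}(x, y) = (x ^ {r_i} y⁻¹ + x ^ {-r_i} y) δ_{ij} - [2 δ_{ij} - C_{ij}]_x`. -/
def defCartan (x y : QT) : Matrix b.support b.support QT := Matrix.of fun i j =>
  (if i = j then x ^ symmetrizer b i * y⁻¹ + x ^ (-symmetrizer b i) * y else 0)
    - qInt x ((if i = j then 2 else 0) - cartan b i j)

/-- `D_{ij}(x, y) = [r_i]_x δ_{ij}`. -/
def defDiag (x : QT) : Matrix b.support b.support QT :=
  Matrix.diagonal fun i => qInt x (symmetrizer b i)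

/-- `B(x, y) = D(x, y) C(x, y)`. -/
def defB (x y : QT) : Matrix b.support b.support QT := defDiag b x * defCartan b x y

/-! ### Heisenberg algebra and Fock modules -/

/-- The space underlying every Fock module `F(μ)`: polynomials in the `a_i[-m]`, `m ≥ 1`.
The variable `(i, n)` is `a_i[-(n + 1)]`, and the vacuum `|μ⟩` is `1`. -/
abbrev Fock : Type _ := MvPolynomial (b.support × ℕ) QT

/-- The constant `[a_i[m], a_j[-m]] = (1 / m) (q ^ m - q ^ (-m)) (t ^ m - t ^ (-m)) B_{ij}`. -/
def heis (m : ℕ) (i j : b.support) : QT :=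
  (m : QT)⁻¹ * (q ^ m - (q ^ m)⁻¹) * (t ^ m - (t ^ m)⁻¹) * defB b (q ^ m) (t ^ m) i j

/-- The action of the oscillator `a_i[m]`, `m ≠ 0`, on the Fock modules: multiplication for
`m < 0`, and the derivation killing the vacuum with `[a_i[m], a_j[-m]]` as above for `m > 0`.
(The zero modes act by scalars depending on the Fock module, see `Weight`; the value at `m = 0`
is not used.) -/
def osc (i : b.support) : ℤ → Module.End QT (Fock b)
  | .ofNat 0 => 0
  | .ofNat (n + 1) => ∑ j, heis b (n + 1) i j • (MvPolynomial.pderiv (j, n)).toLinearMap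
  | .negSucc n => LinearMap.mulLeft QT (MvPolynomial.X (i, n))

/-- Labels of Fock modules. The label of `F(μ)` is the family of pairs `(a_i, c_i)` with
`q ^ {2 (μ, ω_i)} = q ^ {a_i} t ^ {c_i}`; this is the scalar by which `q ^ {2 y_i[0]}` acts
on `F(μ)`. -/
abbrev Weight : Type _ := b.support → ℤ × ℤ

/-! ### Vertex operators -/

/-- The coefficient of `z ^ n` in `exp (∑_{m ≥ 1} x_m z ^ m)`. -/
def expCoeff {V : Type*} [AddCommGroup V] [Module QT V] (x : ℕ → Module.End QT V) (n : ℕ) :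
    Module.End QT V :=
  ∑ k ∈ Finset.range (n + 1), ((k.factorial : QT)⁻¹) •
    PowerSeries.coeff n ((PowerSeries.mk fun m => if m = 0 then 0 else x m) ^ k)

/-- The coefficient of `z ^ {-n}` in the normally ordered exponential
`:exp (∑_{m ≠ 0} ∑_i ξ_{i,m} a_i[m] z ^ {-m}):`, i.e. in
`exp (∑_{m < 0} …) exp (∑_{m > 0} …)`. The sum is finite on every vector. -/
def normalExp (ξ : b.support → ℤ → QT) (n : ℤ) (f : Fock b) : Fock b :=
  ∑ᶠ p : {p : ℕ × ℕ // (p.2 : ℤ) - p.1 = n},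
    expCoeff (fun m => ∑ i, ξ i (-m) • osc b i (-m)) p.1.1
      (expCoeff (fun m => ∑ i, ξ i m • osc b i m) p.1.2 f)

/-- A field `T(z) = ∑_n T[n] z ^ {-n}`: its modes `T[n]` act on all the Fock modules. -/
abbrev QField : Type _ := Weight b → ℤ → Fock b → Fock b

/-- The data `(e, c, ξ)` of a vertex operator
`q ^ {e.1} t ^ {e.2} q ^ {2 ∑_j c_j y_j[0]} :exp (∑_{m ≠ 0} ∑_j ξ_{j,m} a_j[m] z ^ {-m}):`.
The sum of data corresponds to the normally ordered product of vertex operators, and the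
negative of data to the normally ordered inverse. -/
abbrev Vertex : Type _ := (ℤ × ℤ) × (b.support → ℤ) × (b.support → ℤ → QT)

/-- The field given by the data of a vertex operator. -/
def Vertex.toField (v : Vertex b) : QField b := fun μ n f =>
  (mono v.1 * ∏ j, mono (μ j) ^ v.2.1 j) • normalExp b v.2.2 n f

/-- `A_i(z u) = t ^ {2 (ρ^∨, α_i)} q ^ {-2 r^∨ (ρ, α_i) + 2 a_i[0]}
:exp (∑_{m ≠ 0} a_i[m] (z u) ^ {-m}):` with `u = q ^ {u.1} t ^ {u.2}`. Here
`(ρ^∨, α_i) = 1`, `r^∨ (ρ, α_i) = r_i` and `a_i[0] = ∑_j C_{ji} y_j[0]`. -/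
def A (i : b.support) (u : ℤ × ℤ) : Vertex b :=
  ((-2 * symmetrizer b i, 2), fun j => cartan b j i, fun j m => if j = i then mono u ^ (-m) else 0)

/-- `Y_i(z u) = t ^ {2 (ρ^∨, ω_i)} q ^ {-2 r^∨ (ρ, ω_i) + 2 y_i[0]}
:exp (∑_{m ≠ 0} y_i[m] (z u) ^ {-m}):` with `u = q ^ {u.1} t ^ {u.2}`. The `y_i[m]` are defined
by `a_i[m] = ∑_j C_{ji}(q ^ m, t ^ m) y_j[m]`, i.e.
`y_i[m] = ∑_j (C(q ^ m, t ^ m)⁻¹)_{ji} a_j[m]`. -/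
def Y (i : b.support) (u : ℤ × ℤ) : Vertex b :=
  ((-rhoWeight b i, rhoCoweight b i), Pi.single i 1,
    fun j m => (defCartan b (q ^ m) (t ^ m))⁻¹ j i * mono u ^ (-m))

/-! ### Screening operators and generators -/

/-- The label of the target `F(-β α_i^∨)` of `S_i^+`, where `t = q ^ β`. -/
def weightPlus (i : b.support) : Weight b := Pi.single i (0, -2)

/-- The label of the target `F(r^∨ α_i)` of `S_i^-`. -/
def weightMinus (i : b.support) : Weight b := Pi.single i (2 * symmetrizer b i, 0)

/-- The screening operator `S_i^+ : F(0) → F(-β α_i^∨)`, the coefficient of `z ^ {-1}` in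
`e ^ {-Q_i / r_i} z ^ {-s_i^+[0]} :exp (∑_{m ≠ 0} s_i^+[m] z ^ {-m}):` with
`s_i^+[m] = a_i[m] / (q ^ {m r_i} - q ^ {-m r_i})`.
On `F(0)` the zero mode `s_i^+[0]` vanishes, and the shift operator `e ^ {-Q_i / r_i}`, which
commutes with all the `a_j[m]`, `m ≠ 0`, identifies `F(0)` with `F(-β α_i^∨)`. -/
def screenPlus (i : b.support) : Fock b → Fock b :=
  normalExp b (fun j m =>
    if j = i then (q ^ (m * symmetrizer b i) - q ^ (-(m * symmetrizer b i)))⁻¹ else 0) 1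

/-- The screening operator `S_i^- : F(0) → F(r^∨ α_i)`, the coefficient of `z ^ {-1}` in
`e ^ {Q_i / β} z ^ {s_i^-[0]} :exp (-∑_{m ≠ 0} a_i[m] / (t ^ m - t ^ {-m}) z ^ {-m}):`. -/
def screenMinus (i : b.support) : Fock b → Fock b :=
  normalExp b (fun j m => if j = i then -(t ^ m - t ^ (-m))⁻¹ else 0) 1

/-- All the Fourier modes of the field commute with all the screening operators. -/
def CommutesWithScreening (T : QField b) : Prop :=
  ∀ (n : ℤ) (j : b.support) (f : Fock b),
    T (weightPlus b j) n (screenPlus b j f) = screenPlus b j (T 0 n f) ∧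
    T (weightMinus b j) n (screenMinus b j f) = screenMinus b j (T 0 n f)

/-- `T(z)` is a generator `T_i(z)`: its Fourier modes commute with the screening operators, and
it is a finite sum of `Y_i(z)`, with coefficient `1`, and of terms
`c(q, t) :Y_i(z) A_{i_1}(z q ^ {a_1} t ^ {c_1})⁻¹ … A_{i_k}(z q ^ {a_k} t ^ {c_k})⁻¹:`
with `k ≥ 1` and integers `a_l`, `c_l`. -/
def IsGenerator (i : b.support) (T : QField b) : Prop :=
  CommutesWithScreening b T ∧
  ∃ (K : ℕ) (c : Fin K → QT) (L : Fin K → List (b.support × (ℤ × ℤ))),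
    (∀ k, L k ≠ []) ∧
    T = (Y b i 0).toField + ∑ k, c k •
      (Y b i 0 - ((L k).map fun p => A b p.1 p.2).sum).toField

/-! ### The involution `ϑ` -/

/-- The sign change `a_i[-m] ↦ -a_i[-m]` on the polynomial ring. -/
def signFock : Fock b ≃ₐ[QT] Fock b :=
  AlgEquiv.ofAlgHom (MvPolynomial.aeval fun v => -MvPolynomial.X v)
    (MvPolynomial.aeval fun v => -MvPolynomial.X v)
    (by ext v; simp) (by ext v; simp)

/-- The semilinear automorphism of the Fock modules that fixes the vacuum, maps `a_i[-m]` to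
`-a_i[-m]` and acts on the coefficients by `q ↦ q⁻¹`, `t ↦ t⁻¹`. -/
def thetaFock : Fock b ≃+* Fock b :=
  (MvPolynomial.mapEquiv _ conj).trans (signFock b).toRingEquiv

/-- The transformation `ϑ` on operators: conjugation by `thetaFock`. On each Fock module this is
the semilinear automorphism with `q ↦ q⁻¹`, `t ↦ t⁻¹`, `a_i[m] ↦ -a_i[m]` for `m ≠ 0`, and
`q ^ {2 y_i[0]} ↦ q ^ {-2 y_i[0]}`. -/
def thetaOp (X : Fock b → Fock b) : Fock b → Fock b :=
  fun f => thetaFock b (X ((thetaFock b).symm f))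

/-- The transformation `ϑ` on fields, applied to each Fourier mode. -/
def theta (T : QField b) : QField b := fun μ n => thetaOp b (T μ n)

/-- The field `T(z u) = ∑_n T[n] u ^ {-n} z ^ {-n}` for a scalar `u`. -/
def rescale (u : QT) (T : QField b) : QField b := fun μ n f => u ^ (-n) • T μ n f

end

end DeformedW

set_option linter.unusedSectionVars false

/-! A term of `T_i` is a monomial `Y_i ∏ A_k(zu)⁻¹`. It is recorded by a configuration `n`, a family
of Laurent polynomials with nonnegative coefficients, and has weight `e_i - C(q,t) n`. Below,
"degree" means the exponent of `t`.

The screening operators kill the vacuum, so they also kill the value of `T_i(z)` at the vacuum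
(`CommutesWithScreening.singular`). Testing this with differential operators on the Fock space gives
relations between residues of operator products with the screening currents. All poles are simple,
and the residues of the monomials that leave the same vertex operator behind at a pole add up to
zero (`poles_le_one`, `sum_resid_eq_zero`). Two monomials share a pole of `S_j^-` only if they
differ by a `t`-string of factors `A_j` (`Linked.raise_or_lower`).

Cancellation of poles alone determines the lowest monomial `v`. A monomial that is maximal in its
highest degrees is antidominant, lies in degrees strictly between `0` and a number `h`, and is the
inverse of a single `Y_k(zu)` (`PolesCancel.weight_maximal`); it is also the only antidominant term.
Here `h` comes from the specialization `q = 1`: it is the first index at which the Chebyshev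
polynomials of `2 - C` vanish (`exists_isCoxeter`).

The involution commutes with the screening operators. The rescaled field `ϑ(T_{i*})` is again a
combination of monomials based on `Y_i`, now built downwards from `v` (`fieldOf_reflectSum`).
Subtracting `c(v)` times it from `T_i` leaves a singular combination without `v`; its maximal term
would be antidominant, hence equal to `v`, so the difference is zero
(`Singular.eq_smul_reflectSum`). To see `c(v) = 1`, fill `v` column by column. At each step exactly
two monomials share the relevant pole, and the structure factors so produced cancel when a column is
complete (`coeff_maximal_eq`).

The shift is read off along the same filling. At `q = t = 1` the weights move from `ω_i` to `-ω_k`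
by simple reflections, whence `k = i*`. Their first derivatives follow a cocycle defined by a sum
over positive roots, and its end value, computed with the highest root, gives `r^∨ h^∨` and `h`
(`lowest_weight_eq`). -/

namespace DeformedW

noncomputable section

/-! ### Configurations of factors `A_j` and their weights -/

/-- Laurent polynomials `ℤ[q^{±1}, t^{±1}]`. -/
abbrev IntLaurent : Type := AddMonoidAlgebra ℤ (ℤ × ℤ)

namespace IntLaurent

/-- The monomial `q ^ a * t ^ c` for `u = (a, c)`. -/
def X (u : ℤ × ℤ) : IntLaurent := AddMonoidAlgebra.single u 1

lemma coeff_X (u v : ℤ × ℤ) : (X u).coeff v = if u = v then 1 else 0 := by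
  simp [X, Finsupp.single_apply]

@[simp] lemma coeff_X_self (u : ℤ × ℤ) : (X u).coeff u = 1 := by simp [coeff_X]

lemma coeff_X_of_ne {u v : ℤ × ℤ} (h : u ≠ v) : (X u).coeff v = 0 := by simp [coeff_X, h]

lemma coeff_X_mul (u v : ℤ × ℤ) (p : IntLaurent) : (X u * p).coeff v = p.coeff (v - u) := by
  have := AddMonoidAlgebra.coeff_single_mul_apply p 1 u v
  rw [X, this, one_mul, neg_add_eq_sub]

lemma X_mul_X (u v : ℤ × ℤ) : X u * X v = X (u + v) := by
  simp [X, AddMonoidAlgebra.single_mul_single]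

lemma X_zero : X 0 = 1 := rfl

@[ext] lemma ext {p p' : IntLaurent} (h : ∀ a d, p.coeff (a, d) = p'.coeff (a, d)) : p = p' := by
  apply AddMonoidAlgebra.coeff_injective
  ext ⟨a, d⟩
  exact h a d

/-- The `q`-integer `[n]_q` as a Laurent polynomial. -/
def qNat (n : ℕ) : IntLaurent := ∑ l ∈ Finset.range n, X ((n : ℤ) - 1 - 2 * l, 0)

lemma coeff_qNat_mul (n : ℕ) (p : IntLaurent) (a d : ℤ) :
    (qNat n * p).coeff (a, d) = ∑ l ∈ Finset.range n, p.coeff (a - ((n : ℤ) - 1 - 2 * l), d) := by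
  simp [qNat, Finset.sum_mul, AddMonoidAlgebra.coeff_sum, coeff_X_mul]

@[simp] lemma qNat_zero : qNat 0 = 0 := by simp [qNat]

/-- The sum of the coefficients of `t ^ d`. -/
def col (d : ℤ) : IntLaurent →+ ℤ :=
  (Finsupp.liftAddHom fun u : ℤ × ℤ =>
    if u.2 = d then AddMonoidHom.id ℤ else 0).comp
    (AddMonoidAlgebra.coeffAddEquiv (R := ℤ) (M := ℤ × ℤ)).toAddMonoidHom

lemma col_single (d : ℤ) (u : ℤ × ℤ) (k : ℤ) :
    col d (AddMonoidAlgebra.single u k) = if u.2 = d then k else 0 := by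
  simp only [col, AddMonoidHom.coe_comp, Function.comp_apply]
  erw [Finsupp.liftAddHom_apply_single]
  split_ifs <;> simp

lemma col_X (d : ℤ) (u : ℤ × ℤ) : col d (X u) = if u.2 = d then 1 else 0 := col_single d u 1

lemma col_eq_sum (d : ℤ) (p : IntLaurent) :
    col d p = ∑ u ∈ p.coeff.support, if u.2 = d then p.coeff u else 0 := by
  simp only [col, AddMonoidHom.coe_comp, Function.comp_apply]
  erw [Finsupp.liftAddHom_apply]
  rw [Finsupp.sum]
  refine Finset.sum_congr rfl fun u _ => ?_
  split_ifs <;> rfl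

@[elab_as_elim]
lemma induction {motive : IntLaurent → Prop} (p : IntLaurent) (zero : motive 0)
    (single : ∀ u k, motive (AddMonoidAlgebra.single u k))
    (add : ∀ p p', motive p → motive p' → motive (p + p')) : motive p := by
  have : ∀ c : (ℤ × ℤ) →₀ ℤ, motive (AddMonoidAlgebra.ofCoeff c) := by
    intro c
    induction c using Finsupp.induction_linear with
    | zero => exact zero
    | add f g hf hg => exact add _ _ hf hg
    | single u k => exact single u k
  exact this p.coeff

lemma col_X_mul (d : ℤ) (u : ℤ × ℤ) (p : IntLaurent) : col d (X u * p) = col (d - u.2) p := by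
  induction p using induction with
  | zero => simp
  | add p p' h h' => rw [mul_add, map_add, map_add, h, h']
  | single v k =>
    rw [X, AddMonoidAlgebra.single_mul_single, col_single, col_single]
    simp [eq_sub_iff_add_eq, add_comm]

lemma col_qNat_mul (n : ℕ) (d : ℤ) (p : IntLaurent) : col d (qNat n * p) = n * col d p := by
  simp [qNat, Finset.sum_mul, col_X_mul]

lemma col_eq_zero {d : ℤ} {p : IntLaurent} (h : ∀ a, p.coeff (a, d) = 0) : col d p = 0 := by
  rw [col_eq_sum]
  refine Finset.sum_eq_zero fun u _ => ?_
  split_ifs with hu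
  · obtain ⟨a, c⟩ := u
    obtain rfl : c = d := hu
    exact h a
  · rfl

lemma col_nonneg {d : ℤ} {p : IntLaurent} (h : ∀ a, 0 ≤ p.coeff (a, d)) : 0 ≤ col d p := by
  rw [col_eq_sum]
  refine Finset.sum_nonneg fun u _ => ?_
  split_ifs with hu
  · obtain ⟨a, c⟩ := u
    obtain rfl : c = d := hu
    exact h a
  · rfl

lemma coeff_le_col {d : ℤ} {p : IntLaurent} (h : ∀ a, 0 ≤ p.coeff (a, d)) (a : ℤ) :
    p.coeff (a, d) ≤ col d p := by
  rw [col_eq_sum]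
  by_cases ha : (a, d) ∈ p.coeff.support
  · have := Finset.single_le_sum (s := p.coeff.support)
      (f := fun u => if u.2 = d then p.coeff u else 0) (fun u _ => ?_) ha
    · simpa using this
    · obtain ⟨a', c⟩ := u
      dsimp only
      split_ifs with hu
      · obtain rfl : c = d := hu
        exact h a'
      · rfl
  · rw [Finsupp.notMem_support_iff.1 ha, ← col_eq_sum]
    exact col_nonneg h

/-- The way back from `q = 1`: for a nonnegative column the specialization loses no information
about vanishing. -/
lemma coeff_eq_zero_of_col {d : ℤ} {p : IntLaurent} (h : ∀ a, 0 ≤ p.coeff (a, d))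
    (hc : col d p ≤ 0) (a : ℤ) : p.coeff (a, d) = 0 :=
  le_antisymm ((coeff_le_col h a).trans hc) (h a)

lemma exists_bound (p : IntLaurent) : ∃ B : ℤ, ∀ a d, p.coeff (a, d) ≠ 0 → |a| ≤ B ∧ |d| ≤ B := by
  obtain ⟨B, hB⟩ := (p.coeff.support.image fun u : ℤ × ℤ => max |u.1| |u.2|).bddAbove
  refine ⟨B, fun a d h => ?_⟩
  have := hB (Finset.mem_coe.2 (Finset.mem_image_of_mem _ (Finsupp.mem_support_iff.2 h)))
  exact ⟨(le_max_left _ _).trans this, (le_max_right _ _).trans this⟩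

end IntLaurent

open IntLaurent

/-- The combinatorial data of a symmetrizable Cartan matrix `C`: the symmetrizing integers, and
the matrix `2 - C`. -/
structure CartanDatum (I : Type*) where
  /-- The symmetrizing integers. -/
  len : I → ℤ
  /-- The matrix `2 - C`. -/
  adj : I → I → ℕ
  len_pos : ∀ j, 0 < len j
  adj_self : ∀ j, adj j j = 0

namespace CartanDatum

variable {I : Type*} [Fintype I] [DecidableEq I] (D : CartanDatum I)

/-- The matrix `C(q, t)` over the integral Laurent polynomials. -/
def qCartan (n : I → IntLaurent) (j : I) : IntLaurent :=
  (X (D.len j, -1) + X (-D.len j, 1)) * n j - ∑ k, qNat (D.adj j k) * n k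

/-- The weight `e_i - C n` of the monomial `Y_i ∏ A_k(z x)^{-n_k(x)}`. -/
def weight (i : I) (n : I → IntLaurent) (j : I) : IntLaurent :=
  Pi.single (M := fun _ => IntLaurent) i 1 j - D.qCartan n j

/-- The positive part of the formula for the weight. -/
def inflow (i : I) (n : I → IntLaurent) (j : I) : IntLaurent :=
  Pi.single (M := fun _ => IntLaurent) i 1 j + ∑ k, qNat (D.adj j k) * n k

lemma qCartan_add (n n' : I → IntLaurent) (j : I) :
    D.qCartan (n + n') j = D.qCartan n j + D.qCartan n' j := by
  simp only [qCartan, Pi.add_apply, mul_add, Finset.sum_add_distrib]; ring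

lemma qCartan_neg (n : I → IntLaurent) (j : I) :
    D.qCartan (-n) j = -D.qCartan n j := by
  simp only [qCartan, Pi.neg_apply, mul_neg, Finset.sum_neg_distrib]; ring

lemma qCartan_sub (n n' : I → IntLaurent) (j : I) :
    D.qCartan (n - n') j = D.qCartan n j - D.qCartan n' j := by
  rw [sub_eq_add_neg, qCartan_add, qCartan_neg, sub_eq_add_neg]

lemma coeff_qCartan (n : I → IntLaurent) (j : I) (a d : ℤ) :
    (D.qCartan n j).coeff (a, d) = (n j).coeff (a - D.len j, d + 1) +
      (n j).coeff (a + D.len j, d - 1) - ∑ k, (qNat (D.adj j k) * n k).coeff (a, d) := by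
  simp [qCartan, add_mul, coeff_X_mul, AddMonoidAlgebra.coeff_sum]

lemma coeff_weight (i : I) (n : I → IntLaurent) (j : I) (a d : ℤ) :
    (D.weight i n j).coeff (a, d) = (D.inflow i n j).coeff (a, d) -
      (n j).coeff (a - D.len j, d + 1) - (n j).coeff (a + D.len j, d - 1) := by
  simp [weight, coeff_qCartan, inflow, AddMonoidAlgebra.coeff_sum]
  ring

/-- Since `adj j j = 0`, the inflow at `j` does not involve `n_j`. It is constant along all moves in
direction `j`, so only the two shifted copies of `n_j` in the weight change. -/
lemma inflow_congr {i : I} {n n' : I → IntLaurent} {j : I} (h : ∀ k, k ≠ j → n' k = n k) :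
    D.inflow i n' j = D.inflow i n j := by
  unfold inflow
  congr 1
  refine Finset.sum_congr rfl fun k _ => ?_
  by_cases hk : k = j
  · subst hk; simp [D.adj_self]
  · rw [h k hk]

lemma coeff_single_one (i j : I) (a d : ℤ) :
    (Pi.single (M := fun _ => IntLaurent) i 1 j).coeff (a, d) =
      if j = i ∧ a = 0 ∧ d = 0 then 1 else 0 := by
  by_cases h : j = i
  · subst h
    rw [Pi.single_eq_same, ← X_zero, coeff_X]
    simp [Prod.ext_iff, eq_comm]
  · simp [h]

lemma coeff_inflow (i : I) (n : I → IntLaurent) (j : I) (a d : ℤ) :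
    (D.inflow i n j).coeff (a, d) = (if j = i ∧ a = 0 ∧ d = 0 then 1 else 0) +
      ∑ k, ∑ l ∈ Finset.range (D.adj j k),
        (n k).coeff (a - ((D.adj j k : ℤ) - 1 - 2 * l), d) := by
  simp [inflow, AddMonoidAlgebra.coeff_sum, coeff_single_one, coeff_qNat_mul]

lemma col_qCartan (n : I → IntLaurent) (j : I) (d : ℤ) :
    col d (D.qCartan n j) = col (d + 1) (n j) + col (d - 1) (n j) -
      ∑ k, D.adj j k * col d (n k) := by
  simp [qCartan, add_mul, col_X_mul, col_qNat_mul]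

lemma col_single_one (i j : I) (d : ℤ) :
    col d (Pi.single (M := fun _ => IntLaurent) i 1 j) = if j = i ∧ d = 0 then 1 else 0 := by
  by_cases h : j = i
  · subst h
    rw [Pi.single_eq_same, ← X_zero, col_X]
    simp [eq_comm]
  · simp [h]

lemma col_weight (i : I) (n : I → IntLaurent) (j : I) (d : ℤ) :
    col d (D.weight i n j) = (if j = i ∧ d = 0 then 1 else 0) - col (d + 1) (n j) -
      col (d - 1) (n j) + ∑ k, D.adj j k * col d (n k) := by
  rw [weight, map_sub, col_qCartan, col_single_one]; ring

end CartanDatum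

end

end DeformedW

/-! ### Consequences of the cancellation of poles for configurations -/

namespace DeformedW

noncomputable section

open IntLaurent

namespace IntLaurent

lemma X_ne_zero (u : ℤ × ℤ) : X u ≠ 0 := by
  intro h
  have := coeff_X_self u
  rw [h] at this
  simp at this

lemma X_sub_X_ne_zero {u v : ℤ × ℤ} (h : u ≠ v) : X u - X v ≠ 0 := by
  intro h0
  have : (X u - X v).coeff u = 0 := by rw [h0]; rfl
  simp [coeff_X_of_ne h.symm] at this

lemma X_injective : Function.Injective X := by
  intro u v h
  by_contra hne
  exact X_sub_X_ne_zero hne (sub_eq_zero.2 h)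

lemma X_sub_X_mul_sum_range (u v : ℤ × ℤ) (k : ℕ) :
    (X v - X (-v)) * ∑ l ∈ Finset.range k, X (u + v + (2 * l : ℤ) • v) =
      X (u + (2 * k : ℤ) • v) - X u := by
  rw [Finset.mul_sum]
  have : ∀ l ∈ Finset.range k, (X v - X (-v)) * X (u + v + (2 * l : ℤ) • v) =
      X (u + (2 * (l + 1 : ℕ) : ℤ) • v) - X (u + (2 * l : ℤ) • v) := by
    intro l _
    rw [sub_mul, X_mul_X, X_mul_X]
    congr 2
    · push_cast; module
    · module
  rw [Finset.sum_congr rfl this, Finset.sum_range_sub (fun l : ℕ => X (u + (2 * l : ℤ) • v))]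
  simp

/-- If `(t - t⁻¹) p` is a difference of two monomials, they differ by an even power of `t`. -/
lemma parity_of_mul_eq {p : IntLaurent} {u u' : ℤ × ℤ}
    (h : (X (0, 1) - X (0, -1)) * p = X u - X u') :
    u.1 = u'.1 ∧ (2 : ℤ) ∣ u'.2 - u.2 := by
  -- Reducing the exponent of `t` modulo `2` identifies `t` with `t⁻¹` and kills the left-hand side.
  let f : ℤ × ℤ →+ ℤ × ZMod 2 := (AddMonoidHom.id ℤ).prodMap (Int.castAddHom (ZMod 2))
  let F := AddMonoidAlgebra.mapDomainRingHom ℤ f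
  have hF : ∀ v, F (X v) = AddMonoidAlgebra.single (f v) 1 := fun v => by
    simp [F, X]
  have h1 := congrArg F h
  have h2 : f (0, 1) = f (0, -1) := by
    simp [f]
  rw [map_mul, map_sub, map_sub, hF, hF, hF, hF, h2, sub_self, zero_mul, eq_comm, sub_eq_zero] at h1
  have h3 : f u = f u' := by
    by_contra hne
    have := congrArg (fun x => x.coeff (f u)) h1
    simp [Ne.symm hne] at this
  have h4 : (f u).1 = (f u').1 := by rw [h3]
  have h5 : (f u).2 = (f u').2 := by rw [h3]
  refine ⟨h4, ?_⟩
  exact (ZMod.intCast_eq_intCast_iff_dvd_sub _ _ 2).1 h5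

/-- Without a positive coefficient in degree `s`, the coefficients of `p` would be non-increasing
along steps of `2r`, and finite support would make them zero. Applied to a weight, this turns any
nonzero column into a pole of `S_j^-`. -/
lemma exists_ascent {p : IntLaurent} {r s a : ℤ} (hr : 0 < r) (ha : p.coeff (a, s) ≠ 0) :
    ∃ a, 0 < ((X (-r, 0) - X (r, 0)) * p).coeff (a, s) := by
  by_contra! hno
  have step : ∀ c, p.coeff (c + 2 * r, s) ≤ p.coeff (c, s) := by
    intro c
    have := hno (c + r)
    simp only [sub_mul, AddMonoidAlgebra.coeff_sub, Finsupp.sub_apply, coeff_X_mul,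
      Prod.mk_sub_mk, sub_zero, sub_neg_eq_add, add_sub_cancel_right] at this
    rw [show c + r + r = c + 2 * r by ring] at this
    linarith
  have steps : ∀ (k : ℕ) (c : ℤ), p.coeff (c + 2 * r * k, s) ≤ p.coeff (c, s) := by
    intro k
    induction k with
    | zero => intro c; simp
    | succ k ih =>
      intro c
      have := (ih (c + 2 * r)).trans (step c)
      rw [show c + 2 * r + 2 * r * (k : ℤ) = c + 2 * r * ((k + 1 : ℕ) : ℤ) by push_cast; ring] at this
      exact this
  obtain ⟨B, hB⟩ := exists_bound p
  have hB0 : 0 ≤ B := (abs_nonneg _).trans (hB a s ha).1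
  have big : ∀ c : ℤ, B < |c| → p.coeff (c, s) = 0 := by
    intro c hc
    by_contra h
    exact absurd (hB c s h).1 (not_le.2 hc)
  obtain ⟨k, hk⟩ : ∃ k : ℕ, B + |a| < 2 * r * k := by
    refine ⟨(B + |a| + 1).toNat, ?_⟩
    rw [Int.toNat_of_nonneg (by positivity)]
    nlinarith [abs_nonneg a]
  have h1 := steps k a
  have h2 := steps k (a - 2 * r * k)
  rw [sub_add_cancel] at h2
  rw [big (a + 2 * r * k) (by have := neg_abs_le a; rw [lt_abs]; left; linarith)] at h1
  rw [big (a - 2 * r * k) (by have := le_abs_self a; rw [lt_abs]; right; linarith)] at h2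
  exact ha (le_antisymm h2 h1)

end IntLaurent

namespace CartanDatum

variable {I : Type*} [Fintype I] [DecidableEq I] (D : CartanDatum I)

/-- Two configurations whose monomials share the points `u`, `u'` at which they have poles with
respect to the screening current labelled by `j`. -/
def Linked (j : I) (τ : IntLaurent) (n n' : I → IntLaurent) (u u' : ℤ × ℤ) : Prop :=
  (∀ k, k ≠ j → n' k = n k) ∧ τ * (n j - n' j) = X u - X u'

/-- The Laurent polynomial whose coefficient at `u` is the order of the pole at `u` of the operator
product with `S_j^-`. -/
def poles (i : I) (n : I → IntLaurent) (j : I) : IntLaurent :=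
  (X (-D.len j, 0) - X (D.len j, 0)) * D.weight i n j

/-- Every pole with respect to some `S_j^-` is shared with another monomial. -/
def PolesCancel (i : I) (S : Finset (I → IntLaurent)) : Prop :=
  ∀ n ∈ S, ∀ j u, 0 < (D.poles i n j).coeff u →
    ∃ n' ∈ S, n' ≠ n ∧ ∃ u', Linked j (X (0, 1) - X (0, -1)) n n' u u'

/-- `n'` arises from `n` by adding terms to `n_j` in degrees larger than `s`. -/
structure Raise (j : I) (a s : ℤ) (n n' : I → IntLaurent) (k : ℕ) : Prop where
  other : ∀ l, l ≠ j → n' l = n l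
  pos : 1 ≤ k
  eq : n' j = n j + ∑ l ∈ Finset.range k, X (a, s + 1 + 2 * l)

/-- `n'` arises from `n` by removing terms from `n_j` in degrees smaller than `s`. -/
structure Lower (j : I) (a s : ℤ) (n n' : I → IntLaurent) (k : ℕ) : Prop where
  other : ∀ l, l ≠ j → n' l = n l
  pos : 1 ≤ k
  eq : n' j = n j - ∑ l ∈ Finset.range k, X (a, s - 1 - 2 * l)

lemma Linked.ne {j : I} {n n' : I → IntLaurent} {u u' : ℤ × ℤ} {τ : IntLaurent} (hτ : τ ≠ 0)
    (h : Linked j τ n n' u u') (hne : n' ≠ n) : u ≠ u' := by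
  rintro rfl
  apply hne
  have h0 : n j - n' j = 0 := by
    have := h.2
    rw [sub_self] at this
    exact (mul_eq_zero.1 this).resolve_left hτ
  funext k
  by_cases hk : k = j
  · subst hk; exact (sub_eq_zero.1 h0).symm
  · exact h.1 k hk

lemma t_sub_ne_zero : X (0, 1) - X (0, -1) ≠ 0 := X_sub_X_ne_zero (by decide)

/-- Solving `(t - t⁻¹) p = X u - X u'` is summing a geometric progression: by parity `u'` is `u`
times an even power of `t`, and the sign of the exponent decides whether the string is added or
removed. -/
lemma Linked.raise_or_lower {j : I} {n n' : I → IntLaurent} {u u' : ℤ × ℤ}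
    (h : Linked j (X (0, 1) - X (0, -1)) n n' u u') (hne : n' ≠ n) :
    (∃ k : ℕ, Raise j u.1 u.2 n n' k ∧ u' = (u.1, u.2 + 2 * k)) ∨
      ∃ k : ℕ, Lower j u.1 u.2 n n' k ∧ u' = (u.1, u.2 - 2 * k) := by
  have huu := h.ne t_sub_ne_zero hne
  obtain ⟨a, s⟩ := u
  obtain ⟨a', s'⟩ := u'
  obtain ⟨rfl, c, hc⟩ := parity_of_mul_eq h.2
  dsimp only at hc ⊢
  obtain rfl : s' = s + 2 * c := by linarith
  rcases lt_trichotomy c 0 with hc0 | rfl | hc0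
  · right
    obtain ⟨k, rfl⟩ : ∃ k : ℕ, c = -k := ⟨c.natAbs, by omega⟩
    refine ⟨k, ⟨h.1, by omega, ?_⟩, by ext <;> simp; ring⟩
    have key := X_sub_X_mul_sum_range (a, s) (0, -1) k
    have e1 : ∀ l : ℕ, (a, s) + ((0 : ℤ), (-1 : ℤ)) + (2 * l : ℤ) • ((0 : ℤ), (-1 : ℤ)) =
        (a, s - 1 - 2 * l) := by intro l; ext <;> simp; ring
    have e2 : (a, s) + (2 * k : ℤ) • ((0 : ℤ), (-1 : ℤ)) = (a, s + 2 * -(k : ℤ)) := by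
      ext <;> simp
    simp only [e1, e2, Prod.neg_mk, neg_neg, neg_zero] at key
    have : (X (0, 1) - X (0, -1)) *
        (n j - n' j - ∑ l ∈ Finset.range k, X (a, s - 1 - 2 * l)) = 0 := by
      rw [mul_sub, h.2, ← neg_sub (X (0, -1)), neg_mul, key]; ring
    have := (mul_eq_zero.1 this).resolve_left t_sub_ne_zero
    rw [← sub_eq_zero, ← neg_eq_zero, ← this]; ring
  · simp at huu
  · left
    obtain ⟨k, rfl⟩ : ∃ k : ℕ, c = k := ⟨c.natAbs, by omega⟩
    refine ⟨k, ⟨h.1, by omega, ?_⟩, rfl⟩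
    have key := X_sub_X_mul_sum_range (a, s) (0, 1) k
    have e1 : ∀ l : ℕ, (a, s) + ((0 : ℤ), (1 : ℤ)) + (2 * l : ℤ) • ((0 : ℤ), (1 : ℤ)) =
        (a, s + 1 + 2 * l) := by intro l; ext <;> simp
    have e2 : (a, s) + (2 * k : ℤ) • ((0 : ℤ), (1 : ℤ)) = (a, s + 2 * (k : ℤ)) := by
      ext <;> simp
    simp only [e1, e2, Prod.neg_mk, neg_zero] at key
    have : (X (0, 1) - X (0, -1)) *
        (n j - n' j + ∑ l ∈ Finset.range k, X (a, s + 1 + 2 * l)) = 0 := by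
      rw [mul_add, h.2, key]; ring
    have := (mul_eq_zero.1 this).resolve_left t_sub_ne_zero
    rw [← sub_eq_zero, ← neg_eq_zero, ← this]; ring

lemma sum_coeff_nonneg {A : Type*} (T : Finset A) (u : A → ℤ × ℤ) (v : ℤ × ℤ) :
    0 ≤ (∑ l ∈ T, X (u l)).coeff v := by
  rw [AddMonoidAlgebra.coeff_sum, Finsupp.finsetSum_apply]
  refine Finset.sum_nonneg fun l _ => ?_
  rw [coeff_X]; split_ifs <;> simp

lemma sum_coeff_pos {A : Type*} {T : Finset A} {u : A → ℤ × ℤ} {l : A} (hl : l ∈ T) :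
    0 < (∑ l ∈ T, X (u l)).coeff (u l) := by
  rw [AddMonoidAlgebra.coeff_sum, Finsupp.finsetSum_apply]
  refine Finset.sum_pos' (fun l _ => ?_) ⟨l, hl, by simp⟩
  rw [coeff_X]; split_ifs <;> simp

lemma sum_coeff_eq_zero {A : Type*} {T : Finset A} {u : A → ℤ × ℤ} {v : ℤ × ℤ}
    (h : ∀ l ∈ T, u l ≠ v) : (∑ l ∈ T, X (u l)).coeff v = 0 := by
  rw [AddMonoidAlgebra.coeff_sum, Finsupp.finsetSum_apply]
  exact Finset.sum_eq_zero fun l hl => coeff_X_of_ne (h l hl)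

namespace Raise

variable {j : I} {a s : ℤ} {n n' : I → IntLaurent} {k : ℕ} (h : Raise j a s n n' k)
include h

lemma le (l : I) (c d : ℤ) : (n l).coeff (c, d) ≤ (n' l).coeff (c, d) := by
  by_cases hl : l = j
  · subst hl
    rw [h.eq, AddMonoidAlgebra.coeff_add, Finsupp.add_apply]
    linarith [sum_coeff_nonneg (Finset.range k) (fun l : ℕ => (a, s + 1 + 2 * (l : ℤ))) (c, d)]
  · rw [h.other l hl]

lemma eq_of_le {l : I} {c d : ℤ} (hd : d ≤ s) : (n' l).coeff (c, d) = (n l).coeff (c, d) := by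
  by_cases hl : l = j
  · subst hl
    rw [h.eq, AddMonoidAlgebra.coeff_add, Finsupp.add_apply,
      sum_coeff_eq_zero (u := fun l : ℕ => (a, s + 1 + 2 * (l : ℤ))), add_zero]
    intro m _ he
    have : s + 1 + 2 * (m : ℤ) = d := congrArg Prod.snd he
    omega
  · rw [h.other l hl]

lemma lt_of_lt {l : ℕ} (hl : l < k) :
    (n j).coeff (a, s + 1 + 2 * l) < (n' j).coeff (a, s + 1 + 2 * l) := by
  rw [h.eq, AddMonoidAlgebra.coeff_add, Finsupp.add_apply]
  linarith [sum_coeff_pos (u := fun l : ℕ => (a, s + 1 + 2 * (l : ℤ))) (Finset.mem_range.2 hl)]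

lemma eq_of_gt {l : I} {c d : ℤ} (hd : s + 1 + 2 * (k - 1 : ℕ) < d) :
    (n' l).coeff (c, d) = (n l).coeff (c, d) := by
  by_cases hl : l = j
  · subst hl
    rw [h.eq, AddMonoidAlgebra.coeff_add, Finsupp.add_apply,
      sum_coeff_eq_zero (u := fun l : ℕ => (a, s + 1 + 2 * (l : ℤ))), add_zero]
    intro m hm he
    have : s + 1 + 2 * (m : ℤ) = d := congrArg Prod.snd he
    have := Finset.mem_range.1 hm
    omega
  · rw [h.other l hl]

end Raise

namespace Lower

variable {j : I} {a s : ℤ} {n n' : I → IntLaurent} {k : ℕ} (h : Lower j a s n n' k)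
include h

lemma le (l : I) (c d : ℤ) : (n' l).coeff (c, d) ≤ (n l).coeff (c, d) := by
  by_cases hl : l = j
  · subst hl
    rw [h.eq, AddMonoidAlgebra.coeff_sub, Finsupp.sub_apply]
    linarith [sum_coeff_nonneg (Finset.range k) (fun l : ℕ => (a, s - 1 - 2 * (l : ℤ))) (c, d)]
  · rw [h.other l hl]

lemma eq_of_ge {l : I} {c d : ℤ} (hd : s ≤ d) : (n' l).coeff (c, d) = (n l).coeff (c, d) := by
  by_cases hl : l = j
  · subst hl
    rw [h.eq, AddMonoidAlgebra.coeff_sub, Finsupp.sub_apply,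
      sum_coeff_eq_zero (u := fun l : ℕ => (a, s - 1 - 2 * (l : ℤ))), sub_zero]
    intro m _ he
    have : s - 1 - 2 * (m : ℤ) = d := congrArg Prod.snd he
    omega
  · rw [h.other l hl]

lemma lt_of_lt {l : ℕ} (hl : l < k) :
    (n' j).coeff (a, s - 1 - 2 * l) < (n j).coeff (a, s - 1 - 2 * l) := by
  rw [h.eq, AddMonoidAlgebra.coeff_sub, Finsupp.sub_apply]
  linarith [sum_coeff_pos (u := fun l : ℕ => (a, s - 1 - 2 * (l : ℤ))) (Finset.mem_range.2 hl)]

lemma eq_of_lt {l : I} {c d : ℤ} (hd : d < s - 1 - 2 * (k - 1 : ℕ)) :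
    (n' l).coeff (c, d) = (n l).coeff (c, d) := by
  by_cases hl : l = j
  · subst hl
    rw [h.eq, AddMonoidAlgebra.coeff_sub, Finsupp.sub_apply,
      sum_coeff_eq_zero (u := fun l : ℕ => (a, s - 1 - 2 * (l : ℤ))), sub_zero]
    intro m hm he
    have : s - 1 - 2 * (m : ℤ) = d := congrArg Prod.snd he
    have := Finset.mem_range.1 hm
    omega
  · rw [h.other l hl]

end Lower

section
variable {D} {i : I} {S : Finset (I → IntLaurent)} (hS : D.PolesCancel i S)
include hS

/-- There is no finite set of monomials all of which have, for fixed `j` and `s`, a pole in degree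
`s` with respect to `S_j^-`, and which contains all monomials sharing such a pole. -/
lemma PolesCancel.false_of_closed (j : I) (s : ℤ) (Z : (I → IntLaurent) → Prop)
    (hne : ∃ n ∈ S, Z n)
    (hcol : ∀ n ∈ S, Z n → ∃ a, (D.weight i n j).coeff (a, s) ≠ 0)
    (hraise : ∀ n ∈ S, Z n → ∀ n' ∈ S, ∀ a k, Raise j a s n n' k → Z n')
    (hlower : ∀ n ∈ S, Z n → ∀ n' ∈ S, ∀ a k, Lower j a s n n' k → Z n') : False := by
  classical
  -- The column sum in degree `s` of the linking equation shows that passing to the partner at a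
  -- pole of degree `s` raises this quantity by exactly one. The partner stays in the closed set, so
  -- a maximum is impossible.
  obtain ⟨n, hn, hmax⟩ := (S.filter Z).exists_max_image
    (fun n => col (s + 1) (n j) - col (s - 1) (n j))
    (by obtain ⟨n, hn, hZ⟩ := hne; exact ⟨n, Finset.mem_filter.2 ⟨hn, hZ⟩⟩)
  obtain ⟨hnS, hnZ⟩ := Finset.mem_filter.1 hn
  obtain ⟨a, ha⟩ := hcol n hnS hnZ
  obtain ⟨c, hc⟩ := exists_ascent (D.len_pos j) ha
  obtain ⟨n', hn', hne', u', hlink⟩ := hS n hnS j (c, s) hc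
  have hZ' : Z n' ∧ u'.2 ≠ s := by
    rcases hlink.raise_or_lower hne' with ⟨k, hk, rfl⟩ | ⟨k, hk, rfl⟩
    · exact ⟨hraise n hnS hnZ n' hn' c k hk, by have := hk.pos; dsimp only; omega⟩
    · exact ⟨hlower n hnS hnZ n' hn' c k hk, by have := hk.pos; dsimp only; omega⟩
  have h1 := hmax n' (Finset.mem_filter.2 ⟨hn', hZ'.1⟩)
  have h2 := congrArg (col s) hlink.2
  rw [sub_mul, map_sub, map_sub, col_X_mul, col_X_mul, col_X, col_X, if_pos rfl, if_neg hZ'.2,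
    map_sub, map_sub] at h2
  simp only [sub_neg_eq_add] at h2
  linarith

end

/-- The last degree in which `n` and `n'` differ exists, and there `n ≤ n'`. -/
def RightLT (n n' : I → IntLaurent) : Prop :=
  ∃ d, (∀ c, d < c → ∀ k a, (n' k).coeff (a, c) = (n k).coeff (a, c)) ∧
    (∀ k a, (n k).coeff (a, d) ≤ (n' k).coeff (a, d)) ∧
    ∃ k a, (n k).coeff (a, d) < (n' k).coeff (a, d)

/-- The first degree in which `n` and `n'` differ exists, and there `n ≤ n'`. -/
def LeftLT (n n' : I → IntLaurent) : Prop :=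
  ∃ d, (∀ c, c < d → ∀ k a, (n' k).coeff (a, c) = (n k).coeff (a, c)) ∧
    (∀ k a, (n k).coeff (a, d) ≤ (n' k).coeff (a, d)) ∧
    ∃ k a, (n k).coeff (a, d) < (n' k).coeff (a, d)

lemma RightLT.irrefl (n : I → IntLaurent) : ¬ RightLT n n := by
  rintro ⟨d, -, -, k, a, h⟩; exact lt_irrefl _ h

lemma LeftLT.irrefl (n : I → IntLaurent) : ¬ LeftLT n n := by
  rintro ⟨d, -, -, k, a, h⟩; exact lt_irrefl _ h

lemma RightLT.trans {n n' n'' : I → IntLaurent} (h : RightLT n n') (h' : RightLT n' n'') :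
    RightLT n n'' := by
  obtain ⟨d, h1, h2, k, a, h3⟩ := h
  obtain ⟨d', h1', h2', k', a', h3'⟩ := h'
  rcases lt_trichotomy d d' with hd | rfl | hd
  · refine ⟨d', fun c hc k a => (h1' c hc k a).trans (h1 c (hd.trans hc) k a), fun k a => ?_,
      k', a', ?_⟩
    · rw [← h1 d' hd]; exact h2' k a
    · rw [← h1 d' hd]; exact h3'
  · exact ⟨d, fun c hc k a => (h1' c hc k a).trans (h1 c hc k a),
      fun k a => (h2 k a).trans (h2' k a), k, a, h3.trans_le (h2' k a)⟩
  · refine ⟨d, fun c hc k a => (h1' c (hd.trans hc) k a).trans (h1 c hc k a), fun k a => ?_,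
      k, a, ?_⟩
    · rw [h1' d hd]; exact h2 k a
    · rw [h1' d hd]; exact h3

lemma LeftLT.trans {n n' n'' : I → IntLaurent} (h : LeftLT n n') (h' : LeftLT n' n'') :
    LeftLT n n'' := by
  obtain ⟨d, h1, h2, k, a, h3⟩ := h
  obtain ⟨d', h1', h2', k', a', h3'⟩ := h'
  rcases lt_trichotomy d d' with hd | rfl | hd
  · refine ⟨d, fun c hc k a => (h1' c (hc.trans hd) k a).trans (h1 c hc k a), fun k a => ?_,
      k, a, ?_⟩
    · rw [h1' d hd]; exact h2 k a
    · rw [h1' d hd]; exact h3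
  · exact ⟨d, fun c hc k a => (h1' c hc k a).trans (h1 c hc k a),
      fun k a => (h2 k a).trans (h2' k a), k, a, h3.trans_le (h2' k a)⟩
  · refine ⟨d', fun c hc k a => (h1' c hc k a).trans (h1 c (hc.trans hd) k a), fun k a => ?_,
      k', a', ?_⟩
    · rw [← h1 d' hd]; exact h2' k a
    · rw [← h1 d' hd]; exact h3'

lemma exists_maximal_of_trans {A : Type*} (r : A → A → Prop) (hirr : ∀ a, ¬ r a a)
    (htr : ∀ a b c, r a b → r b c → r a c) (S : Finset A) (hS : S.Nonempty) :
    ∃ a ∈ S, ∀ b ∈ S, ¬ r a b := by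
  classical
  induction hS using Finset.Nonempty.cons_induction with
  | singleton a => exact ⟨a, by simp, by simpa using hirr a⟩
  | cons a s ha hs ih =>
    obtain ⟨m, hm, hmax⟩ := ih
    by_cases hr : r m a
    · refine ⟨a, by simp, fun b hb hab => ?_⟩
      rcases Finset.mem_cons.1 hb with rfl | hb
      · exact hirr _ hab
      · exact hmax b hb (htr _ _ _ hr hab)
    · refine ⟨m, by simp [hm], fun b hb => ?_⟩
      rcases Finset.mem_cons.1 hb with rfl | hb
      · exact hr
      · exact hmax b hb

lemma coeff_weight_of_eq {i j : I} {n n' : I → IntLaurent} (h : ∀ k, k ≠ j → n' k = n k)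
    (a d : ℤ) : (D.weight i n' j).coeff (a, d) = (D.weight i n j).coeff (a, d) +
      ((n j).coeff (a - D.len j, d + 1) - (n' j).coeff (a - D.len j, d + 1)) +
      ((n j).coeff (a + D.len j, d - 1) - (n' j).coeff (a + D.len j, d - 1)) := by
  rw [coeff_weight, coeff_weight, D.inflow_congr h]; ring

section
variable {D} {i : I} {S : Finset (I → IntLaurent)} (hS : D.PolesCancel i S)
include hS

/-- Monomials that are maximal with respect to their terms of highest degree are antidominant. -/
lemma PolesCancel.antidominant_of_maximal {v : I → IntLaurent} (hv : v ∈ S)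
    (hmax : ∀ n ∈ S, ¬ RightLT v n) (j : I) (a s : ℤ) : (D.weight i v j).coeff (a, s) ≤ 0 := by
  by_contra! hpos
  -- The closed set: agreement with `v` from degree `s` on, and positive weight at `(a, s)`. A raise
  -- would produce something above `v`; a lowering only changes degrees below `s`, which can only
  -- increase this weight.
  refine hS.false_of_closed j s (fun n => (∀ d, s ≤ d → ∀ k c, (n k).coeff (c, d) =
    (v k).coeff (c, d)) ∧ 0 < (D.weight i n j).coeff (a, s)) ⟨v, hv, by simp, hpos⟩
    (fun n _ hn => ⟨a, hn.2.ne'⟩) ?_ ?_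
  · intro n hn hZ n' hn' c k h
    exfalso
    refine hmax n' hn' ⟨s + 1 + 2 * (k - 1 : ℕ), fun d hd l b => ?_, fun l b => ?_, j, c, ?_⟩
    · rw [h.eq_of_gt hd, hZ.1 d (by omega)]
    · rw [← hZ.1 _ (by omega)]; exact h.le _ _ _
    · rw [← hZ.1 _ (by omega)]; exact h.lt_of_lt (by have := h.pos; omega)
  · intro n hn hZ n' hn' c k h
    refine ⟨fun d hd l b => by rw [h.eq_of_ge hd, hZ.1 d hd], ?_⟩
    rw [D.coeff_weight_of_eq h.other, h.eq_of_ge (by omega : s ≤ s + 1)]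
    linarith [hZ.2, h.le j (a + D.len j) (s - 1)]

/-- Among the monomials that agree with a maximal one in high degrees there is one that is dominant in
low degrees. -/
lemma PolesCancel.exists_dominant_below {v : I → IntLaurent} (hv : v ∈ S)
    (hmax : ∀ n ∈ S, ¬ RightLT v n) (e : ℤ) :
    ∃ w ∈ S, (∀ d, e ≤ d → ∀ k a, (w k).coeff (a, d) = (v k).coeff (a, d)) ∧
      ∀ j a d, d ≤ e → 0 ≤ (D.weight i w j).coeff (a, d) := by
  classical
  -- Among the monomials that agree with `v` from degree `e` on, `w` is taken minimal with respect
  -- to its lowest degrees.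
  obtain ⟨w, hw, hmin⟩ := exists_maximal_of_trans (fun n n' : I → IntLaurent => LeftLT n' n)
    LeftLT.irrefl (fun a b c h h' => h'.trans h)
    (S.filter fun n => ∀ d, e ≤ d → ∀ k a, (n k).coeff (a, d) = (v k).coeff (a, d))
    ⟨v, by simp [hv]⟩
  obtain ⟨hwS, hwe⟩ := Finset.mem_filter.1 hw
  refine ⟨w, hwS, hwe, fun j a s hs => ?_⟩
  by_contra! hneg
  refine hS.false_of_closed j s (fun n => (∀ d, e ≤ d → ∀ k c, (n k).coeff (c, d) =
    (v k).coeff (c, d)) ∧ (∀ d, d ≤ s → ∀ k c, (n k).coeff (c, d) = (w k).coeff (c, d)) ∧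
    (D.weight i n j).coeff (a, s) < 0) ⟨w, hwS, hwe, by simp, hneg⟩
    (fun n _ hn => ⟨a, hn.2.2.ne⟩) ?_ ?_
  · intro n hn hZ n' hn' c k h
    -- `s + 1 + 2(k - 1)` is the last degree of the added string. A string that ends below `e` keeps
    -- the weight negative; one that reaches `e` contradicts the maximality of `v`. A lowering would
    -- contradict the minimality of `w`.
    by_cases hk : s + 1 + 2 * (k - 1 : ℕ) < e
    · refine ⟨fun d hd l b => ?_, fun d hd l b => ?_, ?_⟩
      · rw [h.eq_of_gt (hk.trans_le hd), hZ.1 d hd]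
      · rw [h.eq_of_le hd, hZ.2.1 d hd]
      · rw [D.coeff_weight_of_eq h.other, h.eq_of_le (by omega : s - 1 ≤ s)]
        linarith [hZ.2.2, h.le j (a - D.len j) (s + 1)]
    · exfalso
      refine hmax n' hn' ⟨s + 1 + 2 * (k - 1 : ℕ), fun d hd l b => ?_, fun l b => ?_, j, c, ?_⟩
      · rw [h.eq_of_gt hd, hZ.1 d (by omega)]
      · rw [← hZ.1 _ (by omega)]; exact h.le _ _ _
      · rw [← hZ.1 _ (by omega)]; exact h.lt_of_lt (by have := h.pos; omega)
  · intro n hn hZ n' hn' c k h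
    exfalso
    refine hmin n' (Finset.mem_filter.2 ⟨hn', fun d hd l b => ?_⟩)
      ⟨s - 1 - 2 * (k - 1 : ℕ), fun d hd l b => ?_, fun l b => ?_, j, c, ?_⟩
    · rw [h.eq_of_ge (hs.trans hd), hZ.1 d hd]
    · rw [h.eq_of_lt hd, hZ.2.1 d (by omega)]
    · rw [← hZ.2.1 _ (by omega)]; exact h.le _ _ _
    · rw [← hZ.2.1 _ (by omega)]; exact h.lt_of_lt (by have := h.pos; omega)

variable (hpos : ∀ n ∈ S, ∀ k u, 0 ≤ (n k).coeff u)
include hpos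

/-- The highest weight sits in degree `0`, so nothing flows into negative degrees. Going upwards in
`d` from below the common support, a factor `A_j` in a lowest degree `d ≤ 0` creates a pole in
degree `d - 1` that no move can remove. -/
lemma PolesCancel.coeff_eq_zero_of_le {n : I → IntLaurent} (hn : n ∈ S) (k : I) (a : ℤ) {d : ℤ}
    (hd : d ≤ 0) : (n k).coeff (a, d) = 0 := by
  obtain ⟨B, hB⟩ : ∃ B : ℤ, ∀ n ∈ S, ∀ k a d, (n k).coeff (a, d) ≠ 0 → |d| ≤ B := by
    choose f hf using exists_bound
    obtain ⟨B, hB⟩ := (Finset.image (fun p : (I → IntLaurent) × I => f (p.1 p.2))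
      (S ×ˢ Finset.univ)).bddAbove
    refine ⟨B, fun n hn k a d h => ((hf (n k) a d h).2).trans (hB ?_)⟩
    exact Finset.mem_coe.2 (Finset.mem_image.2 ⟨(n, k), by simp [hn], rfl⟩)
  have main : ∀ m : ℕ, ∀ d : ℤ, d ≤ 0 → d < -B + m → ∀ n ∈ S, ∀ k a, (n k).coeff (a, d) = 0 := by
    intro m
    induction m with
    | zero =>
      intro d hd hdB n hn k a
      by_contra h
      have := hB n hn k a d h
      have := neg_abs_le d
      simp at hdB
      omega
    | succ m ih =>
      intro d hd hdB n hn j a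
      by_contra h
      have hlow : ∀ n ∈ S, ∀ k a c, c < d → (n k).coeff (a, c) = 0 := fun n hn k a c hc =>
        ih c (by omega) (by push_cast at hdB; omega) n hn k a
      -- One degree below `d` there is neither inflow nor anything of `n_j` from degree `d - 2`. The
      -- weight there is minus the shifted column `d`, and a lowering would have to remove terms
      -- from degree `d - 2`, which is empty.
      refine hS.false_of_closed j (d - 1) (fun n => 0 < (n j).coeff (a, d))
        ⟨n, hn, lt_of_le_of_ne (hpos n hn j _) (Ne.symm h)⟩ ?_ ?_ ?_
      · intro n hn hZ
        refine ⟨a + D.len j, ?_⟩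
        rw [coeff_weight, coeff_inflow, if_neg (fun h => by have := h.2.2; omega), Finset.sum_eq_zero fun k _ =>
          Finset.sum_eq_zero fun l _ => hlow n hn k _ _ (by omega), hlow n hn j (a + D.len j + D.len j) (d - 1 - 1) (by omega)]
        simp only [add_sub_cancel_right, sub_add_cancel]
        have hZ' : 0 < (n j).coeff (a, d) := hZ
        omega
      · intro n hn hZ n' hn' c k h
        exact hZ.trans_le (h.le _ _ _)
      · intro n hn hZ n' hn' c k h
        have h1 := h.lt_of_lt (l := 0) h.pos
        simp only [Nat.cast_zero, mul_zero, sub_zero] at h1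
        rw [hlow n hn _ _ _ (by omega), hlow n' hn' _ _ _ (by omega)] at h1
        exact absurd h1 (lt_irrefl _)
  exact main (d + B + 1).toNat d hd (by omega) n hn k a

/-- The number of factors `A_j` in each degree is bounded by the neighbouring factors of the
preceding degree. -/
lemma PolesCancel.coeff_le_inflow {n : I → IntLaurent} (hn : n ∈ S) (j : I) (a e : ℤ) :
    (n j).coeff (a - D.len j, e + 1) ≤ (D.inflow i n j).coeff (a, e) := by
  by_contra! hlt
  -- The excess over the inflow makes the weight at `(a, e)` negative. It persists: moves in
  -- direction `j` fix the inflow, raises only add terms, and lowerings do not reach degree `e + 1`.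
  refine hS.false_of_closed j e (fun n' => D.inflow i n' j = D.inflow i n j ∧
    (D.inflow i n j).coeff (a, e) < (n' j).coeff (a - D.len j, e + 1)) ⟨n, hn, rfl, hlt⟩ ?_ ?_ ?_
  · intro n' hn' hZ
    refine ⟨a, ?_⟩
    rw [coeff_weight, hZ.1]
    linarith [hZ.2, hpos n' hn' j (a + D.len j, e - 1)]
  · intro n' hn' hZ n'' hn'' c k h
    exact ⟨(D.inflow_congr h.other).trans hZ.1, hZ.2.trans_le (h.le _ _ _)⟩
  · intro n' hn' hZ n'' hn'' c k h
    exact ⟨(D.inflow_congr h.other).trans hZ.1, by rw [h.eq_of_ge (by omega)]; exact hZ.2⟩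

end

end CartanDatum

end

end DeformedW

namespace DeformedW

noncomputable section

open IntLaurent

namespace CartanDatum

variable {I : Type*} [Fintype I] [DecidableEq I] (D : CartanDatum I)

/-! ### The lowest monomial -/

/-- The matrix `2 - C` with integral entries. -/
def adjMatrix : Matrix I I ℤ := Matrix.of fun j k => (D.adj j k : ℤ)

/-- Chebyshev polynomials (shifted) of the matrix `2 - C`. -/
def cheb : ℕ → Matrix I I ℤ
  | 0 => 0
  | 1 => 1
  | s + 2 => D.adjMatrix * cheb (s + 1) - cheb s

lemma cheb_zero : D.cheb 0 = 0 := by rw [cheb]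

lemma cheb_one : D.cheb 1 = 1 := by rw [cheb]

lemma cheb_add_two (s : ℕ) : D.cheb (s + 2) = D.adjMatrix * D.cheb (s + 1) - D.cheb s := by
  rw [cheb]

lemma cheb_comm (s : ℕ) : D.adjMatrix * D.cheb s = D.cheb s * D.adjMatrix := by
  induction s using Nat.twoStepInduction with
  | zero => simp [cheb_zero]
  | one => simp [cheb_one]
  | more s h h' => rw [cheb_add_two, mul_sub, sub_mul, h, mul_assoc, h']

/-- Inversion of `x ↦ x (d + 1) + x (d - 1) - (2 - C) x d` on sequences of vectors. -/
lemma sum_cheb_mulVec (x : ℤ → I → ℤ) (m : ℕ) (d : ℤ) :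
    ∑ s ∈ Finset.range m, (D.cheb (s + 1)).mulVec
      (x (d - s) + x (d - s - 2) - D.adjMatrix.mulVec (x (d - s - 1))) =
      x d - (D.cheb (m + 1)).mulVec (x (d - m)) + (D.cheb m).mulVec (x (d - m - 1)) := by
  induction m with
  | zero => simp [cheb_zero, cheb_one]
  | succ m ih =>
    rw [Finset.sum_range_succ, ih, cheb_add_two, Matrix.mulVec_sub, Matrix.mulVec_add,
      Matrix.mulVec_mulVec, ← cheb_comm, Matrix.sub_mulVec]
    push_cast
    rw [show d - ((m : ℤ) + 1) = d - m - 1 by ring, show d - (m : ℤ) - 1 - 1 = d - m - 2 by ring]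
    abel

/-- The data attached to the number `h`: the Chebyshev matrices are nonnegative before they vanish at
`h`, and the last nonzero one is the permutation matrix of `σ`. -/
structure IsCoxeter (h : ℕ) (σ : I → I) : Prop where
  two_le : 2 ≤ h
  nonneg : ∀ s ≤ h, ∀ j k, 0 ≤ D.cheb s j k
  eq_zero : D.cheb h = 0
  perm : ∀ j k, D.cheb (h - 1) j k = if j = σ k then 1 else 0
  injective : Function.Injective σ

/-- The specialization of `n` at `q = 1`, in degree `d` with respect to `t`. -/
def colVec (n : I → IntLaurent) (d : ℤ) : I → ℤ := fun j => col d (n j)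

lemma colVec_qCartan (n : I → IntLaurent) (d : ℤ) :
    colVec (D.qCartan n) (d - 1) =
      colVec n d + colVec n (d - 2) - D.adjMatrix.mulVec (colVec n (d - 1)) := by
  funext j
  simp only [colVec, col_qCartan, Pi.sub_apply, Pi.add_apply, Matrix.mulVec, dotProduct,
    adjMatrix, Matrix.of_apply, sub_add_cancel]
  rw [sub_sub, show (1 : ℤ) + 1 = 2 by norm_num]

lemma sum_cheb_qCartan (n : I → IntLaurent) (m : ℕ) (d : ℤ) :
    ∑ s ∈ Finset.range m, (D.cheb (s + 1)).mulVec (colVec (D.qCartan n) (d - 1 - s)) =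
      colVec n d - (D.cheb (m + 1)).mulVec (colVec n (d - m)) +
        (D.cheb m).mulVec (colVec n (d - m - 1)) := by
  rw [← sum_cheb_mulVec]
  refine Finset.sum_congr rfl fun s _ => ?_
  rw [← colVec_qCartan, show d - 1 - (s : ℤ) = d - s - 1 by ring]

lemma mulVec_le {M : Matrix I I ℤ} (hM : ∀ j k, 0 ≤ M j k) {x y : I → ℤ} (h : ∀ j, x j ≤ y j)
    (j : I) : M.mulVec x j ≤ M.mulVec y j :=
  Finset.sum_le_sum fun k _ => mul_le_mul_of_nonneg_left (h k) (hM j k)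

lemma IsCoxeter.mulVec_perm {D : CartanDatum I} {h : ℕ} {σ : I → I} (hD : D.IsCoxeter h σ)
    (x : I → ℤ) (k : I) : (D.cheb (h - 1)).mulVec x (σ k) = x k := by
  simp only [Matrix.mulVec, dotProduct, hD.perm, ite_mul, one_mul, zero_mul]
  rw [Finset.sum_eq_single k]
  · simp
  · intro l _ hl
    rw [if_neg fun h => hl (hD.injective h).symm]
  · simp

lemma exists_top {n : I → IntLaurent} (hn : n ≠ 0) : ∃ d k a, (n k).coeff (a, d) ≠ 0 ∧
    ∀ c, d < c → ∀ k a, (n k).coeff (a, c) = 0 := by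
  classical
  have hne : (Finset.univ.biUnion fun k => (n k).coeff.support.image fun u => (k, u)).Nonempty := by
    by_contra h
    apply hn
    funext k
    ext a d
    by_contra hne
    exact h ⟨(k, a, d), by simpa using hne⟩
  obtain ⟨⟨k, a, d⟩, hmem, hmax⟩ := Finset.exists_max_image _
    (fun p : I × ℤ × ℤ => p.2.2) hne
  refine ⟨d, k, a, by simpa using hmem, fun c hc l b => ?_⟩
  by_contra h
  exact absurd (hmax (l, b, c) (by simpa using h)) (not_le.2 hc)

lemma exists_bottom {n : I → IntLaurent} (hn : n ≠ 0) : ∃ d k a, (n k).coeff (a, d) ≠ 0 ∧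
    ∀ c, c < d → ∀ k a, (n k).coeff (a, c) = 0 := by
  classical
  have hne : (Finset.univ.biUnion fun k => (n k).coeff.support.image fun u => (k, u)).Nonempty := by
    by_contra h
    apply hn
    funext k
    ext a d
    by_contra hne
    exact h ⟨(k, a, d), by simpa using hne⟩
  obtain ⟨⟨k, a, d⟩, hmem, hmin⟩ := Finset.exists_min_image _
    (fun p : I × ℤ × ℤ => p.2.2) hne
  refine ⟨d, k, a, by simpa using hmem, fun c hc l b => ?_⟩
  by_contra h
  exact absurd (hmin (l, b, c) (by simpa using h)) (not_le.2 hc)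

lemma coeff_qNat_mul_eq_zero {m : ℕ} {p : IntLaurent} {d : ℤ} (h : ∀ a, p.coeff (a, d) = 0)
    (a : ℤ) : (qNat m * p).coeff (a, d) = 0 := by
  rw [coeff_qNat_mul]
  exact Finset.sum_eq_zero fun l _ => h _

/-- One degree above the top of `n`, only the diagonal summand `q^{-len} t` contributes. Together
with its counterpart at the bottom, this makes the extreme columns of `n` visible in `C n`. -/
lemma coeff_qCartan_above {n : I → IntLaurent} {d : ℤ}
    (h : ∀ c, d < c → ∀ k a, (n k).coeff (a, c) = 0) (j : I) (a : ℤ) :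
    (D.qCartan n j).coeff (a, d + 1) = (n j).coeff (a + D.len j, d) := by
  rw [coeff_qCartan, h _ (by omega), Finset.sum_eq_zero fun k _ =>
    coeff_qNat_mul_eq_zero (h _ (by omega) k) a]
  simp

lemma coeff_qCartan_below {n : I → IntLaurent} {d : ℤ}
    (h : ∀ c, c < d → ∀ k a, (n k).coeff (a, c) = 0) (j : I) (a : ℤ) :
    (D.qCartan n j).coeff (a, d - 1) = (n j).coeff (a - D.len j, d) := by
  rw [coeff_qCartan, h (d - 1 - 1) (by omega), Finset.sum_eq_zero fun k _ =>
    coeff_qNat_mul_eq_zero (h _ (by omega) k) a]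
  simp

/-- If `n ≠ 0` has bottom degree `d'` and top degree `d`, then `C n` is nonzero in both degrees `d'
- 1` and `d + 1`, which are different. -/
lemma eq_zero_of_qCartan_single_degree {n : I → IntLaurent} {c : ℤ}
    (h : ∀ j a d, d ≠ c → (D.qCartan n j).coeff (a, d) = 0) : n = 0 := by
  by_contra hn
  obtain ⟨d, k, a, h1, h2⟩ := exists_top hn
  obtain ⟨d', k', a', h1', h2'⟩ := exists_bottom hn
  have hd : d' ≤ d := by
    by_contra hlt
    exact h1' (h2 _ (not_le.1 hlt) k' a')
  have e1 := D.coeff_qCartan_above h2 k (a - D.len k)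
  have e2 := D.coeff_qCartan_below h2' k' (a' + D.len k')
  rw [sub_add_cancel] at e1
  rw [add_sub_cancel_right] at e2
  by_cases hc : d + 1 = c
  · exact h1' (e2.symm.trans (h _ _ _ (by omega)))
  · exact h1 (e1.symm.trans (h _ _ _ hc))

/-- For nonnegative `n ≠ 0`, the extreme columns of `C n` contain positive coefficients in two
different degrees, but the bound allows positivity at the single point `u` only. -/
lemma eq_zero_of_dominant {n : I → IntLaurent} (hn : ∀ k u, 0 ≤ (n k).coeff u) {i : I} {u : ℤ × ℤ}
    (h : ∀ j v, (D.qCartan n j).coeff v ≤ (Pi.single (M := fun _ => IntLaurent) i (X u) j).coeff v) :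
    n = 0 := by
  by_contra hne
  obtain ⟨d, k, a, h1, h2⟩ := exists_top hne
  obtain ⟨d', k', a', h1', h2'⟩ := exists_bottom hne
  have hd : d' ≤ d := by
    by_contra hlt
    exact h1' (h2 _ (not_le.1 hlt) k' a')
  have e1 := D.coeff_qCartan_above h2 k (a - D.len k)
  have e2 := D.coeff_qCartan_below h2' k' (a' + D.len k')
  rw [sub_add_cancel] at e1
  rw [add_sub_cancel_right] at e2
  have key : ∀ j v, 0 < (D.qCartan n j).coeff v → u = v := by
    intro j v hv
    by_contra hne
    have := h j v
    by_cases hj : j = i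
    · subst hj
      rw [Pi.single_eq_same, coeff_X_of_ne hne] at this
      omega
    · rw [Pi.single_eq_of_ne hj] at this
      simp at this
      omega
  have k1 := key k _ (e1 ▸ lt_of_le_of_ne (hn k _) h1.symm)
  have k2 := key k' _ (e2 ▸ lt_of_le_of_ne (hn k' _) h1'.symm)
  have : d + 1 = d' - 1 := congrArg Prod.snd (k1.symm.trans k2)
  omega

lemma eq_X_of_col {p : IntLaurent} {d : ℤ} (h0 : ∀ a c, c ≠ d → p.coeff (a, c) = 0)
    (hpos : ∀ a, 0 ≤ p.coeff (a, d)) (h1 : col d p = 1) : ∃ a, p = X (a, d) := by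
  obtain ⟨a, ha⟩ : ∃ a, p.coeff (a, d) ≠ 0 := by
    by_contra! h
    rw [col_eq_zero h] at h1
    exact zero_ne_one h1
  refine ⟨a, ?_⟩
  have hp : ∀ b, 0 ≤ (p - X (a, d)).coeff (b, d) := by
    intro b
    rw [AddMonoidAlgebra.coeff_sub, Finsupp.sub_apply]
    by_cases hb : b = a
    · subst hb
      rw [coeff_X_self]
      have := hpos b
      omega
    · rw [coeff_X_of_ne (by simp [Ne.symm hb]), sub_zero]
      exact hpos b
  rw [← sub_eq_zero]
  ext b c
  by_cases hc : c = d
  · subst hc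
    rw [coeff_eq_zero_of_col hp (by rw [map_sub, h1, col_X]; simp)]
    rfl
  · rw [AddMonoidAlgebra.coeff_sub, Finsupp.sub_apply, h0 b c hc, coeff_X_of_ne]
    · rfl
    · intro h
      exact hc (congrArg Prod.snd h).symm

lemma qCartan_eq_sub_weight (i : I) (n : I → IntLaurent) (j : I) :
    D.qCartan n j = Pi.single (M := fun _ => IntLaurent) i 1 j - D.weight i n j := by
  rw [weight]; ring

lemma colVec_qCartan_apply (i : I) (n : I → IntLaurent) (d : ℤ) (j : I) :
    colVec (D.qCartan n) d j = (if j = i ∧ d = 0 then 1 else 0) - col d (D.weight i n j) := by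
  rw [colVec, D.qCartan_eq_sub_weight i, map_sub, col_single_one]

section

variable {D} {i : I} {S : Finset (I → IntLaurent)} (hS : D.PolesCancel i S)
  (hpos : ∀ n ∈ S, ∀ k u, 0 ≤ (n k).coeff u) {h : ℕ} {σ : I → I} (hD : D.IsCoxeter h σ)
include hS hpos

lemma PolesCancel.colVec_eq_zero {n : I → IntLaurent} (hn : n ∈ S) {d : ℤ} (hd : d ≤ 0) :
    colVec n d = 0 :=
  funext fun k => col_eq_zero fun a => hS.coeff_eq_zero_of_le hpos hn k a hd

include hD

/-- Suppose the top degree `m` of `v` is at least `h`, and replace `v` by a `w` with the same top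
column that is dominant up to degree `m`. At `q = 1`, `C w` is then nonpositive in degrees `1` to
`m`. Chebyshev inversion over a full period forces column `1` of `w` to vanish, the recursion then
kills all columns up to `m`, and this contradicts the choice of `m`. -/
lemma PolesCancel.coeff_maximal_eq_zero {v : I → IntLaurent} (hv : v ∈ S)
    (hmax : ∀ n ∈ S, ¬ RightLT v n) (k : I) (a d : ℤ) (hd : (h : ℤ) ≤ d) :
    (v k).coeff (a, d) = 0 := by
  by_contra hne
  obtain ⟨m, k, a, h1, h2⟩ := exists_top (n := v) (by rintro rfl; exact hne rfl)
  have hm : (h : ℤ) ≤ m := by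
    by_contra hlt
    exact hne (h2 d (by omega) _ _)
  obtain ⟨w, hw, hwv, hdom⟩ := hS.exists_dominant_below hv hmax m
  have hg : ∀ d, d ≠ 0 → d ≤ m → ∀ j, colVec (D.qCartan w) d j ≤ 0 := by
    intro d hd hdm j
    rw [D.colVec_qCartan_apply i, if_neg (fun h => hd h.2)]
    have := col_nonneg (p := D.weight i w j) (d := d) (fun a => hdom j a d hdm)
    omega
  have hw0 : ∀ d j, 0 ≤ colVec w d j := fun d j => col_nonneg fun a => hpos w hw j _
  have hh := hD.two_le
  -- With these indices only columns `h + 1` and `1` survive on the right, the latter permuted by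
  -- `σ`; the sum on the left involves degrees `2` to `h`.
  have hsum := D.sum_cheb_qCartan w (h - 1) (h + 1)
  rw [Nat.sub_add_cancel (by omega), hD.eq_zero, Matrix.zero_mulVec, sub_zero] at hsum
  have hone : colVec w 1 = 0 := by
    funext j
    have e := congrFun hsum (σ j)
    rw [Pi.add_apply, show ((h : ℤ) + 1 - ((h - 1 : ℕ) : ℤ) - 1) = 1 by omega,
      hD.mulVec_perm, Finset.sum_apply] at e
    have : ∑ s ∈ Finset.range (h - 1), (D.cheb (s + 1)).mulVec
        (colVec (D.qCartan w) ((h : ℤ) + 1 - 1 - s)) (σ j) ≤ 0 := by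
      refine Finset.sum_nonpos fun s hs => ?_
      have hs := Finset.mem_range.1 hs
      have := mulVec_le (hD.nonneg (s + 1) (by omega)) (y := 0)
        (fun j => hg ((h : ℤ) + 1 - 1 - s) (by omega) (by omega) j) (σ j)
      simpa using this
    have := hw0 (h + 1) (σ j)
    have := hw0 1 j
    rw [Pi.zero_apply]
    omega
  have hrec : ∀ d : ℕ, (d : ℤ) + 1 ≤ m → colVec w d = 0 ∧ colVec w (d + 1) = 0 := by
    intro d
    induction d with
    | zero => intro _; exact ⟨hS.colVec_eq_zero hpos hw le_rfl, by simpa using hone⟩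
    | succ d ih =>
      intro hd
      obtain ⟨i1, i2⟩ := ih (by push_cast at hd; omega)
      refine ⟨by push_cast; exact i2, ?_⟩
      funext j
      have e := congrFun (D.colVec_qCartan w (d + 2)) j
      have := hg ((d : ℤ) + 2 - 1) (by omega) (by push_cast at hd; omega) j
      rw [show (d : ℤ) + 2 - 1 = d + 1 by ring, show (d : ℤ) + 2 - 2 = d by ring, i1, i2] at e
      rw [show (d : ℤ) + 2 - 1 = d + 1 by ring, e] at this
      simp only [Matrix.mulVec_zero, add_zero, sub_zero] at this
      have := hw0 (d + 2) j
      rw [show (((d + 1 : ℕ) : ℤ) + 1) = d + 2 by push_cast; ring, Pi.zero_apply]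
      omega
  have hm0 := (hrec (m - 1).toNat (by omega)).2
  rw [show (((m - 1).toNat : ℤ) + 1) = m by omega] at hm0
  apply h1
  rw [← hwv m le_rfl]
  exact coeff_eq_zero_of_col (fun a => hpos w hw k _) (congrFun hm0 k).le a

/-- Compare `v` with a `w` that agrees with it from degree `b` on and is dominant up to `b`. The
columns of `v - w` vanish in degrees `≥ b` and `≤ 0`. Since `b < h`, Chebyshev inversion shows that
a sum of nonnegative terms, the differences of the two weights, is zero. A negative weight of `v` at
`(a, b)` would make the first term positive. -/
lemma PolesCancel.coeff_weight_maximal_eq_zero {v : I → IntLaurent} (hv : v ∈ S)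
    (hmax : ∀ n ∈ S, ¬ RightLT v n) (j : I) (a b : ℤ) (hb : b < h) :
    (D.weight i v j).coeff (a, b) = 0 := by
  by_contra hne
  have hneg := lt_of_le_of_ne (hS.antidominant_of_maximal hv hmax j a b) hne
  obtain ⟨w, hw, hwv, hdom⟩ := hS.exists_dominant_below hv hmax b
  have hh := hD.two_le
  have hsum := D.sum_cheb_qCartan (v - w) (h - 1) (b + 1)
  rw [Nat.sub_add_cancel (by omega), hD.eq_zero, Matrix.zero_mulVec, sub_zero] at hsum
  have hz : ∀ d, b ≤ d → colVec (v - w) d = 0 := by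
    intro d hd
    funext k
    refine col_eq_zero fun a => ?_
    rw [Pi.sub_apply, AddMonoidAlgebra.coeff_sub, Finsupp.sub_apply, hwv d hd, sub_self]
  have hz' : ∀ d, d ≤ 0 → colVec (v - w) d = 0 := by
    intro d hd
    funext k
    refine col_eq_zero fun a => ?_
    rw [Pi.sub_apply, AddMonoidAlgebra.coeff_sub, Finsupp.sub_apply,
      hS.coeff_eq_zero_of_le hpos hv k a hd, hS.coeff_eq_zero_of_le hpos hw k a hd, sub_self]
  rw [hz _ (by omega), hz' _ (by omega), Matrix.mulVec_zero, add_zero] at hsum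
  have hq : ∀ d k, colVec (D.qCartan (v - w)) d k =
      col d (D.weight i w k - D.weight i v k) := by
    intro d k
    rw [colVec, qCartan_sub, D.qCartan_eq_sub_weight i v, D.qCartan_eq_sub_weight i w]
    congr 1; ring
  have hcoef : ∀ d, d ≤ b → ∀ k c, 0 ≤ (D.weight i w k - D.weight i v k).coeff (c, d) := by
    intro d hd k c
    rw [AddMonoidAlgebra.coeff_sub, Finsupp.sub_apply]
    linarith [hdom k c d hd, hS.antidominant_of_maximal hv hmax k c d]
  have hge : ∀ d, d ≤ b → ∀ k, 0 ≤ colVec (D.qCartan (v - w)) d k := by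
    intro d hd k
    rw [hq]
    exact col_nonneg fun c => hcoef d hd k c
  have e := congrFun hsum j
  rw [Finset.sum_apply] at e
  have hpos' : 0 < ∑ s ∈ Finset.range (h - 1), (D.cheb (s + 1)).mulVec
      (colVec (D.qCartan (v - w)) (b + 1 - 1 - s)) j := by
    refine Finset.sum_pos' (fun s hs => ?_) ⟨0, Finset.mem_range.2 (by omega), ?_⟩
    · have hs := Finset.mem_range.1 hs
      have := mulVec_le (hD.nonneg (s + 1) (by omega)) (x := 0)
        (fun j => hge (b + 1 - 1 - s) (by omega) j) j
      simpa using this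
    · rw [zero_add, cheb_one, Matrix.one_mulVec, hq]
      simp only [Nat.cast_zero, sub_zero, add_sub_cancel_right]
      refine lt_of_lt_of_le ?_ (coeff_le_col (hcoef b le_rfl j) a)
      rw [AddMonoidAlgebra.coeff_sub, Finsupp.sub_apply]
      linarith [hdom j a b le_rfl]
  rw [e] at hpos'
  exact lt_irrefl _ hpos'

/-- Below degree `h` the weight of `v` vanishes, so `C v = e_i` there; at `q = 1` this is the
Chebyshev recursion with initial values `0` and `e_i`. -/
lemma PolesCancel.colVec_maximal {v : I → IntLaurent} (hv : v ∈ S)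
    (hmax : ∀ n ∈ S, ¬ RightLT v n) (d : ℕ) (hd : d ≤ h) :
    colVec v d = (D.cheb d).mulVec (Pi.single i 1) := by
  have hzero : ∀ (d : ℤ) (j : I), d < h →
      colVec (D.qCartan v) d j = if j = i ∧ d = 0 then 1 else 0 := by
    intro d j hd
    rw [D.colVec_qCartan_apply i,
      col_eq_zero fun a => hS.coeff_weight_maximal_eq_zero hpos hD hv hmax j a d hd, sub_zero]
  induction d using Nat.twoStepInduction with
  | zero => rw [cheb_zero, Matrix.zero_mulVec]; exact hS.colVec_eq_zero hpos hv le_rfl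
  | one =>
    funext j
    have e := congrFun (D.colVec_qCartan v 1) j
    rw [hzero _ _ (by have := hD.two_le; omega), hS.colVec_eq_zero hpos hv (by norm_num : (1:ℤ) - 1 ≤ 0),
      hS.colVec_eq_zero hpos hv (by norm_num : (1:ℤ) - 2 ≤ 0)] at e
    rw [cheb_one, Matrix.one_mulVec, Pi.single_apply, Nat.cast_one]
    simpa using e.symm
  | more d i1 i2 =>
    funext j
    have e := congrFun (D.colVec_qCartan v (d + 2)) j
    rw [hzero _ _ (by omega), if_neg (by omega), show (d : ℤ) + 2 - 2 = d by ring, i1 (by omega),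
      show (d : ℤ) + 2 - 1 = (d + 1 : ℕ) by push_cast; ring, i2 (by omega)] at e
    rw [cheb_add_two, Matrix.sub_mulVec, ← Matrix.mulVec_mulVec]
    simp only [Pi.add_apply, Pi.sub_apply] at e ⊢
    push_cast at e ⊢
    omega

/-- The weight of a maximal monomial. -/
lemma PolesCancel.weight_maximal {v : I → IntLaurent} (hv : v ∈ S)
    (hmax : ∀ n ∈ S, ¬ RightLT v n) :
    ∃ a, ∀ j, D.weight i v j = -Pi.single (M := fun _ => IntLaurent) (σ i) (X (a, (h : ℤ))) j := by
  have hh := hD.two_le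
  have h0 := hS.coeff_maximal_eq_zero hpos hD hv hmax
  have hoff : ∀ j a c, c ≠ (h : ℤ) → (-D.weight i v j).coeff (a, c) = 0 := by
    intro j a c hc
    rw [AddMonoidAlgebra.coeff_neg, Finsupp.neg_apply, neg_eq_zero]
    rcases lt_or_gt_of_ne hc with hc | hc
    · exact hS.coeff_weight_maximal_eq_zero hpos hD hv hmax j a c hc
    · rw [coeff_weight, coeff_inflow, if_neg (by omega), Finset.sum_eq_zero fun k _ =>
        Finset.sum_eq_zero fun l _ => h0 _ _ _ (by omega), h0 _ _ _ (by omega),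
        h0 _ _ _ (by omega)]
      simp
  have hnn : ∀ j a, 0 ≤ (-D.weight i v j).coeff (a, (h : ℤ)) := by
    intro j a
    rw [AddMonoidAlgebra.coeff_neg, Finsupp.neg_apply]
    linarith [hS.antidominant_of_maximal hv hmax j a h]
  -- In degree `h` only column `h - 1` of `v` contributes, and at `q = 1` this is column `i` of the
  -- permutation matrix `cheb (h - 1)`.
  have hcol : ∀ j, col h (-D.weight i v j) = if j = σ i then 1 else 0 := by
    intro j
    rw [map_neg, col_weight, if_neg (by omega), col_eq_zero fun a => h0 j a _ (by omega),
      Finset.sum_eq_zero fun k _ => by rw [col_eq_zero fun a => h0 k a _ (by omega), mul_zero]]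
    have := congrFun (hS.colVec_maximal hpos hD hv hmax (h - 1) (by omega)) j
    rw [Matrix.mulVec_single_one, Matrix.col_apply, hD.perm, colVec,
      show ((h - 1 : ℕ) : ℤ) = h - 1 by omega] at this
    rw [this]; ring
  obtain ⟨a, ha⟩ := eq_X_of_col (hoff (σ i)) (hnn (σ i)) (by rw [hcol, if_pos rfl])
  refine ⟨a, fun j => ?_⟩
  by_cases hj : j = σ i
  · subst hj
    rw [Pi.single_eq_same, ← ha, neg_neg]
  · rw [Pi.single_eq_of_ne hj, ← neg_inj, neg_zero, neg_zero]
    ext b c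
    by_cases hc : c = (h : ℤ)
    · subst hc
      rw [coeff_eq_zero_of_col (hnn j) (by rw [hcol, if_neg hj])]
      rfl
    · exact hoff j b c hc

/-- The weights of both monomials are concentrated in degree `h` at `σ i`, possibly with different
powers of `q`. Hence `C (v - w)` lives in a single degree. -/
lemma PolesCancel.maximal_unique {v w : I → IntLaurent} (hv : v ∈ S)
    (hvmax : ∀ n ∈ S, ¬ RightLT v n) (hw : w ∈ S) (hwmax : ∀ n ∈ S, ¬ RightLT w n) : v = w := by
  obtain ⟨a, ha⟩ := hS.weight_maximal hpos hD hv hvmax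
  obtain ⟨b, hb⟩ := hS.weight_maximal hpos hD hw hwmax
  rw [← sub_eq_zero]
  refine D.eq_zero_of_qCartan_single_degree (c := h) fun j c d hd => ?_
  rw [qCartan_sub, D.qCartan_eq_sub_weight i v, D.qCartan_eq_sub_weight i w, ha, hb]
  by_cases hj : j = σ i
  · subst hj
    simp [coeff_X, Prod.ext_iff, Ne.symm hd]
  · simp [Pi.single_eq_of_ne hj]

/-- An antidominant monomial is the maximal one. -/
lemma PolesCancel.eq_maximal_of_antidominant {v x : I → IntLaurent} (hv : v ∈ S)
    (hmax : ∀ n ∈ S, ¬ RightLT v n) (hx : x ∈ S)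
    (hanti : ∀ j a d, (D.weight i x j).coeff (a, d) ≤ 0) : x = v := by
  classical
  by_contra hne
  -- A maximal element above `x` is maximal in all of `S`, hence equal to `v`. So `x` lies below
  -- `v`, and `d` is the last degree in which they differ.
  obtain ⟨w, hw, hwmax⟩ := exists_maximal_of_trans (RightLT (I := I)) RightLT.irrefl
    (fun _ _ _ => RightLT.trans) (S.filter fun n => n = x ∨ RightLT x n) ⟨x, by simp [hx]⟩
  obtain ⟨hwS, hwx⟩ := Finset.mem_filter.1 hw
  have hwv : v = w := hS.maximal_unique hpos hD hv hmax hwS fun n hn hlt =>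
    hwmax n (Finset.mem_filter.2 ⟨hn, Or.inr (hwx.elim (fun e => e ▸ hlt) fun h' => h'.trans hlt)⟩) hlt
  subst hwv
  obtain ⟨d, h1, h2, k, a, h3⟩ := hwx.resolve_left (Ne.symm hne)
  have hdh : d < h := by
    by_contra hd
    rw [hS.coeff_maximal_eq_zero hpos hD hv hmax k a d (by omega)] at h3
    exact absurd h3 (not_lt.2 (hpos x hx k _))
  have hd0 : 0 < d := by
    by_contra hd
    rw [hS.coeff_eq_zero_of_le hpos hv k a (by omega)] at h3
    exact absurd h3 (not_lt.2 (hpos x hx k _))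
  obtain ⟨m, rfl⟩ : ∃ m : ℕ, d = (m + 1 : ℕ) := ⟨(d - 1).toNat, by omega⟩
  -- Antidominance means `C x ≥ e_i`. By Chebyshev inversion column `d` of `x` at `q = 1` is then at
  -- least that of `v`, whereas in degree `d` one has `x ≤ v` with a strict inequality somewhere.
  have hsum := congrFun (D.sum_cheb_qCartan x (m + 1) (m + 1 : ℕ)) k
  rw [hS.colVec_eq_zero hpos hx (sub_self _).le,
    hS.colVec_eq_zero hpos hx (by omega : ((m + 1 : ℕ) : ℤ) - (m + 1 : ℕ) - 1 ≤ 0),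
    Matrix.mulVec_zero, Matrix.mulVec_zero, sub_zero, add_zero, Finset.sum_apply] at hsum
  have hge : ∀ d j, (if j = i ∧ d = 0 then 1 else 0) ≤ colVec (D.qCartan x) d j := by
    intro d j
    rw [D.colVec_qCartan_apply i]
    have : 0 ≤ col d (-D.weight i x j) := col_nonneg fun a => by
      have := hanti j a d
      rw [AddMonoidAlgebra.coeff_neg, Finsupp.neg_apply]
      omega
    rw [map_neg] at this
    omega
  have hle : colVec v (m + 1 : ℕ) k ≤ colVec x (m + 1 : ℕ) k := by
    rw [hS.colVec_maximal hpos hD hv hmax (m + 1) (by omega), ← hsum]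
    refine le_trans ?_ (Finset.single_le_sum (fun s hs => ?_) (Finset.mem_range.2 (Nat.lt_succ_self m)))
    · refine mulVec_le (hD.nonneg (m + 1) (by omega)) (fun j => ?_) k
      have := hge (((m + 1 : ℕ) : ℤ) - 1 - m) j
      rw [if_congr (show (j = i ∧ ((m + 1 : ℕ) : ℤ) - 1 - m = 0) ↔ j = i by
        push_cast; constructor <;> simp_all) rfl rfl] at this
      rwa [Pi.single_apply]
    · have hs := Finset.mem_range.1 hs
      have := mulVec_le (hD.nonneg (s + 1) (by omega)) (x := 0)
        (fun j => (show (0 : I → ℤ) j ≤ _ from by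
          refine le_trans ?_ (hge (((m + 1 : ℕ) : ℤ) - 1 - s) j)
          split_ifs <;> simp)) k
      simpa using this
  have hlt : 0 < col (m + 1 : ℕ) (v k - x k) := by
    refine lt_of_lt_of_le ?_ (coeff_le_col (fun c => ?_) a)
    · rw [AddMonoidAlgebra.coeff_sub, Finsupp.sub_apply]; omega
    · rw [AddMonoidAlgebra.coeff_sub, Finsupp.sub_apply]; linarith [h2 k c]
  rw [map_sub] at hlt
  simp only [colVec] at hle
  omega

end

end CartanDatum

end

end DeformedW

namespace DeformedW

noncomputable section

open IntLaurent

/-! ### Monomials in `q` and `t` -/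

instance : CharZero QT :=
  charZero_of_injective_ringHom
    ((algebraMap LaurentQT QT).comp (algebraMap ℂ LaurentQT)).injective

lemma q_ne_zero : q ≠ 0 := by
  unfold q
  rw [Ne, FaithfulSMul.algebraMap_eq_zero_iff]
  simp

lemma t_ne_zero : t ≠ 0 := by
  unfold t
  rw [Ne, FaithfulSMul.algebraMap_eq_zero_iff]
  simp

lemma mono_zero : mono 0 = 1 := by simp [mono]

lemma mono_add (u v : ℤ × ℤ) : mono (u + v) = mono u * mono v := by
  simp only [mono, Prod.fst_add, Prod.snd_add, zpow_add₀ q_ne_zero, zpow_add₀ t_ne_zero]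
  ring

lemma mono_ne_zero (u : ℤ × ℤ) : mono u ≠ 0 :=
  mul_ne_zero (zpow_ne_zero _ q_ne_zero) (zpow_ne_zero _ t_ne_zero)

/-- `mono` as a homomorphism. -/
def monoHom : Multiplicative (ℤ × ℤ) →* QT where
  toFun u := mono u.toAdd
  map_one' := mono_zero
  map_mul' _ _ := mono_add _ _

lemma mono_zsmul (m : ℤ) (u : ℤ × ℤ) : mono (m • u) = mono u ^ m := by
  simp only [mono, Prod.smul_fst, Prod.smul_snd, smul_eq_mul, mul_zpow, ← zpow_mul, mul_comm m]

lemma mono_neg (u : ℤ × ℤ) : mono (-u) = (mono u)⁻¹ := by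
  rw [← neg_one_smul ℤ u, mono_zsmul, zpow_neg_one]

lemma mono_eq_algebraMap (u : ℤ × ℤ) :
    mono u = algebraMap LaurentQT QT (AddMonoidAlgebra.single u 1) := by
  have key : ∀ (v : ℤ × ℤ) (a : ℤ), (algebraMap LaurentQT QT (AddMonoidAlgebra.single v 1)) ^ a =
      algebraMap LaurentQT QT (AddMonoidAlgebra.single (a • v) 1) := by
    intro v a
    have hnat : ∀ a : ℕ, (algebraMap LaurentQT QT (AddMonoidAlgebra.single v 1)) ^ a =
      algebraMap LaurentQT QT (AddMonoidAlgebra.single (a • v) 1) := by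
      intro a
      rw [← map_pow, AddMonoidAlgebra.single_pow, one_pow]
    obtain ⟨a, rfl | rfl⟩ := a.eq_nat_or_neg
    · rw [zpow_natCast, hnat, natCast_zsmul]
    · rw [zpow_neg, zpow_natCast, hnat, inv_eq_of_mul_eq_one_left]
      rw [← map_mul, AddMonoidAlgebra.single_mul_single, neg_smul, natCast_zsmul, neg_add_cancel,
        one_mul, ← AddMonoidAlgebra.one_def, map_one]
  rw [mono, q, t, key, key, ← map_mul, AddMonoidAlgebra.single_mul_single, one_mul]
  congr 2
  ext <;> simp

lemma mono_injective : Function.Injective mono := by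
  intro u v h
  rw [mono_eq_algebraMap, mono_eq_algebraMap] at h
  exact AddMonoidAlgebra.single_left_injective one_ne_zero
    (IsFractionRing.injective LaurentQT QT h)

/-- Evaluation of integral Laurent polynomials at `(q ^ m, t ^ m)`. -/
def ev (m : ℤ) : IntLaurent →+* QT :=
  (AddMonoidAlgebra.lift ℤ QT (ℤ × ℤ)
    ((zpowGroupHom m : QTˣ →* QTˣ) |>.comp (MonoidHom.toHomUnits monoHom) |>
      (Units.coeHom QT).comp)).toRingHom

lemma ev_single (m : ℤ) (u : ℤ × ℤ) (k : ℤ) :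
    ev m (AddMonoidAlgebra.single u k) = k * mono u ^ m := by
  simp [ev, AddMonoidAlgebra.lift_single, monoHom]

lemma ev_X (m : ℤ) (u : ℤ × ℤ) : ev m (X u) = mono u ^ m := by simp [X, ev_single]

/-- `ev m` is the composite of three injections: multiplication of exponents by `m`, the base change
from `ℤ` to `ℂ`, and the inclusion into the fraction field. -/
lemma ev_injective {m : ℤ} (hm : m ≠ 0) : Function.Injective (ev m) := by
  have h : ev m = ((algebraMap LaurentQT QT).comp
      (AddMonoidAlgebra.mapRingHom (ℤ × ℤ) (Int.castRingHom ℂ))).comp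
      (AddMonoidAlgebra.mapDomainRingHom ℤ (zsmulAddGroupHom m : ℤ × ℤ →+ ℤ × ℤ)) := by
    apply AddMonoidAlgebra.ringHom_ext
    · intro r
      simp only [RingHom.comp_apply, AddMonoidAlgebra.mapDomainRingHom_apply,
        AddMonoidAlgebra.mapDomain_single, map_zero, AddMonoidAlgebra.mapRingHom_single, ev_single]
      rw [mono_zero, one_zpow, mul_one]
      have : (AddMonoidAlgebra.single 0 ((Int.castRingHom ℂ) r) : LaurentQT) = (r : LaurentQT) := by
        rw [AddMonoidAlgebra.intCast_def]; rfl
      rw [this, map_intCast]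
    · intro u
      simp only [RingHom.comp_apply, AddMonoidAlgebra.mapDomainRingHom_apply,
        AddMonoidAlgebra.mapDomain_single, AddMonoidAlgebra.mapRingHom_single, ev_single]
      rw [Int.cast_one, one_mul, map_one, ← mono_eq_algebraMap, ← mono_zsmul]
      rfl
  rw [h]
  refine ((IsFractionRing.injective LaurentQT QT).comp
    (AddMonoidAlgebra.map_injective _ Int.cast_injective)).comp
    (AddMonoidAlgebra.mapDomain_injective ?_)
  intro u v huv
  exact smul_right_injective _ hm huv

lemma ev_ne_zero {m : ℤ} (hm : m ≠ 0) {p : IntLaurent} (hp : p ≠ 0) : ev m p ≠ 0 :=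
  (map_ne_zero_iff _ (ev_injective hm)).2 hp

/-! ### Exponentials of power series -/

section pexp

open PowerSeries

variable {K R : Type*} [Field K] [CharZero K] [CommRing R] [Algebra K R]

variable (K) in
/-- The exponential of a power series without constant coefficient. -/
def pexp (f : PowerSeries R) : PowerSeries R :=
  PowerSeries.mk fun n => ∑ k ∈ Finset.range (n + 1), ((k.factorial : K)⁻¹) • coeff n (f ^ k)

lemma coeff_pow_eq_zero {f : PowerSeries R} (hf : constantCoeff f = 0) {n k : ℕ} (h : n < k) :
    coeff n (f ^ k) = 0 :=
  PowerSeries.X_pow_dvd_iff.1 (pow_dvd_pow_of_dvd (PowerSeries.X_dvd_iff.2 hf) k) n h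

lemma coeff_pexp {f : PowerSeries R} (hf : constantCoeff f = 0) {n N : ℕ} (h : n < N) :
    coeff n (pexp K f) = ∑ k ∈ Finset.range N, ((k.factorial : K)⁻¹) • coeff n (f ^ k) := by
  rw [pexp, coeff_mk]
  refine Finset.sum_subset (by simpa using h) fun k _ hk => ?_
  rw [coeff_pow_eq_zero hf (by simpa using hk), smul_zero]

lemma constantCoeff_pexp (f : PowerSeries R) : constantCoeff (pexp K f) = 1 := by
  rw [← coeff_zero_eq_constantCoeff_apply, pexp, coeff_mk]
  simp

/-- Derivations of power series that act coefficientwise satisfy the chain rule for `pexp`. -/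
lemma derivation_pexp (E : Derivation K (PowerSeries R) (PowerSeries R)) (e : ℕ → R →ₗ[K] R)
    (hE : ∀ g n, coeff n (E g) = e n (coeff n g)) {f : PowerSeries R} (hf : constantCoeff f = 0)
    (hEf : constantCoeff (E f) = 0) : E (pexp K f) = pexp K f * E f := by
  ext n
  rw [hE, coeff_pexp hf (Nat.lt_succ_self n), map_sum, Finset.sum_range_succ', coeff_mul]
  have h0 : e n (((Nat.factorial 0 : K)⁻¹) • coeff n (f ^ 0)) = 0 := by
    rw [map_smul, pow_zero, ← hE]; simp
  rw [h0, add_zero]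
  have h1 : ∀ k ∈ Finset.range n, e n ((((k + 1).factorial : K)⁻¹) • coeff n (f ^ (k + 1))) =
      ((k.factorial : K)⁻¹) • coeff n (f ^ k * E f) := by
    intro k _
    rw [map_smul, ← hE, Derivation.leibniz_pow, Nat.add_sub_cancel, map_nsmul, Nat.factorial_succ,
      smul_eq_mul, ← Nat.cast_smul_eq_nsmul K, smul_smul]
    congr 1
    have := (Nat.cast_ne_zero (R := K)).2 (Nat.factorial_ne_zero k)
    have : ((k : K) + 1) ≠ 0 := by exact_mod_cast Nat.succ_ne_zero k
    push_cast
    field_simp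
  rw [Finset.sum_congr rfl h1]
  simp only [coeff_mul, Finset.smul_sum]
  rw [Finset.sum_comm]
  refine Finset.sum_congr rfl fun p hp => ?_
  have hpn := Finset.HasAntidiagonal.mem_antidiagonal.1 hp
  by_cases h2 : p.2 = 0
  · rw [h2, coeff_zero_eq_constantCoeff_apply, hEf]; simp
  · rw [coeff_pexp hf (show p.1 < n by omega), Finset.sum_mul]
    simp

variable (K R) in
/-- The derivation `X d/dX`. -/
def euler : Derivation K (PowerSeries R) (PowerSeries R) :=
  ((PowerSeries.X : PowerSeries R) • PowerSeries.derivative R).restrictScalars K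

lemma coeff_euler (f : PowerSeries R) (n : ℕ) : coeff n (euler K R f) = (n : K) • coeff n f := by
  change coeff n (PowerSeries.X * PowerSeries.derivative R f) = _
  cases n with
  | zero => simp
  | succ n =>
    rw [coeff_succ_X_mul, coeff_derivative, Nat.cast_smul_eq_nsmul, nsmul_eq_mul]
    push_cast
    ring

lemma euler_pexp {f : PowerSeries R} (hf : constantCoeff f = 0) :
    euler K R (pexp K f) = pexp K f * euler K R f := by
  refine derivation_pexp (euler K R) (fun n => (n : K) • LinearMap.id) (fun g n => ?_) hf ?_
  · rw [coeff_euler]; rfl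
  · rw [← coeff_zero_eq_constantCoeff_apply, coeff_euler]; simp

/-- Since `g` has no constant term, `X f' = f g` determines the coefficients of `f` recursively in
characteristic zero. Identities between exponentials thus reduce to logarithmic derivatives. -/
lemma eq_of_euler {f f' g : PowerSeries R} (hg : constantCoeff g = 0)
    (h : euler K R f = f * g) (h' : euler K R f' = f' * g)
    (h0 : constantCoeff f = constantCoeff f') : f = f' := by
  ext n
  induction n using Nat.strong_induction_on with
  | _ n ih =>
    rcases Nat.eq_zero_or_pos n with rfl | hn
    · simpa using h0
    · have e := congrArg (coeff n) h
      have e' := congrArg (coeff n) h'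
      have hs : coeff n (f * g) = coeff n (f' * g) := by
        rw [coeff_mul, coeff_mul]
        refine Finset.sum_congr rfl fun p hp => ?_
        have hpn := Finset.HasAntidiagonal.mem_antidiagonal.1 hp
        by_cases h2 : p.2 = 0
        · rw [h2, coeff_zero_eq_constantCoeff_apply, hg]; simp
        · rw [ih p.1 (by omega)]
      rw [coeff_euler] at e e'
      have hn' : (n : K) ≠ 0 := Nat.cast_ne_zero.2 hn.ne'
      have := e.trans (hs.trans e'.symm)
      have := congrArg (fun x => (n : K)⁻¹ • x) this
      simpa [smul_smul, hn'] using this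

lemma pexp_add {f g : PowerSeries R} (hf : constantCoeff f = 0) (hg : constantCoeff g = 0) :
    pexp K (f + g) = pexp K f * pexp K g := by
  refine eq_of_euler (K := K) (g := euler K R (f + g)) ?_ ?_ ?_ ?_
  · rw [← coeff_zero_eq_constantCoeff_apply, coeff_euler]; simp
  · exact euler_pexp (by simp [hf, hg])
  · rw [Derivation.leibniz, euler_pexp hf, euler_pexp hg, map_add, smul_eq_mul, smul_eq_mul]
    ring
  · rw [map_mul, constantCoeff_pexp, constantCoeff_pexp, constantCoeff_pexp, one_mul]

lemma pexp_zero : pexp K (0 : PowerSeries R) = 1 := by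
  refine eq_of_euler (K := K) (g := 0) (by simp) ?_ (by simp) ?_
  · rw [euler_pexp (by simp)]; simp
  · rw [constantCoeff_pexp]; simp

/-- The exponential of `-log (1 - xX)`. The convention `0⁻¹ = 0` removes the constant term of the
exponent. -/
lemma one_sub_mul_pexp (x : K) :
    (1 - C x * PowerSeries.X) * pexp K (PowerSeries.mk fun n => (n : K)⁻¹ * x ^ n) = 1 := by
  have hc : constantCoeff (PowerSeries.mk fun n => (n : K)⁻¹ * x ^ n) = 0 := by
    rw [← coeff_zero_eq_constantCoeff_apply]; simp
  refine eq_of_euler (K := K) (g := 0) (by simp) ?_ (by simp) ?_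
  · have h1 : (1 - C x * PowerSeries.X) *
        euler K K (PowerSeries.mk fun n => (n : K)⁻¹ * x ^ n) = C x * PowerSeries.X := by
      ext n
      rw [sub_mul, one_mul, map_sub, mul_assoc, coeff_C_mul, coeff_euler, coeff_mk]
      rcases n with _ | _ | n
      · simp
      · rw [coeff_succ_X_mul, coeff_euler, coeff_C_mul, PowerSeries.coeff_X]
        simp
      · rw [coeff_succ_X_mul, coeff_euler, coeff_mk]
        have e1 : ((n + 1 + 1 : ℕ) : K) ≠ 0 := Nat.cast_ne_zero.2 (by omega)
        have e2 : ((n + 1 : ℕ) : K) ≠ 0 := Nat.cast_ne_zero.2 (by omega)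
        rw [smul_eq_mul, smul_eq_mul, mul_inv_cancel_left₀ e1, mul_inv_cancel_left₀ e2, coeff_C_mul,
          PowerSeries.coeff_X]
        simp
        ring
    have h2 : euler K K (1 - C x * PowerSeries.X) = -(C x * PowerSeries.X) := by
      ext n
      rw [coeff_euler]
      rcases n with _ | _ | n
      · simp
      · simp [coeff_one]
      · simp [coeff_one]
    rw [Derivation.leibniz, euler_pexp hc, smul_eq_mul, smul_eq_mul, h2, mul_zero]
    linear_combination (pexp K (PowerSeries.mk fun n => (n : K)⁻¹ * x ^ n)) * h1
  · rw [map_mul, constantCoeff_pexp]; simp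

end pexp

end

end DeformedW

namespace DeformedW

noncomputable section

open IntLaurent

/-! ### Residues of infinite products -/

namespace IntLaurent

/-- The specialization at `q = t = 1`. -/
def aug : IntLaurent →+* ℤ := (AddMonoidAlgebra.lift ℤ ℤ (ℤ × ℤ) 1).toRingHom

lemma aug_single (u : ℤ × ℤ) (k : ℤ) : aug (AddMonoidAlgebra.single u k) = k := by
  simp [aug, AddMonoidAlgebra.lift_single]

@[simp] lemma aug_X (u : ℤ × ℤ) : aug (X u) = 1 := aug_single u 1

lemma aug_sum_X (A : Multiset (ℤ × ℤ)) : aug (A.map X).sum = A.card := by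
  induction A using Multiset.induction_on with
  | empty => simp
  | cons a A ih => simp [ih, add_comm]

lemma coeff_sum_X (A : Multiset (ℤ × ℤ)) (u : ℤ × ℤ) : (A.map X).sum.coeff u = A.count u := by
  induction A using Multiset.induction_on with
  | empty => simp
  | cons a A ih =>
    rw [Multiset.map_cons, Multiset.sum_cons, AddMonoidAlgebra.coeff_add, Finsupp.add_apply, ih,
      coeff_X, Multiset.count_cons]
    push_cast
    rw [add_comm, if_congr (eq_comm (a := a)) rfl rfl]

/-- `A` lists the poles and `B` the zeros of `∏ (1 - uX)^{-g(u)}` with multiplicities; no point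
occurs in both. -/
lemma exists_multiset (g : IntLaurent) : ∃ A B : Multiset (ℤ × ℤ),
    g = (A.map X).sum - (B.map X).sum ∧ (∀ u, A.count u = (g.coeff u).toNat) ∧
      ∀ u, B.count u = (-g.coeff u).toNat := by
  let A := Finsupp.toMultiset (g.coeff.mapRange Int.toNat rfl)
  let B := Finsupp.toMultiset (g.coeff.mapRange (fun k => (-k).toNat) rfl)
  have hA : ∀ u, A.count u = (g.coeff u).toNat := fun u => by simp [A, Finsupp.count_toMultiset]
  have hB : ∀ u, B.count u = (-g.coeff u).toNat := fun u => by simp [B, Finsupp.count_toMultiset]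
  refine ⟨A, B, ?_, hA, hB⟩
  ext a d
  rw [AddMonoidAlgebra.coeff_sub, Finsupp.sub_apply, coeff_sum_X, coeff_sum_X, hA, hB]
  omega

end IntLaurent

/-- The power series `∏_u (1 - u x) ^ {-g(u)}`. -/
def prodSeries (g : IntLaurent) : PowerSeries QT :=
  pexp QT (PowerSeries.mk fun m => (m : QT)⁻¹ * ev m g)

lemma constantCoeff_mk_inv_mul (f : ℕ → QT) :
    PowerSeries.constantCoeff (PowerSeries.mk fun m => (m : QT)⁻¹ * f m) = 0 := by
  rw [← PowerSeries.coeff_zero_eq_constantCoeff_apply]; simp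

lemma prodSeries_add (g g' : IntLaurent) :
    prodSeries (g + g') = prodSeries g * prodSeries g' := by
  rw [prodSeries, prodSeries, prodSeries, ← pexp_add (constantCoeff_mk_inv_mul _)
    (constantCoeff_mk_inv_mul _)]
  congr 1
  ext m
  simp [mul_add]

/-- The power series `1 - x X`. -/
def linSeries (x : QT) : PowerSeries QT := 1 - PowerSeries.C x * PowerSeries.X

lemma prodSeries_X (u : ℤ × ℤ) : linSeries (mono u) * prodSeries (X u) = 1 := by
  have := one_sub_mul_pexp (mono u)
  rw [linSeries, prodSeries]
  simpa only [ev_X, zpow_natCast] using this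

lemma prodSeries_sum_X (A : Multiset (ℤ × ℤ)) :
    (A.map fun u => linSeries (mono u)).prod * prodSeries (A.map X).sum = 1 := by
  induction A using Multiset.induction_on with
  | empty =>
    rw [Multiset.map_zero, Multiset.prod_zero, Multiset.map_zero, Multiset.sum_zero, one_mul,
      prodSeries, ← pexp_zero (K := QT)]
    congr 1
    ext m
    simp
  | cons a A ih =>
    rw [Multiset.map_cons, Multiset.prod_cons, Multiset.map_cons, Multiset.sum_cons, prodSeries_add,
      mul_mul_mul_comm, prodSeries_X, ih, one_mul]

lemma prod_mul_prodSeries {g : IntLaurent} {A B : Multiset (ℤ × ℤ)}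
    (hg : g = (A.map X).sum - (B.map X).sum) :
    (A.map fun u => linSeries (mono u)).prod * prodSeries g =
      (B.map fun u => linSeries (mono u)).prod := by
  have h1 := prodSeries_sum_X A
  have h2 := prodSeries_sum_X B
  have h3 : prodSeries g * prodSeries (B.map X).sum = prodSeries (A.map X).sum := by
    rw [← prodSeries_add, hg, sub_add_cancel]
  linear_combination (B.map fun u => linSeries (mono u)).prod * h1 -
    (A.map fun u => linSeries (mono u)).prod * prodSeries g * h2 +
    (A.map fun u => linSeries (mono u)).prod * (B.map fun u => linSeries (mono u)).prod * h3

/-- The shift of sequences. -/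
def shift : Module.End QT (ℕ → QT) where
  toFun f l := f (l + 1)
  map_add' _ _ := rfl
  map_smul' _ _ := rfl

lemma shift_apply (f : ℕ → QT) (l : ℕ) : shift f l = f (l + 1) := rfl

/-- The pairing `∑ l, φ l * coeff l p`. -/
def pairing (φ : ℕ → QT) (p : Polynomial QT) : QT := Polynomial.aeval shift p φ 0

/-- The coefficients of a power series from degree `c` on. -/
def tail (F : PowerSeries QT) (c : ℕ) : ℕ → QT := fun l => PowerSeries.coeff (l + c) F

/-- The dictionary between test polynomials and poles: a factor `X - x` evaluated at the shift
multiplies the series by `1 - xX`, removing a pole, at the cost of starting one degree later. -/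
lemma aeval_linear_tail (F : PowerSeries QT) (c : ℕ) (x : QT) :
    Polynomial.aeval shift (Polynomial.X - Polynomial.C x) (tail F c) =
      tail (linSeries x * F) (c + 1) := by
  funext l
  rw [map_sub, Polynomial.aeval_X, Polynomial.aeval_C, LinearMap.sub_apply, Pi.sub_apply,
    shift_apply, Module.algebraMap_end_apply, Pi.smul_apply, linSeries, sub_mul, one_mul]
  simp only [tail, map_sub, mul_assoc, PowerSeries.coeff_C_mul]
  rw [← add_assoc l c 1, PowerSeries.coeff_succ_X_mul, add_right_comm]
  rfl

lemma aeval_prod_tail (F : PowerSeries QT) (c : ℕ) (A : Multiset (ℤ × ℤ)) :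
    Polynomial.aeval shift (A.map fun u => Polynomial.X - Polynomial.C (mono u)).prod (tail F c) =
      tail ((A.map fun u => linSeries (mono u)).prod * F) (c + A.card) := by
  induction A using Multiset.induction_on with
  | empty => simp
  | cons a A ih =>
    rw [Multiset.map_cons, Multiset.prod_cons, map_mul, Module.End.mul_apply, ih, aeval_linear_tail,
      Multiset.map_cons, Multiset.prod_cons, mul_assoc, Multiset.card_cons, add_assoc]

lemma coeff_prod_linSeries (B : Multiset (ℤ × ℤ)) {n : ℕ} (hn : B.card < n) :
    PowerSeries.coeff n (B.map fun u => linSeries (mono u)).prod = 0 := by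
  induction B using Multiset.induction_on generalizing n with
  | empty => simp at hn; simp [PowerSeries.coeff_one, hn.ne']
  | cons b B ih =>
    obtain ⟨n, rfl⟩ : ∃ m, n = m + 1 := ⟨n - 1, by omega⟩
    rw [Multiset.card_cons] at hn
    rw [Multiset.map_cons, Multiset.prod_cons, linSeries, sub_mul, one_mul, map_sub, mul_assoc,
      PowerSeries.coeff_C_mul, PowerSeries.coeff_succ_X_mul, ih (by omega), ih (by omega)]
    simp

/-- A series with one pole left has geometric coefficients from degree `|B|` on, and their amplitude
is the value of the numerator at the pole. -/
lemma coeff_geometric (x : QT) (B : Multiset (ℤ × ℤ)) {G : PowerSeries QT}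
    (hG : linSeries x * G = (B.map fun u => linSeries (mono u)).prod) (l : ℕ) :
    PowerSeries.coeff (l + B.card) G = x ^ l * (B.map fun u => x - mono u).prod := by
  have hunit : IsUnit (linSeries x) := by
    rw [PowerSeries.isUnit_iff_constantCoeff]; simp [linSeries]
  induction B using Multiset.induction_on generalizing G l with
  | empty =>
    simp only [Multiset.map_zero, Multiset.prod_zero, Multiset.card_zero, add_zero, mul_one] at hG ⊢
    have : G = PowerSeries.mk fun n => x ^ n := by
      apply hunit.mul_left_cancel
      rw [hG]
      ext n
      rw [linSeries, sub_mul, one_mul, map_sub, mul_assoc, PowerSeries.coeff_C_mul]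
      cases n with
      | zero => simp
      | succ n => rw [PowerSeries.coeff_succ_X_mul]; simp [PowerSeries.coeff_one, pow_succ']
    rw [this, PowerSeries.coeff_mk]
  | cons b B ih =>
    rw [Multiset.map_cons, Multiset.prod_cons] at hG ⊢
    obtain ⟨r, hr⟩ := id hunit
    have hG' : linSeries x * (↑r⁻¹ * (B.map fun u => linSeries (mono u)).prod) =
        (B.map fun u => linSeries (mono u)).prod := by
      rw [← hr, Units.mul_inv_cancel_left]
    have e : G = linSeries (mono b) * (↑r⁻¹ * (B.map fun u => linSeries (mono u)).prod) := by
      apply hunit.mul_left_cancel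
      rw [hG, mul_left_comm, hG']
    rw [e, Multiset.card_cons, ← add_assoc]
    nth_rw 1 [linSeries]
    rw [sub_mul, one_mul, map_sub, mul_assoc (PowerSeries.C (mono b)), PowerSeries.coeff_C_mul,
      PowerSeries.coeff_succ_X_mul, ih hG' l, show l + B.card + 1 = (l + 1) + B.card by ring,
      ih hG' (l + 1)]
    ring

lemma aeval_geometric (x z : QT) (p : Polynomial QT) :
    Polynomial.aeval shift p (fun l => x ^ l * z) = p.eval x • fun l => x ^ l * z := by
  induction p using Polynomial.induction_on' with
  | add p p' h h' => rw [map_add, LinearMap.add_apply, h, h', Polynomial.eval_add, add_smul]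
  | monomial n a =>
    rw [Polynomial.aeval_monomial, Polynomial.eval_monomial, Module.End.mul_apply]
    have : ∀ n : ℕ, (shift ^ n) (fun l => x ^ l * z) = x ^ n • fun l => x ^ l * z := by
      intro n
      induction n with
      | zero => simp
      | succ n ih =>
        rw [pow_succ', Module.End.mul_apply, ih, map_smul, pow_succ, mul_smul]
        congr 1
        funext l
        rw [shift_apply, Pi.smul_apply, smul_eq_mul]
        ring
    rw [this, Module.algebraMap_end_apply, smul_smul]

section
variable {g : IntLaurent} (hg0 : aug g = 0) {A B : Multiset (ℤ × ℤ)}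
  (hg : g = (A.map X).sum - (B.map X).sum)
include hg0 hg

lemma card_eq_of_aug : A.card = B.card := by
  rw [hg, map_sub, aug_sum_X, aug_sum_X] at hg0
  omega

/-- If `p` cancels every pole, a polynomial of degree at most `|B|` remains. Since `aug g = 0` gives
`|A| = |B|`, the tail starting in degree `1 + |A|` does not see it. -/
lemma pairing_eq_zero {p : Polynomial QT}
    (hp : (A.map fun u => Polynomial.X - Polynomial.C (mono u)).prod ∣ p) :
    pairing (tail (prodSeries g) 1) p = 0 := by
  obtain ⟨p, rfl⟩ := hp
  rw [pairing, mul_comm, map_mul, Module.End.mul_apply, aeval_prod_tail, prod_mul_prodSeries hg]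
  have : tail (B.map fun u => linSeries (mono u)).prod (1 + A.card) = 0 := by
    funext l
    exact coeff_prod_linSeries B (by have := card_eq_of_aug hg0 hg; omega)
  rw [this, map_zero]
  rfl

/-- With all poles but one removed, the tail is geometric and the remaining factor `h` is evaluated
at the surviving pole. The pairing becomes a residue. -/
lemma pairing_eq {u : ℤ × ℤ} {A' : Multiset (ℤ × ℤ)} (hA : A = u ::ₘ A') {p h : Polynomial QT}
    (hp : p = (A'.map fun u => Polynomial.X - Polynomial.C (mono u)).prod * h) :
    pairing (tail (prodSeries g) 1) p =
      h.eval (mono u) * (B.map fun v => mono u - mono v).prod := by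
  subst hp
  rw [pairing, mul_comm, map_mul, Module.End.mul_apply, aeval_prod_tail]
  have hcard : 1 + A'.card = B.card := by
    rw [← card_eq_of_aug hg0 hg, hA, Multiset.card_cons, add_comm]
  have hG := prod_mul_prodSeries hg
  rw [hA, Multiset.map_cons, Multiset.prod_cons, mul_assoc] at hG
  have : tail ((A'.map fun u => linSeries (mono u)).prod * prodSeries g) (1 + A'.card) =
      fun l => mono u ^ l * (B.map fun v => mono u - mono v).prod := by
    funext l
    rw [tail, hcard]
    exact coeff_geometric (mono u) B hG l
  rw [this, aeval_geometric]
  simp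

end

/-- The product of all factors of `∏_v (u - v) ^ {-g(v)}` with `v ≠ u`. -/
def resid (u : ℤ × ℤ) (g : IntLaurent) : QT :=
  g.coeff.prod fun v k => if v = u then 1 else (mono u - mono v) ^ (-k)

lemma mono_sub_ne_zero {u v : ℤ × ℤ} (h : v ≠ u) : mono u - mono v ≠ 0 :=
  sub_ne_zero.2 fun e => h (mono_injective e).symm

lemma resid_add (u : ℤ × ℤ) (g g' : IntLaurent) : resid u (g + g') = resid u g * resid u g' := by
  unfold resid
  rw [AddMonoidAlgebra.coeff_add]
  refine Finsupp.prod_add_index' (fun v => by simp) fun v k k' => ?_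
  split_ifs with h
  · rw [one_mul]
  · rw [neg_add, zpow_add₀ (mono_sub_ne_zero h)]

lemma resid_single (u v : ℤ × ℤ) (k : ℤ) :
    resid u (AddMonoidAlgebra.single v k) = if v = u then 1 else (mono u - mono v) ^ (-k) := by
  unfold resid
  rw [AddMonoidAlgebra.coeff_single, Finsupp.prod_single_index (by simp)]

lemma resid_zero (u : ℤ × ℤ) : resid u 0 = 1 := by simp [resid]

lemma resid_ne_zero (u : ℤ × ℤ) (g : IntLaurent) : resid u g ≠ 0 := by
  unfold resid
  refine Finset.prod_ne_zero_iff.2 fun v _ => ?_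
  dsimp only
  split_ifs with h
  · exact one_ne_zero
  · exact zpow_ne_zero _ (mono_sub_ne_zero h)

lemma resid_sum_X {u : ℤ × ℤ} {A : Multiset (ℤ × ℤ)} (hu : u ∉ A) :
    resid u (A.map X).sum * (A.map fun v => mono u - mono v).prod = 1 := by
  induction A using Multiset.induction_on with
  | empty => simp [resid_zero]
  | cons a A ih =>
    rw [Multiset.mem_cons, not_or] at hu
    have ha : a ≠ u := fun h => hu.1 h.symm
    rw [Multiset.map_cons, Multiset.sum_cons, resid_add, Multiset.map_cons, Multiset.prod_cons,
      mul_mul_mul_comm, ih hu.2, mul_one, X, resid_single, if_neg ha, zpow_neg_one,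
      inv_mul_cancel₀ (mono_sub_ne_zero ha)]

lemma resid_X_self (u : ℤ × ℤ) : resid u (X u) = 1 := by rw [X, resid_single, if_pos rfl]

lemma resid_mul_prod {g : IntLaurent} {u : ℤ × ℤ} {A B : Multiset (ℤ × ℤ)}
    (hg : g = ((u ::ₘ A).map X).sum - (B.map X).sum) (hA : u ∉ A) (hB : u ∉ B) :
    resid u g * (A.map fun v => mono u - mono v).prod =
      (B.map fun v => mono u - mono v).prod := by
  have h : resid u g * resid u (B.map X).sum = resid u (A.map X).sum := by
    rw [← resid_add, hg, sub_add_cancel, Multiset.map_cons, Multiset.sum_cons, resid_add,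
      resid_X_self, one_mul]
  have h1 := resid_sum_X hA
  have h2 := resid_sum_X hB
  linear_combination (A.map fun v => mono u - mono v).prod *
    (B.map fun v => mono u - mono v).prod * h + (B.map fun v => mono u - mono v).prod * h1 -
    resid u g * (A.map fun v => mono u - mono v).prod * h2

lemma prod_dvd_of_pow_dvd {A : Multiset (ℤ × ℤ)} {p : Polynomial QT} {M : ℕ}
    (hM : ∀ u, A.count u ≤ M) (h : ∀ u ∈ A, (Polynomial.X - Polynomial.C (mono u)) ^ M ∣ p) :
    (A.map fun u => Polynomial.X - Polynomial.C (mono u)).prod ∣ p := by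
  classical
  rw [Finset.prod_multiset_map_count]
  refine Finset.prod_dvd_of_coprime (fun u _ v _ huv => ?_) fun u hu => ?_
  · exact (Polynomial.pairwise_coprime_X_sub_C mono_injective huv).pow
  · exact (pow_dvd_pow _ (hM u)).trans (h u (Multiset.mem_toFinset.1 hu))

lemma exists_separating {σ : Type*} (x : σ → QT) (Y : Finset (σ → QT)) (hx : x ∉ Y) :
    ∃ P : MvPolynomial σ QT, MvPolynomial.eval x P = 1 ∧ ∀ y ∈ Y, MvPolynomial.eval y P = 0 := by
  classical
  have : ∀ y : σ → QT, ∃ P : MvPolynomial σ QT, y ≠ x → MvPolynomial.eval x P = 1 ∧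
      MvPolynomial.eval y P = 0 := by
    intro y
    by_cases hy : y = x
    · exact ⟨0, fun h => absurd hy h⟩
    · obtain ⟨a, ha⟩ := Function.ne_iff.1 hy
      refine ⟨MvPolynomial.C (x a - y a)⁻¹ * (MvPolynomial.X a - MvPolynomial.C (y a)), fun _ => ?_⟩
      have : x a - y a ≠ 0 := sub_ne_zero.2 (Ne.symm ha)
      simp [this]
  choose P hP using this
  refine ⟨∏ y ∈ Y, P y, ?_, fun y hy => ?_⟩
  · rw [map_prod]
    exact Finset.prod_eq_one fun y hy => (hP y (fun h => hx (h ▸ hy))).1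
  · rw [map_prod]
    exact Finset.prod_eq_zero hy (hP y (fun h => hx (h ▸ hy))).2

lemma eval_aeval {σ : Type*} (ℓ : σ → Polynomial QT) (x : QT) (P : MvPolynomial σ QT) :
    (MvPolynomial.aeval ℓ P).eval x = MvPolynomial.eval (fun s => (ℓ s).eval x) P := by
  induction P using MvPolynomial.induction_on with
  | C a => simp
  | add p p' h h' => simp only [map_add, Polynomial.eval_add, h, h']
  | mul_X p s h => simp only [map_mul, Polynomial.eval_mul, h, MvPolynomial.aeval_X,
      MvPolynomial.eval_X]

section residue

variable {V σ : Type*} {S : Finset V} {c : V → QT} {g : V → IntLaurent}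
  (hc : ∀ n ∈ S, c n ≠ 0) (hg : ∀ n ∈ S, aug (g n) = 0)
  {ℓ : V → σ → Polynomial QT}
  (hrel : ∀ P : MvPolynomial σ QT,
    ∑ n ∈ S, c n * pairing (tail (prodSeries (g n)) 1) (MvPolynomial.aeval (ℓ n) P) = 0)
  {a : ℕ → σ} {s : ℕ → QT} (hs : ∀ m, s m ≠ 0) {v : V → ℕ → QT}
  (hℓ : ∀ n m, ℓ n (a m) = Polynomial.C (v n m) + Polynomial.C (s m) * Polynomial.X ^ (m + 1))
  (hinj : ∀ n ∈ S, ∀ n' ∈ S, ∀ u, (∀ b, (ℓ n b).eval (mono u) = (ℓ n' b).eval (mono u)) → n = n')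

/-- The point at which a pole contributes. -/
def point (ℓ : V → σ → Polynomial QT) (n : V) (u : ℤ × ℤ) : σ → QT :=
  fun b => (ℓ n b).eval (mono u)

include hs hℓ in
lemma point_injective (n : V) : Function.Injective (point ℓ n) := by
  intro u u' h
  have := congrFun h (a 0)
  simp only [point, hℓ] at this
  simp only [Polynomial.eval_add, Polynomial.eval_C, Polynomial.eval_mul,
    Polynomial.eval_X, zero_add, pow_one, add_right_inj] at this
  exact mono_injective (mul_left_cancel₀ (hs 0) this)

include hc hg hrel hs hℓ hinj

/-- A relation between the pairings excludes multiple poles. -/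
theorem poles_le_one {n₀ : V} (hn₀ : n₀ ∈ S) (u₀ : ℤ × ℤ) : (g n₀).coeff u₀ ≤ 1 := by
  classical
  by_contra! hm
  obtain ⟨m, hm'⟩ : ∃ m : ℕ, (g n₀).coeff u₀ = m + 2 := ⟨((g n₀).coeff u₀ - 2).toNat, by omega⟩
  choose A B hAB hA hB using exists_multiset
  set x := point ℓ n₀ u₀ with hx
  let Pts : Finset (V × (ℤ × ℤ)) := S.biUnion fun n => (A (g n)).toFinset.image fun u => (n, u)
  have hPts : ∀ n u, (n, u) ∈ Pts ↔ n ∈ S ∧ u ∈ A (g n) := by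
    intro n u
    simp [Pts]
  -- `P` isolates the point `x`: a power of it cancels all poles of all terms that contribute at
  -- other points.
  obtain ⟨P, hP1, hP0⟩ := exists_separating x ((Pts.image fun p => point ℓ p.1 p.2).erase x) (by simp)
  obtain ⟨M, hM⟩ : ∃ M : ℕ, ∀ n ∈ S, ∀ u, (A (g n)).count u ≤ M :=
    ⟨S.sum fun n => (A (g n)).card, fun n hn u => (Multiset.count_le_card _ _).trans
      (Finset.single_le_sum (f := fun n => (A (g n)).card) (fun _ _ => Nat.zero_le _) hn)⟩
  -- The poles of other terms at the same point `x`. They are removed by `Γ'`, and `Γ` has an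
  -- additional simple zero at `u₀`.
  let E := Pts.filter fun p => p.1 ≠ n₀ ∧ point ℓ p.1 p.2 = x
  let Γ' : Polynomial QT := ∏ p ∈ E, (Polynomial.X - Polynomial.C (mono p.2)) ^ M
  let Γ : Polynomial QT := (Polynomial.X - Polynomial.C (mono u₀)) * Γ'
  -- Because `ℓ n (a k)` is a constant plus a multiple of `X ^ (k + 1)`, any polynomial can be
  -- realized up to an additive constant depending on `n`. `L` realizes `Γ`, with constant `0` for
  -- `n₀`.
  let L : MvPolynomial σ QT := MvPolynomial.C (Γ.coeff 0) + ∑ k ∈ Finset.range Γ.natDegree,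
    MvPolynomial.C (Γ.coeff (k + 1) * (s k)⁻¹) * (MvPolynomial.X (a k) - MvPolynomial.C (v n₀ k))
  let κ : V → QT := fun n => ∑ k ∈ Finset.range Γ.natDegree,
    Γ.coeff (k + 1) * (s k)⁻¹ * (v n k - v n₀ k)
  have hL : ∀ n, MvPolynomial.aeval (ℓ n) L = Γ + Polynomial.C (κ n) := by
    intro n
    simp only [L, map_add, map_sum, map_mul, map_sub, MvPolynomial.algHom_C, MvPolynomial.aeval_X, hℓ,
      Polynomial.algebraMap_eq]
    conv_rhs => rw [Γ.as_sum_range_C_mul_X_pow, Finset.sum_range_succ']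
    rw [pow_zero, mul_one, map_sum, add_right_comm, add_comm, ← Finset.sum_add_distrib]
    congr 1
    refine Finset.sum_congr rfl fun k _ => ?_
    have : Polynomial.C (s k)⁻¹ * Polynomial.C (s k) = 1 := by
      rw [← Polynomial.C_mul, inv_mul_cancel₀ (hs k), Polynomial.C_1]
    simp only [map_mul, map_sub]
    linear_combination Polynomial.C (Γ.coeff (k + 1)) * Polynomial.X ^ (k + 1) * this
  have hκ₀ : κ n₀ = 0 := Finset.sum_eq_zero fun k _ => by rw [sub_self, mul_zero]
  have hΓu : ∀ p ∈ E, Γ.eval (mono p.2) = 0 ∨ M = 0 := by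
    intro p hp
    by_cases hM0 : M = 0
    · exact Or.inr hM0
    · left
      rw [Polynomial.eval_mul, Polynomial.eval_prod, Finset.prod_eq_zero hp, mul_zero]
      simp [hM0]
  have hM2 : 2 ≤ M := le_trans (by rw [hA]; omega) (hM n₀ hn₀ u₀)
  -- Both terms evaluate `L` at the same point `x`, and `Γ` vanishes at both poles, so the constants
  -- agree.
  have hκ : ∀ p ∈ E, κ p.1 = 0 := by
    intro p hp
    have hpx : point ℓ p.1 p.2 = x := (Finset.mem_filter.1 hp).2.2
    have e1 := eval_aeval (ℓ p.1) (mono p.2) L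
    have e2 := eval_aeval (ℓ n₀) (mono u₀) L
    change _ = MvPolynomial.eval (point ℓ p.1 p.2) L at e1
    change _ = MvPolynomial.eval (point ℓ n₀ u₀) L at e2
    rw [hL, hpx, Polynomial.eval_add, Polynomial.eval_C,
      (hΓu p hp).resolve_right (by omega), zero_add] at e1
    rw [hL, hκ₀, ← hx, Polynomial.C_0, add_zero, Polynomial.eval_mul] at e2
    rw [e1, ← e2]
    simp
  have hdvdP : ∀ n ∈ S, ∀ u ∈ A (g n), point ℓ n u ≠ x →
      (Polynomial.X - Polynomial.C (mono u)) ^ M ∣ (MvPolynomial.aeval (ℓ n) P) ^ M := by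
    intro n hn u hu hne
    refine pow_dvd_pow_of_dvd (Polynomial.dvd_iff_isRoot.2 ?_) M
    rw [Polynomial.IsRoot.def, eval_aeval]
    exact hP0 _ (Finset.mem_erase.2 ⟨hne, Finset.mem_image.2 ⟨(n, u), (hPts n u).2 ⟨hn, hu⟩, rfl⟩⟩)
  have hother : ∀ n ∈ S, n ≠ n₀ → c n * pairing (tail (prodSeries (g n)) 1)
      (MvPolynomial.aeval (ℓ n) (P ^ M * L ^ (m + 1))) = 0 := by
    intro n hn hne
    rw [pairing_eq_zero (hg n hn) (hAB (g n)), mul_zero]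
    refine prod_dvd_of_pow_dvd (hM n hn) fun u hu => ?_
    rw [map_mul, map_pow, map_pow]
    by_cases hp : point ℓ n u = x
    · have hE : (n, u) ∈ E := Finset.mem_filter.2 ⟨(hPts n u).2 ⟨hn, hu⟩, hne, hp⟩
      refine Dvd.dvd.mul_left ?_ _
      refine dvd_trans ?_ (dvd_pow_self _ (Nat.succ_ne_zero m))
      rw [hL, hκ (n, u) hE, Polynomial.C_0, add_zero]
      exact (Finset.dvd_prod_of_mem (fun p : V × (ℤ × ℤ) =>
        (Polynomial.X - Polynomial.C (mono p.2)) ^ M) hE).mul_left _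
    · exact (hdvdP n hn u hu hp).mul_right _
  -- For `n₀` the factor `L ^ (m + 1)` lowers the pole of order `m + 2` at `u₀` to a simple one; for
  -- every other term all poles are cancelled. A single nonzero residue is left.
  have hsum := hrel (P ^ M * L ^ (m + 1))
  rw [Finset.sum_eq_single_of_mem n₀ hn₀ fun n hn hne => hother n hn hne] at hsum
  let A' := (A (g n₀)).filter fun u => u ≠ u₀
  have hA' : A (g n₀) = u₀ ::ₘ (Multiset.replicate (m + 1) u₀ + A') := by
    ext u
    simp only [A', Multiset.count_cons, Multiset.count_add, Multiset.count_replicate,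
      Multiset.count_filter]
    by_cases hu : u = u₀
    · subst hu
      simp [hA, hm']
      omega
    · simp [hu, Ne.symm hu]
  have hA'mem : ∀ u ∈ A', u ∈ A (g n₀) ∧ u ≠ u₀ := fun u hu => by
    simpa [A'] using hu
  obtain ⟨h', hh'⟩ : (A'.map fun u => Polynomial.X - Polynomial.C (mono u)).prod ∣
      (MvPolynomial.aeval (ℓ n₀) P) ^ M := by
    refine prod_dvd_of_pow_dvd (fun u => (Multiset.count_le_of_le u
      (Multiset.filter_le _ _)).trans (hM n₀ hn₀ u)) fun u hu => ?_
    obtain ⟨hu1, hu2⟩ := hA'mem u hu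
    exact hdvdP n₀ hn₀ u hu1 fun h => hu2 (point_injective hs hℓ n₀ h)
  have hp : MvPolynomial.aeval (ℓ n₀) (P ^ M * L ^ (m + 1)) =
      ((Multiset.replicate (m + 1) u₀ + A').map fun u =>
        Polynomial.X - Polynomial.C (mono u)).prod * (h' * Γ' ^ (m + 1)) := by
    rw [map_mul, map_pow, map_pow, hL, hκ₀, Polynomial.C_0, add_zero, hh', Multiset.map_add,
      Multiset.prod_add, Multiset.map_replicate, Multiset.prod_replicate, mul_pow]
    ring
  rw [pairing_eq (hg n₀ hn₀) (hAB (g n₀)) hA' hp] at hsum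
  have e1 : h'.eval (mono u₀) ≠ 0 := by
    intro h0
    have := congrArg (Polynomial.eval (mono u₀)) hh'
    rw [Polynomial.eval_pow, eval_aeval, Polynomial.eval_mul, h0, mul_zero] at this
    change (MvPolynomial.eval x P) ^ M = 0 at this
    rw [hP1, one_pow] at this
    exact one_ne_zero this
  -- By `hinj`, another term contributing at `x` has its pole at a position different from `u₀`.
  have e2 : Γ'.eval (mono u₀) ≠ 0 := by
    rw [Polynomial.eval_prod]
    refine Finset.prod_ne_zero_iff.2 fun p hp => ?_
    rw [Polynomial.eval_pow, Polynomial.eval_sub, Polynomial.eval_X, Polynomial.eval_C]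
    refine pow_ne_zero _ (mono_sub_ne_zero ?_)
    intro hpu
    obtain ⟨hp1, hp2, hp3⟩ := Finset.mem_filter.1 hp
    obtain ⟨n, u⟩ := p
    subst hpu
    exact hp2 (hinj n ((hPts n u).1 hp1).1 n₀ hn₀ u (congrFun hp3))
  have e3 : ((B (g n₀)).map fun v => mono u₀ - mono v).prod ≠ 0 := by
    rw [Ne, Multiset.prod_eq_zero_iff, Multiset.mem_map]
    rintro ⟨u, hu, h0⟩
    have : u = u₀ := by
      by_contra hne
      exact mono_sub_ne_zero hne h0
    subst this
    have := Multiset.count_pos.2 hu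
    rw [hB] at this
    omega
  rw [Polynomial.eval_mul, Polynomial.eval_pow] at hsum
  exact mul_ne_zero (hc n₀ hn₀) (mul_ne_zero (mul_ne_zero e1 (pow_ne_zero _ e2)) e3) hsum

open scoped Classical in
/-- A relation between the pairings gives a relation between the residues at each point. -/
theorem sum_resid_eq_zero (x : σ → QT) : ∑ n ∈ S, c n *
    ∑ u ∈ (g n).coeff.support.filter fun u => (g n).coeff u = 1 ∧ point ℓ n u = x,
      resid u (g n) = 0 := by
  classical
  choose A B hAB hA hB using exists_multiset
  have hle := fun n hn u => poles_le_one hc hg hrel hs hℓ hinj (n₀ := n) hn u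
  -- All poles being simple, `P` itself cancels those away from `x` and equals `1` at `x`. Each
  -- pairing is then the residue at `x`; for a fixed term at most one pole maps to `x`.
  obtain ⟨P, hP1, hP0⟩ := exists_separating x
    ((S.biUnion fun n => (A (g n)).toFinset.image fun u => point ℓ n u).erase x) (by simp)
  rw [← hrel P]
  refine Finset.sum_congr rfl fun n hn => ?_
  congr 1
  have hnodup : (A (g n)).Nodup := by
    rw [Multiset.nodup_iff_count_le_one]
    intro u
    have := hle n hn u
    rw [hA]
    omega
  have hzero : ∀ u ∈ A (g n), point ℓ n u ≠ x →
      (Polynomial.X - Polynomial.C (mono u)) ^ 1 ∣ MvPolynomial.aeval (ℓ n) P := by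
    intro u hu hne
    rw [pow_one]
    refine Polynomial.dvd_iff_isRoot.2 ?_
    rw [Polynomial.IsRoot.def, eval_aeval]
    exact hP0 _ (Finset.mem_erase.2 ⟨hne, Finset.mem_biUnion.2 ⟨n, hn,
      Finset.mem_image.2 ⟨u, Multiset.mem_toFinset.2 hu, rfl⟩⟩⟩)
  by_cases hex : ∃ u, (g n).coeff u = 1 ∧ point ℓ n u = x
  · obtain ⟨u, hu1, hux⟩ := hex
    have huA : u ∈ A (g n) := by
      rw [← Multiset.count_pos, hA]; omega
    rw [Finset.sum_eq_single_of_mem u (by simp [hu1, hux]) fun u' hu' hne => by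
      have := (Finset.mem_filter.1 hu').2.2
      exact absurd (point_injective hs hℓ n (this.trans hux.symm)) hne]
    obtain ⟨A', hA'⟩ := Multiset.exists_cons_of_mem huA
    have huA' : u ∉ A' := by
      rw [hA', Multiset.nodup_cons] at hnodup
      exact hnodup.1
    have huB : u ∉ B (g n) := by
      rw [← Multiset.count_pos, hB]; omega
    obtain ⟨h, hh⟩ : (A'.map fun u => Polynomial.X - Polynomial.C (mono u)).prod ∣
        MvPolynomial.aeval (ℓ n) P := by
      refine prod_dvd_of_pow_dvd (M := 1) (fun w => ?_) fun w hw => ?_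
      · rw [hA', Multiset.nodup_cons] at hnodup
        exact Multiset.nodup_iff_count_le_one.1 hnodup.2 w
      · refine hzero w (by rw [hA']; exact Multiset.mem_cons_of_mem hw) fun hwx => ?_
        have := point_injective hs hℓ n (hwx.trans hux.symm)
        subst this
        exact huA' hw
    have hgn := hAB (g n)
    rw [hA'] at hgn
    rw [pairing_eq (hg n hn) (hAB (g n)) hA' hh, ← resid_mul_prod hgn huA' huB]
    have := congrArg (Polynomial.eval (mono u)) hh
    rw [eval_aeval, Polynomial.eval_mul, Polynomial.eval_multiset_prod, Multiset.map_map] at this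
    change MvPolynomial.eval (point ℓ n u) P = _ at this
    rw [hux, hP1] at this
    simp only [Function.comp_def, Polynomial.eval_sub, Polynomial.eval_X, Polynomial.eval_C] at this
    linear_combination resid u (g n) * this
  · rw [pairing_eq_zero (hg n hn) (hAB (g n)), Finset.sum_eq_zero]
    · intro u hu
      exact absurd ⟨u, (Finset.mem_filter.1 hu).2⟩ hex
    · refine prod_dvd_of_pow_dvd (M := 1) (Multiset.nodup_iff_count_le_one.1 hnodup) fun u hu => ?_
      refine hzero u hu fun hux => hex ⟨u, ?_, hux⟩
      have h1 := hle n hn u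
      have h2 := Multiset.count_pos.2 hu
      rw [hA] at h2
      omega

end residue

end

end DeformedW

namespace DeformedW

noncomputable section

open scoped Classical
open IntLaurent

variable {ι R M N : Type*} [Fintype ι] [Field R] [CharZero R] [AddCommGroup M] [Module R M]
  [AddCommGroup N] [Module R N] {P : RootPairing ι R M N} [P.IsRootSystem] [P.IsCrystallographic]
  (b : P.Base)

/-! ### The Cartan datum of a base -/

lemma sqLength_eq (α : ι) : (sqLength P α : ℤ) = (P.posRootForm ℤ).rootLength α := by
  have h : (P.posRootForm ℤ).rootLength α =
      P.RootFormIn ℤ (P.rootSpanMem ℤ α) (P.rootSpanMem ℤ α) := by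
    rw [← P.posRootForm_eq ℤ]; rfl
  have := (P.posRootForm ℤ).rootLength_pos α
  rw [sqLength, ← h]
  omega

lemma sqLength_pos (α : ι) : 0 < sqLength P α := by
  have := (P.posRootForm ℤ).rootLength_pos α
  rw [← sqLength_eq] at this
  exact_mod_cast this

lemma iInf_sqLength_le (α : ι) : ⨅ α, sqLength P α ≤ sqLength P α := ciInf_le (OrderBot.bddBelow _) α

lemma iInf_sqLength_pos (α : ι) : 0 < ⨅ α, sqLength P α := by
  have : Nonempty ι := ⟨α⟩
  obtain ⟨β, hβ⟩ := exists_eq_ciInf_of_finite (f := fun α => sqLength P α)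
  rw [← hβ]
  exact sqLength_pos β

lemma symmetrizer_pos (i : b.support) : 0 < symmetrizer b i := by
  rw [symmetrizer]
  exact_mod_cast Nat.div_pos (iInf_sqLength_le _) (iInf_sqLength_pos (P := P) i)

lemma cartan_self (i : b.support) : cartan b i i = 2 := by
  simp [cartan]

lemma cartan_nonpos {i j : b.support} (h : i ≠ j) : cartan b i j ≤ 0 :=
  RootPairing.Base.cartanMatrix_le_zero_of_ne b j i h.symm

/-- The Cartan datum of a base of a root system. -/
def datum : CartanDatum b.support where
  len := symmetrizer b
  adj i j := ((if i = j then 2 else 0) - cartan b i j).toNat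
  len_pos := symmetrizer_pos b
  adj_self j := by rw [if_pos rfl, cartan_self]; rfl

lemma datum_adj (i j : b.support) :
    ((datum b).adj i j : ℤ) = (if i = j then 2 else 0) - cartan b i j := by
  simp only [datum]
  by_cases h : i = j
  · subst h; simp [cartan_self]
  · have := cartan_nonpos b h
    rw [if_neg h]
    omega

@[simp] lemma datum_len (i : b.support) : (datum b).len i = symmetrizer b i := rfl

lemma det_cartan_ne_zero : (cartan b).det ≠ 0 := by
  rw [cartan, Matrix.det_transpose]
  exact (RootPairing.Base.cartanMatrix_nondegenerate b).det_ne_zero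

/-- The deformed Cartan matrix over the integral Laurent polynomials. -/
def laurentCartan : Matrix b.support b.support IntLaurent := Matrix.of fun i j =>
  (if i = j then X (symmetrizer b i, -1) + X (-symmetrizer b i, 1) else 0) -
    qNat ((datum b).adj i j)

lemma qCartan_eq_mulVec (n : b.support → IntLaurent) :
    (datum b).qCartan n = (laurentCartan b).mulVec n := by
  funext j
  simp only [CartanDatum.qCartan, laurentCartan, Matrix.mulVec, dotProduct, Matrix.of_apply, sub_mul,
    Finset.sum_sub_distrib, datum_len, ite_mul, zero_mul, Finset.sum_ite_eq, Finset.mem_univ, if_true]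

lemma aug_qNat (n : ℕ) : aug (qNat n) = n := by simp [qNat]

lemma aug_laurentCartan (i j : b.support) : aug (laurentCartan b i j) = cartan b i j := by
  simp only [laurentCartan, Matrix.of_apply, map_sub, aug_qNat, datum_adj]
  split_ifs <;> simp

lemma qInt_eq_sum {x : QT} (hx : x ≠ 0) (hx2 : x - x⁻¹ ≠ 0) (n : ℕ) :
    qInt x n = ∑ l ∈ Finset.range n, x ^ ((n : ℤ) - 1 - 2 * l) := by
  rw [qInt, div_eq_iff hx2]
  have key : ∀ m : ℕ, (∑ l ∈ Finset.range m, x ^ ((n : ℤ) - 1 - 2 * l)) * (x - x⁻¹) =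
      x ^ (n : ℤ) - x ^ ((n : ℤ) - 2 * m) := by
    intro m
    induction m with
    | zero => simp
    | succ m ih =>
      have e1 : x ^ ((n : ℤ) - 1 - 2 * m) * x = x ^ ((n : ℤ) - 2 * m) := by
        rw [← zpow_add_one₀ hx]; congr 1; ring
      have e2 : x ^ ((n : ℤ) - 1 - 2 * m) * x⁻¹ = x ^ ((n : ℤ) - 2 * (m + 1 : ℕ)) := by
        rw [← zpow_sub_one₀ hx]; congr 1; push_cast; ring
      rw [Finset.sum_range_succ, add_mul, ih, mul_sub, e1, e2]; ring
  rw [key n]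
  congr 2
  ring

lemma q_zpow_sub_ne_zero {m : ℤ} (hm : m ≠ 0) : q ^ m - (q ^ m)⁻¹ ≠ 0 := by
  have h : q ^ m - (q ^ m)⁻¹ = mono (m, 0) - mono (-m, 0) := by simp [mono]
  rw [h]
  exact mono_sub_ne_zero fun e => by have := congrArg Prod.fst e; dsimp only at this; omega

lemma ev_laurentCartan {m : ℤ} (hm : m ≠ 0) (i j : b.support) :
    ev m (laurentCartan b i j) = defCartan b (q ^ m) (t ^ m) i j := by
  simp only [laurentCartan, defCartan, Matrix.of_apply, map_sub]
  congr 1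
  · split_ifs
    · simp [ev_X, mono, mul_zpow, ← zpow_mul, mul_comm]
    · simp
  · rw [← datum_adj, qInt_eq_sum (zpow_ne_zero _ q_ne_zero) (q_zpow_sub_ne_zero hm)]
    simp [qNat, ev_X, mono, ← zpow_mul, mul_comm]

/-- At `q = t = 1` this is the determinant of the Cartan matrix. -/
lemma det_laurentCartan_ne_zero : (laurentCartan b).det ≠ 0 := by
  intro h
  have := congrArg aug h
  rw [RingHom.map_det, map_zero] at this
  refine det_cartan_ne_zero b (Eq.trans ?_ this)
  congr 1
  ext i j
  exact (aug_laurentCartan b i j).symm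

lemma defCartan_eq_map {m : ℤ} (hm : m ≠ 0) :
    defCartan b (q ^ m) (t ^ m) = (ev m).mapMatrix (laurentCartan b) := by
  ext i j
  exact (ev_laurentCartan b hm i j).symm

lemma isUnit_det_defCartan {m : ℤ} (hm : m ≠ 0) :
    IsUnit (defCartan b (q ^ m) (t ^ m)).det := by
  rw [defCartan_eq_map b hm, ← RingHom.map_det]
  exact (ev_ne_zero hm (det_laurentCartan_ne_zero b)).isUnit

lemma qInt_inv (x : QT) (n : ℤ) : qInt x⁻¹ n = qInt x n := by
  rw [qInt, qInt, inv_zpow', inv_zpow', neg_neg, inv_inv, ← neg_sub, ← neg_sub x]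
  exact neg_div_neg_eq _ _

/-- This symmetry makes positive and negative modes of `y_i` expand with the same coefficients; the
same symmetry is behind the invariance of the coefficients under `ϑ`. -/
lemma defCartan_inv (x y : QT) : defCartan b x⁻¹ y⁻¹ = defCartan b x y := by
  ext i j
  simp only [defCartan, Matrix.of_apply, qInt_inv, inv_zpow', inv_inv, neg_neg]
  congr 1
  split_ifs
  · ring
  · rfl

lemma sum_ev_mul_laurentCartan {m : ℤ} (hm : m ≠ 0) (n : b.support → IntLaurent) (j : b.support) :
    ∑ k, defCartan b (q ^ m) (t ^ m) j k * ev m (n k) = ev m ((datum b).qCartan n j) := by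
  rw [qCartan_eq_mulVec]
  simp [Matrix.mulVec, dotProduct, ev_laurentCartan b hm]

end

end DeformedW

namespace DeformedW

noncomputable section

open scoped Classical
open IntLaurent

/-! ### Exponentials of operators -/

section expCoeff

variable {V : Type*} [AddCommGroup V] [Module QT V]

/-- The power series of operators in the definition of `expCoeff`. -/
def opSeries (x : ℕ → Module.End QT V) : PowerSeries (Module.End QT V) :=
  PowerSeries.mk fun m => if m = 0 then 0 else x m

lemma coeff_opSeries_pow_succ (x : ℕ → Module.End QT V) (k n : ℕ) (f : V) :
    PowerSeries.coeff n (opSeries x ^ (k + 1)) f = ∑ p ∈ Finset.HasAntidiagonal.antidiagonal n,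
      PowerSeries.coeff p.1 (opSeries x ^ k) (if p.2 = 0 then 0 else x p.2 f) := by
  rw [pow_succ, PowerSeries.coeff_mul, LinearMap.sum_apply]
  refine Finset.sum_congr rfl fun p _ => ?_
  rw [Module.End.mul_apply, opSeries, PowerSeries.coeff_mk]
  split_ifs <;> rfl

lemma expCoeff_apply (x : ℕ → Module.End QT V) (n : ℕ) (f : V) :
    expCoeff x n f = ∑ k ∈ Finset.range (n + 1),
      ((k.factorial : QT)⁻¹) • PowerSeries.coeff n (opSeries x ^ k) f := by
  simp [expCoeff, opSeries]

/-- An exponential of operators on a family of vectors that they map to multiples of each other. -/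
lemma expCoeff_family {x : ℕ → Module.End QT V} {H : ℕ → V} {d : ℕ → QT}
    (hx : ∀ m, m ≠ 0 → ∀ n, x m (H n) = if m ≤ n then d m • H (n - m) else 0) (p n : ℕ) :
    expCoeff x p (H n) = if p ≤ n then
      PowerSeries.coeff p (pexp QT (PowerSeries.mk fun m => if m = 0 then 0 else d m)) • H (n - p)
      else 0 := by
  have key : ∀ (k p n : ℕ), PowerSeries.coeff p (opSeries x ^ k) (H n) = if p ≤ n then
      PowerSeries.coeff p ((PowerSeries.mk fun m => if m = 0 then 0 else d m) ^ k) • H (n - p)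
      else 0 := by
    intro k
    induction k with
    | zero =>
      intro p n
      rw [pow_zero, pow_zero, PowerSeries.coeff_one, PowerSeries.coeff_one]
      rcases Nat.eq_zero_or_pos p with rfl | hp
      · simp
      · simp [hp.ne']
    | succ k ih =>
      intro p n
      rw [coeff_opSeries_pow_succ]
      have : ∀ a ∈ Finset.HasAntidiagonal.antidiagonal p, PowerSeries.coeff a.1 (opSeries x ^ k)
          (if a.2 = 0 then 0 else x a.2 (H n)) = if p ≤ n then
            (PowerSeries.coeff a.1 ((PowerSeries.mk fun m => if m = 0 then 0 else d m) ^ k) *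
            (if a.2 = 0 then 0 else d a.2)) • H (n - p) else 0 := by
        intro a ha
        have ha := Finset.HasAntidiagonal.mem_antidiagonal.1 ha
        by_cases h0 : a.2 = 0
        · simp [h0]
        · rw [if_neg h0, hx _ h0, if_neg h0]
          by_cases h1 : a.2 ≤ n
          · rw [if_pos h1, map_smul, ih]
            by_cases h2 : p ≤ n
            · rw [if_pos (by omega), if_pos h2, smul_smul, mul_comm, Nat.sub_sub, add_comm a.2, ha]
            · rw [if_neg (by omega), if_neg h2, smul_zero]
          · rw [if_neg h1, map_zero, if_neg (by omega)]
      rw [Finset.sum_congr rfl this]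
      split_ifs
      · rw [← Finset.sum_smul, pow_succ, PowerSeries.coeff_mul]
        congr 1
        refine Finset.sum_congr rfl fun a _ => ?_
        rw [PowerSeries.coeff_mk]
      · exact Finset.sum_const_zero
  rw [expCoeff_apply]
  simp only [key]
  split_ifs
  · rw [pexp, PowerSeries.coeff_mk, Finset.sum_smul]
    simp only [smul_smul, smul_eq_mul]
  · simp

/-- Intertwining of exponentials by an additive map that is compatible with rational scalars. -/
lemma expCoeff_intertwine {W : Type*} [AddCommGroup W] [Module QT W] (φ : V →+ W)
    (hφ : ∀ (k : ℕ) (f : V), φ ((k : QT)⁻¹ • f) = (k : QT)⁻¹ • φ f) {x : ℕ → Module.End QT V}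
    {y : ℕ → Module.End QT W} (c : QT) (hxy : ∀ m, m ≠ 0 → ∀ f, φ (x m f) = c ^ m • y m (φ f))
    (n : ℕ) (f : V) : φ (expCoeff x n f) = c ^ n • expCoeff y n (φ f) := by
  have key : ∀ (k n : ℕ) (f : V), φ (PowerSeries.coeff n (opSeries x ^ k) f) =
      c ^ n • PowerSeries.coeff n (opSeries y ^ k) (φ f) := by
    intro k
    induction k with
    | zero =>
      intro n f
      rw [pow_zero, pow_zero, PowerSeries.coeff_one, PowerSeries.coeff_one]
      rcases Nat.eq_zero_or_pos n with rfl | hn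
      · simp
      · simp [hn.ne']
    | succ k ih =>
      intro n f
      rw [coeff_opSeries_pow_succ, coeff_opSeries_pow_succ, map_sum, Finset.smul_sum]
      refine Finset.sum_congr rfl fun a ha => ?_
      have ha := Finset.HasAntidiagonal.mem_antidiagonal.1 ha
      rw [ih]
      split_ifs with h
      · simp
      · rw [hxy _ h, map_smul, smul_smul, ← pow_add, ha]
  rw [expCoeff_apply, expCoeff_apply, map_sum, Finset.smul_sum]
  refine Finset.sum_congr rfl fun k _ => ?_
  rw [hφ, key, smul_comm]

lemma expCoeff_zero_of_forall {x : ℕ → Module.End QT V} {f : V} (hx : ∀ m, m ≠ 0 → x m f = 0)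
    (n : ℕ) : expCoeff x n f = if n = 0 then f else 0 := by
  rw [expCoeff_apply, Finset.sum_range_succ', Finset.sum_eq_zero]
  · rw [pow_zero, PowerSeries.coeff_one]
    split_ifs <;> simp
  · intro k _
    rw [coeff_opSeries_pow_succ, Finset.sum_eq_zero, smul_zero]
    intro a _
    split_ifs with h
    · simp
    · rw [hx _ h, map_zero]

end expCoeff

lemma expCoeff_mulLeft {F : Type*} [CommRing F] [Algebra QT F] {x : ℕ → Module.End QT F}
    {L : PowerSeries F} (hL : PowerSeries.constantCoeff L = 0)
    (hx : ∀ m, m ≠ 0 → x m = LinearMap.mulLeft QT (PowerSeries.coeff m L)) (n : ℕ) (f : F) :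
    expCoeff x n f = PowerSeries.coeff n (pexp QT L) * f := by
  have hop : opSeries x = PowerSeries.map (Algebra.lmul QT F).toRingHom L := by
    ext m : 1
    rw [opSeries, PowerSeries.coeff_mk, PowerSeries.coeff_map]
    split_ifs with h
    · subst h
      rw [PowerSeries.coeff_zero_eq_constantCoeff_apply, hL, map_zero]
    · rw [hx m h]; rfl
  rw [expCoeff_apply, hop, pexp, PowerSeries.coeff_mk, Finset.sum_mul]
  refine Finset.sum_congr rfl fun k _ => ?_
  rw [← map_pow, PowerSeries.coeff_map, smul_mul_assoc]
  rfl

/-- The derivation of power series obtained by applying a derivation to the coefficients. -/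
def mapDerivation {K F : Type*} [Field K] [CommRing F] [Algebra K F] (δ : Derivation K F F) :
    Derivation K (PowerSeries F) (PowerSeries F) :=
  Derivation.mk'
    { toFun := fun f => PowerSeries.mk fun n => δ (PowerSeries.coeff n f)
      map_add' := fun f g => by ext n; simp
      map_smul' := fun c f => by ext n; simp }
    fun f g => by
      ext n
      simp only [LinearMap.coe_mk, AddHom.coe_mk, PowerSeries.coeff_mk, map_add, smul_eq_mul,
        PowerSeries.coeff_mul, map_sum, Derivation.leibniz, Finset.sum_add_distrib]
      congr 1
      rw [← Finset.Nat.sum_antidiagonal_swap]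
      rfl

lemma coeff_mapDerivation {K F : Type*} [Field K] [CommRing F] [Algebra K F] (δ : Derivation K F F)
    (f : PowerSeries F) (n : ℕ) :
    PowerSeries.coeff n (mapDerivation δ f) = δ (PowerSeries.coeff n f) := by
  change PowerSeries.coeff n (PowerSeries.mk fun n => δ (PowerSeries.coeff n f)) = _
  rw [PowerSeries.coeff_mk]

lemma mapDerivation_pexp {K F : Type*} [Field K] [CharZero K] [CommRing F] [Algebra K F]
    (δ : Derivation K F F) {L : PowerSeries F} (hL : PowerSeries.constantCoeff L = 0) :
    mapDerivation δ (pexp K L) = pexp K L * mapDerivation δ L := by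
  refine derivation_pexp _ (fun _ => δ.toLinearMap) (fun g n => coeff_mapDerivation δ g n) hL ?_
  rw [← PowerSeries.coeff_zero_eq_constantCoeff_apply, coeff_mapDerivation,
    PowerSeries.coeff_zero_eq_constantCoeff_apply, hL, map_zero]

variable {ι R M N : Type*} [Fintype ι] [Field R] [CharZero R] [AddCommGroup M] [Module R M]
  [AddCommGroup N] [Module R N] {P : RootPairing ι R M N} [P.IsRootSystem] [P.IsCrystallographic]
  (b : P.Base)

/-! ### Vertex operators on the vacuum -/

/-- The creation part `∑_{m ≥ 1} ∑_k x_{k,m} a_k[-m] z ^ m` of a vertex operator. -/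
def creation (x : b.support → ℕ → QT) : PowerSeries (Fock b) :=
  PowerSeries.mk fun m => if m = 0 then 0 else ∑ k, x k m • MvPolynomial.X (k, m - 1)

lemma constantCoeff_creation (x : b.support → ℕ → QT) :
    PowerSeries.constantCoeff (creation b x) = 0 := by
  rw [← PowerSeries.coeff_zero_eq_constantCoeff_apply, creation, PowerSeries.coeff_mk, if_pos rfl]

/-- The operators of the positive half of a vertex operator. -/
def annih (ξ : b.support → ℤ → QT) (m : ℕ) : Module.End QT (Fock b) := ∑ i, ξ i m • osc b i m

/-- The operators of the negative half of a vertex operator. -/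
def creat (ξ : b.support → ℤ → QT) (m : ℕ) : Module.End QT (Fock b) :=
  ∑ i, ξ i (-m) • osc b i (-m)

lemma normalExp_eq (ξ : b.support → ℤ → QT) (n : ℤ) (f : Fock b) :
    normalExp b ξ n f = ∑ᶠ p : {p : ℕ × ℕ // (p.2 : ℤ) - p.1 = n},
      expCoeff (creat b ξ) p.1.1 (expCoeff (annih b ξ) p.1.2 f) := rfl

lemma osc_succ (i : b.support) (n : ℕ) : osc b i ((n + 1 : ℕ) : ℤ) =
    ∑ j, heis b (n + 1) i j • (MvPolynomial.pderiv (j, n)).toLinearMap := rfl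

lemma osc_neg_succ (i : b.support) (n : ℕ) : osc b i (-((n + 1 : ℕ) : ℤ)) =
    LinearMap.mulLeft QT (MvPolynomial.X (i, n)) := rfl

lemma creat_eq (ξ : b.support → ℤ → QT) (m : ℕ) (hm : m ≠ 0) : creat b ξ m =
    LinearMap.mulLeft QT (PowerSeries.coeff m (creation b fun k m => ξ k (-m))) := by
  obtain ⟨m, rfl⟩ : ∃ n, m = n + 1 := ⟨m - 1, by omega⟩
  rw [creat, creation, PowerSeries.coeff_mk, if_neg hm]
  apply LinearMap.ext
  intro f
  simp only [osc_neg_succ, LinearMap.sum_apply, LinearMap.smul_apply, LinearMap.mulLeft_apply,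
    Finset.sum_mul, smul_mul_assoc, Nat.add_sub_cancel]

lemma expCoeff_creat (ξ : b.support → ℤ → QT) (n : ℕ) (f : Fock b) :
    expCoeff (creat b ξ) n f =
      PowerSeries.coeff n (pexp QT (creation b fun k m => ξ k (-m))) * f :=
  expCoeff_mulLeft (constantCoeff_creation b _) (creat_eq b ξ) n f

lemma annih_apply_one (ξ : b.support → ℤ → QT) (m : ℕ) (hm : m ≠ 0) : annih b ξ m 1 = 0 := by
  obtain ⟨m, rfl⟩ : ∃ n, m = n + 1 := ⟨m - 1, by omega⟩
  simp only [annih, osc_succ, LinearMap.sum_apply, LinearMap.smul_apply]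
  refine Finset.sum_eq_zero fun i _ => ?_
  rw [Finset.sum_eq_zero, smul_zero]
  intro j _
  change _ • MvPolynomial.pderiv (j, m) 1 = 0
  rw [Derivation.map_one_eq_zero, smul_zero]

lemma pderiv_creation (x : b.support → ℕ → QT) (k : b.support) (m : ℕ) :
    mapDerivation (K := QT) (MvPolynomial.pderiv (k, m)) (creation b x) =
      PowerSeries.C (algebraMap QT (Fock b) (x k (m + 1))) * PowerSeries.X ^ (m + 1) := by
  ext n : 1
  rw [coeff_mapDerivation, PowerSeries.coeff_C_mul, PowerSeries.coeff_X_pow, creation,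
    PowerSeries.coeff_mk]
  split_ifs with h1 h2 h2
  · omega
  · simp
  · subst h2
    rw [map_sum, Finset.sum_eq_single k]
    · simp [Algebra.smul_def]
    · intro l _ hl
      rw [Derivation.map_smul, MvPolynomial.pderiv_X_of_ne (by simp [hl]), smul_zero]
    · simp
  · rw [map_sum, mul_zero]
    refine Finset.sum_eq_zero fun l _ => ?_
    rw [Derivation.map_smul, MvPolynomial.pderiv_X_of_ne, smul_zero]
    intro he
    have := congrArg Prod.snd he
    dsimp only at this
    omega

lemma pderiv_coeff_pexp (x : b.support → ℕ → QT) (k : b.support) (m n : ℕ) :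
    MvPolynomial.pderiv (k, m) (PowerSeries.coeff n (pexp QT (creation b x))) =
      if m + 1 ≤ n then x k (m + 1) • PowerSeries.coeff (n - (m + 1)) (pexp QT (creation b x))
      else 0 := by
  rw [← coeff_mapDerivation, mapDerivation_pexp _ (constantCoeff_creation b x), pderiv_creation,
    mul_left_comm, PowerSeries.coeff_C_mul, PowerSeries.coeff_mul_X_pow']
  split_ifs
  · rw [Algebra.smul_def]
  · rw [mul_zero]

/-- The exponential of a linear form is a common eigenvector of all derivations: `a_i[m]`, `m > 0`,
multiplies the generating series by a scalar times `z ^ m`. -/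
lemma annih_coeff_pexp (ξ : b.support → ℤ → QT) (x : b.support → ℕ → QT) (m : ℕ) (hm : m ≠ 0)
    (n : ℕ) : annih b ξ m (PowerSeries.coeff n (pexp QT (creation b x))) =
      if m ≤ n then (∑ i, ξ i m * ∑ k, heis b m i k * x k m) •
        PowerSeries.coeff (n - m) (pexp QT (creation b x)) else 0 := by
  obtain ⟨m, rfl⟩ : ∃ n, m = n + 1 := ⟨m - 1, by omega⟩
  simp only [annih, osc_succ, LinearMap.sum_apply, LinearMap.smul_apply]
  have : ∀ j : b.support, (MvPolynomial.pderiv (R := QT) (j, m)).toLinearMap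
      (PowerSeries.coeff n (pexp QT (creation b x))) = if m + 1 ≤ n then
        x j (m + 1) • PowerSeries.coeff (n - (m + 1)) (pexp QT (creation b x)) else 0 :=
    fun j => pderiv_coeff_pexp b x j m n
  simp only [this]
  split_ifs
  · simp only [Finset.sum_smul, smul_smul, Finset.smul_sum, Finset.mul_sum]
  · simp

lemma normalExp_zero (ξ : b.support → ℤ → QT) (n : ℤ) : normalExp b ξ n 0 = 0 := by
  simp [normalExp]

/-- With mode `1` this says that screening operators kill the vacuum, which turns commutation into
annihilation. -/
lemma normalExp_one_of_pos (ξ : b.support → ℤ → QT) {n : ℤ} (hn : 0 < n) :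
    normalExp b ξ n 1 = 0 := by
  rw [normalExp_eq]
  refine finsum_eq_zero_of_forall_eq_zero fun p => ?_
  rw [expCoeff_zero_of_forall (annih_apply_one b ξ), if_neg, map_zero]
  have := p.2
  omega

lemma normalExp_one_neg (ξ : b.support → ℤ → QT) (n : ℕ) : normalExp b ξ (-n) 1 =
    PowerSeries.coeff n (pexp QT (creation b fun k m => ξ k (-m))) := by
  rw [normalExp_eq, finsum_eq_single _ ⟨(n, 0), by simp⟩]
  · rw [expCoeff_zero_of_forall (annih_apply_one b ξ), if_pos rfl, expCoeff_creat, mul_one]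
  · intro p hp
    rw [expCoeff_zero_of_forall (annih_apply_one b ξ), if_neg, map_zero]
    intro h
    apply hp
    have := p.2
    ext
    · dsimp only; omega
    · exact h

lemma finsum_subtype_one {F : Type*} [AddCommMonoid F] (f : ℕ × ℕ → F) :
    ∑ᶠ p : {p : ℕ × ℕ // (p.2 : ℤ) - p.1 = 1}, f p.1 = ∑ᶠ l : ℕ, f (l, l + 1) := by
  let e : ℕ ≃ {p : ℕ × ℕ // (p.2 : ℤ) - p.1 = 1} :=
    { toFun := fun l => ⟨(l, l + 1), by push_cast; ring⟩
      invFun := fun p => p.1.1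
      left_inv := fun l => rfl
      right_inv := fun p => by
        have := p.2
        ext
        · rfl
        · dsimp only; omega }
  exact (finsum_comp_equiv e (f := fun p : {p : ℕ × ℕ // (p.2 : ℤ) - p.1 = 1} => f p.1)).symm

/-- The action of the coefficient of `z⁻¹` of a vertex operator on vectors `coeff n (exp L_v)`. -/
lemma normalExp_sum {V : Type*} (S : Finset V) (c : V → QT) (x : V → b.support → ℕ → QT)
    (ξ : b.support → ℤ → QT) (n : ℕ) :
    normalExp b ξ 1 (∑ v ∈ S, c v • PowerSeries.coeff n (pexp QT (creation b (x v)))) =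
      ∑ v ∈ S, c v • ∑ l ∈ Finset.range n,
        PowerSeries.coeff (l + 1) (pexp QT (PowerSeries.mk fun m => if m = 0 then 0 else
          ∑ i, ξ i m * ∑ k, heis b m i k * x v k m)) •
        (PowerSeries.coeff l (pexp QT (creation b fun k m => ξ k (-m))) *
          PowerSeries.coeff (n - (l + 1)) (pexp QT (creation b (x v)))) := by
  rw [normalExp_eq, finsum_subtype_one (fun p => expCoeff (creat b ξ) p.1
    (expCoeff (annih b ξ) p.2 _))]
  have hterm : ∀ l : ℕ, expCoeff (creat b ξ) l (expCoeff (annih b ξ) (l + 1)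
      (∑ v ∈ S, c v • PowerSeries.coeff n (pexp QT (creation b (x v))))) =
      ∑ v ∈ S, c v • if l + 1 ≤ n then
        PowerSeries.coeff (l + 1) (pexp QT (PowerSeries.mk fun m => if m = 0 then 0 else
          ∑ i, ξ i m * ∑ k, heis b m i k * x v k m)) •
        (PowerSeries.coeff l (pexp QT (creation b fun k m => ξ k (-m))) *
          PowerSeries.coeff (n - (l + 1)) (pexp QT (creation b (x v)))) else 0 := by
    intro l
    rw [map_sum, map_sum]
    refine Finset.sum_congr rfl fun v _ => ?_
    rw [map_smul, map_smul, expCoeff_family (H := fun n => PowerSeries.coeff n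
      (pexp QT (creation b (x v)))) (fun m hm n => annih_coeff_pexp b ξ (x v) m hm n)]
    split_ifs
    · rw [map_smul, expCoeff_creat]
    · rw [map_zero]
  simp only [hterm]
  rw [finsum_eq_sum_of_support_subset (s := Finset.range n)]
  · rw [Finset.sum_comm]
    refine Finset.sum_congr rfl fun v _ => ?_
    rw [Finset.smul_sum]
    refine Finset.sum_congr rfl fun l hl => ?_
    rw [if_pos (show l + 1 ≤ n from Finset.mem_range.1 hl)]
  · intro l hl
    rw [Function.mem_support] at hl
    by_contra hn
    apply hl
    refine Finset.sum_eq_zero fun v _ => ?_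
    rw [if_neg (by simpa using hn), smul_zero]

/-! ### From the Fock space to pairings -/

/-- The coefficients of `(∑_l φ_l h_l z ^ l) H(z)`. -/
def weighted (φ : ℕ → QT) (h H : PowerSeries (Fock b)) : PowerSeries (Fock b) :=
  PowerSeries.mk (fun l => φ l • PowerSeries.coeff l h) * H

lemma weighted_add (φ φ' : ℕ → QT) (h H : PowerSeries (Fock b)) :
    weighted b (φ + φ') h H = weighted b φ h H + weighted b φ' h H := by
  rw [weighted, weighted, weighted, ← add_mul]
  congr 1
  ext n : 1
  simp [add_smul]

lemma weighted_smul (c : QT) (φ : ℕ → QT) (h H : PowerSeries (Fock b)) :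
    weighted b (c • φ) h H = c • weighted b φ h H := by
  rw [weighted, weighted, ← smul_mul_assoc]
  congr 1
  ext n : 1
  simp [mul_smul]

lemma shift_pow_apply (m : ℕ) (φ : ℕ → QT) (l : ℕ) : (shift ^ m) φ l = φ (l + m) := by
  induction m generalizing l with
  | zero => rfl
  | succ m ih => rw [pow_succ', Module.End.mul_apply, shift_apply, ih]; congr 1; ring

/-- The current `exp (∑_m s_m a_j[-m] z ^ m)`. -/
def singleCreation (j : b.support) (s : ℕ → QT) : b.support → ℕ → QT :=
  fun k m => if k = j then s m else 0

/-- The linear polynomials describing how a derivative acts on `weighted`. -/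
def linPoly (j : b.support) (s : ℕ → QT) (x : b.support → ℕ → QT) (a : b.support × ℕ) :
    Polynomial QT :=
  Polynomial.C (x a.1 (a.2 + 1)) +
    Polynomial.C (singleCreation b j s a.1 (a.2 + 1)) * Polynomial.X ^ (a.2 + 1)

/-- The derivation hits either `H`, giving the constant part of the linear polynomial, or the
screening current, where the power `z ^ (m + 1)` that comes out shifts the weights `φ` by `m + 1`.
-/
lemma pderiv_weighted (j : b.support) (s : ℕ → QT) (x : b.support → ℕ → QT) (φ : ℕ → QT)
    (a : b.support × ℕ) (n : ℕ) :
    MvPolynomial.pderiv a (PowerSeries.coeff (n + (a.2 + 1))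
      (weighted b φ (pexp QT (creation b (singleCreation b j s))) (pexp QT (creation b x)))) =
    PowerSeries.coeff n (weighted b (Polynomial.aeval shift (linPoly b j s x a) φ)
      (pexp QT (creation b (singleCreation b j s))) (pexp QT (creation b x))) := by
  obtain ⟨k, m⟩ := a
  have h1 : mapDerivation (K := QT) (MvPolynomial.pderiv (k, m)) (PowerSeries.mk fun l => φ l •
      PowerSeries.coeff l (pexp QT (creation b (singleCreation b j s)))) =
      (singleCreation b j s k (m + 1)) • (PowerSeries.mk (fun l => ((shift ^ (m + 1)) φ) l •
        PowerSeries.coeff l (pexp QT (creation b (singleCreation b j s))))) *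
        PowerSeries.X ^ (m + 1) := by
    ext n : 1
    rw [coeff_mapDerivation, PowerSeries.coeff_mk, Derivation.map_smul, pderiv_coeff_pexp,
      PowerSeries.coeff_mul_X_pow']
    split_ifs with h
    · rw [PowerSeries.coeff_smul, PowerSeries.coeff_mk, shift_pow_apply, Nat.sub_add_cancel h,
        smul_comm]
    · rw [smul_zero]
  rw [← coeff_mapDerivation]
  have h2 : mapDerivation (K := QT) (MvPolynomial.pderiv (k, m)) (weighted b φ
      (pexp QT (creation b (singleCreation b j s))) (pexp QT (creation b x))) =
      weighted b (Polynomial.aeval shift (linPoly b j s x (k, m)) φ)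
      (pexp QT (creation b (singleCreation b j s))) (pexp QT (creation b x)) *
        PowerSeries.X ^ (m + 1) := by
    rw [weighted, Derivation.leibniz, h1, mapDerivation_pexp _ (constantCoeff_creation b x),
      pderiv_creation, linPoly, map_add, map_mul, map_pow, Polynomial.aeval_X, Polynomial.aeval_C,
      Polynomial.aeval_C, LinearMap.add_apply, Module.End.mul_apply, Module.algebraMap_end_apply,
      Module.algebraMap_end_apply, weighted_add, weighted_smul, weighted_smul, weighted, weighted]
    simp only [smul_eq_mul, Algebra.smul_def]
    simp only [PowerSeries.algebraMap_apply]
    ring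
  rw [h2, PowerSeries.coeff_mul_X_pow]

/-- Applying the constant coefficient differential operator `p(∂)` to the relation replaces each `φ
v` by a polynomial in the shift applied to `φ v`. The coefficient of `z ^ 0` of the outcome is the
scalar pairing. -/
theorem sum_pairing_eq_zero {V : Type*} {S : Finset V} {c : V → QT} {φ : V → ℕ → QT}
    {x : V → b.support → ℕ → QT} {j : b.support} {s : ℕ → QT}
    (h : ∀ n, ∑ v ∈ S, c v • PowerSeries.coeff n (weighted b (φ v)
      (pexp QT (creation b (singleCreation b j s))) (pexp QT (creation b (x v)))) = 0)
    (p : MvPolynomial (b.support × ℕ) QT) :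
    ∑ v ∈ S, c v * pairing (φ v) (MvPolynomial.aeval (linPoly b j s (x v)) p) = 0 := by
  have main : ∀ n, ∑ v ∈ S, c v • PowerSeries.coeff n (weighted b
      (Polynomial.aeval shift (MvPolynomial.aeval (linPoly b j s (x v)) p) (φ v))
      (pexp QT (creation b (singleCreation b j s))) (pexp QT (creation b (x v)))) = 0 := by
    induction p using MvPolynomial.induction_on with
    | C a =>
      intro n
      simp only [MvPolynomial.algHom_C, Polynomial.algebraMap_eq, Polynomial.aeval_C,
        Module.algebraMap_end_apply, weighted_smul, PowerSeries.coeff_smul]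
      simp only [smul_comm _ a]
      rw [← Finset.smul_sum, h, smul_zero]
    | add p p' hp hp' =>
      intro n
      simp only [map_add, LinearMap.add_apply, weighted_add, smul_add, Finset.sum_add_distrib]
      rw [hp, hp', add_zero]
    | mul_X p a hp =>
      intro n
      have := congrArg (MvPolynomial.pderiv a) (hp (n + (a.2 + 1)))
      rw [map_zero, map_sum] at this
      rw [← this]
      refine Finset.sum_congr rfl fun v _ => ?_
      rw [Derivation.map_smul, pderiv_weighted, map_mul, MvPolynomial.aeval_X, mul_comm, map_mul,
        Module.End.mul_apply]
  have h0 := main 0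
  have : ∀ v, PowerSeries.coeff 0 (weighted b
      (Polynomial.aeval shift (MvPolynomial.aeval (linPoly b j s (x v)) p) (φ v))
      (pexp QT (creation b (singleCreation b j s))) (pexp QT (creation b (x v)))) =
      algebraMap QT (Fock b) (pairing (φ v) (MvPolynomial.aeval (linPoly b j s (x v)) p)) := by
    intro v
    rw [weighted, PowerSeries.coeff_zero_eq_constantCoeff_apply, map_mul, constantCoeff_pexp, mul_one,
      ← PowerSeries.coeff_zero_eq_constantCoeff_apply, PowerSeries.coeff_mk,
      PowerSeries.coeff_zero_eq_constantCoeff_apply, constantCoeff_pexp, Algebra.smul_def, mul_one]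
    rfl
  simp only [this, Algebra.smul_def, ← map_mul] at h0
  rw [← map_sum] at h0
  exact (algebraMap QT (Fock b)).injective (h0.trans (map_zero _).symm)

/-- A combination of vertex operators whose value at the vacuum is killed by a screening operator. -/
theorem sum_pairing_eq_zero_of_screen {V : Type*} {S : Finset V} {c : V → QT}
    {x : V → b.support → ℕ → QT} {j : b.support} {ξ : ℤ → QT}
    (h : ∀ n : ℕ, normalExp b (fun k m => if k = j then ξ m else 0) 1
      (∑ v ∈ S, c v • PowerSeries.coeff n (pexp QT (creation b (x v)))) = 0)
    (p : MvPolynomial (b.support × ℕ) QT) :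
    ∑ v ∈ S, c v * pairing (tail (pexp QT (PowerSeries.mk fun m => if m = 0 then 0 else
      ξ m * ∑ k, heis b m j k * x v k m)) 1)
      (MvPolynomial.aeval (linPoly b j (fun m => ξ (-m)) (x v)) p) = 0 := by
  refine sum_pairing_eq_zero b (fun n => ?_) p
  have := h (n + 1)
  rw [normalExp_sum] at this
  rw [← this]
  refine Finset.sum_congr rfl fun v _ => ?_
  rw [weighted, PowerSeries.coeff_mul, Finset.Nat.sum_antidiagonal_eq_sum_range_succ_mk]
  congr 1
  refine Finset.sum_congr rfl fun l hl => ?_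
  rw [PowerSeries.coeff_mk, tail, smul_mul_assoc, Nat.add_sub_add_right]
  congr 4
  ext m
  simp

end

end DeformedW

namespace DeformedW

noncomputable section

open scoped Classical
open IntLaurent

variable {ι R M N : Type*} [Fintype ι] [Field R] [CharZero R] [AddCommGroup M] [Module R M]
  [AddCommGroup N] [Module R N] {P : RootPairing ι R M N} [P.IsRootSystem] [P.IsCrystallographic]
  (b : P.Base)

/-! ### The terms of a generator -/

/-- A configuration records the factors `A_k(z u)⁻¹` of a monomial, with multiplicities. -/
abbrev Config : Type _ := b.support → IntLaurent

/-- The exponents of the prefactor of the monomial of a configuration. -/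
def charge (i : b.support) (n : Config b) : ℤ × ℤ :=
  (-rhoWeight b i + 2 * ∑ k, symmetrizer b k * aug (n k), rhoCoweight b i - 2 * ∑ k, aug (n k))

/-- The data of the monomial `:Y_i(z) ∏ A_k(z u)⁻¹:` of a configuration. -/
def vtx (i : b.support) (n : Config b) : Vertex b :=
  (charge b i n, fun j => aug ((datum b).weight i n j),
    fun j m => (defCartan b (q ^ m) (t ^ m))⁻¹ j i - ev (-m) (n j))

/-- A linear combination of monomials. -/
def fieldOf (i : b.support) (c : Config b →₀ QT) : QField b :=
  c.sum fun n x => x • (vtx b i n).toField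

/-- The configuration of a list of factors. -/
def configOf (L : List (b.support × (ℤ × ℤ))) : Config b :=
  (L.map fun p => Pi.single (M := fun _ => IntLaurent) p.1 (X p.2)).sum

lemma aug_weight (i : b.support) (n : Config b) (j : b.support) :
    aug ((datum b).weight i n j) = (if j = i then 1 else 0) - ∑ k, cartan b j k * aug (n k) := by
  rw [CartanDatum.weight, map_sub, qCartan_eq_mulVec]
  congr 1
  · by_cases h : j = i
    · subst h; simp
    · simp [h]
  · simp [Matrix.mulVec, dotProduct, aug_laurentCartan]

lemma vtx_configOf (i : b.support) (L : List (b.support × (ℤ × ℤ))) :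
    Y b i 0 - (L.map fun p => A b p.1 p.2).sum = vtx b i (configOf b L) := by
  induction L with
  | nil =>
    simp only [List.map_nil, List.sum_nil, sub_zero, configOf]
    refine Prod.ext ?_ (Prod.ext ?_ ?_)
    · simp [Y, vtx, charge]
    · funext j
      simp [Y, vtx, aug_weight, Pi.single_apply]
    · funext j m
      simp [Y, vtx, mono_zero]
  | cons p L ih =>
    rw [List.map_cons, List.sum_cons, add_comm, ← sub_sub, ih]
    have hc : configOf b (p :: L) =
        configOf b L + Pi.single (M := fun _ => IntLaurent) p.1 (X p.2) := by
      rw [configOf, List.map_cons, List.sum_cons, add_comm, configOf]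
    have ha : ∀ k, aug (Pi.single (M := fun _ => IntLaurent) p.1 (X p.2) k) =
        if k = p.1 then 1 else 0 := by
      intro k
      by_cases h : k = p.1
      · subst h; simp
      · simp [h]
    rw [hc]
    refine Prod.ext ?_ (Prod.ext ?_ ?_)
    · simp only [vtx, charge, Prod.fst_sub, A, Pi.add_apply, map_add, mul_add,
        Finset.sum_add_distrib, ha]
      refine Prod.ext ?_ ?_
      · simp; ring
      · simp; ring
    · funext j
      simp only [vtx, Prod.snd_sub, Prod.fst_sub, Pi.sub_apply, A, aug_weight, Pi.add_apply,
        map_add, mul_add, Finset.sum_add_distrib, ha]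
      simp
      ring
    · funext j m
      simp only [vtx, Prod.snd_sub, Pi.sub_apply, A, Pi.add_apply, map_add]
      by_cases h : j = p.1
      · subst h
        simp [ev_X]
        ring
      · simp [h]

/-- The configurations of lists have nonnegative coefficients. -/
lemma coeff_configOf_nonneg (L : List (b.support × (ℤ × ℤ))) (j : b.support) (u : ℤ × ℤ) :
    0 ≤ (configOf b L j).coeff u := by
  induction L with
  | nil => simp [configOf]
  | cons p L ih =>
    rw [configOf, List.map_cons, List.sum_cons, Pi.add_apply, AddMonoidAlgebra.coeff_add,
      Finsupp.add_apply]
    refine add_nonneg ?_ ih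
    by_cases h : j = p.1
    · subst h
      rw [Pi.single_eq_same, coeff_X]
      split_ifs <;> norm_num
    · simp [h]

/-- Nonnegativity rules out cancellation, so no further term contributes to the coefficient `1` of
`Y_i`. -/
lemma configOf_ne_zero {L : List (b.support × (ℤ × ℤ))} (hL : L ≠ []) : configOf b L ≠ 0 := by
  obtain ⟨p, L, rfl⟩ := List.exists_cons_of_ne_nil hL
  intro h
  have h1 := congrArg (fun p' : IntLaurent => p'.coeff p.2) (congrFun h p.1)
  have h2 := coeff_configOf_nonneg b L p.1 p.2
  rw [configOf] at h1 h2
  simp only [List.map_cons, List.sum_cons, Pi.add_apply, Pi.single_eq_same,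
    AddMonoidAlgebra.coeff_add, Finsupp.add_apply, coeff_X_self, Pi.zero_apply,
    AddMonoidAlgebra.coeff_zero, Finsupp.zero_apply] at h1
  omega

/-- The terms of a generator. -/
lemma IsGenerator.exists_fieldOf {i : b.support} {T : QField b} (hT : IsGenerator b i T) :
    ∃ c : Config b →₀ QT, T = fieldOf b i c ∧ c 0 = 1 ∧
      ∀ n ∈ c.support, ∀ j u, 0 ≤ (n j).coeff u := by
  obtain ⟨-, K, c, L, hL, rfl⟩ := hT
  have hadd : ∀ c c' : Config b →₀ QT, fieldOf b i (c + c') = fieldOf b i c + fieldOf b i c' :=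
    fun c c' => Finsupp.sum_add_index' (fun _ => zero_smul _ _) fun _ _ _ => add_smul _ _ _
  have hsingle : ∀ n x, fieldOf b i (Finsupp.single n x) = x • (vtx b i n).toField :=
    fun n x => Finsupp.sum_single_index (zero_smul _ _)
  refine ⟨Finsupp.single 0 1 + ∑ k, Finsupp.single (configOf b (L k)) (c k), ?_, ?_, ?_⟩
  · have hsum : fieldOf b i (∑ k, Finsupp.single (configOf b (L k)) (c k)) =
        ∑ k, fieldOf b i (Finsupp.single (configOf b (L k)) (c k)) :=
      map_sum (⟨⟨fieldOf b i, Finsupp.sum_zero_index⟩, hadd⟩ : (Config b →₀ QT) →+ QField b) _ _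
    rw [hadd, hsum]
    simp only [hsingle, one_smul, vtx_configOf]
    congr 2
    have := vtx_configOf b i []
    simpa [configOf] using this
  · rw [Finsupp.add_apply, Finsupp.single_eq_same, Finsupp.finsetSum_apply, Finset.sum_eq_zero,
      add_zero]
    intro k _
    rw [Finsupp.single_eq_of_ne (configOf_ne_zero b (hL k)).symm]
  · intro n hn j u
    by_cases h0 : n = 0
    · simp [h0]
    · obtain ⟨k, rfl⟩ : ∃ k, n = configOf b (L k) := by
        by_contra! hno
        apply Finsupp.mem_support_iff.1 hn
        rw [Finsupp.add_apply, Finsupp.single_eq_of_ne h0, Finsupp.finsetSum_apply,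
          Finset.sum_eq_zero, add_zero]
        intro k _
        rw [Finsupp.single_eq_of_ne (hno k)]
      exact coeff_configOf_nonneg b _ j u

/-! ### Combinations of monomials whose value at the vacuum is killed by the screening operators -/

/-- The coefficients of the creation operators in the monomial of a configuration. -/
def modes (i : b.support) (n : Config b) (k : b.support) (m : ℕ) : QT :=
  (defCartan b (q ^ m) (t ^ m))⁻¹ k i - ev m (n k)

/-- The value of a combination of monomials at the vacuum. -/
def vacuumMode (i : b.support) (c : Config b →₀ QT) (l : ℕ) : Fock b :=
  ∑ n ∈ c.support, (c n * mono (charge b i n)) • PowerSeries.coeff l (pexp QT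
    (creation b (modes b i n)))

/-- The value at the vacuum is killed by the screening operators. -/
def Singular (i : b.support) (c : Config b →₀ QT) : Prop :=
  ∀ l j, screenPlus b j (vacuumMode b i c l) = 0 ∧ screenMinus b j (vacuumMode b i c l) = 0

lemma fieldOf_zero_one (i : b.support) (c : Config b →₀ QT) (l : ℕ) :
    fieldOf b i c 0 (-l) 1 = vacuumMode b i c l := by
  have hm : ∀ n : Config b, (fun k (m : ℕ) => (vtx b i n).2.2 k (-m)) = modes b i n := by
    intro n
    funext k m
    simp only [vtx, modes, neg_neg, zpow_neg, defCartan_inv, zpow_natCast]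
  rw [fieldOf, Finsupp.sum, vacuumMode]
  simp only [Finset.sum_apply, Pi.smul_apply, Vertex.toField]
  refine Finset.sum_congr rfl fun n _ => ?_
  have h1 : ∏ j, mono ((0 : Weight b) j) ^ (vtx b i n).2.1 j = 1 :=
    Finset.prod_eq_one fun j _ => by rw [Pi.zero_apply, mono_zero, one_zpow]
  rw [normalExp_one_neg, smul_smul, hm, h1, mul_one]
  rfl

/-- Both sides of the commutation relation are applied to the vacuum. One side vanishes, whatever
the field does on the target Fock module. -/
lemma CommutesWithScreening.singular {i : b.support} {c : Config b →₀ QT}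
    (h : CommutesWithScreening b (fieldOf b i c)) : Singular b i c := by
  have hz : ∀ μ n, fieldOf b i c μ n 0 = 0 := by
    intro μ n
    rw [fieldOf, Finsupp.sum]
    simp only [Finset.sum_apply, Pi.smul_apply, Vertex.toField, normalExp_zero, smul_zero,
      Finset.sum_const_zero]
  intro l j
  obtain ⟨h1, h2⟩ := h (-l) j 1
  rw [screenPlus, normalExp_one_of_pos b _ one_pos, hz, fieldOf_zero_one] at h1
  rw [screenMinus, normalExp_one_of_pos b _ one_pos, hz, fieldOf_zero_one] at h2
  exact ⟨h1.symm, h2.symm⟩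

/-! ### The consequences of the screening relations -/

lemma sum_defCartan_mul_modes (i : b.support) (n : Config b) (j : b.support) {m : ℕ} (hm : m ≠ 0) :
    ∑ k, defCartan b (q ^ m) (t ^ m) j k * modes b i n k m = ev m ((datum b).weight i n j) := by
  have hm' : (m : ℤ) ≠ 0 := by exact_mod_cast hm
  have h1 := congrFun (congrFun (Matrix.mul_nonsing_inv _ (isUnit_det_defCartan b hm')) j) i
  have h2 := sum_ev_mul_laurentCartan b hm' n j
  simp only [zpow_natCast] at h1 h2
  rw [Matrix.mul_apply] at h1
  simp only [modes, mul_sub, Finset.sum_sub_distrib]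
  rw [h1, h2, CartanDatum.weight, map_sub, Matrix.one_apply]
  congr 1
  by_cases h : j = i
  · subst h; simp
  · simp [h]

/-- The commutators contain `C`, the modes of `Y_i` contain `C⁻¹`, so the operator product of `a_j`
with a monomial depends only on its weight at `j`. The factor `[r_j]_q` combines with `q - q⁻¹` to
`q^{r_j} - q^{-r_j}`. -/
lemma sum_heis_mul_modes (i : b.support) (n : Config b) (j : b.support) {m : ℕ} (hm : m ≠ 0) :
    ∑ k, heis b m j k * modes b i n k m = (m : QT)⁻¹ * ev m ((X (symmetrizer b j, 0) -
      X (-symmetrizer b j, 0)) * (X (0, 1) - X (0, -1)) * (datum b).weight i n j) := by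
  have hm' : (m : ℤ) ≠ 0 := by exact_mod_cast hm
  have hq := q_zpow_sub_ne_zero hm'
  rw [zpow_natCast] at hq
  have hr : (q ^ m - (q ^ m)⁻¹) * qInt (q ^ m) (symmetrizer b j) =
      ev m (X (symmetrizer b j, 0) - X (-symmetrizer b j, 0)) := by
    rw [qInt, mul_div_cancel₀ _ hq, map_sub, ev_X, ev_X]
    simp [mono, ← zpow_natCast, ← zpow_mul, mul_comm]
  have ht : t ^ m - (t ^ m)⁻¹ = ev m (X (0, 1) - X (0, -1)) := by
    rw [map_sub, ev_X, ev_X]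
    simp [mono]
  rw [map_mul, map_mul, ← sum_defCartan_mul_modes b i n j hm, ← hr, ← ht, Finset.mul_sum,
    Finset.mul_sum]
  refine Finset.sum_congr rfl fun k _ => ?_
  simp only [heis, defB, defDiag, Matrix.diagonal_mul]
  ring

/-- The point of a pole records the creation modes of the vertex operator left there, namely the
monomial times the screening current at `u`. Equality of mode `1` at each vertex already determines
the Laurent polynomials, and it then holds in all modes. -/
lemma ev_modes_eq_iff {i : b.support} {j : b.support} {τ : IntLaurent} (hτ : τ ≠ 0)
    {n n' : Config b} {u u' : ℤ × ℤ} {s : ℕ → QT} (hs : ∀ m, m ≠ 0 → s m = (ev m τ)⁻¹) :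
    point (fun n => linPoly b j s (modes b i n)) n u =
      point (fun n => linPoly b j s (modes b i n)) n' u' ↔ CartanDatum.Linked j τ n n' u u' := by
  have hval : ∀ n u a, point (fun n => linPoly b j s (modes b i n)) n u a =
      modes b i n a.1 (a.2 + 1) + if a.1 = j then s (a.2 + 1) * ev (a.2 + 1) (X u) else 0 := by
    intro n u a
    have e : mono u ^ ((a.2 : ℤ) + 1) = mono u ^ (a.2 + 1) := by norm_cast
    simp only [point, linPoly, singleCreation, ev_X, e]
    split_ifs <;> simp
  have hev : ∀ m : ℕ, ev (m + 1) τ ≠ 0 := fun m => ev_ne_zero (by omega) hτ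
  constructor
  · intro h
    constructor
    · intro k hk
      have := congrFun h (k, 0)
      rw [hval, hval] at this
      simp only [hk, if_false, add_zero, modes, sub_right_inj] at this
      exact (ev_injective (by norm_num) this).symm
    · have := congrFun h (j, 0)
      rw [hval, hval] at this
      simp only [if_true, modes, hs _ (Nat.succ_ne_zero _)] at this
      apply ev_injective (m := 1) one_ne_zero
      have h1 := hev 0
      simp only [Nat.cast_zero, zero_add, Nat.cast_one] at h1 this
      have h2 : ev 1 (X u) - ev 1 (X u') = ev 1 τ * (ev 1 (n j) - ev 1 (n' j)) := by
        field_simp at this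
        linear_combination this
      rw [map_mul, map_sub, map_sub, h2]
  · rintro ⟨h1, h2⟩
    funext a
    rw [hval, hval]
    by_cases ha : a.1 = j
    · obtain ⟨k, m⟩ := a
      dsimp only at ha
      subst ha
      have h3 := congrArg (ev ((m : ℤ) + 1)) h2
      rw [map_mul, map_sub, map_sub] at h3
      have h4 := hev m
      simp only [if_true, modes, hs (m + 1) (Nat.succ_ne_zero _), Nat.cast_add, Nat.cast_one]
      field_simp
      linear_combination -h3
    · simp only [ha, if_false, modes, h1 _ ha]

section

-- A uniform treatment of both screening currents: `τ` is the inverse of their creation coefficients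
-- and `τ'` multiplies the weight in the operator product. For `S_j^-` these are `t - t⁻¹` and
-- `q^{-r_j} - q^{r_j}`; for `S_j^+` the two are interchanged.
variable {i : b.support} {c : Config b →₀ QT} {j : b.support} {ξ : ℤ → QT} {τ τ' : IntLaurent}
  (h : ∀ l, normalExp b (fun k m => if k = j then ξ m else 0) 1 (vacuumMode b i c l) = 0)
  (hτ : τ ≠ 0) (hs : ∀ m : ℕ, m ≠ 0 → ξ (-m) = (ev m τ)⁻¹)
  (hτ' : ∀ m : ℕ, m ≠ 0 → ξ m * ev m ((X (symmetrizer b j, 0) - X (-symmetrizer b j, 0)) *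
    (X (0, 1) - X (0, -1))) = ev m τ') (hτ0 : aug τ' = 0)

include h hτ' in
lemma sum_pairing_of_screen (p : MvPolynomial (b.support × ℕ) QT) :
    ∑ n ∈ c.support, (c n * mono (charge b i n)) *
      pairing (tail (prodSeries (τ' * (datum b).weight i n j)) 1)
        (MvPolynomial.aeval (linPoly b j (fun m => ξ (-m)) (modes b i n)) p) = 0 := by
  have hser : ∀ n, prodSeries (τ' * (datum b).weight i n j) = pexp QT (PowerSeries.mk fun m =>
      if m = 0 then 0 else ξ m * ∑ k, heis b m j k * modes b i n k m) := by
    intro n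
    rw [prodSeries]
    congr 1
    ext m
    simp only [PowerSeries.coeff_mk]
    split_ifs with hm
    · subst hm; simp
    · rw [sum_heis_mul_modes b i n j hm, map_mul, map_mul, ← hτ' m hm]; ring
  simp only [hser]
  exact sum_pairing_eq_zero_of_screen b h p

include h hτ hs hτ' hτ0

lemma coeff_mul_weight_le_one {n : Config b} (hn : n ∈ c.support) (u : ℤ × ℤ) :
    (τ' * (datum b).weight i n j).coeff u ≤ 1 := by
  refine poles_le_one (S := c.support) (c := fun n => c n * mono (charge b i n))
    (g := fun n => τ' * (datum b).weight i n j)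
    (ℓ := fun n => linPoly b j (fun m => ξ (-m)) (modes b i n))
    (a := fun m => (j, m)) (s := fun m => ξ (-(m + 1 : ℕ)))
    (v := fun n m => modes b i n j (m + 1)) ?_ ?_ ?_ ?_ ?_ ?_ hn u
  · exact fun n hn => mul_ne_zero (Finsupp.mem_support_iff.1 hn) (mono_ne_zero _)
  · intro n _
    rw [map_mul, hτ0, zero_mul]
  · exact sum_pairing_of_screen b h hτ'
  · intro m
    rw [hs _ (Nat.succ_ne_zero _)]
    exact inv_ne_zero (ev_ne_zero (by omega) hτ)
  · intro n m
    simp [linPoly, singleCreation]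
  · intro n _ n' _ u he
    have := (ev_modes_eq_iff b hτ hs (i := i) (j := j) (n := n) (n' := n') (u := u) (u' := u)).1
      (funext he)
    by_contra hne
    exact this.ne hτ (Ne.symm hne) rfl

lemma sum_resid_linked {n : Config b} (u : ℤ × ℤ) : ∑ n' ∈ c.support, (c n' * mono (charge b i n')) *
    ∑ u' ∈ (τ' * (datum b).weight i n' j).coeff.support.filter fun u' =>
      (τ' * (datum b).weight i n' j).coeff u' = 1 ∧ CartanDatum.Linked j τ n n' u u',
      resid u' (τ' * (datum b).weight i n' j) = 0 := by
  have := sum_resid_eq_zero (S := c.support) (c := fun n => c n * mono (charge b i n))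
    (g := fun n => τ' * (datum b).weight i n j)
    (ℓ := fun n => linPoly b j (fun m => ξ (-m)) (modes b i n))
    (a := fun m => (j, m)) (s := fun m => ξ (-(m + 1 : ℕ)))
    (v := fun n m => modes b i n j (m + 1)) ?_ ?_ ?_ ?_ ?_ ?_
    (point (fun n => linPoly b j (fun m => ξ (-m)) (modes b i n)) n u)
  · rw [← this]
    refine Finset.sum_congr rfl fun n' _ => ?_
    congr 1
    refine Finset.sum_congr (Finset.filter_congr fun u' _ => ?_) fun _ _ => rfl
    rw [← ev_modes_eq_iff b hτ hs (i := i), eq_comm (a := point _ n' u')]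
  · exact fun n hn => mul_ne_zero (Finsupp.mem_support_iff.1 hn) (mono_ne_zero _)
  · intro n _
    rw [map_mul, hτ0, zero_mul]
  · exact sum_pairing_of_screen b h hτ'
  · intro m
    rw [hs _ (Nat.succ_ne_zero _)]
    exact inv_ne_zero (ev_ne_zero (by omega) hτ)
  · intro n m
    simp [linPoly, singleCreation]
  · intro n _ n' _ u he
    have := (ev_modes_eq_iff b hτ hs (i := i) (j := j) (n := n) (n' := n') (u := u) (u' := u)).1
      (funext he)
    by_contra hne
    exact this.ne hτ (Ne.symm hne) rfl

end

lemma ev_X_q (m a : ℤ) : ev m (X (a, 0)) = q ^ (m * a) := by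
  rw [ev_X, mono, zpow_zero, mul_one, ← zpow_mul, mul_comm]

lemma screenPlus_coeff {j : b.support} {m : ℕ} (hm : m ≠ 0) :
    (q ^ ((m : ℤ) * symmetrizer b j) - q ^ (-((m : ℤ) * symmetrizer b j)))⁻¹ *
      ev m ((X (symmetrizer b j, 0) - X (-symmetrizer b j, 0)) * (X (0, 1) - X (0, -1))) =
    ev m (X (0, 1) - X (0, -1)) := by
  have h : q ^ ((m : ℤ) * symmetrizer b j) - q ^ (-((m : ℤ) * symmetrizer b j)) =
      ev m (X (symmetrizer b j, 0) - X (-symmetrizer b j, 0)) := by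
    rw [map_sub, ev_X_q, ev_X_q, mul_neg]
  have h0 : ev m (X (symmetrizer b j, 0) - X (-symmetrizer b j, 0)) ≠ 0 := by
    refine ev_ne_zero (by exact_mod_cast hm) (X_sub_X_ne_zero fun e => ?_)
    have := congrArg Prod.fst e
    have := symmetrizer_pos b j
    dsimp only at *
    omega
  rw [h, map_mul, inv_mul_cancel_left₀ h0]

lemma screenPlus_coeff_neg {j : b.support} {m : ℕ} :
    (q ^ (-(m : ℤ) * symmetrizer b j) - q ^ (-(-(m : ℤ) * symmetrizer b j)))⁻¹ =
      (ev m (X (-symmetrizer b j, 0) - X (symmetrizer b j, 0)))⁻¹ := by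
  rw [map_sub, ev_X_q, ev_X_q]
  congr 3 <;> ring

lemma screenMinus_coeff {j : b.support} {m : ℕ} (hm : m ≠ 0) :
    -(t ^ (m : ℤ) - t ^ (-(m : ℤ)))⁻¹ *
      ev m ((X (symmetrizer b j, 0) - X (-symmetrizer b j, 0)) * (X (0, 1) - X (0, -1))) =
    ev m (X (-symmetrizer b j, 0) - X (symmetrizer b j, 0)) := by
  have h : t ^ (m : ℤ) - t ^ (-(m : ℤ)) = ev m (X (0, 1) - X (0, -1)) := by
    rw [map_sub, ev_X, ev_X]
    simp [mono]
  have h0 : ev m (X (0, 1) - X (0, -1)) ≠ 0 :=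
    ev_ne_zero (by exact_mod_cast hm) (X_sub_X_ne_zero (by decide))
  rw [h, map_mul, neg_mul, mul_comm, mul_assoc, mul_inv_cancel₀ h0, mul_one, ← map_neg, neg_sub]

lemma screenMinus_coeff_neg {m : ℕ} :
    -(t ^ (-(m : ℤ)) - t ^ (-(-(m : ℤ))))⁻¹ = (ev m (X (0, 1) - X (0, -1)))⁻¹ := by
  rw [map_sub, ev_X, ev_X, ← inv_neg, neg_sub]
  simp [mono]

lemma symmetrizer_shift_ne_zero (j : b.support) :
    X (-symmetrizer b j, 0) - X (symmetrizer b j, 0) ≠ 0 := X_sub_X_ne_zero fun e => by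
  have := congrArg Prod.fst e
  have := symmetrizer_pos b j
  dsimp only at *
  omega

namespace Singular

variable {b} {i : b.support} {c : Config b →₀ QT} (h : Singular b i c)
include h

/-- The poles with respect to `S_j^-` are simple. -/
lemma poles_le_one {n : Config b} (hn : n ∈ c.support) (j : b.support) (u : ℤ × ℤ) :
    ((datum b).poles i n j).coeff u ≤ 1 :=
  coeff_mul_weight_le_one b (fun l => (h l j).2) CartanDatum.t_sub_ne_zero (fun m _ => screenMinus_coeff_neg)
    (fun m hm => screenMinus_coeff b hm) (by simp) hn u

/-- The poles with respect to `S_j^+` are simple. -/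
lemma polesPlus_le_one {n : Config b} (hn : n ∈ c.support) (j : b.support) (u : ℤ × ℤ) :
    ((X (0, 1) - X (0, -1)) * (datum b).weight i n j).coeff u ≤ 1 :=
  coeff_mul_weight_le_one b (fun l => (h l j).1) (symmetrizer_shift_ne_zero b j)
    (fun m _ => screenPlus_coeff_neg b) (fun m hm => screenPlus_coeff b hm) (by simp) hn u

lemma sum_resid (n : Config b) (j : b.support) (u : ℤ × ℤ) :
    ∑ n' ∈ c.support, (c n' * mono (charge b i n')) *
      ∑ u' ∈ ((datum b).poles i n' j).coeff.support.filter fun u' =>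
        ((datum b).poles i n' j).coeff u' = 1 ∧
          CartanDatum.Linked j (X (0, 1) - X (0, -1)) n n' u u',
      resid u' ((datum b).poles i n' j) = 0 :=
  sum_resid_linked b (fun l => (h l j).2) CartanDatum.t_sub_ne_zero (fun m _ => screenMinus_coeff_neg)
    (fun m hm => screenMinus_coeff b hm) (by simp) u

/-- Every pole with respect to `S_j^-` is shared with another monomial. -/
lemma polesCancel : (datum b).PolesCancel i c.support := by
  intro n hn j u hu
  by_contra! hno
  have hu1 : ((datum b).poles i n j).coeff u = 1 := le_antisymm (h.poles_le_one hn j u) hu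
  have := h.sum_resid n j u
  -- If no other monomial shares the pole, the residue relation has a single summand, and that is
  -- nonzero.
  rw [Finset.sum_eq_single n, Finset.sum_eq_single u] at this
  · exact mul_ne_zero (mul_ne_zero (Finsupp.mem_support_iff.1 hn) (mono_ne_zero _))
      (resid_ne_zero _ _) this
  · intro u' hu' hne
    have := (Finset.mem_filter.1 hu').2.2.2
    rw [sub_self, mul_zero, eq_comm, sub_eq_zero] at this
    exact absurd (X_injective this).symm hne
  · intro hu'
    refine absurd (Finset.mem_filter.2 ⟨?_, hu1, fun _ _ => rfl, by simp⟩) hu'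
    rw [Finsupp.mem_support_iff, hu1]
    exact one_ne_zero
  · intro n' hn' hne
    rw [Finset.sum_eq_zero, mul_zero]
    intro u' hu'
    exact absurd (Finset.mem_filter.1 hu').2.2 (hno n' hn' hne u')
  · exact fun hn' => absurd hn hn'

/-- The relation between the residues at a pole that is shared by at most two monomials. -/
lemma resid_add_resid {n n₁ : Config b} (hn : n ∈ c.support) {j : b.support} {u u₁ : ℤ × ℤ}
    (hu : 0 < ((datum b).poles i n j).coeff u)
    (hlink : CartanDatum.Linked j (X (0, 1) - X (0, -1)) n n₁ u u₁)
    (hne : n₁ ≠ n) (hclass : ∀ n' ∈ c.support, ∀ u', n' ≠ n →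
      CartanDatum.Linked j (X (0, 1) - X (0, -1)) n n' u u' → n' = n₁) :
    n₁ ∈ c.support ∧ ((datum b).poles i n₁ j).coeff u₁ = 1 ∧
      c n * mono (charge b i n) * resid u ((datum b).poles i n j) +
        c n₁ * mono (charge b i n₁) * resid u₁ ((datum b).poles i n₁ j) = 0 := by
  have hu1 : ((datum b).poles i n j).coeff u = 1 := le_antisymm (h.poles_le_one hn j u) hu
  have huniq : ∀ n' u' u'', CartanDatum.Linked j (X (0, 1) - X (0, -1)) n n' u u' →
      CartanDatum.Linked j (X (0, 1) - X (0, -1)) n n' u u'' → u' = u'' := by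
    intro n' u' u'' h' h''
    have := h'.2.symm.trans h''.2
    exact X_injective (sub_right_injective this)
  have hmem : n₁ ∈ c.support := by
    obtain ⟨n', hn', hne', u', hl⟩ := h.polesCancel n hn j u hu
    rw [← hclass n' hn' u' hne' hl]
    exact hn'
  have hself : CartanDatum.Linked j (X (0, 1) - X (0, -1)) n n u u := ⟨fun _ _ => rfl, by simp⟩
  have hsum := h.sum_resid n j u
  rw [Finset.sum_eq_add_of_mem n n₁ hn hmem (Ne.symm hne)] at hsum
  · have e1 : (((datum b).poles i n j).coeff.support.filter fun u' =>
        ((datum b).poles i n j).coeff u' = 1 ∧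
          CartanDatum.Linked j (X (0, 1) - X (0, -1)) n n u u') = {u} := by
      ext u'
      rw [Finset.mem_filter, Finset.mem_singleton]
      constructor
      · exact fun h' => huniq n u' u h'.2.2 hself
      · rintro rfl
        exact ⟨by rw [Finsupp.mem_support_iff, hu1]; exact one_ne_zero, hu1, hself⟩
    rw [e1, Finset.sum_singleton] at hsum
    -- Otherwise `n₁` would contribute nothing and the residue of `n` would have to vanish.
    have hu1' : ((datum b).poles i n₁ j).coeff u₁ = 1 := by
      by_contra hno
      rw [Finset.sum_eq_zero (s := Finset.filter _ ((datum b).poles i n₁ j).coeff.support), mul_zero,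
        add_zero] at hsum
      · exact mul_ne_zero (mul_ne_zero (Finsupp.mem_support_iff.1 hn) (mono_ne_zero _))
          (resid_ne_zero _ _) hsum
      · intro u' hu'
        obtain ⟨h1, h2⟩ := (Finset.mem_filter.1 hu').2
        rw [huniq n₁ u' u₁ h2 hlink] at h1
        exact absurd h1 hno
    refine ⟨hmem, hu1', ?_⟩
    have e2 : (((datum b).poles i n₁ j).coeff.support.filter fun u' =>
        ((datum b).poles i n₁ j).coeff u' = 1 ∧
          CartanDatum.Linked j (X (0, 1) - X (0, -1)) n n₁ u u') = {u₁} := by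
      ext u'
      rw [Finset.mem_filter, Finset.mem_singleton]
      constructor
      · exact fun h' => huniq n₁ u' u₁ h'.2.2 hlink
      · rintro rfl
        exact ⟨by rw [Finsupp.mem_support_iff, hu1']; exact one_ne_zero, hu1', hlink⟩
    rwa [e2, Finset.sum_singleton] at hsum
  · rintro n' hn' ⟨h1, h2⟩
    rw [Finset.sum_eq_zero, mul_zero]
    intro u' hu'
    exact absurd (hclass n' hn' u' h1 (Finset.mem_filter.1 hu').2.2) h2

end Singular

end

end DeformedW

namespace DeformedW

noncomputable section

open scoped Classical
open IntLaurent

variable {ι R M N : Type*} [Fintype ι] [Field R] [CharZero R] [AddCommGroup M] [Module R M]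
  [AddCommGroup N] [Module R N] {P : RootPairing ι R M N} [P.IsRootSystem] [P.IsCrystallographic]
  (b : P.Base)

/-! ### The involution of the coefficients -/

lemma conj_algebraMap (x : LaurentQT) : conj (algebraMap LaurentQT QT x) =
    algebraMap LaurentQT QT (AddMonoidAlgebra.domCongr ℂ ℂ (AddEquiv.neg (ℤ × ℤ)) x) := by
  simp [conj]

lemma conj_mono (u : ℤ × ℤ) : conj (mono u) = mono (-u) := by
  rw [mono_eq_algebraMap, mono_eq_algebraMap, conj_algebraMap]
  congr 1
  simp

lemma conj_q : conj q = q⁻¹ := by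
  have := conj_mono (1, 0)
  simpa [mono] using this

lemma conj_t : conj t = t⁻¹ := by
  have := conj_mono (0, 1)
  simpa [mono] using this

lemma conj_conj (x : QT) : conj (conj x) = x := by
  have h : (conj.toRingHom.comp conj.toRingHom) = RingHom.id QT := by
    refine IsFractionRing.ringHom_ext (A := LaurentQT) ?_
    intro x
    simp only [RingHom.comp_apply, RingEquiv.toRingHom_eq_coe, RingEquiv.coe_toRingHom,
      conj_algebraMap, RingHom.id_apply]
    congr 1
    induction x using AddMonoidAlgebra.induction_linear with
    | zero => simp
    | add f g hf hg => simp [hf, hg]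
    | single a c => simp
  exact congrFun (congrArg DFunLike.coe h) x

lemma conj_qInt (x : QT) (n : ℤ) (hx : conj x = x⁻¹) : conj (qInt x n) = qInt x n := by
  rw [show conj (qInt x n) = qInt x⁻¹ n by
    rw [qInt, qInt, map_div₀, map_sub, map_sub, map_zpow₀, map_zpow₀, map_inv₀, hx], qInt_inv]

lemma conj_defCartan (m : ℤ) (i j : b.support) :
    conj (defCartan b (q ^ m) (t ^ m) i j) = defCartan b (q ^ m) (t ^ m) i j := by
  have hq : conj (q ^ m) = (q ^ m)⁻¹ := by rw [map_zpow₀, conj_q, inv_zpow]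
  have ht : conj (t ^ m) = (t ^ m)⁻¹ := by rw [map_zpow₀, conj_t, inv_zpow]
  simp only [defCartan, Matrix.of_apply, map_sub, conj_qInt _ _ hq]
  congr 1
  split_ifs
  · simp only [map_add, map_mul, map_zpow₀, map_inv₀, conj_q, conj_t]
    simp only [inv_zpow', zpow_neg, inv_inv]
    ring
  · simp

lemma conj_inv_defCartan {m : ℤ} (i j : b.support) :
    conj ((defCartan b (q ^ m) (t ^ m))⁻¹ i j) = (defCartan b (q ^ m) (t ^ m))⁻¹ i j := by
  have h : (defCartan b (q ^ m) (t ^ m)).map conj = defCartan b (q ^ m) (t ^ m) := by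
    ext i j
    exact conj_defCartan b m i j
  have h2 := RingHom.map_adjugate conj.toRingHom (defCartan b (q ^ m) (t ^ m))
  have h3 := RingHom.map_det conj.toRingHom (defCartan b (q ^ m) (t ^ m))
  change _ = ((defCartan b (q ^ m) (t ^ m)).map conj).det at h3
  change (_ : Matrix _ _ _).map conj = ((defCartan b (q ^ m) (t ^ m)).map conj).adjugate at h2
  rw [h] at h2 h3
  have h4 := congrFun (congrFun h2 i) j
  rw [Matrix.map_apply] at h4
  simp only [Matrix.inv_def, Matrix.smul_apply, smul_eq_mul, map_mul, h4]
  congr 1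
  rw [Ring.inverse_eq_inv', map_inv₀]
  exact congrArg _ h3

/-- The substitution `q ↦ q⁻¹`, `t ↦ t⁻¹` on integral Laurent polynomials. -/
def bar : IntLaurent →+* IntLaurent :=
  (AddMonoidAlgebra.domCongr ℤ ℤ (AddEquiv.neg (ℤ × ℤ))).toRingEquiv.toRingHom

lemma bar_single (u : ℤ × ℤ) (k : ℤ) : bar (AddMonoidAlgebra.single u k) =
    AddMonoidAlgebra.single (-u) k := by
  simp [bar]

lemma coeff_bar (p : IntLaurent) (u : ℤ × ℤ) : (bar p).coeff u = p.coeff (-u) := by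
  induction p using IntLaurent.induction with
  | zero => simp
  | add p p' h h' => simp [h, h']
  | single v k => rw [bar_single]; simp [Finsupp.single_apply, neg_eq_iff_eq_neg]

lemma aug_bar (p : IntLaurent) : aug (bar p) = aug p := by
  induction p using IntLaurent.induction with
  | zero => simp
  | add p p' h h' => simp [h, h']
  | single v k => rw [bar_single, aug_single, aug_single]

lemma ev_bar (m : ℤ) (p : IntLaurent) : ev m (bar p) = ev (-m) p := by
  induction p using IntLaurent.induction with
  | zero => simp
  | add p p' h h' => simp [h, h']
  | single v k => rw [bar_single, ev_single, ev_single, mono_neg, inv_zpow']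

lemma conj_ev (m : ℤ) (p : IntLaurent) : conj (ev m p) = ev (-m) p := by
  induction p using IntLaurent.induction with
  | zero => simp
  | add p p' h h' => simp [h, h']
  | single v k => rw [ev_single, ev_single, map_mul, map_zpow₀, conj_mono, mono_neg, inv_zpow']; simp

/-! ### Intertwining properties of vertex operators -/

/-- Serves linearity, rescaling of `z` and `ϑ` at once. Only the scalars `1 / k` need to commute
with `φ`, so semilinear maps are allowed. -/
lemma normalExp_intertwine (φ : Fock b ≃+ Fock b)
    (hφ : ∀ (k : ℕ) (f : Fock b), φ ((k : QT)⁻¹ • f) = (k : QT)⁻¹ • φ f) {u : QT} (hu : u ≠ 0)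
    {ξ ξ' : b.support → ℤ → QT} (h : ∀ m : ℤ, m ≠ 0 → ∀ f,
      φ ((∑ i, ξ i m • osc b i m) f) = u ^ (-m) • (∑ i, ξ' i m • osc b i m) (φ f)) (n : ℤ)
    (f : Fock b) : φ (normalExp b ξ n f) = u ^ (-n) • normalExp b ξ' n (φ f) := by
  have h1 : ∀ (l : ℕ) (f : Fock b), φ (expCoeff (annih b ξ) l f) =
      u⁻¹ ^ l • expCoeff (annih b ξ') l (φ f) := by
    intro l f
    refine expCoeff_intertwine (φ : Fock b →+ Fock b) hφ _ (fun m hm f => ?_) l f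
    have := h m (by exact_mod_cast hm) f
    rw [zpow_neg, zpow_natCast, ← inv_pow] at this
    exact this
  have h2 : ∀ (l : ℕ) (f : Fock b), φ (expCoeff (creat b ξ) l f) =
      u ^ l • expCoeff (creat b ξ') l (φ f) := by
    intro l f
    refine expCoeff_intertwine (φ : Fock b →+ Fock b) hφ _ (fun m hm f => ?_) l f
    have := h (-m) (by omega) f
    rw [neg_neg, zpow_natCast] at this
    exact this
  rw [normalExp_eq, normalExp_eq, AddEquiv.map_finsum, smul_finsum]
  refine finsum_congr fun p => ?_
  obtain ⟨p, rfl⟩ := p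
  rw [h2, h1, map_smul, smul_smul]
  congr 1
  rw [inv_pow, ← zpow_natCast, ← zpow_natCast, ← zpow_neg, ← zpow_add₀ hu]
  congr 1
  ring

lemma normalExp_smul (ξ : b.support → ℤ → QT) (n : ℤ) {x : QT} (hx : x ≠ 0) (f : Fock b) :
    normalExp b ξ n (x • f) = x • normalExp b ξ n f := by
  have := normalExp_intertwine b (DistribMulAction.toAddEquiv₀ (Fock b) x hx)
    (fun k f => ?_) one_ne_zero (ξ := ξ) (ξ' := ξ) ?_ n f
  · rw [one_zpow, one_smul] at this
    exact this.symm
  · change x • (k : QT)⁻¹ • f = (k : QT)⁻¹ • x • f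
    exact smul_comm _ _ _
  · intro m _ f
    rw [one_zpow, one_smul]
    exact (LinearMap.map_smul (∑ i, ξ i m • osc b i m) x f).symm

lemma normalExp_rescale (ξ ξ' : b.support → ℤ → QT) {u : QT} (hu : u ≠ 0)
    (h : ∀ j m, m ≠ 0 → ξ j m = ξ' j m * u ^ m) (n : ℤ) (f : Fock b) :
    u ^ (-n) • normalExp b ξ n f = normalExp b ξ' n f := by
  have := normalExp_intertwine b (AddEquiv.refl (Fock b)) (fun _ _ => rfl) hu (ξ := ξ') (ξ' := ξ) ?_ n f
  · exact this.symm
  · intro m hm f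
    simp only [AddEquiv.refl_apply, LinearMap.sum_apply, LinearMap.smul_apply, Finset.smul_sum,
      smul_smul]
    refine Finset.sum_congr rfl fun i _ => ?_
    congr 1
    rw [h i m hm, mul_comm, mul_assoc, ← zpow_add₀ hu, add_neg_cancel, zpow_zero, mul_one]

lemma thetaFock_C (x : QT) : thetaFock b (MvPolynomial.C x) = MvPolynomial.C (conj x) := by
  simp [thetaFock, signFock]

lemma thetaFock_X (v : b.support × ℕ) :
    thetaFock b (MvPolynomial.X v) = -MvPolynomial.X v := by
  simp [thetaFock, signFock]

lemma thetaFock_X_mul (v : b.support × ℕ) (f : Fock b) :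
    thetaFock b (MvPolynomial.X v * f) = -(MvPolynomial.X v * thetaFock b f) := by
  rw [map_mul, thetaFock_X]
  ring

lemma thetaFock_smul (x : QT) (f : Fock b) : thetaFock b (x • f) = conj x • thetaFock b f := by
  rw [MvPolynomial.smul_eq_C_mul, MvPolynomial.smul_eq_C_mul, map_mul, thetaFock_C]

lemma thetaFock_pderiv (v : b.support × ℕ) (f : Fock b) :
    thetaFock b (MvPolynomial.pderiv v f) = -MvPolynomial.pderiv v (thetaFock b f) := by
  induction f using MvPolynomial.induction_on with
  | C a => simp [thetaFock_C]
  | add f g hf hg => simp only [map_add, hf, hg, neg_add]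
  | mul_X f w hf =>
    rw [Derivation.leibniz, map_add, smul_eq_mul, smul_eq_mul, map_mul, map_mul, map_mul, hf,
      Derivation.leibniz, smul_eq_mul, smul_eq_mul, thetaFock_X, map_neg]
    by_cases h : w = v
    · subst h
      simp only [MvPolynomial.pderiv_X_self, map_one]
      ring
    · rw [MvPolynomial.pderiv_X_of_ne h, map_zero]
      ring

lemma conj_heis (m : ℕ) (i j : b.support) : conj (heis b m i j) = heis b m i j := by
  have hq : conj (q ^ m) = (q ^ m)⁻¹ := by rw [map_pow, conj_q, inv_pow]
  have ht : conj (t ^ m) = (t ^ m)⁻¹ := by rw [map_pow, conj_t, inv_pow]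
  have hC := conj_defCartan b m i j
  simp only [zpow_natCast] at hC
  have hB : conj (defB b (q ^ m) (t ^ m) i j) = defB b (q ^ m) (t ^ m) i j := by
    rw [defB, defDiag, Matrix.diagonal_mul, map_mul, conj_qInt _ _ hq, hC]
  rw [heis, map_mul, map_mul, map_mul, map_sub, map_sub, map_inv₀, map_inv₀, map_inv₀, hq, ht, hB,
    map_natCast, inv_inv, inv_inv]
  ring

lemma thetaFock_osc (i : b.support) (m : ℤ) (f : Fock b) :
    thetaFock b (osc b i m f) = -osc b i m (thetaFock b f) := by
  rcases m with (_ | m) | m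
  · simp [osc]
  · have h : osc b i (Int.ofNat (m + 1)) =
      ∑ j, heis b (m + 1) i j • (MvPolynomial.pderiv (j, m)).toLinearMap := rfl
    rw [h]
    simp only [LinearMap.sum_apply, LinearMap.smul_apply, map_sum, thetaFock_smul, conj_heis]
    rw [← Finset.sum_neg_distrib]
    refine Finset.sum_congr rfl fun j _ => ?_
    rw [← smul_neg]
    congr 1
    exact thetaFock_pderiv b _ f
  · have h : osc b i (Int.negSucc m) = LinearMap.mulLeft QT (MvPolynomial.X (i, m)) := rfl
    rw [h, LinearMap.mulLeft_apply, LinearMap.mulLeft_apply, thetaFock_X_mul]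

lemma thetaFock_normalExp (ξ ξ' : b.support → ℤ → QT)
    (h : ∀ j m, m ≠ 0 → ξ' j m = -conj (ξ j m)) (n : ℤ) (f : Fock b) :
    thetaFock b (normalExp b ξ n f) = normalExp b ξ' n (thetaFock b f) := by
  have := normalExp_intertwine b (thetaFock b).toAddEquiv (fun k f => ?_) one_ne_zero
    (ξ := ξ) (ξ' := ξ') ?_ n f
  · rw [one_zpow, one_smul] at this
    exact this
  · change thetaFock b _ = _ • thetaFock b _
    rw [thetaFock_smul, map_inv₀, map_natCast]
  · intro m hm f
    rw [one_zpow, one_smul]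
    change thetaFock b ((∑ i, ξ i m • osc b i m : Module.End QT (Fock b)) f) =
      (∑ i, ξ' i m • osc b i m : Module.End QT (Fock b)) (thetaFock b f)
    simp only [LinearMap.sum_apply, LinearMap.smul_apply, map_sum, thetaFock_smul, thetaFock_osc]
    refine Finset.sum_congr rfl fun i _ => ?_
    rw [h i m hm, smul_neg, neg_smul]

/-- The coefficient `1 / (q^{mr} - q^{-mr})` is odd under `q ↦ q⁻¹`, which compensates the sign in
`a_j[m] ↦ -a_j[m]`. -/
lemma thetaFock_screenPlus (j : b.support) (f : Fock b) :
    thetaFock b (screenPlus b j f) = screenPlus b j (thetaFock b f) := by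
  refine thetaFock_normalExp b _ _ (fun k m _ => ?_) 1 f
  split_ifs
  · rw [map_inv₀, map_sub, map_zpow₀, map_zpow₀, conj_q, ← inv_neg, neg_sub, inv_zpow', inv_zpow',
      neg_neg]
  · simp

lemma thetaFock_screenMinus (j : b.support) (f : Fock b) :
    thetaFock b (screenMinus b j f) = screenMinus b j (thetaFock b f) := by
  refine thetaFock_normalExp b _ _ (fun k m _ => ?_) 1 f
  split_ifs
  · rw [map_neg, map_inv₀, map_sub, map_zpow₀, map_zpow₀, conj_t, ← inv_neg, ← inv_neg, ← inv_neg,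
      neg_sub, neg_sub, neg_sub, inv_zpow', inv_zpow', neg_neg]
  · simp

lemma thetaFock_symm_apply (f : Fock b) : (thetaFock b).symm f = thetaFock b f := by
  rw [RingEquiv.symm_apply_eq]
  induction f using MvPolynomial.induction_on with
  | C a => simp [thetaFock_C, conj_conj]
  | add f g hf hg => simp only [map_add, ← hf, ← hg]
  | mul_X f v hf => rw [map_mul, map_mul, ← hf, thetaFock_X, map_neg, thetaFock_X, neg_neg]

lemma theta_theta (T : QField b) : theta b (theta b T) = T := by
  funext μ n f
  simp only [theta, thetaOp, thetaFock_symm_apply]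
  rw [← thetaFock_symm_apply b (thetaFock b _), RingEquiv.symm_apply_apply,
    ← thetaFock_symm_apply b (thetaFock b f), RingEquiv.symm_apply_apply]

lemma theta_rescale (u : QT) (T : QField b) :
    theta b (rescale b u T) = rescale b (conj u) (theta b T) := by
  funext μ n f
  simp only [theta, thetaOp, rescale, thetaFock_smul, map_zpow₀]

/-- The image of a monomial under the involution and a rescaling. -/
lemma rescale_theta_toField (p : ℤ × ℤ) {v v' : Vertex b} (h1 : v'.1 = -v.1) (h2 : v'.2.1 = -v.2.1)
    (h3 : ∀ j m, m ≠ 0 → v'.2.2 j m = -conj (v.2.2 j m) * mono p ^ (-m)) :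
    rescale b (mono p) (theta b v.toField) = v'.toField := by
  funext μ n f
  simp only [rescale, theta, thetaOp, Vertex.toField, thetaFock_smul]
  rw [thetaFock_normalExp b v.2.2 (fun j m => -conj (v.2.2 j m)) (fun _ _ _ => rfl),
    RingEquiv.apply_symm_apply, smul_comm, normalExp_rescale b _ v'.2.2 (mono_ne_zero p)]
  · congr 1
    rw [map_mul, conj_mono, map_prod, h1, h2]
    congr 1
    refine Finset.prod_congr rfl fun j _ => ?_
    rw [map_zpow₀, conj_mono, mono_neg, inv_zpow', Pi.neg_apply]
  · intro j m hm
    rw [h3 j m hm, mul_assoc, ← zpow_add₀ (mono_ne_zero p), neg_add_cancel, zpow_zero, mul_one]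

/-! ### Reflected combinations of monomials -/

/-- The configuration `v - u ^ p n(q⁻¹, t⁻¹)`. -/
def reflect (v : Config b) (p : ℤ × ℤ) (n : Config b) : Config b :=
  fun k => v k - X p * bar (n k)

lemma bar_bar (x : IntLaurent) : bar (bar x) = x := by
  ext a d
  rw [coeff_bar, coeff_bar, neg_neg]

lemma reflect_injective (v : Config b) (p : ℤ × ℤ) : Function.Injective (reflect b v p) := by
  intro n n' h
  funext k
  have h1 : X p * bar (n k) = X p * bar (n' k) := sub_right_injective (congrFun h k)
  rw [← bar_bar (n k), mul_left_cancel₀ (X_ne_zero p) h1, bar_bar]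

lemma coeff_reflect (v : Config b) (p : ℤ × ℤ) (n : Config b) (k : b.support) (u : ℤ × ℤ) :
    (reflect b v p n k).coeff u = (v k).coeff u - (n k).coeff (p - u) := by
  rw [reflect, AddMonoidAlgebra.coeff_sub, Finsupp.sub_apply, coeff_X_mul, coeff_bar, neg_sub]

/-- The image of a combination of monomials under the involution. -/
def reflectSum (v : Config b) (p : ℤ × ℤ) (c : Config b →₀ QT) : Config b →₀ QT :=
  (c.mapRange conj (map_zero _)).mapDomain (reflect b v p)

lemma reflectSum_apply (v : Config b) (p : ℤ × ℤ) (c : Config b →₀ QT) (n : Config b) :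
    reflectSum b v p c (reflect b v p n) = conj (c n) := by
  rw [reflectSum, Finsupp.mapDomain_apply (reflect_injective b v p), Finsupp.mapRange_apply]

lemma exists_of_mem_support_reflectSum {v : Config b} {p : ℤ × ℤ} {c : Config b →₀ QT}
    {n : Config b} (hn : n ∈ (reflectSum b v p c).support) :
    ∃ n' ∈ c.support, n = reflect b v p n' := by
  obtain ⟨n', hn', rfl⟩ := Finset.mem_image.1 (Finsupp.mapDomain_support hn)
  exact ⟨n', Finsupp.support_mapRange hn', rfl⟩

section

variable {i i' : b.support} {v : Config b} {p : ℤ × ℤ}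
  (hv : ∀ j, (datum b).weight i v j = -Pi.single (M := fun _ => IntLaurent) i' (X p) j)
include hv

/-- Solving `C v = e_i + u^p e_{i'}` with `C⁻¹`. In terms of vertex operators, the monomial of `v`
is the inverse of `Y_{i'}(z u^p)`. -/
lemma ev_eq_of_weight {m : ℤ} (hm : m ≠ 0) (j : b.support) :
    ev m (v j) = (defCartan b (q ^ m) (t ^ m))⁻¹ j i +
      mono p ^ m * (defCartan b (q ^ m) (t ^ m))⁻¹ j i' := by
  have h1 : (defCartan b (q ^ m) (t ^ m)).mulVec (fun k => ev m (v k)) =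
      Pi.single i 1 + Pi.single i' (mono p ^ m) := by
    funext k
    have h2 := sum_ev_mul_laurentCartan b hm v k
    rw [Matrix.mulVec, dotProduct, h2]
    have h3 := hv k
    rw [CartanDatum.weight] at h3
    have h4 : (datum b).qCartan v k = Pi.single (M := fun _ => IntLaurent) i 1 k +
        Pi.single (M := fun _ => IntLaurent) i' (X p) k := by
      linear_combination -h3
    rw [h4, map_add, Pi.add_apply]
    congr 1
    · by_cases h : k = i
      · subst h; simp
      · simp [h]
    · by_cases h : k = i'
      · subst h; simp [ev_X]
      · simp [h]
  have h2 := congrArg (defCartan b (q ^ m) (t ^ m))⁻¹.mulVec h1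
  rw [Matrix.mulVec_mulVec, Matrix.nonsing_inv_mul _ (isUnit_det_defCartan b hm),
    Matrix.one_mulVec, Matrix.mulVec_add, Matrix.mulVec_single, Matrix.mulVec_single] at h2
  have := congrFun h2 j
  simp only [Pi.add_apply, Pi.smul_apply, MulOpposite.op_one, one_smul, Matrix.col_apply] at this
  rw [this]
  simp [mul_comm]

lemma aug_eq_of_weight (j : b.support) : ∑ k, cartan b j k * aug (v k) =
    (if j = i then 1 else 0) + if j = i' then 1 else 0 := by
  have h := congrArg aug (hv j)
  rw [aug_weight, map_neg] at h
  have h2 : aug (Pi.single (M := fun _ => IntLaurent) i' (X p) j) = if j = i' then 1 else 0 := by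
    by_cases h : j = i'
    · subst h; simp
    · simp [h]
  rw [h2] at h
  linarith

variable (hrho : ∀ k, ∑ j, rhoWeight b j * cartan b j k = 2 * symmetrizer b k)
  (hrhoco : ∀ k, ∑ j, rhoCoweight b j * cartan b j k = 2)
include hrho hrhoco

lemma charge_reflect (n : Config b) : charge b i (reflect b v p n) = -charge b i' n := by
  -- Both prefactors are sums `∑ y_k aug (v_k)` with `2 y = x C` for a vector `x` of Weyl vector
  -- type. At `q = t = 1`, `C v = e_i + e_{i'}`, which leaves `x_i + x_{i'}`.
  have key : ∀ x y : b.support → ℤ, (∀ k, ∑ j, x j * cartan b j k = 2 * y k) →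
      2 * ∑ k, y k * aug (v k) = x i + x i' := by
    intro x y hxy
    rw [Finset.mul_sum]
    have : ∀ k ∈ Finset.univ, 2 * (y k * aug (v k)) = ∑ j, x j * (cartan b j k * aug (v k)) := by
      intro k _
      rw [← mul_assoc, ← hxy k, Finset.sum_mul]
      exact Finset.sum_congr rfl fun j _ => by ring
    rw [Finset.sum_congr rfl this, Finset.sum_comm]
    simp only [← Finset.mul_sum, aug_eq_of_weight b hv]
    simp [mul_add, Finset.sum_add_distrib]
  have k1 := key _ _ hrho
  have k2 := key (rhoCoweight b) 1 (by simpa using hrhoco)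
  simp only [Pi.one_apply, one_mul] at k2
  simp only [charge, reflect, map_sub, map_mul, aug_X, aug_bar, one_mul, mul_sub,
    Finset.sum_sub_distrib]
  refine Prod.ext ?_ ?_
  · simp only [Prod.fst_neg]
    linarith
  · simp only [Prod.snd_neg]
    linarith

/-- Up to the bar involution, `ϑ` inverts a monomial `Y_{i'} ∏ A^{-n}`. As `Y_{i'}(z u^p)⁻¹` is the
monomial of `v` over `Y_i`, the inverse is a monomial over `Y_i` with `u^p n̄` removed from `v`. -/
lemma fieldOf_reflectSum (c : Config b →₀ QT) :
    fieldOf b i (reflectSum b v p c) = rescale b (mono p) (theta b (fieldOf b i' c)) := by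
  have hterm : ∀ n, rescale b (mono p) (theta b (vtx b i' n).toField) =
      (vtx b i (reflect b v p n)).toField := by
    intro n
    refine rescale_theta_toField b p (charge_reflect b hv hrho hrhoco n) ?_ ?_
    · funext j
      have h1 := aug_weight b i (reflect b v p n) j
      have h2 := aug_weight b i' n j
      have h3 := aug_eq_of_weight b hv j
      simp only [reflect, map_sub, map_mul, aug_X, aug_bar, one_mul, mul_sub,
        Finset.sum_sub_distrib] at h1
      simp only [vtx, Pi.neg_apply]
      rw [h1, h2, h3]
      ring
    · intro j m hm
      simp only [vtx, reflect, map_sub, map_mul, conj_inv_defCartan, conj_ev, ev_bar, neg_neg, ev_X]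
      have := ev_eq_of_weight b hv (neg_ne_zero.2 hm) j
      simp only [zpow_neg q, zpow_neg t, defCartan_inv] at this
      rw [this]
      ring
  have hsum : fieldOf b i (reflectSum b v p c) =
      c.sum fun n x => conj x • (vtx b i (reflect b v p n)).toField := by
    rw [fieldOf, reflectSum, Finsupp.sum_mapDomain_index
      (h := fun n x => x • (vtx b i n).toField) (fun _ => zero_smul _ _)
      (fun _ _ _ => add_smul _ _ _), Finsupp.sum_mapRange_index
      (h := fun n x => x • (vtx b i (reflect b v p n)).toField) (fun _ => zero_smul _ _)]
  rw [hsum]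
  funext μ n f
  simp only [Finsupp.sum, fieldOf, rescale, theta, thetaOp, Finset.sum_apply, Pi.smul_apply, map_sum,
    thetaFock_smul, Finset.smul_sum, ← hterm]
  exact Finset.sum_congr rfl fun n' _ => smul_comm _ _ _

/-- The reflection of a combination of monomials that is killed by the screening operators. -/
lemma Singular.reflected {c : Config b →₀ QT} (h : Singular b i' c) :
    Singular b i (reflectSum b v p c) := by
  intro l j
  obtain ⟨h1, h2⟩ := h l j
  rw [← fieldOf_zero_one] at h1 h2 ⊢
  rw [fieldOf_reflectSum b hv hrho hrhoco]
  simp only [rescale, theta, thetaOp, map_one]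
  constructor
  · rw [screenPlus, normalExp_smul b _ _ (zpow_ne_zero _ (mono_ne_zero p)), ← screenPlus,
      ← thetaFock_screenPlus, h1, map_zero, smul_zero]
  · rw [screenMinus, normalExp_smul b _ _ (zpow_ne_zero _ (mono_ne_zero p)), ← screenMinus,
      ← thetaFock_screenMinus, h2, map_zero, smul_zero]

end

end

end DeformedW

namespace DeformedW

noncomputable section

open scoped Classical
open IntLaurent

variable {ι R M N : Type*} [Fintype ι] [Field R] [CharZero R] [AddCommGroup M] [Module R M]
  [AddCommGroup N] [Module R N] {P : RootPairing ι R M N} [P.IsRootSystem] [P.IsCrystallographic]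
  (b : P.Base)

/-! ### Uniqueness of combinations that are killed by the screening operators -/

lemma vacuumMode_eq_sum {i : b.support} {c : Config b →₀ QT} {S : Finset (Config b)}
    (hS : c.support ⊆ S) (l : ℕ) : vacuumMode b i c l =
      ∑ n ∈ S, (c n * mono (charge b i n)) • PowerSeries.coeff l (pexp QT
        (creation b (modes b i n))) := by
  refine Finset.sum_subset hS fun n _ hn => ?_
  rw [Finsupp.notMem_support_iff.1 hn, zero_mul, zero_smul]

/-- The screening operators act linearly on the values of combinations of monomials. -/
lemma normalExp_vacuumMode_sub_smul (ξ : b.support → ℤ → QT) (i : b.support)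
    (c c' : Config b →₀ QT) (x : QT) (l : ℕ) :
    normalExp b ξ 1 (vacuumMode b i (c - x • c') l) =
      normalExp b ξ 1 (vacuumMode b i c l) - x • normalExp b ξ 1 (vacuumMode b i c' l) := by
  have h : (c - x • c').support ⊆ c.support ∪ c'.support := by
    intro n hn
    by_contra hno
    simp only [Finset.mem_union, not_or, Finsupp.mem_support_iff, not_not] at hno
    apply Finsupp.mem_support_iff.1 hn
    simp [hno]
  rw [vacuumMode_eq_sum b h, vacuumMode_eq_sum b Finset.subset_union_left,
    vacuumMode_eq_sum b Finset.subset_union_right, normalExp_sum, normalExp_sum, normalExp_sum,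
    Finset.smul_sum, ← Finset.sum_sub_distrib]
  refine Finset.sum_congr rfl fun n _ => ?_
  rw [smul_smul, ← sub_smul, Finsupp.sub_apply, Finsupp.smul_apply, smul_eq_mul]
  congr 1
  ring

lemma Singular.sub_smul {b : P.Base} {i : b.support} {c c' : Config b →₀ QT} (h : Singular b i c)
    (h' : Singular b i c') (x : QT) : Singular b i (c - x • c') := by
  intro l j
  obtain ⟨h1, h2⟩ := h l j
  obtain ⟨h1', h2'⟩ := h' l j
  rw [screenPlus] at h1 h1' ⊢
  rw [screenMinus] at h2 h2' ⊢
  rw [normalExp_vacuumMode_sub_smul, normalExp_vacuumMode_sub_smul, h1, h2, h1', h2']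
  simp

open CartanDatum in
/-- Two combinations, related by reflection, of which the first has the maximal monomial `v` and the
second is dominated by it, are proportional. -/
lemma Singular.eq_smul_reflectSum {i i' : b.support} {c c' : Config b →₀ QT} {v : Config b}
    {p : ℤ × ℤ} {h : ℕ} {σ : b.support → b.support} (hD : (datum b).IsCoxeter h σ)
    (hc : Singular b i c) (hpos : ∀ n ∈ c.support, ∀ j u, 0 ≤ (n j).coeff u)
    (hpos' : ∀ n ∈ c'.support, ∀ j u, 0 ≤ (n j).coeff u)
    (hv : v ∈ c.support) (hmax : ∀ n ∈ c.support, ¬ RightLT v n)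
    (hw : ∀ j, (datum b).weight i v j = -Pi.single (M := fun _ => IntLaurent) i' (X p) j)
    (h0 : c' 0 = 1) (hr : Singular b i (reflectSum b v p c')) :
    c = c v • reflectSum b v p c' := by
  rw [← sub_eq_zero]
  by_contra hne
  -- The difference is singular and has coefficient `0` at `v`. If it were nonzero, its maximal
  -- monomial would be antidominant, and both possible origins of an antidominant monomial give `v`.
  have hX := hc.sub_smul hr (c v)
  have hv1 : reflectSum b v p c' v = 1 := by
    have := reflectSum_apply b v p c' 0
    rw [h0, map_one] at this
    have e : reflect b v p 0 = v := by
      funext k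
      simp [reflect]
    rwa [e] at this
  obtain ⟨n, hn, hnmax⟩ := exists_maximal_of_trans (RightLT (I := b.support)) RightLT.irrefl
    (fun _ _ _ => RightLT.trans) (c - c v • reflectSum b v p c').support
    (Finsupp.support_nonempty_iff.2 hne)
  have hanti := hX.polesCancel.antidominant_of_maximal hn hnmax
  have hnv : n = v := by
    by_cases hnc : n ∈ c.support
    · exact hc.polesCancel.eq_maximal_of_antidominant hpos hD hv hmax hnc hanti
    · have hnr : n ∈ (reflectSum b v p c').support := by
        rw [Finsupp.mem_support_iff] at hn ⊢
        intro h'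
        apply hn
        rw [Finsupp.sub_apply, Finsupp.smul_apply, h', Finsupp.notMem_support_iff.1 hnc]
        simp
      obtain ⟨n', hn', rfl⟩ := exists_of_mem_support_reflectSum b hnr
      -- Antidominance of `v - u^p n̄'`, where `v` has weight `-u^p e_{i'}`, says `C (u^p n̄') ≤ u^p
      -- e_{i'}`.
      have hz : (fun k => X p * bar (n' k)) = (0 : Config b) := by
        refine (datum b).eq_zero_of_dominant (i := i') (u := p) (fun k u => ?_) fun j u => ?_
        · rw [coeff_X_mul, coeff_bar]
          exact hpos' n' hn' k _
        · have e1 : (datum b).qCartan (fun k => X p * bar (n' k)) j =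
              (datum b).qCartan v j - (datum b).qCartan (reflect b v p n') j := by
            rw [← qCartan_sub]
            congr 1
            funext k
            simp [reflect]
          rw [e1, qCartan_eq_sub_weight _ i, qCartan_eq_sub_weight _ i, hw]
          have := hanti j u.1 u.2
          simp only [AddMonoidAlgebra.coeff_sub, Finsupp.sub_apply, AddMonoidAlgebra.coeff_neg,
            Finsupp.neg_apply]
          rw [Prod.mk.eta] at this
          linarith
      funext k
      rw [reflect, congrFun hz k]
      simp
  apply Finsupp.mem_support_iff.1 hn
  rw [hnv, Finsupp.sub_apply, Finsupp.smul_apply, hv1, smul_eq_mul, mul_one, sub_self]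

end

end DeformedW

/-! ### Filling the lowest configuration column by column -/

namespace DeformedW

noncomputable section

open scoped Classical
open IntLaurent

namespace IntLaurent

/-- The part of a Laurent polynomial whose degrees in `t` satisfy a predicate. -/
def truncate (p : IntLaurent) (Q : ℤ → Prop) : IntLaurent :=
  AddMonoidAlgebra.ofCoeff (p.coeff.filter fun u => Q u.2)

lemma coeff_truncate (p : IntLaurent) (Q : ℤ → Prop) (a d : ℤ) :
    (truncate p Q).coeff (a, d) = if Q d then p.coeff (a, d) else 0 := by
  simp only [truncate, AddMonoidAlgebra.coeff_ofCoeff, Finsupp.filter_apply]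

lemma coeff_sum_X_pair {A : Finset ℤ} {f : ℤ → ℤ} (hf : Function.Injective f) (e a d : ℤ) :
    (∑ x ∈ A, X (f x, e)).coeff (a, d) = if d = e ∧ ∃ x ∈ A, f x = a then 1 else 0 := by
  rw [AddMonoidAlgebra.coeff_sum, Finsupp.finsetSum_apply]
  split_ifs with h
  · obtain ⟨rfl, x, hx, rfl⟩ := h
    rw [Finset.sum_eq_single_of_mem x hx, coeff_X_self]
    intro y _ hy
    exact coeff_X_of_ne fun e => hy (hf (congrArg Prod.fst e))
  · refine Finset.sum_eq_zero fun x hx => coeff_X_of_ne fun he => h ?_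
    exact ⟨(congrArg Prod.snd he).symm, x, hx, congrArg Prod.fst he⟩

end IntLaurent

namespace CartanDatum

variable {I : Type*} [Fintype I] [DecidableEq I] {D : CartanDatum I}

/-- The matrix `2 - C` exchanges the two colours, and `cheb s` is a polynomial in it with the parity
of `s - 1`. -/
lemma odd_of_cheb_ne_zero {ε : I → Bool} (hε : ∀ j k, D.adj j k ≠ 0 → ε j ≠ ε k) (s : ℕ) (j k : I)
    (h : D.cheb s j k ≠ 0) : ε j = ε k ↔ Odd s := by
  induction s using Nat.twoStepInduction generalizing j with
  | zero => simp [cheb_zero] at h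
  | one =>
    rw [cheb_one, Matrix.one_apply] at h
    have : j = k := by
      by_contra hne
      simp [hne] at h
    simp [this]
  | more s h1 h2 =>
    rw [cheb_add_two, Matrix.sub_apply] at h
    have e1 : Odd (s + 2) ↔ Odd s := by grind
    have e2 : Odd (s + 1) ↔ ¬ Odd s := by grind
    rw [e1]
    by_cases hs : D.cheb s j k = 0
    · rw [hs, sub_zero, Matrix.mul_apply] at h
      obtain ⟨l, -, hl⟩ := Finset.exists_ne_zero_of_sum_ne_zero h
      have hjl := hε j l fun e => left_ne_zero_of_mul hl (by simp [adjMatrix, e])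
      have := h2 l (right_ne_zero_of_mul hl)
      rw [e2] at this
      revert hjl this
      cases ε j <;> cases ε l <;> cases ε k <;> simp
    · exact h1 j hs

/-- A configuration that can be filled column by column. -/
structure Staged (D : CartanDatum I) (i : I) (h : ℤ) (ε : I → Bool) (v : I → IntLaurent) :
    Prop where
  nonneg : ∀ k u, 0 ≤ (v k).coeff u
  support : ∀ k a d, (v k).coeff (a, d) ≠ 0 → 0 < d ∧ d < h ∧ (ε k = ε i ↔ Odd d)
  weight : ∀ j a d, d < h → (D.weight i v j).coeff (a, d) = 0

lemma PolesCancel.staged {i : I} {S : Finset (I → IntLaurent)} (hS : D.PolesCancel i S)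
    (hpos : ∀ n ∈ S, ∀ k u, 0 ≤ (n k).coeff u) {h : ℕ} {σ : I → I} (hD : D.IsCoxeter h σ)
    {ε : I → Bool} (hε : ∀ j k, D.adj j k ≠ 0 → ε j ≠ ε k) {v : I → IntLaurent} (hv : v ∈ S)
    (hmax : ∀ n ∈ S, ¬ RightLT v n) : Staged D i h ε v where
  nonneg := hpos v hv
  support k a d hne := by
    have h0 : 0 < d := by
      by_contra hd
      exact hne (hS.coeff_eq_zero_of_le hpos hv k a (not_lt.1 hd))
    have h1 : d < h := by
      by_contra hd
      exact hne (hS.coeff_maximal_eq_zero hpos hD hv hmax k a d (not_lt.1 hd))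
    refine ⟨h0, h1, ?_⟩
    obtain ⟨m, rfl⟩ : ∃ m : ℕ, d = m := ⟨d.toNat, by omega⟩
    have := congrFun (hS.colVec_maximal hpos hD hv hmax m (by omega)) k
    rw [Matrix.mulVec_single_one, Matrix.col_apply, colVec] at this
    rw [odd_of_cheb_ne_zero hε m k i, Int.odd_coe_nat]
    rw [← this]
    intro hz
    exact hne (coeff_eq_zero_of_col (fun a => hpos v hv k _) hz.le a)
  weight j a d hd := hS.coeff_weight_maximal_eq_zero hpos hD hv hmax j a d hd

/-- The columns of `v` of degree at most `s`, and those of degree `s + 1` of the vertices in `K`. -/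
def stage (v : I → IntLaurent) (s : ℤ) (K : Finset I) : I → IntLaurent :=
  fun k => truncate (v k) fun d => d ≤ s ∨ d = s + 1 ∧ k ∈ K

lemma coeff_stage (v : I → IntLaurent) (s : ℤ) (K : Finset I) (k : I) (a d : ℤ) :
    (stage v s K k).coeff (a, d) = if d ≤ s ∨ d = s + 1 ∧ k ∈ K then (v k).coeff (a, d) else 0 := by
  rw [stage, coeff_truncate]
  by_cases hd : d ≤ s ∨ d = s + 1 ∧ k ∈ K
  · rw [if_pos hd, if_pos hd]
  · rw [if_neg hd, if_neg hd]

lemma stage_univ (v : I → IntLaurent) (s : ℤ) : stage v s Finset.univ = stage v (s + 1) ∅ := by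
  funext k
  ext a d
  rw [coeff_stage, coeff_stage]
  refine if_congr ?_ rfl rfl
  simp
  omega

namespace Staged

variable {i : I} {h : ℤ} {ε : I → Bool} {v : I → IntLaurent} (hv : Staged D i h ε v)
include hv

lemma stage_zero : stage v 0 ∅ = 0 := by
  funext k
  ext a d
  rw [coeff_stage]
  split_ifs with hd
  · by_contra hne
    have := (hv.support k a d hne).1
    simp at hd
    omega
  · rfl

lemma stage_last : stage v h ∅ = v := by
  funext k
  ext a d
  rw [coeff_stage]
  split_ifs with hd
  · rfl
  · by_contra hne
    have := (hv.support k a d (Ne.symm hne)).2.1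
    simp at hd
    omega

variable (hε : ∀ j k, D.adj j k ≠ 0 → ε j ≠ ε k)
include hε

/-- By the colouring, `v_j` has no terms in degree `s`, and the neighbours of `j` none in degree `s
+ 1`. The partial configuration therefore has the weight of `v` at `j`, which is zero below `h`,
except that the outflow of the missing column `s + 1` is not yet subtracted. -/
lemma coeff_weight_stage {s : ℤ} (h0 : 0 ≤ s) (hs : s < h) {K : Finset I} {j : I} (hj : j ∉ K)
    (hne : ∃ a, (v j).coeff (a, s + 1) ≠ 0) (a d : ℤ) :
    (D.weight i (stage v s K) j).coeff (a, d) =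
      if d = s then (v j).coeff (a - D.len j, s + 1) else 0 := by
  obtain ⟨x, hx⟩ := hne
  have hjs := (hv.support j x _ hx).2.2
  have hodd : Odd (s + 1) ↔ ¬ Odd s := by grind
  have hnb : ∀ k, D.adj j k ≠ 0 → ∀ c, (v k).coeff (c, s + 1) = 0 := by
    intro k hk c
    by_contra hne
    have h1 := (hv.support k c _ hne).2.2
    have h2 := hε j k hk
    rw [← hjs] at h1
    revert h1 h2
    cases ε j <;> cases ε i <;> cases ε k <;> simp
  have hjs0 : ∀ c, (v j).coeff (c, s) = 0 := by
    intro c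
    by_contra hne
    have h1 := (hv.support j c _ hne).2.2
    rw [hjs, hodd] at h1
    by_cases ho : Odd s <;> simp [ho] at h1
  have hw := hv.weight j a d
  rw [coeff_weight, coeff_inflow] at hw ⊢
  rcases lt_trichotomy d s with hd | rfl | hd
  · rw [if_neg (by omega : ¬ d = s)]
    have hw := hw (by omega)
    simp only [coeff_stage]
    simp only [show d ≤ s by omega, show d + 1 ≤ s by omega, show d - 1 ≤ s by omega, true_or, if_true]
    exact hw
  · rw [if_pos rfl]
    have hw := hw (by omega)
    simp only [coeff_stage]
    simp only [show ¬ d + 1 ≤ d by omega, show d - 1 ≤ d by omega, le_refl, true_or, if_true, hj,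
      and_false, or_false, if_false]
    linarith
  · rw [if_neg (by omega : ¬ d = s), if_neg (by omega), Finset.sum_eq_zero]
    · simp only [coeff_stage, hj, and_false, or_false]
      rw [if_neg (by omega)]
      split_ifs
      · rw [show d - 1 = s by omega, hjs0]; simp
      · simp
    · intro k _
      refine Finset.sum_eq_zero fun l hl => ?_
      have hk : D.adj j k ≠ 0 := by
        have := Finset.mem_range.1 hl
        omega
      rw [coeff_stage]
      split_ifs with hd'
      · rw [show d = s + 1 by omega]
        exact hnb k hk _
      · rfl

end Staged

/-- A configuration with further terms at the vertex `j`, in degree `s + 1`. -/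
def extend (D : CartanDatum I) (n : I → IntLaurent) (j : I) (s : ℤ) (g : Finset ℤ) :
    I → IntLaurent :=
  n + Pi.single (M := fun _ => IntLaurent) j (∑ x ∈ g, X (x - D.len j, s + 1))

lemma extend_other (n : I → IntLaurent) {j k : I} (s : ℤ) (g : Finset ℤ) (hk : k ≠ j) :
    D.extend n j s g k = n k := by
  simp [extend, hk]

lemma extend_self (n : I → IntLaurent) (j : I) (s : ℤ) (g : Finset ℤ) :
    D.extend n j s g j = n j + ∑ x ∈ g, X (x - D.len j, s + 1) := by
  simp [extend]

lemma extend_empty (n : I → IntLaurent) (j : I) (s : ℤ) : D.extend n j s ∅ = n := by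
  simp [extend]

lemma qCartan_single_self (j : I) (p : IntLaurent) :
    D.qCartan (Pi.single (M := fun _ => IntLaurent) j p) j =
      (X (D.len j, -1) + X (-D.len j, 1)) * p := by
  rw [qCartan, Pi.single_eq_same, Finset.sum_eq_zero, sub_zero]
  intro k _
  by_cases hk : k = j
  · subst hk; simp [D.adj_self]
  · simp [hk]

lemma weight_extend (i : I) (n : I → IntLaurent) (j : I) (s : ℤ) (g : Finset ℤ) :
    D.weight i (D.extend n j s g) j = D.weight i n j -
      ∑ x ∈ g, (X (x, s) + X (x - 2 * D.len j, s + 2)) := by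
  rw [weight, weight, extend, qCartan_add, qCartan_single_self, ← sub_sub, Finset.mul_sum]
  congr 1
  refine Finset.sum_congr rfl fun x _ => ?_
  rw [add_mul, X_mul_X, X_mul_X]
  congr 2
  · ext <;> simp
  · ext <;> simp <;> ring

end CartanDatum

end

end DeformedW

namespace DeformedW

noncomputable section

open scoped Classical
open IntLaurent CartanDatum

/-! ### Residues of products over chains -/

lemma resid_X_of_ne {u v : ℤ × ℤ} (h : v ≠ u) : resid u (X v) = (mono u - mono v)⁻¹ := by
  rw [X, resid_single, if_neg h, zpow_neg_one]

lemma resid_sub (u : ℤ × ℤ) (g g' : IntLaurent) :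
    resid u (g - g') = resid u g / resid u g' := by
  rw [eq_div_iff (resid_ne_zero _ _), ← resid_add, sub_add_cancel]

lemma resid_sum {A : Type*} (u : ℤ × ℤ) (S : Finset A) (f : A → IntLaurent) :
    resid u (∑ x ∈ S, f x) = ∏ x ∈ S, resid u (f x) := by
  induction S using Finset.induction_on with
  | empty => rw [Finset.sum_empty, Finset.prod_empty, resid_zero]
  | insert x S hx ih => rw [Finset.sum_insert hx, Finset.prod_insert hx, resid_add, ih]

/-- The structure function of the relations between the coefficients along a chain. -/
def chainFactor (r a c : ℤ) : QT :=
  ((mono (a, 0) - mono (c + 2 * r, 0)) * (mono (a, 2) - mono (c, 0))) /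
    ((mono (a, 0) - mono (c, 0)) * (mono (a, 2) - mono (c + 2 * r, 0)))

lemma mono_pair_sub_ne_zero {a c d e : ℤ} (h : ¬ (a = c ∧ d = e)) :
    mono (a, d) - mono (c, e) ≠ 0 :=
  mono_sub_ne_zero fun e => h ⟨(congrArg Prod.fst e).symm, (congrArg Prod.snd e).symm⟩

lemma chainFactor_ne_zero {r a c : ℤ} (hr : 0 < r) (h : a < c) : chainFactor r a c ≠ 0 := by
  refine div_ne_zero (mul_ne_zero ?_ ?_) (mul_ne_zero ?_ ?_) <;>
  · refine mono_pair_sub_ne_zero ?_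
    omega

/-- Compares the contributions of an unfilled element `y` to the residues before and after filling
`w`; the poles are at degrees `s` and `s + 2`. -/
lemma resid_tail {r w y s : ℤ} (hr : 0 < r) (h : w < y) :
    resid (w - r, s) (X (y - r, s) - X (y + r, s)) =
      chainFactor r w y * resid (w - r, s + 2) (X (y - r, s) - X (y + r, s)) := by
  have key : ∀ a d c e : ℤ, mono (a - r, s + d) - mono (c - r, s + e) =
      mono (-r, s) * (mono (a, d) - mono (c, e)) := by
    intro a d c e
    rw [mul_sub, ← mono_add, ← mono_add]
    congr 2 <;> ext <;> simp <;> ring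
  have e1 : (w - r, s) = (w - r, s + 0) := by simp
  have e2 : (y - r, s) = (y - r, s + 0) := by simp
  have e3 : (y + r, s) = (y + 2 * r - r, s + 0) := by ext <;> simp; ring
  rw [e1, e2, e3, resid_sub, resid_sub, resid_X_of_ne, resid_X_of_ne, resid_X_of_ne, resid_X_of_ne,
    key, key, key, key, chainFactor]
  · have h1 := mono_ne_zero (-r, s)
    have h2 : mono (w, 0) - mono (y, 0) ≠ 0 := mono_pair_sub_ne_zero (by omega)
    have h3 : mono (w, 0) - mono (y + 2 * r, 0) ≠ 0 := mono_pair_sub_ne_zero (by omega)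
    have h4 : mono (w, 2) - mono (y, 0) ≠ 0 := mono_pair_sub_ne_zero (by omega)
    have h5 : mono (w, 2) - mono (y + 2 * r, 0) ≠ 0 := mono_pair_sub_ne_zero (by omega)
    field_simp
  all_goals
    rw [Ne, Prod.ext_iff]
    dsimp only
    omega

/-- The same comparison for an element `a` that is already filled; the roles of the two residues are
interchanged. -/
lemma resid_head {r w a s : ℤ} (hr : 0 < r) (h : a < w) :
    resid (w - r, s + 2) (X (a - r, s + 2) - X (a - 3 * r, s + 2)) =
      chainFactor r a w * resid (w - r, s) (X (a - r, s + 2) - X (a - 3 * r, s + 2)) := by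
  have k1 : mono (w - r, s + 2) - mono (a - r, s + 2) =
      -mono (-r, s + 2) * (mono (a, 0) - mono (w, 0)) := by
    rw [neg_mul, mul_sub, ← mono_add, ← mono_add, neg_sub]
    congr 2 <;> ext <;> simp <;> ring
  have k2 : mono (w - r, s + 2) - mono (a - 3 * r, s + 2) =
      -mono (-3 * r, s + 2) * (mono (a, 0) - mono (w + 2 * r, 0)) := by
    rw [neg_mul, mul_sub, ← mono_add, ← mono_add, neg_sub]
    congr 2 <;> ext <;> simp <;> ring
  have k3 : mono (w - r, s) - mono (a - r, s + 2) =
      -mono (-r, s) * (mono (a, 2) - mono (w, 0)) := by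
    rw [neg_mul, mul_sub, ← mono_add, ← mono_add, neg_sub]
    congr 2 <;> ext <;> simp <;> ring
  have k4 : mono (w - r, s) - mono (a - 3 * r, s + 2) =
      -mono (-3 * r, s) * (mono (a, 2) - mono (w + 2 * r, 0)) := by
    rw [neg_mul, mul_sub, ← mono_add, ← mono_add, neg_sub]
    congr 2 <;> ext <;> simp <;> ring
  have k5 : mono (-r, s + 2) = mono (-r, s) * mono (0, 2) := by rw [← mono_add]; simp
  have k6 : mono (-3 * r, s + 2) = mono (-3 * r, s) * mono (0, 2) := by rw [← mono_add]; simp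
  rw [resid_sub, resid_sub, resid_X_of_ne, resid_X_of_ne, resid_X_of_ne, resid_X_of_ne,
    k1, k2, k3, k4, k5, k6, chainFactor]
  · have h1 := mono_ne_zero (-r, s)
    have h1' := mono_ne_zero (-3 * r, s)
    have h1'' := mono_ne_zero (0, 2)
    have h2 : mono (a, 0) - mono (w, 0) ≠ 0 := mono_pair_sub_ne_zero (by omega)
    have h3 : mono (a, 0) - mono (w + 2 * r, 0) ≠ 0 := mono_pair_sub_ne_zero (by omega)
    have h4 : mono (a, 2) - mono (w, 0) ≠ 0 := mono_pair_sub_ne_zero (by omega)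
    have h5 : mono (a, 2) - mono (w + 2 * r, 0) ≠ 0 := mono_pair_sub_ne_zero (by omega)
    field_simp
  all_goals
    rw [Ne, Prod.ext_iff]
    dsimp only
    omega

/-- The contribution of `w` itself. The ratio `-q^{2r} t^{-2}` is matched by the change of the
prefactor of the monomial when a factor `A_j` is added. -/
lemma resid_first {r w s : ℤ} (hr : 0 < r) : resid (w - r, s) (X (w - r, s) - X (w + r, s)) +
    mono (2 * r, -2) * resid (w - r, s + 2) (X (w - r, s + 2) - X (w - 3 * r, s + 2)) = 0 := by
  rw [resid_sub, resid_sub, resid_X_self, resid_X_self, resid_X_of_ne, resid_X_of_ne, one_div,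
    one_div, inv_inv, inv_inv, mul_sub, ← mono_add, ← mono_add]
  · rw [show ((2 * r, -2) : ℤ × ℤ) + (w - r, s + 2) = (w + r, s) by ext <;> simp; ring,
      show ((2 * r, -2) : ℤ × ℤ) + (w - 3 * r, s + 2) = (w - r, s) by ext <;> simp; ring]
    ring
  all_goals
    rw [Ne, Prod.ext_iff]
    dsimp only
    omega

/-- Polynomial recording the poles of the member `g` of the chain with set of elements `g ∪ C`. -/
def chainPoles (r s : ℤ) (C g : Finset ℤ) : IntLaurent :=
  ∑ y ∈ C, (X (y - r, s) - X (y + r, s)) + ∑ a ∈ g, (X (a - r, s + 2) - X (a - 3 * r, s + 2))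

lemma resid_chainPoles {r s w : ℤ} (hr : 0 < r) {C g : Finset ℤ} (hC : ∀ y ∈ C, w < y)
    (hg : ∀ a ∈ g, a < w) :
    resid (w - r, s) (chainPoles r s (insert w C) g) * ∏ a ∈ g, chainFactor r a w =
      -mono (2 * r, -2) * (∏ y ∈ C, chainFactor r w y) *
        resid (w - r, s + 2) (chainPoles r s C (insert w g)) := by
  have hwC : w ∉ C := fun h => lt_irrefl _ (hC w h)
  have hwg : w ∉ g := fun h => lt_irrefl _ (hg w h)
  simp only [chainPoles, resid_add, resid_sum, Finset.prod_insert hwC, Finset.prod_insert hwg]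
  rw [Finset.prod_congr rfl fun y hy => resid_tail (s := s) hr (hC y hy), Finset.prod_mul_distrib,
    Finset.prod_congr (rfl : g = g) fun a ha => resid_head (s := s) hr (hg a ha),
    Finset.prod_mul_distrib]
  linear_combination (resid_first (w := w) (s := s) hr) *
    (∏ y ∈ C, chainFactor r w y) * (∏ y ∈ C, resid (w - r, s + 2) (X (y - r, s) - X (y + r, s))) *
    (∏ a ∈ g, resid (w - r, s) (X (a - r, s + 2) - X (a - 3 * r, s + 2))) *
    (∏ a ∈ g, chainFactor r a w)

variable {ι R M N : Type*} [Fintype ι] [Field R] [CharZero R] [AddCommGroup M] [Module R M]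
  [AddCommGroup N] [Module R N] {P : RootPairing ι R M N} [P.IsRootSystem] [P.IsCrystallographic]
  {b : P.Base}

/-! ### The coefficients along the filling of the maximal configuration -/

section

variable {i : b.support} {c : Config b →₀ QT} (hc : Singular b i c)
  (hpos : ∀ n ∈ c.support, ∀ j u, 0 ≤ (n j).coeff u) {h : ℤ} {ε : b.support → Bool}
  {v : Config b} (hv : Staged (datum b) i h ε v)
  (hε : ∀ j k, (datum b).adj j k ≠ 0 → ε j ≠ ε k)
  (hdual : ∀ n ∈ c.support, ∀ j x e, e < h → (v j - n j).coeff (x + symmetrizer b j, e - 1) ≤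
    ∑ k, ∑ l ∈ Finset.range ((datum b).adj j k),
      (v k - n k).coeff (x + (((datum b).adj j k : ℤ) - 1 - 2 * l), e))
  {s : ℤ} (h0 : 0 ≤ s) (hs : s < h) {K : Finset b.support} {j : b.support} (hj : j ∉ K)
  {W : Finset ℤ} (hW : (datum b).weight i (stage v s K) j = ∑ y ∈ W, X (y, s))
  (hWv : ∀ a, (v j).coeff (a - symmetrizer b j, s + 1) = if a ∈ W then 1 else 0)
include hW

lemma weight_extend_stage {g : Finset ℤ} (hg : g ⊆ W) :
    (datum b).weight i ((datum b).extend (stage v s K) j s g) j =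
      ∑ y ∈ W \ g, X (y, s) - ∑ a ∈ g, X (a - 2 * symmetrizer b j, s + 2) := by
  rw [weight_extend, hW, ← Finset.sum_sdiff hg, Finset.sum_add_distrib]
  simp only [datum_len]
  abel

lemma poles_extend_stage {g : Finset ℤ} (hg : g ⊆ W) :
    (datum b).poles i ((datum b).extend (stage v s K) j s g) j =
      chainPoles (symmetrizer b j) s (W \ g) g := by
  rw [poles, weight_extend_stage hW hg, chainPoles, mul_sub, Finset.mul_sum, Finset.mul_sum,
    sub_eq_add_neg, ← Finset.sum_neg_distrib]
  congr 1
  · refine Finset.sum_congr rfl fun y _ => ?_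
    rw [sub_mul, X_mul_X, X_mul_X, datum_len]
    congr 2 <;> ext <;> simp <;> ring
  · refine Finset.sum_congr rfl fun y _ => ?_
    rw [sub_mul, X_mul_X, X_mul_X, datum_len, neg_sub]
    congr 2 <;> ext <;> simp <;> ring

lemma charge_extend_insert (n : Config b) {g : Finset ℤ} {w : ℤ} (hw : w ∉ g) :
    charge b i ((datum b).extend n j s (insert w g)) =
      charge b i ((datum b).extend n j s g) + (2 * symmetrizer b j, -2) := by
  have key : ∀ k, aug ((datum b).extend n j s (insert w g) k) =
      aug ((datum b).extend n j s g k) + if k = j then 1 else 0 := by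
    intro k
    by_cases hk : k = j
    · subst hk
      rw [extend_self, extend_self, Finset.sum_insert hw, map_add, map_add, map_add, aug_X,
        if_pos rfl]
      ring
    · rw [extend_other _ _ _ hk, extend_other _ _ _ hk, if_neg hk, add_zero]
  simp only [charge, key, mul_add, Finset.sum_add_distrib]
  ext
  · simp; ring
  · simp; ring

include hc hpos hv hdual h0 hs hj hWv hε

/-- For `w` the smallest unfilled element, the pole at `(w - r_j, s)` is shared by exactly two
monomials, before and after `w` is filled. The residue relation then gives the ratio of their
coefficients. -/
lemma coeff_extend_insert {g : Finset ℤ} {w : ℤ} (hw : w ∈ W) (hgw : ∀ a ∈ g, a < w)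
    (hg : ∀ y ∈ W, y ∈ g ↔ y < w) (hgW : g ⊆ W)
    (hmem : (datum b).extend (stage v s K) j s g ∈ c.support) :
    (datum b).extend (stage v s K) j s (insert w g) ∈ c.support ∧
    c ((datum b).extend (stage v s K) j s (insert w g)) *
        ∏ a ∈ g, chainFactor (symmetrizer b j) a w =
      c ((datum b).extend (stage v s K) j s g) *
        ∏ y ∈ W \ insert w g, chainFactor (symmetrizer b j) w y := by
  have hr := symmetrizer_pos b j
  have hwg : w ∉ g := fun h => lt_irrefl _ (hgw w h)
  have hgW' : insert w g ⊆ W := Finset.insert_subset hw hgW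
  have hWg : W \ g = insert w (W \ insert w g) := by
    ext y
    simp only [Finset.mem_sdiff, Finset.mem_insert, not_or]
    by_cases hy : y = w
    · subst hy; simp [hw, hwg]
    · simp [hy]
  have hC : ∀ y ∈ W \ insert w g, w < y := by
    intro y hy
    simp only [Finset.mem_sdiff, Finset.mem_insert, not_or] at hy
    have h1 := (not_congr (hg y hy.1)).1 hy.2.2
    omega
  have hpole : 0 < ((datum b).poles i ((datum b).extend (stage v s K) j s g) j).coeff
      (w - symmetrizer b j, s) := by
    rw [poles_extend_stage hW hgW, hWg, chainPoles, Finset.sum_insert (by simp)]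
    have e1 : (∑ y ∈ W \ insert w g, (X (y - symmetrizer b j, s) - X (y + symmetrizer b j, s))).coeff
        (w - symmetrizer b j, s) = 0 := by
      rw [AddMonoidAlgebra.coeff_sum, Finsupp.finsetSum_apply]
      refine Finset.sum_eq_zero fun y hy => ?_
      have := hC y hy
      rw [AddMonoidAlgebra.coeff_sub, Finsupp.sub_apply, coeff_X_of_ne, coeff_X_of_ne, sub_zero] <;>
      · rw [Ne, Prod.ext_iff]
        dsimp only
        omega
    have e2 : (∑ a ∈ g, (X (a - symmetrizer b j, s + 2) -
        X (a - 3 * symmetrizer b j, s + 2))).coeff (w - symmetrizer b j, s) = 0 := by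
      rw [AddMonoidAlgebra.coeff_sum, Finsupp.finsetSum_apply]
      refine Finset.sum_eq_zero fun a _ => ?_
      rw [AddMonoidAlgebra.coeff_sub, Finsupp.sub_apply, coeff_X_of_ne, coeff_X_of_ne, sub_zero] <;>
      · rw [Ne, Prod.ext_iff]
        dsimp only
        omega
    rw [AddMonoidAlgebra.coeff_add, Finsupp.add_apply, AddMonoidAlgebra.coeff_add,
      Finsupp.add_apply, e1, e2, AddMonoidAlgebra.coeff_sub, Finsupp.sub_apply, coeff_X_self,
      coeff_X_of_ne]
    · norm_num
    · rw [Ne, Prod.ext_iff]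
      dsimp only
      omega
  have hlink : Linked j (X (0, 1) - X (0, -1)) ((datum b).extend (stage v s K) j s g)
      ((datum b).extend (stage v s K) j s (insert w g)) (w - symmetrizer b j, s)
      (w - symmetrizer b j, s + 2) := by
    refine ⟨fun k hk => by rw [extend_other _ _ _ hk, extend_other _ _ _ hk], ?_⟩
    rw [extend_self, extend_self, Finset.sum_insert hwg, datum_len,
      show ∀ x y z : IntLaurent, x + y - (x + (z + y)) = -z by intros; ring, mul_neg, sub_mul,
      X_mul_X, X_mul_X, neg_sub]
    congr 2 <;> ext <;> simp <;> ring
  have hne : (datum b).extend (stage v s K) j s (insert w g) ≠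
      (datum b).extend (stage v s K) j s g := by
    intro he
    have := congrFun he j
    rw [extend_self, extend_self, Finset.sum_insert hwg] at this
    exact X_ne_zero (w - symmetrizer b j, s + 1) (by
      rw [datum_len] at this
      linear_combination this)
  have hclass : ∀ n' ∈ c.support, ∀ u', n' ≠ (datum b).extend (stage v s K) j s g →
      Linked j (X (0, 1) - X (0, -1)) ((datum b).extend (stage v s K) j s g) n'
        (w - symmetrizer b j, s) u' → n' = (datum b).extend (stage v s K) j s (insert w g) := by
    intro n' hn' u' hne' hl
    have hother : ∀ k, k ≠ j → n' k = stage v s K k := fun k hk => by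
      rw [hl.1 k hk, extend_other _ _ _ hk]
    rcases hl.raise_or_lower hne' with ⟨k, hk, -⟩ | ⟨k, hk, -⟩
    -- A longer string would put a factor `A_j` in degree `s + 3`, but there is no inflow in degree
    -- `s + 2`, where the neighbours have no factors yet.
    · have hk1 : k = 1 := by
        by_contra hk1
        have hk2 : 1 < k := lt_of_le_of_ne hk.pos (Ne.symm hk1)
        have h1 := hk.lt_of_lt hk2
        have h2 := hc.polesCancel.coeff_le_inflow hpos hn' j w (s + 2)
        rw [coeff_inflow, if_neg (by omega), Finset.sum_eq_zero] at h2
        · have h3 := hpos _ hmem j (w - symmetrizer b j, s + 1 + 2 * (1 : ℕ))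
          rw [datum_len, show s + 2 + 1 = s + 1 + 2 * (1 : ℕ) by push_cast; ring] at h2
          dsimp only at h1
          linarith
        · intro k _
          by_cases hkj : k = j
          · subst hkj
            rw [(datum b).adj_self, Finset.range_zero, Finset.sum_empty]
          · refine Finset.sum_eq_zero fun l _ => ?_
            rw [hother k hkj, coeff_stage, if_neg (by omega)]
      subst hk1
      funext l
      by_cases hlj : l = j
      · subst hlj
        rw [hk.eq, Finset.range_one, Finset.sum_singleton, extend_self, extend_self,
          Finset.sum_insert hwg]
        simp
        ring
      · rw [hother l hlj, extend_other _ _ _ hlj]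
    -- A lowering would remove a factor of `v_j` in degree `s - 1`. The dual bound forbids this,
    -- since the neighbours agree with `v` in degree `s`.
    · exfalso
      have h1 := hk.lt_of_lt hk.pos
      have h2 := hdual n' hn' j (w - 2 * symmetrizer b j) s hs
      rw [Finset.sum_eq_zero] at h2
      · rw [extend_self, AddMonoidAlgebra.coeff_add, Finsupp.add_apply, coeff_stage,
          coeff_sum_X_pair (f := fun x => x - (datum b).len j) (fun x y h => by simpa using h),
          if_pos (by simp), if_neg (by simp; omega)] at h1
        rw [AddMonoidAlgebra.coeff_sub, Finsupp.sub_apply,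
          show w - 2 * symmetrizer b j + symmetrizer b j = w - symmetrizer b j by ring] at h2
        simp only [Nat.cast_zero, mul_zero, sub_zero, add_zero] at h1
        linarith
      · intro k _
        by_cases hkj : k = j
        · subst hkj
          rw [(datum b).adj_self, Finset.range_zero, Finset.sum_empty]
        · refine Finset.sum_eq_zero fun l _ => ?_
          rw [hother k hkj, AddMonoidAlgebra.coeff_sub, Finsupp.sub_apply, coeff_stage,
            if_pos (by simp), sub_self]
  obtain ⟨h1, -, h2⟩ := hc.resid_add_resid hmem hpole hlink hne hclass
  refine ⟨h1, ?_⟩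
  rw [poles_extend_stage hW hgW, poles_extend_stage hW hgW', charge_extend_insert hW _ hwg,
    mono_add, hWg] at h2
  have h3 := resid_chainPoles (s := s) hr hC hgw
  have h4 : mono (charge b i ((datum b).extend (stage v s K) j s g)) *
      (mono (2 * symmetrizer b j, -2) * resid (w - symmetrizer b j, s + 2)
        (chainPoles (symmetrizer b j) s (W \ insert w g) (insert w g))) ≠ 0 :=
    mul_ne_zero (mono_ne_zero _) (mul_ne_zero (mono_ne_zero _) (resid_ne_zero _ _))
  apply mul_left_cancel₀ h4
  linear_combination (∏ a ∈ g, chainFactor (symmetrizer b j) a w) * h2 -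
    c ((datum b).extend (stage v s K) j s g) *
      mono (charge b i ((datum b).extend (stage v s K) j s g)) * h3

/-- Elements of `W` are filled in increasing order. Filling `w` removes the factors of the pairs
`(a, w)` with `a` filled and creates those of the pairs `(w, y)` with `y` unfilled, so the product
always runs over pairs of a filled and an unfilled element. -/
lemma coeff_extend_eq (hmem : stage v s K ∈ c.support) (g : Finset ℤ) (hgW : g ⊆ W)
    (hg : ∀ y ∈ W, ∀ a ∈ g, y ≤ a → y ∈ g) :
    (datum b).extend (stage v s K) j s g ∈ c.support ∧
    c ((datum b).extend (stage v s K) j s g) = c (stage v s K) *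
      ∏ a ∈ g, ∏ y ∈ W \ g, chainFactor (symmetrizer b j) a y := by
  induction g using Finset.induction_on_max with
  | empty => rw [extend_empty, Finset.prod_empty, mul_one]; exact ⟨hmem, rfl⟩
  | insert w g hgw ih =>
    have hwg : w ∉ g := fun h => lt_irrefl _ (hgw w h)
    have hw : w ∈ W := hgW (Finset.mem_insert_self _ _)
    have hgW' := (Finset.subset_insert _ _).trans hgW
    have hlow : ∀ y ∈ W, y ∈ g ↔ y < w := fun y hy => ⟨fun h => hgw y h, fun h =>
      (Finset.mem_insert.1 (hg y hy w (Finset.mem_insert_self _ _) h.le)).resolve_left h.ne⟩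
    obtain ⟨h1, h2⟩ := ih hgW' fun y hy a ha hya => (hlow y hy).2 (hya.trans_lt (hgw a ha))
    obtain ⟨h3, h4⟩ := coeff_extend_insert hc hpos hv hε hdual h0 hs hj hW hWv hw hgw hlow hgW' h1
    refine ⟨h3, ?_⟩
    have hne : ∏ a ∈ g, chainFactor (symmetrizer b j) a w ≠ 0 :=
      Finset.prod_ne_zero_iff.2 fun a ha => chainFactor_ne_zero (symmetrizer_pos b j) (hgw a ha)
    apply mul_right_cancel₀ hne
    have hWg : W \ g = insert w (W \ insert w g) := by
      ext y
      simp only [Finset.mem_sdiff, Finset.mem_insert, not_or]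
      by_cases hy : y = w
      · subst hy; simp [hw, hwg]
      · simp [hy]
    rw [h4, h2, hWg, Finset.prod_insert hwg]
    simp only [Finset.prod_insert (show w ∉ W \ insert w g by simp), Finset.prod_mul_distrib]
    ring

end

section

variable {i : b.support} {c : Config b →₀ QT} (hc : Singular b i c)
  (hpos : ∀ n ∈ c.support, ∀ j u, 0 ≤ (n j).coeff u) {h : ℤ} {ε : b.support → Bool}
  {v : Config b} (hv : Staged (datum b) i h ε v)
  (hε : ∀ j k, (datum b).adj j k ≠ 0 → ε j ≠ ε k)
  (hdual : ∀ n ∈ c.support, ∀ j x e, e < h → (v j - n j).coeff (x + symmetrizer b j, e - 1) ≤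
    ∑ k, ∑ l ∈ Finset.range ((datum b).adj j k),
      (v k - n k).coeff (x + (((datum b).adj j k : ℤ) - 1 - 2 * l), e))
include hc hpos hv hε hdual

lemma coeff_stage_insert {s : ℤ} (h0 : 0 ≤ s) (hs : s < h) {K : Finset b.support} {j : b.support}
    (hj : j ∉ K) (hmem : stage v s K ∈ c.support) :
    stage v s (insert j K) ∈ c.support ∧ c (stage v s (insert j K)) = c (stage v s K) := by
  by_cases hne : ∃ a, (v j).coeff (a, s + 1) ≠ 0
  · have hw := hv.coeff_weight_stage hε h0 hs hj hne
    -- Since the poles of `S_j^+` are simple, the column to be filled has multiplicities at most one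
    -- and is described by a set `W`.
    have hle : ∀ a, (v j).coeff (a - symmetrizer b j, s + 1) ≤ 1 := by
      intro a
      have h1 := hc.polesPlus_le_one hmem j (a, s + 1)
      rw [sub_mul, AddMonoidAlgebra.coeff_sub, Finsupp.sub_apply, coeff_X_mul, coeff_X_mul,
        Prod.mk_sub_mk, Prod.mk_sub_mk, hw, hw, if_pos (by ring), if_neg (by omega)] at h1
      simpa using h1
    let W : Finset ℤ := ((v j).coeff.support.filter fun u => u.2 = s + 1).image
      fun u => u.1 + symmetrizer b j
    have hWv : ∀ a, (v j).coeff (a - symmetrizer b j, s + 1) = if a ∈ W then 1 else 0 := by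
      intro a
      have h1 : a ∈ W ↔ (v j).coeff (a - symmetrizer b j, s + 1) ≠ 0 := by
        constructor
        · intro ha
          obtain ⟨⟨x, d⟩, hu, rfl⟩ := Finset.mem_image.1 ha
          obtain ⟨hu1, rfl⟩ := Finset.mem_filter.1 hu
          rw [add_sub_cancel_right]
          exact Finsupp.mem_support_iff.1 hu1
        · intro ha
          refine Finset.mem_image.2 ⟨(a - symmetrizer b j, s + 1), Finset.mem_filter.2
            ⟨Finsupp.mem_support_iff.2 ha, rfl⟩, by simp⟩
      split_ifs with ha
      · have := hv.nonneg j (a - symmetrizer b j, s + 1)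
        have := h1.1 ha
        have := hle a
        omega
      · by_contra h2
        exact ha (h1.2 h2)
    have hW : (datum b).weight i (stage v s K) j = ∑ y ∈ W, X (y, s) := by
      ext a d
      rw [hw, coeff_sum_X_pair (f := fun x => x) (fun _ _ h => h), datum_len, hWv]
      by_cases hd : d = s <;> by_cases ha : a ∈ W <;> simp [hd, ha]
    obtain ⟨h1, h2⟩ := coeff_extend_eq hc hpos hv hε hdual h0 hs hj hW hWv hmem W
      Finset.Subset.rfl fun y hy _ _ _ => hy
    have he : (datum b).extend (stage v s K) j s W = stage v s (insert j K) := by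
      funext k
      ext a d
      rw [coeff_stage]
      by_cases hk : k = j
      · subst hk
        rw [extend_self, AddMonoidAlgebra.coeff_add, Finsupp.add_apply, coeff_stage,
          coeff_sum_X_pair (f := fun x => x - (datum b).len k) (fun x y h => by simpa using h)]
        by_cases hd : d = s + 1
        · subst hd
          have e1 := hWv (a + symmetrizer b k)
          rw [add_sub_cancel_right] at e1
          have e2 : (∃ x ∈ W, x - (datum b).len k = a) ↔ a + symmetrizer b k ∈ W := by
            constructor
            · rintro ⟨x, hx, rfl⟩
              simpa using hx
            · exact fun ha => ⟨_, ha, by simp⟩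
          rw [datum_len] at e2
          simp [hj, e1, e2]
        · simp [hd]
      · rw [extend_other _ _ _ hk, coeff_stage]
        refine if_congr ?_ rfl rfl
        simp [hk]
    rw [he] at h1 h2
    refine ⟨h1, ?_⟩
    -- When the column is complete no unfilled element is left, and the product of structure factors
    -- is empty.
    rw [h2, Finset.sdiff_self]
    simp
  · push Not at hne
    have he : stage v s (insert j K) = stage v s K := by
      funext k
      ext a d
      rw [coeff_stage, coeff_stage]
      by_cases hk : k = j
      · subst hk
        by_cases hd : d = s + 1
        · subst hd
          simp [hne]
        · simp [hd]
      · refine if_congr ?_ rfl rfl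
        simp [hk]
    rw [he]
    exact ⟨hmem, rfl⟩

/-- The coefficient of the maximal configuration is the coefficient of the trivial one. -/
theorem coeff_maximal_eq (hh : 0 ≤ h) (h0 : c 0 ≠ 0) : c v = c 0 := by
  have hstage : ∀ s : ℤ, 0 ≤ s → s < h → ∀ K : Finset b.support, stage v s ∅ ∈ c.support →
      stage v s K ∈ c.support ∧ c (stage v s K) = c (stage v s ∅) := by
    intro s hs0 hs K hmem
    induction K using Finset.induction_on with
    | empty => exact ⟨hmem, rfl⟩
    | insert j K hj ih =>
      obtain ⟨h1, h2⟩ := coeff_stage_insert hc hpos hv hε hdual hs0 hs hj ih.1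
      exact ⟨h1, h2.trans ih.2⟩
  have hind : ∀ m : ℕ, (m : ℤ) ≤ h → stage v m ∅ ∈ c.support ∧ c (stage v m ∅) = c 0 := by
    intro m
    induction m with
    | zero =>
      intro _
      rw [Nat.cast_zero, hv.stage_zero]
      exact ⟨Finsupp.mem_support_iff.2 h0, rfl⟩
    | succ m ih =>
      intro hm
      obtain ⟨h1, h2⟩ := ih (by omega)
      obtain ⟨h3, h4⟩ := hstage m (by omega) (by omega) Finset.univ h1
      rw [stage_univ] at h3 h4
      rw [Nat.cast_add, Nat.cast_one]
      exact ⟨h3, h4.trans h2⟩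
  have := (hind h.toNat (by omega)).2
  rwa [Int.toNat_of_nonneg hh, hv.stage_last] at this

end

end

end DeformedW

/-! ### Coordinates of roots and coroots with respect to a base -/

namespace DeformedW

noncomputable section

open scoped Classical
open RootPairing

section coordinates

variable {ι R M N : Type*} [Fintype ι] [Field R] [CharZero R] [AddCommGroup M] [Module R M]
  [AddCommGroup N] [Module R N] {P : RootPairing ι R M N} (b : P.Base)

/-- The coordinates of a root with respect to the simple roots. -/
def rootCoord (β : ι) (k : b.support) : ℤ := b.toWeightBasisInt.repr (P.rootSpanMem ℤ β) k

/-- The coordinates of a coroot with respect to the simple coroots. -/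
def corootCoord (β : ι) (k : b.support) : ℤ := rootCoord b.flip β k

lemma root_eq_sum (β : ι) : P.root β = ∑ k : b.support, rootCoord b β k • P.root k := by
  have h := congrArg Subtype.val (b.toWeightBasisInt.sum_repr (P.rootSpanMem ℤ β))
  rw [AddSubmonoidClass.coe_finsetSum] at h
  simp only [Submodule.coe_smul, RootPairing.Base.coe_toWeightBasisInt_apply] at h
  exact h.symm

lemma coroot_eq_sum (β : ι) : P.coroot β = ∑ k : b.support, corootCoord b β k • P.coroot k :=
  root_eq_sum b.flip β

lemma rootCoord_unique {β : ι} {f : b.support → ℤ}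
    (h : P.root β = ∑ k : b.support, f k • P.root k) : rootCoord b β = f := by
  have h1 : P.rootSpanMem ℤ β = ∑ k, f k • b.toWeightBasisInt k := by
    apply Subtype.val_injective
    rw [AddSubmonoidClass.coe_finsetSum]
    simp only [Submodule.coe_smul, RootPairing.Base.coe_toWeightBasisInt_apply]
    exact h
  funext k
  rw [rootCoord, h1, b.toWeightBasisInt.repr_sum_self]

lemma corootCoord_unique {β : ι} {f : b.support → ℤ}
    (h : P.coroot β = ∑ k : b.support, f k • P.coroot k) : corootCoord b β = f :=
  rootCoord_unique b.flip h

lemma rootCoord_support (j : b.support) : rootCoord b j = Pi.single j 1 := by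
  refine rootCoord_unique b ?_
  rw [Finset.sum_eq_single j]
  · simp
  · intro k _ hk
    simp [hk]
  · simp

lemma corootCoord_support (j : b.support) : corootCoord b j = Pi.single j 1 :=
  rootCoord_support b.flip j

lemma height_eq (β : ι) : b.height β = ∑ k, rootCoord b β k := by
  have h : P.root β = ∑ j ∈ b.support,
      (fun j => if hj : j ∈ b.support then rootCoord b β ⟨j, hj⟩ else 0) j • P.root j := by
    rw [← Finset.sum_coe_sort, root_eq_sum b β]
    exact Finset.sum_congr rfl fun k _ => by simp
  rw [RootPairing.Base.height_eq_sum h, ← Finset.sum_coe_sort]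
  exact Finset.sum_congr rfl fun k _ => by simp

lemma rootCoord_sign (β : ι) : (∀ k, 0 ≤ rootCoord b β k) ∨ ∀ k, rootCoord b β k ≤ 0 := by
  obtain ⟨f, -, hf, h⟩ := b.exists_root_eq_sum_int β
  rw [← Finset.sum_coe_sort] at h
  rw [rootCoord_unique b h]
  rcases hf with hf | hf
  · exact Or.inl fun k => hf.le k
  · exact Or.inr fun k => hf.le k

lemma rootCoord_nonneg {β : ι} (h : b.IsPos β) (k : b.support) : 0 ≤ rootCoord b β k := by
  rcases rootCoord_sign b β with h' | h'
  · exact h' k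
  · rw [RootPairing.Base.IsPos, height_eq] at h
    exact absurd h (not_lt.2 (Finset.sum_nonpos fun k _ => h' k))

lemma rootCoord_nonpos {β : ι} (h : ¬ b.IsPos β) (k : b.support) : rootCoord b β k ≤ 0 := by
  rcases rootCoord_sign b β with h' | h'
  · rw [RootPairing.Base.isPos_iff', height_eq] at h
    exact absurd (Finset.sum_nonneg fun k _ => h' k) h
  · exact h' k

lemma isPos_of_pos {β : ι} {k : b.support} (h : 0 < rootCoord b β k) : b.IsPos β := by
  by_contra hn
  exact absurd h (not_lt.2 (rootCoord_nonpos b hn k))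

lemma isPos_iff_forall {β : ι} : b.IsPos β ↔ ∀ k, 0 ≤ rootCoord b β k := by
  refine ⟨rootCoord_nonneg b, fun h => ?_⟩
  rw [RootPairing.Base.isPos_iff', height_eq]
  exact Finset.sum_nonneg fun k _ => h k

lemma exists_rootCoord_ne_zero (β : ι) : ∃ k, rootCoord b β k ≠ 0 := by
  by_contra! h
  apply b.height_ne_zero β
  rw [height_eq]
  exact Finset.sum_eq_zero fun k _ => h k

variable [P.IsCrystallographic]

lemma rootCoord_reflectionPerm (j : b.support) (β : ι) : rootCoord b (P.reflectionPerm j β) =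
    rootCoord b β - P.pairingIn ℤ β j • Pi.single j 1 := by
  refine rootCoord_unique b ?_
  rw [root_reflectionPerm, reflection_apply_root' ℤ]
  simp only [Pi.sub_apply, sub_smul, Finset.sum_sub_distrib, ← root_eq_sum b β]
  congr 1
  rw [Finset.sum_eq_single j]
  · simp
  · intro k _ hk
    simp [hk]
  · simp

lemma corootCoord_reflectionPerm (j : b.support) (β : ι) :
    corootCoord b (P.reflectionPerm j β) =
      corootCoord b β - P.pairingIn ℤ j β • Pi.single j 1 :=
  rootCoord_reflectionPerm b.flip j β

end coordinates

variable {ι R M N : Type*} [Fintype ι] [Field R] [CharZero R] [AddCommGroup M] [Module R M]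
  [AddCommGroup N] [Module R N] {P : RootPairing ι R M N} [P.IsRootSystem] [P.IsCrystallographic]
  (b : P.Base)

lemma cartan_apply (i j : b.support) : cartan b i j = P.pairingIn ℤ j i := rfl

lemma pairingIn_eq_sum_root (β γ : ι) :
    P.pairingIn ℤ β γ = ∑ k, rootCoord b β k * P.pairingIn ℤ k γ := by
  apply FaithfulSMul.algebraMap_injective ℤ R
  rw [map_sum, algebraMap_pairingIn, ← root_coroot_eq_pairing, root_eq_sum b β]
  simp only [map_sum, LinearMap.sum_apply, map_mul, algebraMap_pairingIn, map_zsmul,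
    LinearMap.smul_apply, zsmul_eq_mul, root_coroot_eq_pairing]
  simp only [eq_intCast]

lemma pairingIn_eq_sum_coroot (β γ : ι) :
    P.pairingIn ℤ β γ = ∑ k, corootCoord b γ k * P.pairingIn ℤ β k := by
  apply FaithfulSMul.algebraMap_injective ℤ R
  rw [map_sum, algebraMap_pairingIn, ← root_coroot_eq_pairing, coroot_eq_sum b γ]
  simp only [map_sum, map_mul, algebraMap_pairingIn, map_zsmul, zsmul_eq_mul,
    root_coroot_eq_pairing]
  simp only [eq_intCast]

/-- The coordinates of roots and coroots are proportional. -/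
lemma sqLength_mul_corootCoord [P.IsReduced] (β : ι) (k : b.support) :
    (sqLength P β : ℤ) * corootCoord b β k = sqLength P k * rootCoord b β k := by
  have key : ∀ β : ι, ∀ k : b.support, (P.posRootForm ℤ).rootLength β * corootCoord b β k =
      (P.posRootForm ℤ).rootLength k * rootCoord b β k := by
    intro β
    refine b.induction_reflect β (p := fun β => ∀ k : b.support,
      (P.posRootForm ℤ).rootLength β * corootCoord b β k =
      (P.posRootForm ℤ).rootLength k * rootCoord b β k) ?_ ?_ ?_
    · intro γ h k
      have h1 : rootCoord b (P.reflectionPerm γ γ) = -rootCoord b γ := by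
        refine rootCoord_unique b ?_
        rw [root_reflectionPerm, reflection_apply_self]
        simp only [Pi.neg_apply, neg_smul, Finset.sum_neg_distrib, ← root_eq_sum b γ]
      have h2 : corootCoord b (P.reflectionPerm γ γ) = -corootCoord b γ := by
        refine corootCoord_unique b ?_
        rw [coroot_reflectionPerm, coreflection_apply_self]
        simp only [Pi.neg_apply, neg_smul, Finset.sum_neg_distrib, ← coroot_eq_sum b γ]
      rw [RootPositiveForm.rootLength_reflectionPerm_self, h1, h2, Pi.neg_apply, Pi.neg_apply,
        mul_neg, mul_neg, h]
    · intro j hj k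
      rw [rootCoord_support b ⟨j, hj⟩, corootCoord_support b ⟨j, hj⟩]
      by_cases hk : k = ⟨j, hj⟩
      · subst hk; rfl
      · simp [hk]
    · intro γ j h hj k
      have hl : (P.posRootForm ℤ).rootLength (P.reflectionPerm j γ) =
          (P.posRootForm ℤ).rootLength γ := by
        apply FaithfulSMul.algebraMap_injective ℤ R
        rw [RootPositiveForm.algebraMap_rootLength, RootPositiveForm.algebraMap_rootLength,
          root_reflectionPerm]
        exact (P.posRootForm ℤ).isOrthogonal_reflection j _ _
      have hs := (P.posRootForm ℤ).pairingIn_mul_eq_pairingIn_mul_swap γ j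
      have e1 := congrFun (rootCoord_reflectionPerm b ⟨j, hj⟩ γ) k
      have e2 := congrFun (corootCoord_reflectionPerm b ⟨j, hj⟩ γ) k
      dsimp only at e1 e2
      rw [hl, e1, e2]
      simp only [Pi.sub_apply, Pi.smul_apply, smul_eq_mul, mul_sub, h k]
      congr 1
      by_cases hk : k = ⟨j, hj⟩
      · subst hk
        simp only [Pi.single_eq_same, mul_one]
        linear_combination hs
      · simp [hk]
  rw [sqLength_eq, sqLength_eq, key]

lemma corootCoord_nonneg [P.IsReduced] {β : ι} (h : b.IsPos β) (k : b.support) :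
    0 ≤ corootCoord b β k := by
  have h1 := sqLength_mul_corootCoord b β k
  have h2 : (0 : ℤ) < sqLength P β := by exact_mod_cast sqLength_pos β
  have h3 : (0 : ℤ) < sqLength P k := by exact_mod_cast sqLength_pos (k : ι)
  have h4 := rootCoord_nonneg b h k
  by_contra hn
  nlinarith [mul_nonneg h3.le h4]

lemma isPos_flip_iff [P.IsReduced] (β : ι) : b.flip.IsPos β ↔ b.IsPos β := by
  have h1 := sqLength_mul_corootCoord b β
  have h2 : (0 : ℤ) < sqLength P β := by exact_mod_cast sqLength_pos β
  refine ⟨fun h => ?_, fun h => (isPos_iff_forall b.flip).2 (corootCoord_nonneg b h)⟩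
  rw [isPos_iff_forall]
  intro k
  have h3 : (0 : ℤ) < sqLength P k := by exact_mod_cast sqLength_pos (k : ι)
  have h4 : 0 ≤ corootCoord b β k := rootCoord_nonneg b.flip h k
  have := h1 k
  by_contra hn
  nlinarith [mul_nonneg h2.le h4]

/-! ### Sums over positive roots -/

/-- The positive roots. -/
def posRoots : Finset ι := Finset.univ.filter fun β => b.IsPos β

lemma mem_posRoots {β : ι} : β ∈ posRoots b ↔ b.IsPos β := by simp [posRoots]

lemma support_mem_posRoots (j : b.support) : (j : ι) ∈ posRoots b :=
  (mem_posRoots b).2 (b.isPos_of_mem_support j.2)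

/-- A simple reflection permutes the other positive roots. -/
lemma sum_erase_reflectionPerm [P.IsReduced] {A : Type*} [AddCommMonoid A] (j : b.support)
    (f : ι → A) : ∑ β ∈ (posRoots b).erase j, f (P.reflectionPerm j β) =
      ∑ β ∈ (posRoots b).erase j, f β := by
  have hmap : ∀ β ∈ (posRoots b).erase (j : ι), P.reflectionPerm j β ∈ (posRoots b).erase (j : ι) := by
    intro β hβ
    rw [Finset.mem_erase, mem_posRoots] at hβ ⊢
    have hp := hβ.2.reflectionPerm j.2 hβ.1
    refine ⟨fun he => ?_, hp⟩
    have h1 : β = P.reflectionPerm j j := by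
      have h0 := congrArg (P.reflectionPerm j) he
      rwa [reflectionPerm_self] at h0
    have h2 := rootCoord_reflectionPerm b j j
    rw [← h1, rootCoord_support b j, pairingIn_same] at h2
    have h3 := rootCoord_nonneg b hβ.2 j
    rw [h2] at h3
    simp at h3
  refine Finset.sum_bij' (fun β _ => P.reflectionPerm j β) (fun β _ => P.reflectionPerm j β)
    hmap hmap ?_ ?_ ?_ <;> intros <;> simp

/-- The pairing of `2ρ` with a simple coroot: the simple reflection permutes the positive roots
other than `α_j` and negates their pairings with `α_j^∨`, so only `α_j` contributes. -/
lemma sum_pairingIn_posRoots [P.IsReduced] (j : b.support) :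
    ∑ β ∈ posRoots b, P.pairingIn ℤ β j = 2 := by
  rw [← Finset.add_sum_erase _ _ (support_mem_posRoots b j), pairingIn_same]
  have h := sum_erase_reflectionPerm b j fun β => P.pairingIn ℤ β j
  have h2 : ∀ β, P.pairingIn ℤ (P.reflectionPerm j β) j = -P.pairingIn ℤ β j := by
    intro β
    rw [← pairingIn_reflectionPerm, pairingIn_reflectionPerm_self_right]
  simp only [h2, Finset.sum_neg_distrib] at h
  omega

lemma sum_pairingIn_posRoots' [P.IsReduced] (j : b.support) :
    ∑ β ∈ posRoots b, P.pairingIn ℤ j β = 2 := by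
  have h := sum_pairingIn_posRoots b.flip j
  have h2 : posRoots b.flip = posRoots b := by
    ext β
    rw [mem_posRoots, mem_posRoots, isPos_flip_iff]
  rwa [h2] at h

end

end DeformedW

namespace DeformedW

noncomputable section

open scoped Classical
open RootPairing

variable {ι R M N : Type*} [Fintype ι] [Field R] [CharZero R] [AddCommGroup M] [Module R M]
  [AddCommGroup N] [Module R N] {P : RootPairing ι R M N} [P.IsRootSystem] [P.IsCrystallographic]
  [P.IsReduced] [P.IsIrreducible] (b : P.Base)

/-! ### Normalized lengths and the Weyl vector -/

/-- In an irreducible system, squared lengths differ at most by a factor `2` or `3`. Hence the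
truncated division in the definition of the normalized lengths is exact. -/
lemma iInf_sqLength_dvd (β : ι) : ⨅ α, sqLength P α ∣ sqLength P β := by
  have : Nonempty ι := ⟨β⟩
  obtain ⟨γ, hγ⟩ := exists_eq_ciInf_of_finite (f := fun α => sqLength P α)
  have hle := iInf_sqLength_le (P := P) β
  have hpos := sqLength_pos (P := P) γ
  rw [← hγ] at hle ⊢
  have h1 : ∀ α : ι, (P.posRootForm ℤ).toInvariantForm.form (P.root α) (P.root α) = ((sqLength P α : ℤ) : R) := by
    intro α
    rw [sqLength_eq, ← eq_intCast (algebraMap ℤ R), RootPositiveForm.algebraMap_rootLength]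
    rfl
  have h := (P.posRootForm ℤ).toInvariantForm.apply_eq_or β γ
  rw [h1, h1] at h
  have h2 : sqLength P β = sqLength P γ ∨ sqLength P β = 2 * sqLength P γ ∨
      sqLength P β = 3 * sqLength P γ ∨ sqLength P γ = 2 * sqLength P β ∨
      sqLength P γ = 3 * sqLength P β := by
    exact_mod_cast h
  rcases h2 with h | h | h | h | h
  · rw [h]
  · rw [h]; exact dvd_mul_left _ _
  · rw [h]; exact dvd_mul_left _ _
  · omega
  · omega

/-- The squared length of a root, where short roots have squared length `1`. -/
def lengthRatio (P : RootPairing ι R M N) [P.IsCrystallographic] (β : ι) : ℤ :=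
  ((sqLength P β / (⨅ α, sqLength P α) : ℕ) : ℤ)

lemma lengthRatio_mul (β : ι) :
    lengthRatio P β * ((⨅ α, sqLength P α : ℕ) : ℤ) = sqLength P β := by
  rw [lengthRatio]
  exact_mod_cast Nat.div_mul_cancel (iInf_sqLength_dvd β)

lemma iInf_sqLength_ne_zero (β : ι) : ((⨅ α, sqLength P α : ℕ) : ℤ) ≠ 0 := by
  exact_mod_cast (iInf_sqLength_pos (P := P) β).ne'

lemma lengthRatio_pos (β : ι) : 0 < lengthRatio P β := by
  rw [lengthRatio]
  exact_mod_cast Nat.div_pos (iInf_sqLength_le _) (iInf_sqLength_pos (P := P) β)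

lemma lengthRatio_support (j : b.support) : lengthRatio P j = symmetrizer b j := rfl

lemma lengthRatio_swap (β γ : ι) :
    P.pairingIn ℤ β γ * lengthRatio P γ = P.pairingIn ℤ γ β * lengthRatio P β := by
  have h := (P.posRootForm ℤ).pairingIn_mul_eq_pairingIn_mul_swap γ β
  rw [← sqLength_eq, ← sqLength_eq, ← lengthRatio_mul, ← lengthRatio_mul] at h
  refine mul_right_cancel₀ (iInf_sqLength_ne_zero (P := P) β) ?_
  linear_combination h

lemma lengthRatio_reflectionPerm (α β : ι) :
    lengthRatio P (P.reflectionPerm α β) = lengthRatio P β := by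
  have hl : (P.posRootForm ℤ).rootLength (P.reflectionPerm α β) =
      (P.posRootForm ℤ).rootLength β := by
    apply FaithfulSMul.algebraMap_injective ℤ R
    rw [RootPositiveForm.algebraMap_rootLength, RootPositiveForm.algebraMap_rootLength,
      root_reflectionPerm]
    exact (P.posRootForm ℤ).isOrthogonal_reflection α _ _
  rw [← sqLength_eq, ← sqLength_eq, ← lengthRatio_mul, ← lengthRatio_mul] at hl
  exact mul_right_cancel₀ (iInf_sqLength_ne_zero (P := P) β) hl

lemma symmetrizer_mul_cartan (j k : b.support) :
    symmetrizer b j * cartan b j k = symmetrizer b k * cartan b k j := by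
  have h := lengthRatio_swap (P := P) k j
  rw [lengthRatio_support, lengthRatio_support] at h
  rw [cartan_apply, cartan_apply]
  linear_combination h

lemma rhoWeight_eq (i : b.support) :
    rhoWeight b i = symmetrizer b i * ∑ β ∈ posRoots b, rootCoord b β i := by
  rw [rhoWeight, posRoots, Finset.sum_filter]
  rfl

lemma rhoCoweight_eq (i : b.support) :
    rhoCoweight b i = ∑ β ∈ posRoots b, corootCoord b β i := by
  rw [rhoCoweight, posRoots, Finset.sum_filter]
  rfl

/-- Symmetrizing `C` turns the sum into `r_k` times the pairing of `2ρ` with `α_k^∨`. -/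
lemma sum_rhoWeight_mul_cartan (k : b.support) :
    ∑ j, rhoWeight b j * cartan b j k = 2 * symmetrizer b k := by
  have h : ∀ j, rhoWeight b j * cartan b j k =
      symmetrizer b k * ∑ β ∈ posRoots b, rootCoord b β j * P.pairingIn ℤ j k := by
    intro j
    rw [rhoWeight_eq, ← Finset.sum_mul, ← cartan_apply b k j]
    linear_combination (∑ β ∈ posRoots b, rootCoord b β j) * symmetrizer_mul_cartan b j k
  simp only [h]
  rw [← Finset.mul_sum, Finset.sum_comm]
  simp only [← pairingIn_eq_sum_root]
  rw [sum_pairingIn_posRoots, mul_comm]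

lemma sum_rhoCoweight_mul_cartan (k : b.support) :
    ∑ j, rhoCoweight b j * cartan b j k = 2 := by
  simp only [rhoCoweight_eq, Finset.sum_mul]
  rw [Finset.sum_comm]
  simp only [cartan_apply, ← pairingIn_eq_sum_coroot]
  exact sum_pairingIn_posRoots' b k

/-! ### Bipartiteness of the Dynkin diagram -/

lemma cartan_eq_zero_symm {j k : b.support} (h : cartan b j k = 0) : cartan b k j = 0 := by
  have h1 := symmetrizer_mul_cartan b j k
  rw [h, mul_zero] at h1
  exact (mul_eq_zero.1 h1.symm).resolve_left (symmetrizer_pos b k).ne'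

/-- The Dynkin diagram is a forest: a nonempty set of vertices contains a vertex with at most one
neighbour. -/
lemma exists_sum_cartan_pos (K : Finset b.support) (hK : K.Nonempty) :
    ∃ k ∈ K, 0 < ∑ l ∈ K, cartan b k l := by
  by_contra! hn
  obtain ⟨i, hi⟩ := hK
  obtain ⟨d, hd, hS⟩ := b.exists_cartanMatrix_mul_diagaonal_posDef
  -- The symmetrized Cartan matrix is positive definite; it is tested on the indicator function of
  -- `K`.
  set x : b.support → ℤ := fun k => if k ∈ K then 1 else 0 with hx
  have hx0 : x ≠ 0 := fun h => by simpa [hx, hi] using congrFun h i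
  have hpos := hS.dotProduct_mulVec_pos hx0
  have heq : star x ⬝ᵥ (b.cartanMatrix * Matrix.diagonal d).mulVec x =
      ∑ k ∈ K, d k * ∑ l ∈ K, cartan b k l := by
    simp only [dotProduct, Matrix.mulVec, Matrix.mul_diagonal, hx, Pi.star_apply, star_trivial,
      ite_mul, one_mul, zero_mul, mul_ite, mul_one, mul_zero, Finset.sum_ite_mem,
      Finset.univ_inter, Finset.mul_sum]
    rw [Finset.sum_comm]
    simp only [← Finset.sum_filter, Finset.filter_mem_eq_inter, Finset.univ_inter]
    refine Finset.sum_congr rfl fun k _ => Finset.sum_congr rfl fun l _ => ?_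
    rw [mul_comm]; rfl
  rw [heq] at hpos
  refine absurd hpos (not_lt.2 (Finset.sum_nonpos fun k hk => ?_))
  exact mul_nonpos_of_nonneg_of_nonpos (hd k).le (hn k hk)

/-- A vertex with at most one neighbour in `K` is removed, the rest is coloured, and the vertex gets
the colour opposite to that of its neighbour. -/
lemma exists_coloring_on (K : Finset b.support) : ∃ ε : b.support → Bool,
    ∀ j ∈ K, ∀ k ∈ K, j ≠ k → cartan b j k ≠ 0 → ε j ≠ ε k := by
  induction K using Finset.strongInduction with
  | H K ih =>
    rcases K.eq_empty_or_nonempty with rfl | hK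
    · exact ⟨fun _ => true, by simp⟩
    obtain ⟨x, hx, hpos⟩ := exists_sum_cartan_pos b K hK
    obtain ⟨ε, hε⟩ := ih (K.erase x) (Finset.erase_ssubset hx)
    rw [← Finset.add_sum_erase _ _ hx, cartan_self] at hpos
    have hnp : ∀ l ∈ K.erase x, cartan b x l ≤ 0 := fun l hl =>
      cartan_nonpos b (Finset.ne_of_mem_erase hl).symm
    -- Two neighbours would each contribute at most `-1` to the row sum, which starts from `2` and
    -- is positive.
    have huniq : ∀ l ∈ K.erase x, ∀ m ∈ K.erase x, cartan b x l ≠ 0 → cartan b x m ≠ 0 →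
        l = m := by
      intro l hl m hm h1 h2
      by_contra hne
      have hm' : m ∈ (K.erase x).erase l := Finset.mem_erase.2 ⟨Ne.symm hne, hm⟩
      rw [← Finset.add_sum_erase _ _ hl, ← Finset.add_sum_erase _ _ hm'] at hpos
      have h3 : ∑ y ∈ ((K.erase x).erase l).erase m, cartan b x y ≤ 0 :=
        Finset.sum_nonpos fun y hy =>
          hnp y (Finset.mem_of_mem_erase (Finset.mem_of_mem_erase hy))
      have h4 := hnp l hl
      have h5 := hnp m hm
      omega
    have hcol : ∃ e : Bool, ∀ l ∈ K.erase x, cartan b x l ≠ 0 → e ≠ ε l := by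
      by_cases hex : ∃ l ∈ K.erase x, cartan b x l ≠ 0
      · obtain ⟨l, hl, h1⟩ := hex
        refine ⟨!ε l, fun m hm h2 => ?_⟩
        rw [huniq m hm l hl h2 h1]
        simp
      · push Not at hex
        exact ⟨true, fun l hl h => absurd (hex l hl) h⟩
    obtain ⟨e, he⟩ := hcol
    refine ⟨Function.update ε x e, fun j hj k hk hne hc => ?_⟩
    by_cases hjx : j = x
    · subst hjx
      rw [Function.update_self, Function.update_of_ne hne.symm]
      exact he k (Finset.mem_erase.2 ⟨hne.symm, hk⟩) hc
    · by_cases hkx : k = x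
      · subst hkx
        rw [Function.update_self, Function.update_of_ne hne]
        exact (he j (Finset.mem_erase.2 ⟨hne, hj⟩) fun h => hc (cartan_eq_zero_symm b h)).symm
      · rw [Function.update_of_ne hjx, Function.update_of_ne hkx]
        exact hε j (Finset.mem_erase.2 ⟨hjx, hj⟩) k (Finset.mem_erase.2 ⟨hkx, hk⟩) hne hc

/-- The Dynkin diagram is bipartite. -/
lemma exists_coloring : ∃ ε : b.support → Bool,
    ∀ j k, (datum b).adj j k ≠ 0 → ε j ≠ ε k := by
  obtain ⟨ε, hε⟩ := exists_coloring_on b Finset.univ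
  refine ⟨ε, fun j k hjk => ?_⟩
  have hne : j ≠ k := by
    rintro rfl
    exact hjk ((datum b).adj_self j)
  refine hε j (Finset.mem_univ _) k (Finset.mem_univ _) hne fun h => hjk ?_
  have := datum_adj b j k
  rw [if_neg hne, h] at this
  omega

/-- Induction along the edges of the Dynkin diagram. -/
lemma connected_induction (p : b.support → Prop) {j₀ : b.support} (h0 : p j₀)
    (hstep : ∀ j k, p j → (datum b).adj j k ≠ 0 → p k) (j : b.support) : p j := by
  refine b.induction_on_cartanMatrix p h0 (fun j k hj hc => ?_) 
  by_cases hjk : j = k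
  · rwa [← hjk]
  refine hstep j k hj fun h => hc ?_
  have := datum_adj b j k
  rw [h, if_neg hjk] at this
  have h2 : cartan b j k = 0 := by omega
  exact h2

end

end DeformedW

namespace DeformedW

noncomputable section

open scoped Classical

/-! ### The Coxeter number of the Dynkin diagram -/

/-- A nonnegative integral involution is a permutation matrix. -/
lemma exists_perm_of_sq_eq_one {I : Type*} [Fintype I] [DecidableEq I] {Q : Matrix I I ℤ}
    (h0 : ∀ j k, 0 ≤ Q j k) (hQ : Q * Q = 1) :
    ∃ σ : I → I, (∀ j k, Q j k = if j = σ k then 1 else 0) ∧ Function.Injective σ := by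
  have hle : ∀ j k l, Q j k * Q k l ≤ (1 : Matrix I I ℤ) j l := by
    intro j k l
    rw [← hQ, Matrix.mul_apply]
    exact Finset.single_le_sum (f := fun k => Q j k * Q k l)
      (fun m _ => mul_nonneg (h0 j m) (h0 m l)) (Finset.mem_univ k)
  have hex : ∀ k, ∃ l, 0 < Q k l ∧ 0 < Q l k := by
    intro k
    have h1 : ∑ l, Q k l * Q l k ≠ 0 := by
      rw [← Matrix.mul_apply, hQ, Matrix.one_apply_eq]
      exact one_ne_zero
    obtain ⟨l, -, hl⟩ := Finset.exists_ne_zero_of_sum_ne_zero h1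
    exact ⟨l, lt_of_le_of_ne (h0 k l) (left_ne_zero_of_mul hl).symm,
      lt_of_le_of_ne (h0 l k) (right_ne_zero_of_mul hl).symm⟩
  choose σ hσ1 hσ2 using hex
  refine ⟨σ, fun j k => ?_, fun k k' hk => ?_⟩
  · by_cases hj : j = σ k
    · rw [if_pos hj, hj]
      have := hle (σ k) k (σ k)
      rw [Matrix.one_apply_eq] at this
      nlinarith [hσ1 k, hσ2 k]
    · rw [if_neg hj]
      have := hle j k (σ k)
      rw [Matrix.one_apply_ne hj] at this
      nlinarith [hσ1 k, h0 j k]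
  · by_contra hne
    have := hle k (σ k) k'
    rw [Matrix.one_apply_ne hne] at this
    have h1 := hσ1 k
    have h2 := hσ2 k'
    rw [← hk] at h2
    nlinarith

namespace CartanDatum

variable {I : Type*} [Fintype I] [DecidableEq I] (D : CartanDatum I)

/-- Cassini's identity for Chebyshev polynomials. Where `cheb h` vanishes, it makes `cheb (h - 1)`
an involution. -/
lemma cheb_mul_cheb_sub (s : ℕ) :
    D.cheb (s + 1) * D.cheb (s + 1) - D.cheb (s + 2) * D.cheb s = 1 := by
  have hcomm : ∀ s, D.cheb s * D.cheb (s + 1) = D.cheb (s + 1) * D.cheb s := by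
    intro s
    induction s with
    | zero => simp [cheb_zero]
    | succ s ih =>
      rw [cheb_add_two, mul_sub, sub_mul, ih, ← mul_assoc, ← cheb_comm]
  induction s with
  | zero => simp [cheb_zero, cheb_one]
  | succ s ih =>
    have h3 : D.cheb (s + 1 + 2) = D.adjMatrix * D.cheb (s + 2) - D.cheb (s + 1) :=
      D.cheb_add_two (s + 1)
    rw [h3, ← ih, sub_mul]
    have e1 : D.cheb (s + 1 + 1) * D.cheb (s + 1 + 1) =
        D.cheb (s + 2) * D.cheb (s + 1) * D.adjMatrix - D.cheb (s + 2) * D.cheb s := by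
      rw [show s + 1 + 1 = s + 2 from rfl]
      nth_rw 2 [cheb_add_two]
      rw [mul_sub, cheb_comm, mul_assoc]
    have e2 : D.cheb (s + 2) * D.cheb (s + 1) * D.adjMatrix =
        D.adjMatrix * D.cheb (s + 2) * D.cheb (s + 1) := by
      rw [mul_assoc, ← cheb_comm, ← mul_assoc, ← cheb_comm]
    rw [e1, e2]
    abel

lemma cheb_row (s : ℕ) (j : I) : D.cheb (s + 2) j =
    Matrix.vecMul (D.cheb (s + 1) j) D.adjMatrix - D.cheb s j := by
  rw [cheb_add_two, cheb_comm]
  rfl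

end CartanDatum

variable {ι R M N : Type*} [Fintype ι] [Field R] [CharZero R] [AddCommGroup M] [Module R M]
  [AddCommGroup N] [Module R N] {P : RootPairing ι R M N} [P.IsRootSystem] [P.IsCrystallographic]
  [P.IsReduced] [P.IsIrreducible] (b : P.Base)

lemma cartan_eq_adj (j k : b.support) :
    cartan b j k = (if j = k then 2 else 0) - ((datum b).adj j k : ℤ) := by
  rw [datum_adj]; ring

lemma sum_mul_cartan (y : b.support → ℤ) (k : b.support) : ∑ j, y j * cartan b j k =
    2 * y k - Matrix.vecMul y (datum b).adjMatrix k := by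
  simp only [cartan_eq_adj, mul_sub, Finset.sum_sub_distrib, mul_ite, mul_zero,
    Finset.sum_ite_eq', Finset.mem_univ, if_true, Matrix.vecMul, dotProduct,
    CartanDatum.adjMatrix, Matrix.of_apply]
  ring

lemma corootCoord_reflectionPerm_eq (j : b.support) (β : ι) (k : b.support) :
    corootCoord b (P.reflectionPerm j β) k =
      if k = j then Matrix.vecMul (corootCoord b β) (datum b).adjMatrix k - corootCoord b β k
      else corootCoord b β k := by
  rw [corootCoord_reflectionPerm, pairingIn_eq_sum_coroot b]
  have h := sum_mul_cartan b (corootCoord b β) j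
  simp only [cartan_apply] at h
  rw [h]
  by_cases hk : k = j
  · subst hk
    simp only [Pi.sub_apply, Pi.smul_apply, Pi.single_eq_same, smul_eq_mul, mul_one, if_true]
    ring
  · simp [hk]

/-- The product of the commuting reflections in a set of pairwise non adjacent simple roots. -/
lemma exists_corootCoord_eq_of_not_adj (K : Finset b.support)
    (hK : ∀ j ∈ K, ∀ k ∈ K, (datum b).adj j k = 0) (β : ι) : ∃ γ : ι, ∀ k, corootCoord b γ k =
      if k ∈ K then Matrix.vecMul (corootCoord b β) (datum b).adjMatrix k - corootCoord b β k
      else corootCoord b β k := by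
  induction K using Finset.induction_on with
  | empty => exact ⟨β, fun k => by simp⟩
  | insert x K hx ih =>
    obtain ⟨γ, hγ⟩ := ih fun j hj k hk =>
      hK j (Finset.mem_insert_of_mem hj) k (Finset.mem_insert_of_mem hk)
    have hA : Matrix.vecMul (corootCoord b γ) (datum b).adjMatrix x =
        Matrix.vecMul (corootCoord b β) (datum b).adjMatrix x := by
      refine Finset.sum_congr rfl fun l _ => ?_
      by_cases hl : l ∈ K
      · have h0 := hK l (Finset.mem_insert_of_mem hl) x (Finset.mem_insert_self _ _)
        simp [CartanDatum.adjMatrix, h0]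
      · rw [hγ l, if_neg hl]
    refine ⟨P.reflectionPerm x γ, fun k => ?_⟩
    rw [corootCoord_reflectionPerm_eq]
    by_cases hk : k = x
    · subst hk
      rw [if_pos rfl, if_pos (Finset.mem_insert_self _ _), hA, hγ k, if_neg hx]
    · rw [if_neg hk, hγ k]
      by_cases hk' : k ∈ K
      · rw [if_pos hk', if_pos (Finset.mem_insert_of_mem hk')]
      · rw [if_neg hk', if_neg (by simp [hk, hk'])]

section

variable {ε : b.support → Bool} (hε : ∀ j k, (datum b).adj j k ≠ 0 → ε j ≠ ε k)

include hε

lemma cheb_eq_zero_of_parity {s : ℕ} {j k : b.support} (h : ¬ (ε j = ε k ↔ Odd s)) :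
    (datum b).cheb s j k = 0 := by
  by_contra hn
  exact h (CartanDatum.odd_of_cheb_ne_zero hε s j k hn)

/-- Sums of consecutive rows of the Chebyshev matrices are coordinates of coroots. -/
lemma exists_corootCoord_eq_cheb (j : b.support) (s : ℕ) :
    ∃ β : ι, ∀ k, corootCoord b β k = (datum b).cheb (s + 1) j k + (datum b).cheb s j k := by
  induction s with
  | zero =>
    refine ⟨j, fun k => ?_⟩
    rw [corootCoord_support, CartanDatum.cheb_zero, CartanDatum.cheb_one, Matrix.one_apply,
      Pi.single_apply]
    simp [eq_comm]
  | succ s ih =>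
    obtain ⟨β, hβ⟩ := ih
    -- By parity, row `s` lives on the colour class `K` and row `s + 1` on the other one. Reflecting
    -- in all simple roots of `K` replaces row `s` by row `s + 2`; alternating the two classes is
    -- the action of a bipartite Coxeter element.
    obtain ⟨K, hK⟩ : ∃ K : Finset b.support, ∀ k, k ∈ K ↔ (ε j = ε k ↔ Odd s) :=
      ⟨Finset.univ.filter fun k => (ε j = ε k ↔ Odd s), fun k => by
        rw [Finset.mem_filter, and_iff_right (Finset.mem_univ k)]⟩
    obtain ⟨γ, hγ⟩ := exists_corootCoord_eq_of_not_adj b K (by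
        intro k hk l hl
        rw [hK] at hk hl
        by_contra hadj
        have h1 := hε k l hadj
        have h2 := hk.trans hl.symm
        revert h1 h2
        cases ε j <;> cases ε k <;> cases ε l <;> simp) β
    refine ⟨γ, fun k => ?_⟩
    have ho1 : Odd (s + 1) ↔ ¬ Odd s := by grind
    have ho2 : Odd (s + 2) ↔ Odd s := by grind
    rw [hγ k]
    by_cases hk : (ε j = ε k ↔ Odd s)
    · rw [if_pos ((hK k).2 hk)]
      have h1 : (datum b).cheb (s + 1) j k = 0 := cheb_eq_zero_of_parity b hε (by
        rw [ho1, hk]; tauto)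
      have h2 : Matrix.vecMul (corootCoord b β) (datum b).adjMatrix k =
          Matrix.vecMul ((datum b).cheb (s + 1) j) (datum b).adjMatrix k := by
        refine Finset.sum_congr rfl fun l _ => ?_
        rw [hβ l]
        by_cases hl : (datum b).adj l k = 0
        · simp [CartanDatum.adjMatrix, hl]
        · have h3 : (datum b).cheb s j l = 0 := cheb_eq_zero_of_parity b hε (by
            rw [← hk]
            have := hε l k hl
            revert this
            cases ε j <;> cases ε k <;> cases ε l <;> simp)
          rw [h3, add_zero]
      rw [h2, hβ k, h1, CartanDatum.cheb_row, Pi.sub_apply]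
      ring
    · rw [if_neg fun h => hk ((hK k).1 h), hβ k, cheb_eq_zero_of_parity b hε hk,
        cheb_eq_zero_of_parity b hε (s := s + 1 + 1) (j := j) (k := k) (by rwa [ho2])]
      ring

/-- If all entries of the row were nonnegative, finiteness of the root system would make the
sequence of rows periodic. Its sum over a period is killed by the nonsingular Cartan matrix, so all
rows in the period vanish, although their sums are coordinates of coroots. -/
lemma exists_cheb_neg (j : b.support) : ∃ s k, (datum b).cheb s j k < 0 := by
  by_contra! h0
  choose β hβ using exists_corootCoord_eq_cheb b hε j
  -- Recording the parity of `m` along with the coroot allows the two rows to be recovered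
  -- separately from their sum.
  obtain ⟨m, m', hne, heq⟩ := Finite.exists_ne_map_eq_of_infinite
    fun m : ℕ => (β m, decide (Odd m))
  wlog hlt : m < m' generalizing m m'
  · exact this m' m hne.symm heq.symm (by omega)
  rw [Prod.mk.injEq, decide_eq_decide] at heq
  obtain ⟨hb, ho⟩ := heq
  have hrow : ∀ k, (datum b).cheb (m + 1) j k = (datum b).cheb (m' + 1) j k ∧
      (datum b).cheb m j k = (datum b).cheb m' j k := by
    intro k
    have e1 := hβ m k
    have e2 := hβ m' k
    rw [hb] at e1
    have ho1 : ∀ s, Odd (s + 1) ↔ ¬ Odd s := fun s => by grind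
    by_cases hk : (ε j = ε k ↔ Odd m)
    · have h1 := cheb_eq_zero_of_parity b hε (s := m + 1) (j := j) (k := k) (by rw [ho1, hk]; tauto)
      have h2 := cheb_eq_zero_of_parity b hε (s := m' + 1) (j := j) (k := k)
        (by rw [ho1, hk, ho]; tauto)
      constructor <;> linarith
    · have h1 := cheb_eq_zero_of_parity b hε hk
      have h2 := cheb_eq_zero_of_parity b hε (s := m') (j := j) (k := k) (by rwa [← ho])
      constructor <;> linarith
  -- Multiplied by `C = 2 - (2 - C)`, the partial sums of the recursion telescope to boundary rows.
  set S : ℕ → b.support → ℤ := fun n k => ∑ s ∈ Finset.range n, (datum b).cheb (s + 1) j k with hS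
  have hSA : ∀ n k, ∑ l, S n l * cartan b l k = (datum b).cheb 1 j k + (datum b).cheb n j k -
      (datum b).cheb (n + 1) j k := by
    intro n k
    induction n with
    | zero => simp [hS, CartanDatum.cheb_zero]
    | succ n ih =>
      have : S (n + 1) = S n + (datum b).cheb (n + 1) j := by
        funext k; simp [hS, Finset.sum_range_succ]
      have h2 := congrFun ((datum b).cheb_row n j) k
      rw [Pi.sub_apply] at h2
      rw [this]
      simp only [Pi.add_apply, add_mul, Finset.sum_add_distrib]
      rw [ih, sum_mul_cartan, show n + 1 + 1 = n + 2 from rfl, h2]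
      ring
  have hSeq : Matrix.vecMul (S m' - S m) (cartan b) = 0 := by
    funext k
    rw [Matrix.sub_vecMul, Pi.sub_apply]
    have e1 : Matrix.vecMul (S m') (cartan b) k = _ := hSA m' k
    have e2 : Matrix.vecMul (S m) (cartan b) k = _ := hSA m k
    rw [e1, e2, (hrow k).1, (hrow k).2, sub_self]
    rfl
  have hS0 := Matrix.eq_zero_of_vecMul_eq_zero (det_cartan_ne_zero b) hSeq
  have hz : ∀ k, (datum b).cheb (m + 1) j k = 0 := by
    intro k
    have h1 : S m' k - S m k = 0 := congrFun hS0 k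
    rw [hS] at h1
    dsimp only at h1
    rw [Finset.sum_range_sub_sum_range hlt.le] at h1
    exact (Finset.sum_eq_zero_iff_of_nonneg fun s _ => h0 (s + 1) k).1 h1 m (by simp [hlt])
  have hz2 : ∀ k, (datum b).cheb m j k = 0 := by
    intro k
    have h1 := congrFun ((datum b).cheb_row m j) k
    have h2 : (datum b).cheb (m + 1) j = 0 := funext hz
    rw [h2, Matrix.zero_vecMul, Pi.sub_apply, Pi.zero_apply, zero_sub] at h1
    have h3 := h0 (m + 2) k
    have h4 := h0 m k
    linarith
  obtain ⟨k, hk⟩ : ∃ k : b.support, corootCoord b (β m) k ≠ 0 :=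
    exists_rootCoord_ne_zero b.flip (β m)
  have := hβ m k
  rw [hz, hz2] at this
  exact hk this

/-- Before the first vanishing row, the Chebyshev matrices are nonnegative. -/
lemma exists_row_eq_zero (j : b.support) : ∃ s, 1 ≤ s ∧ (∀ k, (datum b).cheb s j k = 0) ∧
    ∀ s' ≤ s, ∀ k, 0 ≤ (datum b).cheb s' j k := by
  have hex := exists_cheb_neg b hε j
  obtain ⟨k, hk⟩ := Nat.find_spec hex
  have hmin : ∀ s' < Nat.find hex, ∀ k, 0 ≤ (datum b).cheb s' j k := by
    intro s' hs' k
    have := Nat.find_min hex hs'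
    push Not at this
    exact this k
  obtain ⟨s, hs⟩ : ∃ s, Nat.find hex = s + 1 := by
    refine Nat.exists_eq_succ_of_ne_zero fun h0 => ?_
    rw [h0, CartanDatum.cheb_zero] at hk
    simp at hk
  rw [hs] at hk hmin
  refine ⟨s, ?_, ?_, fun s' hs' => hmin s' (by omega)⟩
  · by_contra hlt
    have : s = 0 := by omega
    rw [this, zero_add, CartanDatum.cheb_one, Matrix.one_apply] at hk
    split_ifs at hk <;> omega
  -- Row `s + 1` is the first with a negative entry, so the coroot whose coordinates are rows `s +
  -- 1` and `s` added is negative. Row `s` occupies the other colour class and is nonnegative, hence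
  -- it vanishes.
  · obtain ⟨β, hβ⟩ := exists_corootCoord_eq_cheb b hε j s
    have ho1 : Odd (s + 1) ↔ ¬ Odd s := by grind
    have hpar := CartanDatum.odd_of_cheb_ne_zero hε _ j k hk.ne
    have h0 : (datum b).cheb s j k = 0 := cheb_eq_zero_of_parity b hε (by rw [hpar, ho1]; tauto)
    have hneg : ∀ l, corootCoord b β l ≤ 0 := by
      rcases rootCoord_sign b.flip β with h | h
      · have h1 : 0 ≤ corootCoord b β k := h k
        rw [hβ k, h0] at h1
        omega
      · exact h
    intro l
    have h1 := hneg l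
    rw [hβ l] at h1
    have h2 := hmin s (by omega) l
    by_cases hl : (ε j = ε l ↔ Odd s)
    · have h3 := cheb_eq_zero_of_parity b hε (s := s + 1) (j := j) (k := l)
        (by rw [ho1, hl]; tauto)
      omega
    · exact cheb_eq_zero_of_parity b hε hl

/-- Existence of the Coxeter number of the Dynkin diagram. -/
lemma exists_isCoxeter [Nonempty b.support] : ∃ h σ, (datum b).IsCoxeter h σ := by
  have hex : ∃ s, 1 ≤ s ∧ ∃ j, ∀ k, (datum b).cheb s j k = 0 := by
    obtain ⟨j⟩ := ‹Nonempty b.support›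
    obtain ⟨s, h1, h2, -⟩ := exists_row_eq_zero b hε j
    exact ⟨s, h1, j, h2⟩
  set h := Nat.find hex with hh
  obtain ⟨h1, j₀, hj₀⟩ := Nat.find_spec hex
  rw [← hh] at h1 hj₀
  have hnn : ∀ s ≤ h, ∀ j k, 0 ≤ (datum b).cheb s j k := by
    intro s hs j k
    obtain ⟨s', h1', h2', h3'⟩ := exists_row_eq_zero b hε j
    exact h3' s (hs.trans (Nat.find_min' hex ⟨h1', j, h2'⟩)) k
  -- Vanishing of one row spreads along the edges: `(2 - C) cheb h` has the same zero row, and its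
  -- summands are nonnegative because `h` was chosen minimal over all rows.
  have hzero : (datum b).cheb h = 0 := by
    have key : ∀ j, ∀ k, (datum b).cheb h j k = 0 := by
      refine connected_induction b (fun j => ∀ k, (datum b).cheb h j k = 0) hj₀ ?_
      intro j l hj hadj k
      have e1 : ((datum b).adjMatrix * (datum b).cheb h) j k = 0 := by
        rw [CartanDatum.cheb_comm, Matrix.mul_apply]
        exact Finset.sum_eq_zero fun m _ => by rw [hj m, zero_mul]
      rw [Matrix.mul_apply] at e1
      have e2 := (Finset.sum_eq_zero_iff_of_nonneg fun m _ =>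
        mul_nonneg (Int.natCast_nonneg _) (hnn h le_rfl m k)).1 e1 l (Finset.mem_univ _)
      exact (mul_eq_zero.1 e2).resolve_left (by exact_mod_cast hadj)
    ext j k
    exact key j k
  have h2 : 2 ≤ h := by
    by_contra hlt
    have he : h = 1 := by omega
    rw [he, CartanDatum.cheb_one] at hj₀
    simpa using hj₀ j₀
  obtain ⟨m, hm⟩ : ∃ m, h = m + 2 := ⟨h - 2, by omega⟩
  have hsq := (datum b).cheb_mul_cheb_sub m
  rw [← hm, hzero, zero_mul, sub_zero] at hsq
  have hm1 : h - 1 = m + 1 := by omega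
  obtain ⟨σ, hσ1, hσ2⟩ := exists_perm_of_sq_eq_one (hnn (m + 1) (by omega)) hsq
  exact ⟨h, σ, h2, hnn, hzero, by rw [hm1]; exact hσ1, hσ2⟩

end

end

end DeformedW

namespace DeformedW

noncomputable section

open scoped Classical
open RootPairing

variable {ι R M N : Type*} [Fintype ι] [Field R] [CharZero R] [AddCommGroup M] [Module R M]
  [AddCommGroup N] [Module R N] {P : RootPairing ι R M N} [P.IsRootSystem] [P.IsCrystallographic]
  [P.IsReduced] [P.IsIrreducible] (b : P.Base)

/-! ### Quadratic sums over the positive roots -/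

/-- The matrix of `∑_{β > 0} g_β β ⊗ β^∨`. -/
def quadSum (g : ι → ℤ) (i l : b.support) : ℤ :=
  ∑ β ∈ posRoots b, g β * corootCoord b β i * P.pairingIn ℤ β l

section

variable {g : ι → ℤ} (hg : ∀ (j : b.support) (β : ι), g (P.reflectionPerm j β) = g β)

include hg

/-- The reflection in `α_l` fixes the coefficient of `α_i^∨` for `i ≠ l` and negates the pairing
with `α_l^∨`. -/
lemma quadSum_of_ne {i l : b.support} (h : i ≠ l) : quadSum b g i l = 0 := by
  rw [quadSum, ← Finset.add_sum_erase _ _ (support_mem_posRoots b l), corootCoord_support,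
    Pi.single_eq_of_ne h, mul_zero, zero_mul, zero_add]
  have h1 := sum_erase_reflectionPerm b l fun β => g β * corootCoord b β i * P.pairingIn ℤ β l
  simp only [hg, corootCoord_reflectionPerm, ← pairingIn_reflectionPerm,
    pairingIn_reflectionPerm_self_right, Pi.sub_apply, Pi.smul_apply, Pi.single_eq_of_ne h,
    smul_zero, sub_zero, mul_neg, Finset.sum_neg_distrib] at h1
  omega

lemma sum_cartan_mul_quadSum (j l : b.support) : cartan b l j * quadSum b g l l =
    ∑ β ∈ posRoots b, g β * P.pairingIn ℤ j β * P.pairingIn ℤ β l := by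
  have h1 : ∑ i, cartan b i j * quadSum b g i l = cartan b l j * quadSum b g l l := by
    rw [Finset.sum_eq_single l]
    · intro i _ hi
      rw [quadSum_of_ne b hg hi, mul_zero]
    · simp
  rw [← h1]
  simp only [quadSum, Finset.mul_sum]
  rw [Finset.sum_comm]
  refine Finset.sum_congr rfl fun β _ => ?_
  rw [pairingIn_eq_sum_coroot b (j : ι) β, Finset.mul_sum, Finset.sum_mul]
  exact Finset.sum_congr rfl fun i _ => by rw [cartan_apply]; ring

/-- Both sides compute the same sum `∑ g_β ⟨α_j, β^∨⟩ ⟨β, α_l^∨⟩` up to lengths, which is symmetric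
in `j` and `l` after normalization; `C_{jl} ≠ 0` can be cancelled. With connectedness, the matrix is
scalar. -/
lemma quadSum_eq_of_adj {j l : b.support} (h : (datum b).adj j l ≠ 0) :
    quadSum b g j j = quadSum b g l l := by
  have hne : j ≠ l := by
    rintro rfl
    exact h ((datum b).adj_self j)
  have h1 := sum_cartan_mul_quadSum b hg j l
  have h2 := sum_cartan_mul_quadSum b hg l j
  have h3 : symmetrizer b l * (cartan b l j * quadSum b g l l) =
      symmetrizer b j * (cartan b j l * quadSum b g j j) := by
    rw [h1, h2, Finset.mul_sum, Finset.mul_sum]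
    refine Finset.sum_congr rfl fun β _ => ?_
    have e1 := lengthRatio_swap (P := P) β l
    have e2 := lengthRatio_swap (P := P) β j
    rw [lengthRatio_support] at e1 e2
    linear_combination g β * P.pairingIn ℤ j β * e1 - g β * P.pairingIn ℤ l β * e2
  have h4 := symmetrizer_mul_cartan b j l
  have h5 : cartan b j l ≠ 0 := by
    intro h0
    have := datum_adj b j l
    rw [h0, if_neg hne] at this
    omega
  have h6 := (symmetrizer_pos b j).ne'
  refine mul_left_cancel₀ (mul_ne_zero h6 h5) ?_
  linear_combination -quadSum b g l l * h4 - h3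

lemma quadSum_eq (i j l : b.support) :
    quadSum b g j l = if j = l then quadSum b g i i else 0 := by
  by_cases h : j = l
  · subst h
    rw [if_pos rfl]
    refine connected_induction b (fun j => quadSum b g j j = quadSum b g i i) (j₀ := i) rfl ?_ j
    intro j k hj hadj
    rw [← quadSum_eq_of_adj b hg hadj, hj]
  · rw [if_neg h, quadSum_of_ne b hg h]

/-- A scalar matrix evaluated at `θ` and `θ^∨`, with `⟨θ, θ^∨⟩ = 2`. This lets the scalar be
computed from one root. -/
lemma sum_pairingIn_mul_pairingIn (i : b.support) (θ : ι) :
    ∑ β ∈ posRoots b, g β * P.pairingIn ℤ θ β * P.pairingIn ℤ β θ = 2 * quadSum b g i i := by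
  have h1 : ∀ β : ι, g β * P.pairingIn ℤ θ β * P.pairingIn ℤ β θ = ∑ j : b.support, ∑ l : b.support,
      P.pairingIn ℤ θ j * corootCoord b θ l * (g β * corootCoord b β j * P.pairingIn ℤ β l) := by
    intro β
    rw [pairingIn_eq_sum_coroot b θ β, pairingIn_eq_sum_coroot b β θ, mul_assoc,
      Finset.sum_mul_sum, Finset.mul_sum]
    simp only [Finset.mul_sum]
    exact Finset.sum_congr rfl fun j _ => Finset.sum_congr rfl fun l _ => by ring
  simp only [h1]
  rw [Finset.sum_comm]
  have h2 : ∀ j : b.support, ∑ β ∈ posRoots b, ∑ l, P.pairingIn ℤ θ j * corootCoord b θ l *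
      (g β * corootCoord b β j * P.pairingIn ℤ β l) =
      corootCoord b θ j * P.pairingIn ℤ θ j * quadSum b g i i := by
    intro j
    rw [Finset.sum_comm]
    simp only [← Finset.mul_sum]
    have h3 : ∀ l : b.support, ∑ β ∈ posRoots b, g β * corootCoord b β j * P.pairingIn ℤ β l =
        if j = l then quadSum b g i i else 0 := fun l => quadSum_eq b hg i j l
    simp only [h3, mul_ite, mul_zero, Finset.sum_ite_eq, Finset.mem_univ, if_true]
    ring
  simp only [h2]
  rw [← Finset.sum_mul, ← pairingIn_eq_sum_coroot, pairingIn_same]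

end

/-! ### The highest root -/

lemma exists_nat_of_mem_closure {x : M} (hx : x ∈ AddSubmonoid.closure (P.root '' b.support)) :
    ∃ f : b.support → ℕ, x = ∑ k : b.support, f k • P.root k := by
  induction hx using AddSubmonoid.closure_induction with
  | mem x hx =>
    obtain ⟨j, hj, rfl⟩ := hx
    refine ⟨Pi.single ⟨j, hj⟩ 1, ?_⟩
    rw [Finset.sum_eq_single ⟨j, hj⟩]
    · simp
    · intro k _ hk
      simp [hk]
    · simp
  | zero => exact ⟨0, by simp⟩
  | add x y _ _ hx hy =>
    obtain ⟨f, rfl⟩ := hx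
    obtain ⟨g, rfl⟩ := hy
    exact ⟨f + g, by simp [add_smul, Finset.sum_add_distrib]⟩

section highest

variable {b} {θ : ι} (hθ : IsHighestRoot b θ)

include hθ

lemma IsHighestRoot.rootCoord_le (β : ι) (k : b.support) :
    rootCoord b β k ≤ rootCoord b θ k := by
  obtain ⟨f, hf⟩ := exists_nat_of_mem_closure b (hθ β)
  have h1 : rootCoord b θ = rootCoord b β + fun k => (f k : ℤ) := by
    refine rootCoord_unique b ?_
    simp only [Pi.add_apply, add_smul, Finset.sum_add_distrib, ← root_eq_sum b β, natCast_zsmul,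
      ← hf]
    abel
  rw [h1]
  simp

lemma IsHighestRoot.isPos : b.IsPos θ := by
  obtain ⟨k, hk⟩ := exists_rootCoord_ne_zero b θ
  have h1 : rootCoord b (P.reflectionPerm θ θ) = -rootCoord b θ := by
    refine rootCoord_unique b ?_
    rw [root_reflectionPerm, reflection_apply_self]
    simp only [Pi.neg_apply, neg_smul, Finset.sum_neg_distrib, ← root_eq_sum b θ]
  have h2 := hθ.rootCoord_le (P.reflectionPerm θ θ) k
  rw [h1, Pi.neg_apply] at h2
  exact isPos_of_pos b (k := k) (by omega)

lemma IsHighestRoot.pairingIn_nonneg (j : b.support) : 0 ≤ P.pairingIn ℤ θ j := by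
  have h1 := hθ.rootCoord_le (P.reflectionPerm j θ) j
  rw [rootCoord_reflectionPerm] at h1
  simp at h1
  exact h1

lemma IsHighestRoot.pairingIn_nonneg_right {β : ι} (hβ : b.IsPos β) : 0 ≤ P.pairingIn ℤ θ β := by
  rw [pairingIn_eq_sum_coroot b]
  exact Finset.sum_nonneg fun k _ => mul_nonneg (corootCoord_nonneg b hβ k) (hθ.pairingIn_nonneg k)

lemma IsHighestRoot.pairingIn_nonneg_left {β : ι} (hβ : b.IsPos β) : 0 ≤ P.pairingIn ℤ β θ := by
  have h1 := lengthRatio_swap (P := P) β θ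
  have h2 := hθ.pairingIn_nonneg_right hβ
  have h3 := lengthRatio_pos (P := P) θ
  have h4 := lengthRatio_pos (P := P) β
  by_contra hn
  nlinarith [mul_nonneg h2 h4.le]

/-- Let `p` be the pairing. If `p ≥ 2`, the root `-s_θ β = pθ - β` is at most `θ`, so `β ≥ (p - 1)θ
≥ θ`, and `β = θ`. -/
lemma IsHighestRoot.pairingIn_le_one {β : ι} (hne : β ≠ θ) : P.pairingIn ℤ β θ ≤ 1 := by
  by_contra hn
  refine hne (P.root.injective ?_)
  have h1 : rootCoord b (P.reflectionPerm θ β) =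
      rootCoord b β - P.pairingIn ℤ β θ • rootCoord b θ := by
    refine rootCoord_unique b ?_
    rw [root_reflectionPerm, reflection_apply_root' ℤ]
    simp only [Pi.sub_apply, sub_smul, Finset.sum_sub_distrib, ← root_eq_sum b β, Pi.smul_apply,
      smul_assoc, ← Finset.smul_sum, ← root_eq_sum b θ]
  have h2 : rootCoord b (P.reflectionPerm θ (P.reflectionPerm θ β)) = rootCoord b β := by simp
  have h3 : rootCoord b (P.reflectionPerm (P.reflectionPerm θ β) (P.reflectionPerm θ β)) =
      -rootCoord b (P.reflectionPerm θ β) := by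
    refine rootCoord_unique b ?_
    rw [root_reflectionPerm, reflection_apply_self]
    simp only [Pi.neg_apply, neg_smul, Finset.sum_neg_distrib, ← root_eq_sum b]
  rw [root_eq_sum b β, root_eq_sum b θ]
  refine Finset.sum_congr rfl fun k _ => ?_
  congr 1
  have h4 := hθ.rootCoord_le β k
  have h5 := hθ.rootCoord_le (P.reflectionPerm (P.reflectionPerm θ β) (P.reflectionPerm θ β)) k
  rw [h3, h1] at h5
  simp only [Pi.neg_apply, Pi.sub_apply, Pi.smul_apply, smul_eq_mul] at h5
  have h6 := rootCoord_nonneg b hθ.isPos k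
  nlinarith

lemma IsHighestRoot.pairingIn_eq {β : ι} (hβ : b.IsPos β) (hne : β ≠ θ) :
    P.pairingIn ℤ β θ = 0 ∨ P.pairingIn ℤ β θ = 1 := by
  have h1 := hθ.pairingIn_le_one hne
  have h2 := hθ.pairingIn_nonneg_left hβ
  omega

/-- By irreducibility some root of the length of `γ` is not orthogonal to `θ`. Unless it is `±θ`,
its pairing with `θ^∨` is `±1`, so it is not longer than `θ`. -/
lemma IsHighestRoot.sqLength_le (γ : ι) : sqLength P γ ≤ sqLength P θ := by
  obtain ⟨k, hk1, hk2⟩ :=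
    P.exists_form_eq_form_and_form_ne_zero (P.posRootForm ℤ).toInvariantForm θ γ
  have hlen : ∀ α : ι, (P.posRootForm ℤ).toInvariantForm.form (P.root α) (P.root α) =
      ((sqLength P α : ℤ) : R) := by
    intro α
    rw [sqLength_eq, ← eq_intCast (algebraMap ℤ R), RootPositiveForm.algebraMap_rootLength]
    rfl
  rw [hlen, hlen] at hk1
  have hk3 : sqLength P k = sqLength P γ := by exact_mod_cast hk1
  have hk4 : P.pairingIn ℤ k θ ≠ 0 := by
    intro h0
    apply hk2
    have h1 : P.pairing k θ = 0 := by rw [← P.algebraMap_pairingIn ℤ, h0, map_zero]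
    exact ((P.posRootForm ℤ).toInvariantForm.apply_root_root_zero_iff θ k).2
      (P.pairing_eq_zero_iff.1 h1)
  rw [← hk3]
  clear hk1 hk2 hk3
  have hsw := (P.posRootForm ℤ).pairingIn_mul_eq_pairingIn_mul_swap θ k
  rw [← sqLength_eq, ← sqLength_eq] at hsw
  have p1 : (0 : ℤ) < sqLength P θ := by exact_mod_cast sqLength_pos θ
  have p2 : (0 : ℤ) < sqLength P k := by exact_mod_cast sqLength_pos k
  by_cases hk5 : P.reflectionPerm k k = θ
  · have h1 := lengthRatio_reflectionPerm (P := P) k k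
    rw [hk5] at h1
    have h2 := lengthRatio_mul (P := P) θ
    rw [h1, lengthRatio_mul] at h2
    exact (by exact_mod_cast h2 : sqLength P k = sqLength P θ).le
  by_cases hkθ : k = θ
  · rw [hkθ]
  have key : P.pairingIn ℤ k θ = 1 ∨ P.pairingIn ℤ k θ = -1 := by
    by_cases hkp : b.IsPos k
    · have := hθ.pairingIn_eq hkp hkθ
      omega
    · have h1 : b.IsPos (P.reflectionPerm k k) := by
        rw [isPos_iff_forall]
        intro l
        have h2 : rootCoord b (P.reflectionPerm k k) = -rootCoord b k := by
          refine rootCoord_unique b ?_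
          rw [root_reflectionPerm, reflection_apply_self]
          simp only [Pi.neg_apply, neg_smul, Finset.sum_neg_distrib, ← root_eq_sum b]
        rw [h2, Pi.neg_apply]
        have := rootCoord_nonpos b hkp l
        omega
      have := hθ.pairingIn_eq h1 hk5
      rw [pairingIn_reflectionPerm_self_left] at this
      omega
  have hle : (sqLength P k : ℤ) ≤ sqLength P θ := by
    rcases key with h | h <;> rw [h] at hsw
    · have : 0 < P.pairingIn ℤ θ k := by
        by_contra hn
        nlinarith
      nlinarith
    · have : P.pairingIn ℤ θ k < 0 := by
        by_contra hn
        nlinarith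
      nlinarith
  exact_mod_cast hle

lemma IsHighestRoot.lengthRatio_eq : lengthRatio P θ = dualTier P := by
  have : Nonempty ι := ⟨θ⟩
  rw [lengthRatio, dualTier]
  congr 2
  exact le_antisymm (le_ciSup (Set.finite_range _).bddAbove θ) (ciSup_le hθ.sqLength_le)

/-- In `∑ ⟨θ, β^∨⟩ ⟨β, θ^∨⟩` the root `θ` contributes `4`, and for all other positive roots the
second factor is `0` or `1`. The rest is the pairing of `θ` with `2ρ^∨` minus `2`, so the total is
`2 (ht θ + 1)`. -/
lemma IsHighestRoot.quadSum_one (i : b.support) :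
    quadSum b (fun _ => 1) i i = coxeterNumber b θ := by
  have h := sum_pairingIn_mul_pairingIn b (g := fun _ => 1) (fun _ _ => rfl) i θ
  have hpos := (mem_posRoots b).2 hθ.isPos
  have h2 : ∑ β ∈ posRoots b, P.pairingIn ℤ θ β = 2 * b.height θ := by
    rw [height_eq, Finset.mul_sum]
    simp only [pairingIn_eq_sum_root b θ]
    rw [Finset.sum_comm]
    refine Finset.sum_congr rfl fun k _ => ?_
    rw [← Finset.mul_sum, sum_pairingIn_posRoots', mul_comm]
  rw [← Finset.add_sum_erase _ _ hpos, pairingIn_same] at h h2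
  have h3 : ∑ β ∈ (posRoots b).erase θ, 1 * P.pairingIn ℤ θ β * P.pairingIn ℤ β θ =
      ∑ β ∈ (posRoots b).erase θ, P.pairingIn ℤ θ β := by
    refine Finset.sum_congr rfl fun β hβ => ?_
    rw [Finset.mem_erase, mem_posRoots] at hβ
    rcases hθ.pairingIn_eq hβ.2 hβ.1 with h | h
    · have h4 := lengthRatio_swap (P := P) β θ
      rw [h, zero_mul] at h4
      have h5 := (mul_eq_zero.1 h4.symm).resolve_right (lengthRatio_pos (P := P) β).ne'
      rw [h, h5]; rfl
    · rw [h]; ring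
  rw [h3] at h
  rw [coxeterNumber]
  linarith

/-- As for the unweighted sum, but the weights convert `⟨θ, β^∨⟩` to `⟨β, θ^∨⟩`, so that `2ρ` paired
with `θ^∨` appears. The factor `r_θ` is `r^∨` because `θ` is long. -/
lemma IsHighestRoot.quadSum_lengthRatio (i : b.support) :
    quadSum b (lengthRatio P) i i = dualTier P * dualCoxeterNumber b θ := by
  have h := sum_pairingIn_mul_pairingIn b (g := lengthRatio P)
    (fun _ _ => lengthRatio_reflectionPerm _ _) i θ
  have hpos := (mem_posRoots b).2 hθ.isPos
  have h2 : ∑ β ∈ posRoots b, P.pairingIn ℤ β θ = 2 * b.flip.height θ := by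
    rw [height_eq, Finset.mul_sum]
    simp only [pairingIn_eq_sum_coroot b _ θ]
    rw [Finset.sum_comm]
    refine Finset.sum_congr rfl fun k _ => ?_
    rw [← Finset.mul_sum, sum_pairingIn_posRoots, mul_comm]
    rfl
  rw [← Finset.add_sum_erase _ _ hpos, pairingIn_same] at h h2
  have h3 : ∑ β ∈ (posRoots b).erase θ, lengthRatio P β * P.pairingIn ℤ θ β * P.pairingIn ℤ β θ =
      lengthRatio P θ * ∑ β ∈ (posRoots b).erase θ, P.pairingIn ℤ β θ := by
    rw [Finset.mul_sum]
    refine Finset.sum_congr rfl fun β hβ => ?_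
    rw [Finset.mem_erase, mem_posRoots] at hβ
    have h4 := lengthRatio_swap (P := P) β θ
    rcases hθ.pairingIn_eq hβ.2 hβ.1 with h | h
    · rw [h]; ring
    · rw [h] at h4 ⊢
      linarith
  rw [h3] at h
  have h5 : ∑ β ∈ (posRoots b).erase θ, P.pairingIn ℤ β θ = 2 * b.flip.height θ - 2 := by linarith
  rw [h5] at h
  rw [dualCoxeterNumber, ← hθ.lengthRatio_eq]
  linarith

end highest

end

end DeformedW

namespace DeformedW

noncomputable section

open scoped Classical
open RootPairing

variable {ι R M N : Type*} [Fintype ι] [Field R] [CharZero R] [AddCommGroup M] [Module R M]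
  [AddCommGroup N] [Module R N] {P : RootPairing ι R M N} [P.IsRootSystem] [P.IsCrystallographic]
  [P.IsReduced] [P.IsIrreducible] (b : P.Base)

/-! ### Words in the simple reflections -/

/-- The product of the simple reflections of a word, acting on the weight space. -/
def wordRefl (L : List b.support) : M ≃ₗ[R] M := (L.map fun j : b.support => P.reflection j).prod

/-- The product of the simple reflections of a word, acting on the roots. -/
def wordPerm (L : List b.support) : Equiv.Perm ι :=
  (L.map fun j : b.support => P.reflectionPerm j).prod

@[simp] lemma wordRefl_nil : wordRefl b [] = 1 := rfl

@[simp] lemma wordPerm_nil : wordPerm b [] = 1 := rfl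

lemma wordRefl_cons (j : b.support) (L : List b.support) :
    wordRefl b (j :: L) = P.reflection j * wordRefl b L := by
  simp [wordRefl]

lemma wordPerm_cons (j : b.support) (L : List b.support) :
    wordPerm b (j :: L) = P.reflectionPerm j * wordPerm b L := by
  simp [wordPerm]

lemma wordRefl_append (L L' : List b.support) :
    wordRefl b (L ++ L') = wordRefl b L * wordRefl b L' := by
  simp [wordRefl]

lemma reflection_mul_self (j : ι) : P.reflection j * P.reflection j = 1 := by
  have := P.reflection_sq j
  rwa [sq] at this

lemma wordRefl_reverse_mul (L : List b.support) : wordRefl b L.reverse * wordRefl b L = 1 := by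
  induction L with
  | nil => simp
  | cons j L ih =>
    rw [List.reverse_cons, wordRefl_append, wordRefl_cons, wordRefl_cons, wordRefl_nil, mul_one,
      mul_assoc, ← mul_assoc (P.reflection j), reflection_mul_self, one_mul, ih]

lemma reflection_wordPerm (L : List b.support) (β : ι) :
    P.reflection (wordPerm b L β) = wordRefl b L * P.reflection β * (wordRefl b L)⁻¹ := by
  induction L with
  | nil => simp
  | cons j L ih =>
    rw [wordPerm_cons, wordRefl_cons, Equiv.Perm.mul_apply, reflection_reflectionPerm, ih,
      mul_inv_rev, reflection_inv]
    simp only [mul_assoc]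

lemma pairing_reflection (j β : ι) (x : M) :
    P.toLinearMap (P.reflection j x) (P.coroot (P.reflectionPerm j β)) =
      P.toLinearMap x (P.coroot β) := by
  rw [coroot_reflectionPerm, reflection_apply, coreflection_apply]
  simp
  ring

lemma pairing_wordRefl (L : List b.support) (β : ι) (x : M) :
    P.toLinearMap (wordRefl b L x) (P.coroot (wordPerm b L β)) =
      P.toLinearMap x (P.coroot β) := by
  induction L with
  | nil => simp
  | cons j L ih =>
    rw [wordRefl_cons, wordPerm_cons, LinearEquiv.mul_apply, Equiv.Perm.mul_apply,
      pairing_reflection, ih]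

/-- The exchange condition. -/
lemma exists_wordRefl_eq (L : List b.support) (j : b.support) (h : ¬ b.IsPos (wordPerm b L j)) :
    ∃ L' : List b.support, L'.length < L.length ∧
      wordRefl b L * P.reflection j = wordRefl b L' := by
  induction L with
  | nil => exact absurd (b.isPos_of_mem_support j.2) h
  | cons k L ih =>
    by_cases hp : b.IsPos (wordPerm b L j)
    · have hk : wordPerm b L j = k := by
        by_contra hne
        exact h (by rw [wordPerm_cons]; exact hp.reflectionPerm k.2 hne)
      refine ⟨L, by simp, ?_⟩
      rw [wordRefl_cons, ← hk, reflection_wordPerm]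
      simp only [mul_assoc, inv_mul_cancel_left, reflection_mul_self, mul_one]
    · obtain ⟨L', hL', he⟩ := ih hp
      refine ⟨k :: L', by simpa using hL', ?_⟩
      rw [wordRefl_cons, wordRefl_cons, mul_assoc, he]

/-! ### Dominant weights -/

/-- `l` is the family of the pairings of `x` with the simple coroots. -/
def HasCoord (x : M) (l : b.support → ℤ) : Prop :=
  ∀ k : b.support, P.toLinearMap x (P.coroot k) = (l k : R)

lemma HasCoord.reflection {x : M} {l : b.support → ℤ} (h : HasCoord b x l) (j : b.support) :
    HasCoord b (P.reflection j x) fun k => l k - l j * cartan b k j := by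
  intro k
  rw [reflection_apply, map_sub, LinearMap.sub_apply, h k]
  have h1 : P.toLinearMap (P.root j) (P.coroot k) = ((cartan b k j : ℤ) : R) := by
    rw [root_coroot_eq_pairing, ← P.algebraMap_pairingIn ℤ, cartan_apply]
    rfl
  have h2 : (P.coroot' (j : ι)) x = (l j : R) := h j
  rw [map_smul, LinearMap.smul_apply, h1, h2]
  push_cast
  rfl

lemma HasCoord.pairing {x : M} {l : b.support → ℤ} (h : HasCoord b x l) (β : ι) :
    P.toLinearMap x (P.coroot β) = ((∑ k, corootCoord b β k * l k : ℤ) : R) := by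
  rw [coroot_eq_sum b β, map_sum]
  push_cast
  refine Finset.sum_congr rfl fun k _ => ?_
  rw [map_zsmul, h k, zsmul_eq_mul]

lemma HasCoord.neg {x : M} {l : b.support → ℤ} (h : HasCoord b x l) : HasCoord b (-x) (-l) := by
  intro k
  rw [map_neg, LinearMap.neg_apply, h k]
  simp

/-- An orbit of the Weyl group contains at most one dominant weight. -/
lemma HasCoord.eq_of_dominant {x : M} {l : b.support → ℤ} (h : HasCoord b x l) (hl : ∀ k, 0 ≤ l k)
    (L : List b.support) {m : b.support → ℤ} (hm : ∀ k, 0 ≤ m k)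
    (h' : HasCoord b (wordRefl b L x) m) : wordRefl b L x = x := by
  induction hn : L.length using Nat.strong_induction_on generalizing L with
  | _ n ih =>
    rcases List.eq_nil_or_concat L with rfl | ⟨L₁, j, rfl⟩
    · simp
    rw [List.concat_eq_append] at h' hn ⊢
    have hlen : (L₁ ++ [j]).length = L₁.length + 1 := by simp
    have hw : wordRefl b (L₁ ++ [j]) = wordRefl b L₁ * P.reflection j := by
      rw [wordRefl_append, wordRefl_cons, wordRefl_nil, mul_one]
    -- If the word sends `α_j` to a positive root, dominance of the image gives `-l_j ≥ 0`, so `l_j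
    -- = 0` and the last reflection fixes `x`. Otherwise the exchange condition shortens the word.
    by_cases hp : b.IsPos (wordPerm b L₁ j)
    · have h1 := h'.pairing b (wordPerm b L₁ j)
      rw [hw, LinearEquiv.mul_apply, pairing_wordRefl, h.reflection b j j] at h1
      dsimp only at h1
      rw [cartan_self] at h1
      have h2 : l j - l j * 2 = ∑ k, corootCoord b (wordPerm b L₁ j) k * m k := by
        exact_mod_cast h1
      have h3 : 0 ≤ ∑ k, corootCoord b (wordPerm b L₁ j) k * m k :=
        Finset.sum_nonneg fun k _ => mul_nonneg (corootCoord_nonneg b hp k) (hm k)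
      have h4 : l j = 0 := by
        have := hl j
        omega
      have h5 : P.reflection j x = x := by
        have h6 : (P.coroot' (j : ι)) x = 0 := by
          have : (P.coroot' (j : ι)) x = (l j : R) := h j
          rw [this, h4, Int.cast_zero]
        rw [reflection_apply, h6, zero_smul, sub_zero]
      have h6 : wordRefl b (L₁ ++ [j]) x = wordRefl b L₁ x := by
        rw [hw, LinearEquiv.mul_apply, h5]
      rw [h6] at h' ⊢
      exact ih L₁.length (by omega) L₁ h' rfl
    · obtain ⟨L', hL', he⟩ := exists_wordRefl_eq b L₁ j hp
      rw [hw, he] at h' ⊢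
      exact ih L'.length (by omega) L' h' rfl

lemma exists_wordRefl_eq_reflection (β : ι) :
    ∃ L : List b.support, P.reflection β = wordRefl b L := by
  refine b.induction_reflect β (p := fun β => ∃ L : List b.support,
    P.reflection β = wordRefl b L) ?_ ?_ ?_
  · rintro γ ⟨L, hL⟩
    refine ⟨L, ?_⟩
    rw [← hL, reflection_reflectionPerm, reflection_mul_self, one_mul]
  · intro j hj
    exact ⟨[⟨j, hj⟩], by rw [wordRefl_cons, wordRefl_nil, mul_one]⟩
  · rintro γ j ⟨L, hL⟩ hj
    refine ⟨[⟨j, hj⟩] ++ L ++ [⟨j, hj⟩], ?_⟩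
    rw [wordRefl_append, wordRefl_append, wordRefl_cons, wordRefl_nil, mul_one,
      reflection_reflectionPerm, hL]

lemma exists_wordRefl_eq_smul (w : P.weylGroup) :
    ∃ L : List b.support, ∀ x : M, w • x = wordRefl b L x := by
  obtain ⟨w, hw⟩ := w
  induction hw using weylGroup.induction with
  | mem β =>
    obtain ⟨L, hL⟩ := exists_wordRefl_eq_reflection b β
    exact ⟨L, fun x => by rw [← hL]; exact weylGroup.ofIdx_smul P β x⟩
  | one => exact ⟨[], fun x => by simp⟩
  | mul g₁ g₂ hg₁ hg₂ h₁ h₂ =>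
    obtain ⟨L₁, h₁⟩ := h₁
    obtain ⟨L₂, h₂⟩ := h₂
    refine ⟨L₁ ++ L₂, fun x => ?_⟩
    rw [wordRefl_append, LinearEquiv.mul_apply, ← h₂, ← h₁, ← mul_smul]
    rfl

lemma hasCoord_fundamentalWeight (i : b.support) :
    HasCoord b (fundamentalWeight b i) (Pi.single i 1) := by
  intro k
  have h1 : P.toLinearMap (fundamentalWeight b i) = b.toCoweightBasis.coord i :=
    P.toPerfPair.apply_symm_apply _
  rw [h1, Module.Basis.coord_apply, RootPairing.Base.toCoweightBasis_repr_coroot, Finsupp.single_apply,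
    Pi.single_apply]
  by_cases hk : k = i <;> simp [hk]

/-- One step of the orbit of a weight under the simple reflections. -/
def SimpleStep (l m : b.support → ℤ) : Prop := ∃ j, m = fun k => l k - l j * cartan b k j

lemma HasCoord.exists_word {x : M} {l m : b.support → ℤ} (h : HasCoord b x l)
    (hlm : Relation.ReflTransGen (SimpleStep b) l m) :
    ∃ L : List b.support, HasCoord b (wordRefl b L x) m := by
  induction hlm with
  | refl => exact ⟨[], by simpa using h⟩
  | tail _ hs ih =>
    obtain ⟨L, hL⟩ := ih
    obtain ⟨j, rfl⟩ := hs
    refine ⟨j :: L, ?_⟩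
    rw [wordRefl_cons, LinearEquiv.mul_apply]
    exact hL.reflection b j

/-- The involution of the Dynkin diagram given by the longest element. -/
lemma eq_of_reflTransGen {i i' k : b.support} {w : P.weylGroup}
    (hw : fundamentalWeight b i' = -(w • fundamentalWeight b i))
    (h : Relation.ReflTransGen (SimpleStep b) (Pi.single i 1) (-Pi.single k 1)) : k = i' := by
  obtain ⟨L, hL⟩ := (hasCoord_fundamentalWeight b i).exists_word b h
  obtain ⟨L₀, hL₀⟩ := exists_wordRefl_eq_smul b w
  rw [hL₀] at hw
  have h1 := hL.neg b
  rw [neg_neg] at h1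
  -- The weights with coordinates `e_k` and `e_{i'}` are both dominant and both lie in the orbit of
  -- `-ω_i`.
  have h2 : wordRefl b (L₀ ++ L.reverse) (-(wordRefl b L (fundamentalWeight b i))) =
      fundamentalWeight b i' := by
    rw [wordRefl_append, LinearEquiv.mul_apply, map_neg, map_neg, ← LinearEquiv.mul_apply _ (wordRefl b L),
      wordRefl_reverse_mul, hw]
    rfl
  have h0 : ∀ j k : b.support, 0 ≤ (Pi.single j 1 : b.support → ℤ) k := by
    intro j k
    rw [Pi.single_apply]
    split_ifs <;> simp
  have h3 := h1.eq_of_dominant b (h0 k) (L₀ ++ L.reverse) (m := Pi.single i' 1) (h0 i') (by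
    rw [h2]; exact hasCoord_fundamentalWeight b i')
  rw [h2] at h3
  have h4 := h1 k
  rw [← h3, hasCoord_fundamentalWeight b i' k, Pi.single_eq_same] at h4
  have h5 : (Pi.single i' 1 : b.support → ℤ) k = 1 := by exact_mod_cast h4
  by_contra hne
  rw [Pi.single_eq_of_ne hne] at h5
  omega

end

end DeformedW

namespace DeformedW

noncomputable section

open scoped Classical
open IntLaurent

/-! ### First order specializations at `q = t = 1` -/

namespace IntLaurent

/-- The derivative at `q = t = 1` in the direction `ℓ`. -/
def deriv (ℓ : ℤ × ℤ →+ ℤ) : IntLaurent →+ ℤ :=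
  (Finsupp.liftAddHom fun u => AddMonoidHom.mulRight (ℓ u)).comp
    AddMonoidAlgebra.coeffAddEquiv.toAddMonoidHom

variable (ℓ : ℤ × ℤ →+ ℤ)

lemma deriv_single (u : ℤ × ℤ) (k : ℤ) : deriv ℓ (AddMonoidAlgebra.single u k) = k * ℓ u := by
  simp [deriv]

lemma deriv_X_mul (u : ℤ × ℤ) (p : IntLaurent) :
    deriv ℓ (X u * p) = deriv ℓ p + ℓ u * aug p := by
  induction p using induction with
  | zero => simp
  | add p p' h h' => rw [mul_add, map_add, map_add, map_add, h, h']; ring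
  | single v k =>
    rw [X, AddMonoidAlgebra.single_mul_single, deriv_single, deriv_single, aug_single, map_add]
    ring

/-- The exponents of `[n]_q` are symmetric about `0`, so it has no first order term at `q = 1`. -/
lemma deriv_qNat_mul (n : ℕ) (p : IntLaurent) : deriv ℓ (qNat n * p) = n * deriv ℓ p := by
  have h1 : ∀ m : ℕ, deriv ℓ ((∑ l ∈ Finset.range m, X ((n : ℤ) - 1 - 2 * l, 0)) * p) =
      m * deriv ℓ p + m * (n - m) * ℓ (1, 0) * aug p := by
    intro m
    induction m with
    | zero => simp
    | succ m ih =>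
      have h2 : ((n : ℤ) - 1 - 2 * m, (0 : ℤ)) = ((n : ℤ) - 1 - 2 * m) • ((1 : ℤ), (0 : ℤ)) := by
        simp
      rw [Finset.sum_range_succ, add_mul, map_add, ih, deriv_X_mul, h2, map_zsmul]
      push_cast
      simp only [smul_eq_mul]
      ring
  have h2 := h1 n
  rw [sub_self, mul_zero, zero_mul, zero_mul, add_zero] at h2
  exact h2

lemma aug_nonneg {p : IntLaurent} (h : ∀ u, 0 ≤ p.coeff u) : 0 ≤ aug p := by
  have h1 : aug p = ∑ u ∈ p.coeff.support, p.coeff u := by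
    have h2 : ∀ c : (ℤ × ℤ) →₀ ℤ, aug (AddMonoidAlgebra.ofCoeff c) = c.sum fun _ k => k := by
      intro c
      induction c using Finsupp.induction_linear with
      | zero => exact map_zero aug
      | add f g hf hg =>
        rw [Finsupp.sum_add_index' (fun _ => rfl) (fun _ _ _ => rfl), ← hf, ← hg]
        exact map_add aug _ _
      | single u k =>
        rw [Finsupp.sum_single_index rfl]
        exact aug_single u k
    exact h2 p.coeff
  rw [h1]
  exact Finset.sum_nonneg fun u _ => h u

end IntLaurent

namespace CartanDatum

variable {I : Type*} [Fintype I] [DecidableEq I] (D : CartanDatum I)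

lemma qCartan_single (j : I) (p : IntLaurent) (l : I) :
    D.qCartan (Pi.single (M := fun _ => IntLaurent) j p) l =
      (if l = j then (X (D.len j, -1) + X (-D.len j, 1)) * p else 0) - qNat (D.adj l j) * p := by
  rw [qCartan, Finset.sum_eq_single j]
  · rw [Pi.single_eq_same]
    congr 1
    by_cases h : l = j
    · subst h
      rw [if_pos rfl, Pi.single_eq_same]
    · rw [if_neg h, Pi.single_eq_of_ne h, mul_zero]
  · intro k _ hk
    rw [Pi.single_eq_of_ne hk, mul_zero]
  · simp

lemma aug_qCartan_single (j : I) (p : IntLaurent) (l : I) :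
    aug (D.qCartan (Pi.single (M := fun _ => IntLaurent) j p) l) =
      ((if l = j then 2 else 0) - (D.adj l j : ℤ)) * aug p := by
  rw [qCartan_single, map_sub, map_mul, aug_qNat]
  split_ifs
  · simp
    ring
  · simp

/-- The exponents `(r, -1)` and `(-r, 1)` cancel to first order: near `q = t = 1`, `C(q,t)` behaves
like the constant Cartan matrix. -/
lemma deriv_qCartan_single (ℓ : ℤ × ℤ →+ ℤ) (j : I) (p : IntLaurent) (l : I) :
    deriv ℓ (D.qCartan (Pi.single (M := fun _ => IntLaurent) j p) l) =
      ((if l = j then 2 else 0) - (D.adj l j : ℤ)) * deriv ℓ p := by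
  rw [qCartan_single, map_sub, deriv_qNat_mul]
  split_ifs
  · have h : ((-D.len j, 1) : ℤ × ℤ) = -(D.len j, -1) := by simp
    rw [add_mul, map_add, deriv_X_mul, deriv_X_mul, h, map_neg]
    ring
  · simp

variable {D}

/-- A staged configuration is built by adding, one vertex at a time, terms that cancel all of the
weight at the vertex. -/
lemma Staged.induction {i : I} {h : ℤ} {ε : I → Bool} {v : I → IntLaurent}
    (hv : Staged D i h ε v) (hε : ∀ j k, D.adj j k ≠ 0 → ε j ≠ ε k) (hh : 0 ≤ h)
    {motive : (I → IntLaurent) → Prop} (zero : motive 0)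
    (step : ∀ n j p, motive n → (∀ u, 0 ≤ p.coeff u) → D.weight i n j = X (D.len j, -1) * p →
      motive (n + Pi.single (M := fun _ => IntLaurent) j p)) : motive v := by
  have key : ∀ s : ℕ, (s : ℤ) ≤ h → motive (stage v s ∅) := by
    intro s
    induction s with
    | zero =>
      intro _
      rw [Nat.cast_zero, hv.stage_zero]
      exact zero
    | succ s ih =>
      intro hs
      push_cast at hs ⊢
      rw [← stage_univ]
      have hK : ∀ K : Finset I, motive (stage v s K) := by
        intro K
        induction K using Finset.induction_on with
        | empty => exact ih (by omega)
        | insert j K hj ihK =>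
          set p : IntLaurent := truncate (v j) fun d => d = s + 1 with hp
          have hst : stage v s (insert j K) =
              stage v s K + Pi.single (M := fun _ => IntLaurent) j p := by
            funext k
            ext a d
            rw [Pi.add_apply, AddMonoidAlgebra.coeff_add, Finsupp.add_apply, coeff_stage,
              coeff_stage]
            by_cases hk : k = j
            · subst hk
              rw [Pi.single_eq_same, hp, coeff_truncate]
              by_cases hd : d = s + 1
              · subst hd
                rw [if_pos (Or.inr ⟨rfl, Finset.mem_insert_self _ _⟩), if_neg (by simp [hj]),
                  if_pos rfl, zero_add]
              · rw [if_neg hd, add_zero]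
                simp [hd]
            · rw [Pi.single_eq_of_ne hk]
              simp [hk]
          rw [hst]
          by_cases hne : ∃ a, (v j).coeff (a, (s : ℤ) + 1) ≠ 0
          · refine step _ j p ihK ?_ ?_
            · rintro ⟨a, d⟩
              rw [hp, coeff_truncate]
              split_ifs
              · exact hv.nonneg j _
              · exact le_rfl
            · ext a d
              rw [hv.coeff_weight_stage hε (by omega) (by omega) hj hne, coeff_X_mul, hp,
                Prod.mk_sub_mk, coeff_truncate]
              by_cases hd : d = s
              · rw [if_pos hd, if_pos (by omega), hd, sub_neg_eq_add]
              · rw [if_neg hd, if_neg (by omega)]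
          · push Not at hne
            have hp0 : p = 0 := by
              ext a d
              rw [hp, coeff_truncate]
              split_ifs with hd
              · rw [hd]; exact hne a
              · rfl
            rw [hp0, Pi.single_zero, add_zero]
            exact ihK
      exact hK Finset.univ
  have h1 := key h.toNat (by omega)
  rwa [Int.toNat_of_nonneg hh, hv.stage_last] at h1

end CartanDatum

variable {ι R M N : Type*} [Fintype ι] [Field R] [CharZero R] [AddCommGroup M] [Module R M]
  [AddCommGroup N] [Module R N] {P : RootPairing ι R M N} [P.IsRootSystem] [P.IsCrystallographic]
  [P.IsReduced] [P.IsIrreducible] (b : P.Base)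

/-! ### A cocycle on the weights -/

/-- The value on the coroot of `β` of the weight with coordinates `l`. -/
def corootValue (β : ι) (l : b.support → ℤ) : ℤ := ∑ k, corootCoord b β k * l k

/-- The coordinate at `k` of `∑_{β > 0} g_β max(0, ⟨l, β^∨⟩) β - κ l`, where `κ` is such that this
vanishes for the dominant weights. -/
def cocycle (g : ι → ℤ) (κ : ℤ) (l : b.support → ℤ) (k : b.support) : ℤ :=
  ∑ β ∈ posRoots b, g β * max 0 (corootValue b β l) * P.pairingIn ℤ β k - κ * l k

lemma corootValue_reflection (β : ι) (l : b.support → ℤ) (j : b.support) :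
    corootValue b β (fun k => l k - l j * cartan b k j) =
      corootValue b (P.reflectionPerm j β) l := by
  rw [corootValue, corootValue, corootCoord_reflectionPerm, pairingIn_eq_sum_coroot b]
  simp only [Pi.sub_apply, Pi.smul_apply, sub_mul, mul_sub, Finset.sum_sub_distrib, smul_eq_mul,
    Pi.single_apply, mul_ite, mul_one, mul_zero, ite_mul, zero_mul, Finset.sum_ite_eq',
    Finset.mem_univ, if_true, Finset.sum_mul, cartan_apply]
  congr 1
  exact Finset.sum_congr rfl fun k _ => by ring

lemma corootValue_support (j : b.support) (l : b.support → ℤ) : corootValue b j l = l j := by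
  rw [corootValue, corootCoord_support]
  simp [Pi.single_apply]

section

variable {g : ι → ℤ} (hg : ∀ (j : b.support) (β : ι), g (P.reflectionPerm j β) = g β)
include hg

/-- The simple reflection permutes the positive roots other than `α_j`. The term of `α_j` itself is
`g_j l_j` before the reflection and disappears afterwards, which produces the correction. -/
lemma cocycle_reflection (κ : ℤ) {l : b.support → ℤ} {j : b.support} (hl : 0 ≤ l j)
    (k : b.support) : cocycle b g κ (fun k => l k - l j * cartan b k j) k =
      cocycle b g κ l k - cartan b k j * (cocycle b g κ l j - g j * l j) := by
  have hsum : ∀ f : ι → ℤ, ∑ β ∈ posRoots b, f β = f j + ∑ β ∈ (posRoots b).erase (j : ι), f β :=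
    fun f => (Finset.add_sum_erase _ _ (support_mem_posRoots b j)).symm
  have h1 := sum_erase_reflectionPerm b j fun β => g β * max 0 (corootValue b β l) *
    P.pairingIn ℤ (P.reflectionPerm j β) k
  have h2 : ∀ β, P.pairingIn ℤ (P.reflectionPerm j β) k =
      P.pairingIn ℤ β k - P.pairingIn ℤ β j * P.pairingIn ℤ j k := by
    intro β
    rw [pairingIn_eq_sum_root b (P.reflectionPerm j β), rootCoord_reflectionPerm,
      pairingIn_eq_sum_root b β k]
    simp [sub_mul, Pi.single_apply]
  have h0 : corootValue b (P.reflectionPerm j j) l = -l j := by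
    rw [← corootValue_reflection, corootValue_support, cartan_self]
    ring
  simp only [RootPairing.reflectionPerm_self, hg, h2] at h1
  simp only [mul_sub, Finset.sum_sub_distrib] at h1
  have h3 : ∑ β ∈ (posRoots b).erase (j : ι), g β * max 0 (corootValue b β l) *
      (P.pairingIn ℤ β j * P.pairingIn ℤ j k) = (∑ β ∈ (posRoots b).erase (j : ι),
      g β * max 0 (corootValue b β l) * P.pairingIn ℤ β j) * P.pairingIn ℤ j k := by
    rw [Finset.sum_mul]
    exact Finset.sum_congr rfl fun β _ => by ring
  rw [h3] at h1
  simp only [cocycle, corootValue_reflection]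
  rw [hsum, hsum, hsum, h0, h1, corootValue_support, RootPairing.pairingIn_same, max_eq_right hl,
    max_eq_left (neg_nonpos.2 hl), cartan_apply]
  ring

/-- For a fundamental weight all coroot values are nonnegative, so the maxima drop out and the
scalar matrix `quadSum` remains. This fixes `κ`. -/
lemma cocycle_single (i : b.support) (k : b.support) :
    cocycle b g (quadSum b g i i) (Pi.single i 1) k = 0 := by
  have h1 := quadSum_eq b hg i i k
  rw [cocycle]
  have h2 : ∑ β ∈ posRoots b, g β * max 0 (corootValue b β (Pi.single i 1)) * P.pairingIn ℤ β k =
      quadSum b g i k := by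
    refine Finset.sum_congr rfl fun β hβ => ?_
    have h3 : corootValue b β (Pi.single i 1) = corootCoord b β i := by
      simp [corootValue, Pi.single_apply]
    rw [h3, max_eq_right (corootCoord_nonneg b ((mem_posRoots b).1 hβ) i)]
  rw [h2, h1, Pi.single_apply]
  by_cases h : i = k
  · subst h; simp
  · simp [h, Ne.symm h]

end

/-- For the negative of a fundamental weight all maxima are zero, and only `κ` survives. -/
lemma cocycle_neg_single (g : ι → ℤ) (κ : ℤ) (i : b.support) (k : b.support) :
    cocycle b g κ (-Pi.single i 1) k = if k = i then κ else 0 := by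
  rw [cocycle, Finset.sum_eq_zero]
  · simp [Pi.single_apply]
  · intro β hβ
    have h3 : corootValue b β (-Pi.single i 1) = -corootCoord b β i := by
      simp [corootValue, Pi.single_apply]
    rw [h3, max_eq_left (neg_nonpos.2 (corootCoord_nonneg b ((mem_posRoots b).1 hβ) i)), mul_zero,
      zero_mul]

/-! ### The lowest weight -/

/-- Each step of the filling cancels the full weight at one vertex. At `q = t = 1` this is a simple
reflection of a weight that is nonnegative at that vertex; to first order it is the recursion of
`cocycle_reflection` with `g_j = ℓ (r_j, -1)`. -/
lemma CartanDatum.Staged.path {i : b.support} {h : ℤ} {ε : b.support → Bool}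
    {v : b.support → IntLaurent} (hv : CartanDatum.Staged (datum b) i h ε v)
    (hε : ∀ j k, (datum b).adj j k ≠ 0 → ε j ≠ ε k) (hh : 0 ≤ h) :
    Relation.ReflTransGen (SimpleStep b) (Pi.single i 1)
      (fun k => aug ((datum b).weight i v k)) ∧
    ∀ (ℓ : ℤ × ℤ →+ ℤ) (g : ι → ℤ), (∀ (j : b.support) (β : ι), g (P.reflectionPerm j β) = g β) →
      (∀ j : b.support, g j = ℓ (symmetrizer b j, -1)) →
      ∀ k, deriv ℓ ((datum b).weight i v k) =
        cocycle b g (quadSum b g i i) (fun k => aug ((datum b).weight i v k)) k := by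
  have h0 : (fun k => aug ((datum b).weight i 0 k)) = Pi.single i 1 := by
    funext k
    rw [CartanDatum.weight]
    have : (datum b).qCartan 0 k = 0 := by simp [CartanDatum.qCartan]
    rw [this, sub_zero]
    by_cases hk : k = i
    · subst hk; simp
    · simp [hk]
  refine hv.induction hε hh (motive := fun v => Relation.ReflTransGen (SimpleStep b)
    (Pi.single i 1) (fun k => aug ((datum b).weight i v k)) ∧
    ∀ (ℓ : ℤ × ℤ →+ ℤ) (g : ι → ℤ), (∀ (j : b.support) (β : ι), g (P.reflectionPerm j β) = g β) →
      (∀ j : b.support, g j = ℓ (symmetrizer b j, -1)) →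
      ∀ k, deriv ℓ ((datum b).weight i v k) =
        cocycle b g (quadSum b g i i) (fun k => aug ((datum b).weight i v k)) k) ?_ ?_
  · rw [h0]
    refine ⟨Relation.ReflTransGen.refl, fun ℓ g hg hgl k => ?_⟩
    rw [cocycle_single b hg]
    have h1 : (datum b).weight i 0 k = Pi.single (M := fun _ => IntLaurent) i 1 k := by
      rw [CartanDatum.weight]
      have : (datum b).qCartan 0 k = 0 := by simp [CartanDatum.qCartan]
      rw [this, sub_zero]
    rw [h1]
    by_cases hk : k = i
    · subst hk
      rw [Pi.single_eq_same]
      have := deriv_single ℓ 0 1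
      rw [map_zero, mul_zero] at this
      exact this
    · rw [Pi.single_eq_of_ne hk, map_zero]
  · rintro n j p ⟨ih1, ih2⟩ hp hw
    have hwt : ∀ k, (datum b).weight i (n + Pi.single (M := fun _ => IntLaurent) j p) k =
        (datum b).weight i n k - (datum b).qCartan (Pi.single (M := fun _ => IntLaurent) j p) k := by
      intro k
      rw [CartanDatum.weight, CartanDatum.weight, CartanDatum.qCartan_add]
      ring
    have hC : ∀ k, (if k = j then 2 else 0) - ((datum b).adj k j : ℤ) = cartan b k j :=
      fun k => (cartan_eq_adj b k j).symm
    have haug : aug ((datum b).weight i n j) = aug p := by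
      rw [hw, map_mul, aug_X, one_mul]
    have hl : (fun k => aug ((datum b).weight i (n + Pi.single (M := fun _ => IntLaurent) j p) k)) =
        fun k => aug ((datum b).weight i n k) - aug ((datum b).weight i n j) * cartan b k j := by
      funext k
      rw [hwt, map_sub, CartanDatum.aug_qCartan_single, hC, haug]
      ring
    rw [hl]
    refine ⟨ih1.tail ⟨j, rfl⟩, fun ℓ g hg hgl k => ?_⟩
    have hpos : 0 ≤ aug ((datum b).weight i n j) := by
      rw [haug]
      exact aug_nonneg hp
    rw [cocycle_reflection b hg _ (l := fun k => aug ((datum b).weight i n k)) hpos,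
      ← ih2 ℓ g hg hgl, ← ih2 ℓ g hg hgl, hwt, map_sub, CartanDatum.deriv_qCartan_single, hC, haug,
      hw, deriv_X_mul, hgl j]
    simp only [datum_len]
    ring

end

end DeformedW

namespace DeformedW

noncomputable section

open scoped Classical
open IntLaurent CartanDatum

variable {ι R M N : Type*} [Fintype ι] [Field R] [CharZero R] [AddCommGroup M] [Module R M]
  [AddCommGroup N] [Module R N] {P : RootPairing ι R M N} [P.IsRootSystem] [P.IsCrystallographic]

/-! ### The duality of generators -/

/-- The bound `coeff_le_inflow` for `c'` read upside down: `v - n` is the reflection of a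
configuration of `c'`. -/
lemma Singular.reflectSum_dual {b : P.Base} {i' : b.support} {c' : Config b →₀ QT}
    (hc : Singular b i' c') (hpos : ∀ n ∈ c'.support, ∀ j u, 0 ≤ (n j).coeff u) {v : Config b}
    {a h : ℤ} {n : Config b} (hn : n ∈ (reflectSum b v (a, h) c').support) (j : b.support)
    (x e : ℤ) (he : e < h) : (v j - n j).coeff (x + symmetrizer b j, e - 1) ≤
      ∑ k, ∑ l ∈ Finset.range ((datum b).adj j k),
        (v k - n k).coeff (x + (((datum b).adj j k : ℤ) - 1 - 2 * l), e) := by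
  obtain ⟨m, hm, rfl⟩ := exists_of_mem_support_reflectSum b hn
  have hsub : ∀ k u, (v k - reflect b v (a, h) m k).coeff u = (m k).coeff ((a, h) - u) := by
    intro k u
    rw [AddMonoidAlgebra.coeff_sub, Finsupp.sub_apply, coeff_reflect]
    ring
  have h1 := hc.polesCancel.coeff_le_inflow hpos hm j (a - x) (h - e)
  rw [coeff_inflow, if_neg (by omega), zero_add] at h1
  rw [hsub, Prod.mk_sub_mk]
  refine le_of_eq_of_le ?_ (h1.trans_eq ?_)
  · rw [datum_len]
    congr 2
    · ring
    · ring
  · refine Finset.sum_congr rfl fun k _ => Finset.sum_congr rfl fun l _ => ?_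
    rw [hsub, Prod.mk_sub_mk]
    congr 2
    ring

variable [P.IsReduced] [P.IsIrreducible] {b : P.Base}

/-- The bottom of a weight string: its weight is determined by the root system. -/
lemma lowest_weight_eq {θ : ι} (hθ : IsHighestRoot b θ) {i i' : b.support} {w : P.weylGroup}
    (hw : fundamentalWeight b i' = -(w • fundamentalWeight b i)) {k : b.support} {a h : ℤ}
    {ε : b.support → Bool} {v : Config b} (hv : Staged (datum b) i h ε v)
    (hε : ∀ j k, (datum b).adj j k ≠ 0 → ε j ≠ ε k) (hh : 0 ≤ h)
    (hwt : ∀ j, (datum b).weight i v j = -Pi.single (M := fun _ => IntLaurent) k (X (a, h)) j) :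
    k = i' ∧ a = -(dualTier P * dualCoxeterNumber b θ) ∧ h = coxeterNumber b θ := by
  obtain ⟨hpath, hder⟩ := hv.path b hε hh
  have haug : (fun j => aug ((datum b).weight i v j)) = -Pi.single k 1 := by
    funext j
    rw [hwt, map_neg, Pi.neg_apply]
    by_cases hj : j = k
    · subst hj; simp
    · simp [hj]
  have hderiv : ∀ ℓ : ℤ × ℤ →+ ℤ, deriv ℓ ((datum b).weight i v k) = -ℓ (a, h) := by
    intro ℓ
    have h1 := deriv_X_mul ℓ (a, h) 1
    have h2 : deriv ℓ 1 = 0 := by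
      have := deriv_single ℓ 0 1
      rw [map_zero, mul_zero] at this
      exact this
    rw [h2, map_one, mul_one, mul_one, zero_add] at h1
    rw [hwt, Pi.single_eq_same, map_neg, h1]
  rw [haug] at hpath
  have hκ : ∀ (ℓ : ℤ × ℤ →+ ℤ) (g : ι → ℤ),
      (∀ (j : b.support) (β : ι), g (P.reflectionPerm j β) = g β) →
      (∀ j : b.support, g j = ℓ (symmetrizer b j, -1)) → -ℓ (a, h) = quadSum b g i i := by
    intro ℓ g hg hgl
    have h1 := hder ℓ g hg hgl k
    rw [haug, cocycle_neg_single, if_pos rfl, hderiv] at h1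
    exact h1
  refine ⟨eq_of_reflTransGen b hw hpath, ?_, ?_⟩
  -- The exponent of `q` corresponds to `g_β = r_β` and gives `-a = r^∨ h^∨`. The exponent of `t`
  -- below corresponds to `g_β = -1` and gives the Coxeter number.
  · have h1 := hκ (AddMonoidHom.fst ℤ ℤ) (lengthRatio P)
      (fun _ _ => lengthRatio_reflectionPerm _ _) fun _ => rfl
    rw [hθ.quadSum_lengthRatio] at h1
    rw [← h1]
    simp
  · have h1 := hκ (AddMonoidHom.snd ℤ ℤ) (fun _ => -1) (fun _ _ => rfl) fun _ => rfl
    have h2 : quadSum b (fun _ => -1) i i = -quadSum b (fun _ => 1) i i := by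
      simp [quadSum]
    rw [h2, hθ.quadSum_one] at h1
    simpa using h1

/-- A generator is the image of the dual generator under the involution and a rescaling. -/
lemma IsGenerator.eq_rescale_theta {θ : ι} (hθ : IsHighestRoot b θ) {i i' : b.support}
    {w : P.weylGroup} (hw : fundamentalWeight b i' = -(w • fundamentalWeight b i))
    {T T' : QField b} (hT : IsGenerator b i T) (hT' : IsGenerator b i' T') :
    T = rescale b (mono (-(dualTier P * dualCoxeterNumber b θ), coxeterNumber b θ))
      (theta b T') := by
  obtain ⟨c, rfl, h0, hpos⟩ := hT.exists_fieldOf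
  obtain ⟨c', rfl, h0', hpos'⟩ := hT'.exists_fieldOf
  have hc : Singular b i c := hT.1.singular
  have hc' : Singular b i' c' := hT'.1.singular
  have : Nonempty b.support := ⟨i⟩
  obtain ⟨ε, hε⟩ := exists_coloring b
  obtain ⟨h, σ, hD⟩ := exists_isCoxeter b hε
  have hne : c.support.Nonempty := ⟨0, by rw [Finsupp.mem_support_iff, h0]; exact one_ne_zero⟩
  obtain ⟨v, hv, hmax⟩ := exists_maximal_of_trans RightLT RightLT.irrefl
    (fun _ _ _ => RightLT.trans) c.support hne
  have hst := hc.polesCancel.staged hpos hD hε hv hmax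
  obtain ⟨a, ha⟩ := hc.polesCancel.weight_maximal hpos hD hv hmax
  obtain ⟨hσ, rfl, hh⟩ := lowest_weight_eq hθ hw hst hε (Int.natCast_nonneg h) ha
  rw [hσ] at ha
  have hr := hc'.reflected b ha (sum_rhoWeight_mul_cartan b) (sum_rhoCoweight_mul_cartan b)
  have heq := hc.eq_smul_reflectSum b hD hpos hpos' hv hmax ha h0' hr
  have hone : c v = 1 := by
    rw [← h0]
    refine coeff_maximal_eq hc hpos hst hε ?_ (Int.natCast_nonneg h) (by rw [h0]; exact one_ne_zero)
    intro n hn j x e he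
    -- By proportionality every term of `c` is also a term of the reflected combination, so the dual
    -- bound applies to it.
    refine hc'.reflectSum_dual hpos' (v := v)
      (a := -(dualTier P * dualCoxeterNumber b θ)) ?_ j x e he
    rw [Finsupp.mem_support_iff] at hn ⊢
    intro hz
    apply hn
    rw [heq, Finsupp.smul_apply, hz, smul_zero]
  rw [hone, one_smul] at heq
  nth_rw 1 [heq]
  rw [fieldOf_reflectSum b ha (sum_rhoWeight_mul_cartan b) (sum_rhoCoweight_mul_cartan b), hh]

end

end DeformedW

theorem theorem2p6 {ι R M N : Type*} [Fintype ι] [Field R] [CharZero R]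
    [AddCommGroup M] [Module R M] [AddCommGroup N] [Module R N]
    (P : RootPairing ι R M N) [P.IsRootSystem] [P.IsCrystallographic] [P.IsReduced]
    [P.IsIrreducible] (b : P.Base)
    (θ : ι) (hθ : DeformedW.IsHighestRoot b θ)
    (w₀ : P.weylGroup) (hw₀ : DeformedW.IsLongest b w₀)
    (i i' : b.support)
    (hi' : DeformedW.fundamentalWeight b i' = -(w₀ • DeformedW.fundamentalWeight b i))
    (T T' : DeformedW.QField b)
    (hT : DeformedW.IsGenerator b i T) (hT' : DeformedW.IsGenerator b i' T') :
    DeformedW.theta b T =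
      DeformedW.rescale b
        (DeformedW.q ^ (DeformedW.dualTier P * DeformedW.dualCoxeterNumber b θ) *
          DeformedW.t ^ (-DeformedW.coxeterNumber b θ)) T' := by
  -- Applying the involution `ϑ` once more undoes it on `T'` and inverts the scale factor.
  rw [hT.eq_rescale_theta hθ hi' hT', DeformedW.theta_rescale, DeformedW.theta_theta,
    DeformedW.conj_mono]
  simp [DeformedW.mono]
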